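/- **Conventions.** Let $0\le r<n$. Let $\Delta_k=(\mathbb{C}^2)^{\otimes\lfloor k/2\rfloor}$ be the spinor module of the Clifford algebra $Cl_k$ ($x\cdot x=-|x|^2$), with $\kappa:Cl_k\to \mathrm{End}(\Delta_k)$ given by the standard matrices: with $g_1=\begin{pmatrix} i&0\\0&-i\end{pmatrix}$, $g_2=\begin{pmatrix}0&i\\ i&0\end{pmatrix}$, $T=\begin{pmatrix}0&-i\\ i&0\end{pmatrix}$, $$e_{2s-1}\mapsto \mathrm{Id}^{\otimes(\lfloor k/2\rfloor-s)}\otimes g_1\otimes T^{\otimes (s-1)},\qquad e_{2s}\mapsto \mathrm{Id}^{\otimes(\lfloor k/2\rfloor-s)}\otimes g_2\otimes T^{\otimes (s-1)},$$ and, for $k$ odd, $e_k\mapsto i\,T\otimes\cdots\otimes T$. With $u_{\pm1}=\frac1{\sqrt2}(1,\mp i)$, and $k$ even, $\Delta_k^+$ is the span of the $u_{\varepsilon_1}\otimes\cdots\otimes u_{\varepsilon_{k/2}}$ with $\prod_j\varepsilon_j=1$. Put $\Sigma_r=\Delta_r$ if $r$ is odd or $r\in\{2,4\}$, and $\Sigma_r=\Delta_r^+$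 for all other even $r$. In $\Delta_r\otimes \Delta_n$, vectors $X\in\mathbb{R}^n$ act on the factor $\Delta_n$ and $\kappa(f_kf_l)$, for the standard basis $(f_k)$ of $\mathbb{R}^r$, acts on $\Delta_r$. *Partially pure spinors.* Let $\phi\in\Sigma_r\otimes\Delta_n$ and $\eta^\phi_{kl}(X,Y)=\mathrm{Re}\langle X\wedge Y\cdot\kappa(f_kf_l)\phi,\phi\rangle$, where $X\wedge Y$ acts as $\frac12(XY-YX)$. Let $V^\phi$ be the space of all $X\in\mathbb{R}^n$ for which there is $Y\in\mathbb{R}^n$ with $X\cdot\phi=iY\cdot\phi$; if $\phi\ne0$, then $Y$ is unique, lies in $V^\phi$, and is denoted $J^\phi X$. The spinor $\phi$ is *partially pure* if $|\phi|=1$, $\dim V^\phi=n-r$, $(\eta^\phi_{kl}+\kappa(f_kf_l))\cdot\phi=0$ and $\langle\kappa(f_kf_l)\phi,\phi\rangle=0$ for all $1\le k<l\le r$, and, if $r=4$, also $\langle\kappa(f_1f_2f_3f_4)\phi,\phi\rangle=0$. (A $2$-form $\eta$ acts as $\sum_{a<b}\eta(e_a,e_b)e_ae_b$.) *$\mathrm{Spin}^{c,r}$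 structures.* Let $\mathrm{Spin}^c(r)=(\mathrm{Spin}(r)\times U(1))/\{\pm(1,1)\}$ and $\mathrm{Spin}^{c,r}(n)=(\mathrm{Spin}(n)\times \mathrm{Spin}^c(r))/\{\pm(1,1)\}$, with the two-fold covering $\lambda:\mathrm{Spin}^{c,r}(n)\to SO(n)\times SO(r)\times U(1)$, $[g,[h,z]]\mapsto(\lambda_n(g),\lambda_r(h),z^2)$, and the representation on $\Delta_r\otimes\Delta_n$ given by $z\,\kappa(h)\otimes\kappa(g)$. A $\mathrm{Spin}^{c,r}(n)$ structure on an oriented Riemannian $n$-manifold $M$ consists of smooth principal bundles $P_{\mathrm{Spin}^{c,r}(n)}$, $P_{SO(r)}$, $P_{U(1)}$ and a smooth $\lambda$-equivariant two-fold covering $\Lambda:P_{\mathrm{Spin}^{c,r}(n)}\to P_{SO(M)}\tilde\times P_{SO(r)}\tilde\times P_{U(1)}$, where $P_{SO(M)}$ is the bundle of positively oriented orthonormal frames. Spinor fields are the smooth sections of the associated bundle with fibre $\Delta_r\otimes\Delta_n$. A spinor field $\phi$ is *partially pure* if it is so at each point (in particular it takes values in the subset corresponding to $\Sigma_r\otimes\Delta_n$);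 then $V^\phi\subset TM$ and $J^\phi:V^\phi\to V^\phi$ are defined pointwise. *CR structures.* An almost CR hermitian structure of codimension $r$ on $M$ is a smooth subbundle $D\subset TM$ of rank $n-r$ with a smooth bundle automorphism $J$ of $D$, orthogonal for the metric, such that $J^2=-\mathrm{Id}$. It is a *CR hermitian structure* if for all $X,Y\in\Gamma(D)$ both $[X,Y]-[JX,JY]$ and $[JX,Y]+[X,JY]$ lie in $\Gamma(D)$ and $J([X,Y]-[JX,JY])=[JX,Y]+[X,JY]$. *The adapted connection.* Let $(D,J)$ be an almost CR hermitian structure, $2m=\mathrm{rk}\,D$, and $\nabla$ the Levi-Civita connection. Let $\nabla^D$ and $\nabla^{D^\perp}$ be its projections to $D$ and $D^\perp$, let $\tilde\nabla^D_XY=\nabla^D_XY+\frac12(\nabla^D_XJ)(JY)$ be the hermitian connection on $(D,J)$, and let $\kappa_D^{-1}\cong\Lambda^mD^{0,1}$ be the bundle of $J$-complex multilinear alternating $m$-forms $D^m\to\mathbb{C}$, with the connection induced by $\tilde\nabla^D$. Suppose given a $\mathrm{Spin}^{c,r}(n)$ structure, an identification of $P_{SO(r)}$ with the bundle of positively oriented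 orthonormal frames of $D^\perp$ for some orientation of $D^\perp$, and an identification of $P_{U(1)}$ with the bundle of unit vectors of $\kappa_D^{-1}$, so that the spinor bundle is $S=[\kappa_D^{-1/2}\otimes\Sigma(D^\perp)]\otimes\Delta(M)$. Then $\nabla^S$ is the connection on $S$ determined by $\nabla$, $\nabla^{D^\perp}$ and the connection on $\kappa_D^{-1}$. Explicitly, in a local section of $P_{\mathrm{Spin}^{c,r}(n)}$ with corresponding frames $(e_a)$ of $TM$, $(f_k)$ of $D^\perp$ and unit section $\alpha$ of $\kappa_D^{-1}$, $$\nabla^S_v\phi=v(\phi)+\tfrac12\sum_{a<b}\langle\nabla_ve_a,e_b\rangle e_ae_b\cdot\phi+\tfrac12\sum_{k<l}\langle\nabla^{D^\perp}_vf_k,f_l\rangle\kappa(f_kf_l)\cdot\phi+\tfrac i2A(v)\phi,\qquad \nabla_v\alpha=iA(v)\alpha .$$ **Theorem.** Let $0\le r<n$ and let $M$ be an oriented Riemannian manifold of dimension $n$ (smooth, Hausdorff, second countable). The following are equivalent: (i) $M$ carries a CR hermitian structure of codimension $r$. (ii) $M$ admits a $\mathrm{Spin}^{c,r}(n)$ structure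 with a partially pure spinor field $\phi\in\Gamma(S)$, together with identifications of $P_{SO(r)}$ with the orthonormal frames of $(V^\phi)^\perp$ and of $P_{U(1)}$ with the unit vectors of $\kappa_{V^\phi}^{-1}$ as above, such that for the resulting connection $\nabla^S$ $$(X-iJ^\phi X)\cdot\nabla^S_{Y-iJ^\phi Y}\phi=(Y-iJ^\phi Y)\cdot\nabla^S_{X-iJ^\phi X}\phi\qquad\text{for all }X,Y\in V^\phi,$$ where $\nabla^S$ is extended complex linearly in its lower argument. -/

import Mathlib

open Matrix Manifold ContDiff Bundle Topology
open scoped Kronecker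

universe u

noncomputable section

namespace SpinCR

/-! ## Clifford algebra, gamma matrices, Spin groups -/

/-- The quadratic form `v ↦ -|v|²` on `ℝⁿ`, so that `v * v = -|v|²` in its Clifford algebra. -/
def negSq (n : ℕ) : QuadraticForm ℝ (Fin n → ℝ) :=
  QuadraticMap.weightedSumSquares ℝ (fun _ : Fin n => (-1 : ℝ))

theorem negSq_apply {n : ℕ} (v : Fin n → ℝ) : negSq n v = -(v ⬝ᵥ v) := by
  simp [negSq, QuadraticMap.weightedSumSquares_apply, dotProduct]

/-- The real Clifford algebra `Cl_n`. -/
abbrev Cl (n : ℕ) := CliffordAlgebra (negSq n)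

/-- Index set of the standard basis of `Δ_n = (ℂ²)^{⊗ ⌊n/2⌋}`; the tensor factors are counted
from the right, starting at `0`. -/
abbrev SpinIdx (n : ℕ) := Fin (n / 2) → Fin 2

/-- Tensor product of `2 × 2` matrices. -/
def tensorMat {k : ℕ} (A : Fin k → Matrix (Fin 2) (Fin 2) ℂ) :
    Matrix (Fin k → Fin 2) (Fin k → Fin 2) ℂ :=
  Matrix.of fun a b => ∏ p, A p (a p) (b p)

def matG1 : Matrix (Fin 2) (Fin 2) ℂ := !![Complex.I, 0; 0, -Complex.I]
def matG2 : Matrix (Fin 2) (Fin 2) ℂ := !![0, Complex.I; Complex.I, 0]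
def matT : Matrix (Fin 2) (Fin 2) ℂ := !![0, -Complex.I; Complex.I, 0]

/-- The tensor factor in position `p` of the matrix of the `i`-th basis vector
(`i` is counted from `0`). -/
def gammaFactor (i p : ℕ) : Matrix (Fin 2) (Fin 2) ℂ :=
  if p < i / 2 then matT
  else if p = i / 2 then (if i % 2 = 0 then matG1 else matG2)
  else 1

/-- The matrix `κ(e_i)` on `Δ_n`. For `n` odd the last one is `i T ⊗ ⋯ ⊗ T`. -/
def gamma (n : ℕ) (i : Fin n) : Matrix (SpinIdx n) (SpinIdx n) ℂ :=
  (if i.val / 2 < n / 2 then (1 : ℂ) else Complex.I) •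
    tensorMat (fun p : Fin (n / 2) => gammaFactor i p)

theorem tensorMat_mul {k : ℕ} (A B : Fin k → Matrix (Fin 2) (Fin 2) ℂ) :
    tensorMat A * tensorMat B = tensorMat (fun p => A p * B p) := by
  ext a b
  simp only [tensorMat, Matrix.mul_apply, Matrix.of_apply]
  rw [Finset.prod_univ_sum]
  simp [Finset.prod_mul_distrib]

theorem tensorMat_one {k : ℕ} :
    tensorMat (fun _ : Fin k => (1 : Matrix (Fin 2) (Fin 2) ℂ)) = 1 := by
  ext a b
  simp only [tensorMat, Matrix.of_apply, Matrix.one_apply]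
  by_cases h : a = b
  · subst h; simp
  · rw [if_neg h]
    obtain ⟨p, hp⟩ := Function.ne_iff.mp h
    exact Finset.prod_eq_zero (Finset.mem_univ p) (by simp [hp])

theorem tensorMat_neg {k : ℕ} (A B : Fin k → Matrix (Fin 2) (Fin 2) ℂ) (q : Fin k)
    (hq : A q = -B q) (h : ∀ p, p ≠ q → A p = B p) : tensorMat A = -tensorMat B := by
  ext a b
  simp only [tensorMat, Matrix.of_apply, Matrix.neg_apply]
  rw [Fintype.prod_eq_mul_prod_compl q, Fintype.prod_eq_mul_prod_compl q, hq]
  have : ∏ p ∈ {q}ᶜ, A p (a p) (b p) = ∏ p ∈ {q}ᶜ, B p (a p) (b p) :=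
    Finset.prod_congr rfl fun p hp => by rw [h p (by simpa using hp)]
  rw [this]; simp

theorem matT_sq : matT * matT = 1 := by
  ext i j; fin_cases i <;> fin_cases j <;> simp [matT]
theorem matG1_sq : matG1 * matG1 = -1 := by
  ext i j; fin_cases i <;> fin_cases j <;> simp [matG1]
theorem matG2_sq : matG2 * matG2 = -1 := by
  ext i j; fin_cases i <;> fin_cases j <;> simp [matG2]
theorem matG1_mul_matT : matG1 * matT = -(matT * matG1) := by
  ext i j; fin_cases i <;> fin_cases j <;> simp [matG1, matT]
theorem matG2_mul_matT : matG2 * matT = -(matT * matG2) := by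
  ext i j; fin_cases i <;> fin_cases j <;> simp [matG2, matT]
theorem matG1_mul_matG2 : matG1 * matG2 = -(matG2 * matG1) := by
  ext i j; fin_cases i <;> fin_cases j <;> simp [matG1, matG2]

theorem gamma_sq {n : ℕ} (i : Fin n) : gamma n i * gamma n i = -1 := by
  unfold gamma
  rw [smul_mul_smul_comm, tensorMat_mul]
  by_cases h : i.val / 2 < n / 2
  · rw [if_pos h, one_mul, one_smul, tensorMat_neg _ (fun _ => 1) ⟨i.val / 2, h⟩, tensorMat_one]
    · simp only [gammaFactor, lt_irrefl, if_false, if_true]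
      split_ifs
      · exact matG1_sq
      · exact matG2_sq
    · intro p hp
      have hp' : (p : ℕ) ≠ i.val / 2 := fun h' => hp (Fin.ext h')
      simp only [gammaFactor]
      split_ifs <;> first | exact matT_sq | simp
  · rw [if_neg h, Complex.I_mul_I, neg_smul, one_smul]
    congr 1
    rw [← tensorMat_one]
    congr 1
    funext p
    have : (p : ℕ) < i.val / 2 := by omega
    simp only [gammaFactor, if_pos this, matT_sq]

theorem gamma_anticomm_of_lt {n : ℕ} {i j : Fin n} (hij : i < j) :
    gamma n i * gamma n j = -(gamma n j * gamma n i) := by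
  unfold gamma
  have hij' : i.val < j.val := hij
  have hi : i.val / 2 < n / 2 := by omega
  rw [smul_mul_smul_comm, smul_mul_smul_comm, tensorMat_mul, tensorMat_mul, mul_comm, ← smul_neg]
  congr 1
  apply tensorMat_neg _ _ ⟨i.val / 2, hi⟩
  · simp only [gammaFactor, lt_irrefl, if_false, if_true]
    rcases Nat.lt_or_ge (i.val / 2) (j.val / 2) with h | h
    · simp only [if_pos h]
      split_ifs
      · exact matG1_mul_matT
      · exact matG2_mul_matT
    · have h1 : i.val / 2 = j.val / 2 := by omega
      have h2 : i.val % 2 = 0 := by omega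
      have h3 : ¬ j.val % 2 = 0 := by omega
      simp [h1, h2, h3, matG1_mul_matG2]
  · intro p hp
    have hp' : (p : ℕ) ≠ i.val / 2 := fun h' => hp (Fin.ext h')
    simp only [gammaFactor]
    rcases lt_or_gt_of_ne hp' with h | h
    · simp [h, show (p : ℕ) < j.val / 2 by omega]
    · simp [hp', show ¬ (p : ℕ) < i.val / 2 by omega]

theorem gamma_anticomm {n : ℕ} {i j : Fin n} (hij : i ≠ j) :
    gamma n i * gamma n j = -(gamma n j * gamma n i) := by
  rcases lt_or_gt_of_ne hij with h | h
  · exact gamma_anticomm_of_lt h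
  · rw [gamma_anticomm_of_lt h, neg_neg]

/-- Clifford multiplication by vectors, `x ↦ κ(x) = ∑ xᵢ κ(eᵢ)`. -/
def gammaVec (n : ℕ) : (Fin n → ℝ) →ₗ[ℝ] Matrix (SpinIdx n) (SpinIdx n) ℂ :=
  Fintype.linearCombination ℝ (gamma n)

theorem gammaVec_apply {n : ℕ} (x : Fin n → ℝ) : gammaVec n x = ∑ i, x i • gamma n i := rfl

theorem gammaVec_sq {n : ℕ} (x : Fin n → ℝ) :
    gammaVec n x * gammaVec n x = algebraMap ℝ _ (negSq n x) := by
  have key : (2 : ℝ) • (gammaVec n x * gammaVec n x) = (2 : ℝ) • algebraMap ℝ _ (negSq n x) := by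
    have e1 : gammaVec n x * gammaVec n x
        = ∑ i, ∑ j, (x i * x j) • (gamma n i * gamma n j) := by
      simp only [gammaVec_apply, Finset.sum_mul_sum, smul_mul_smul_comm]
    have e2 : gammaVec n x * gammaVec n x
        = ∑ i, ∑ j, (x i * x j) • (gamma n j * gamma n i) := by
      rw [e1, Finset.sum_comm]
      simp only [mul_comm]
    calc (2 : ℝ) • (gammaVec n x * gammaVec n x)
        = ∑ i, ∑ j, (x i * x j) • (gamma n i * gamma n j + gamma n j * gamma n i) := by
          rw [two_smul]
          nth_rw 1 [e1]
          rw [e2]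
          simp only [← Finset.sum_add_distrib, smul_add]
      _ = ∑ i, (x i * x i) • ((-2 : ℝ) • (1 : Matrix (SpinIdx n) (SpinIdx n) ℂ)) := by
          refine Finset.sum_congr rfl fun i _ => ?_
          rw [Finset.sum_eq_single i]
          · rw [gamma_sq]; congr 1; rw [neg_smul, two_smul]; abel
          · intro j _ hj
            rw [gamma_anticomm hj.symm]; simp
          · simp
      _ = _ := by
          rw [← Finset.sum_smul, negSq_apply, Algebra.algebraMap_eq_smul_one, smul_smul, smul_smul]
          congr 1
          simp only [dotProduct]; ring
  exact smul_right_injective _ (two_ne_zero' ℝ) key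

/-- The representation `κ` of the Clifford algebra on `Δ_n`. -/
def kappa (n : ℕ) : Cl n →ₐ[ℝ] Matrix (SpinIdx n) (SpinIdx n) ℂ :=
  CliffordAlgebra.lift (negSq n) ⟨gammaVec n, gammaVec_sq⟩

theorem kappa_ι {n : ℕ} (x : Fin n → ℝ) :
    kappa n (CliffordAlgebra.ι (negSq n) x) = gammaVec n x := by
  simp [kappa]

/-- `Spin(n)`: the products of an even number of unit vectors of `Cl_n`.
The generator `-1` matters only for `n = 0`, where `Spin(0) = {±1}`. -/
def Spin (n : ℕ) : Subgroup (Cl n)ˣ :=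
  Subgroup.closure ({-1} ∪ {u | ∃ x y : Fin n → ℝ, x ⬝ᵥ x = 1 ∧ y ⬝ᵥ y = 1 ∧
    (u : Cl n) = CliffordAlgebra.ι (negSq n) x * CliffordAlgebra.ι (negSq n) y})

/-- The element `-1` of `Spin(n)`. -/
def negOne (n : ℕ) : Spin n := ⟨-1, Subgroup.subset_closure (Or.inl rfl)⟩

theorem negOne_mul_self (n : ℕ) : negOne n * negOne n = 1 := by
  ext; simp [negOne]

/-- `A` is the matrix of the rotation `v ↦ g v g⁻¹` of `ℝⁿ`. -/
def IsRotationOf {n : ℕ} (g : Spin n) (A : Matrix (Fin n) (Fin n) ℝ) : Prop :=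
  ∀ v : Fin n → ℝ, ((g : (Cl n)ˣ) : Cl n) * CliffordAlgebra.ι (negSq n) v
    = CliffordAlgebra.ι (negSq n) (A *ᵥ v) * ((g : (Cl n)ˣ) : Cl n)

theorem gammaVec_injective (n : ℕ) : Function.Injective (gammaVec n) := by
  rw [injective_iff_map_eq_zero]
  intro x hx
  have h := gammaVec_sq x
  rw [hx, mul_zero, negSq_apply] at h
  have h2 := (FaithfulSMul.algebraMap_injective ℝ (Matrix (SpinIdx n) (SpinIdx n) ℂ))
    (h.symm.trans (map_zero _).symm)
  simpa using h2

theorem ι_injective (n : ℕ) : Function.Injective (CliffordAlgebra.ι (negSq n)) := by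
  intro x y h
  apply gammaVec_injective n
  rw [← kappa_ι, ← kappa_ι, h]

theorem IsRotationOf.unique {n : ℕ} {g : Spin n} {A B : Matrix (Fin n) (Fin n) ℝ}
    (hA : IsRotationOf g A) (hB : IsRotationOf g B) : A = B := by
  apply Matrix.ext_of_mulVec_single
  intro i
  apply ι_injective n
  have h := (hA (Pi.single i 1)).symm.trans (hB (Pi.single i 1))
  exact (Units.mul_left_inj _).mp h

theorem IsRotationOf.mul {n : ℕ} {g h : Spin n} {A B : Matrix (Fin n) (Fin n) ℝ}
    (hA : IsRotationOf g A) (hB : IsRotationOf h B) : IsRotationOf (g * h) (A * B) := by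
  intro v
  simp only [Subgroup.coe_mul, Units.val_mul]
  rw [mul_assoc, hB v, ← mul_assoc, hA, mul_assoc, Matrix.mulVec_mulVec]

theorem isRotationOf_one {n : ℕ} : IsRotationOf (1 : Spin n) 1 := by
  intro v; simp

theorem isRotationOf_negOne {n : ℕ} : IsRotationOf (negOne n) 1 := by
  intro v; simp [negOne]

/-- The linear map `v ↦ x v x⁻¹` for a unit vector `x`, namely `v ↦ 2⟨x,v⟩x - v`. -/
def halfTurn {n : ℕ} (x : Fin n → ℝ) : Matrix (Fin n) (Fin n) ℝ :=
  (2 : ℝ) • Matrix.vecMulVec x x - 1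

theorem halfTurn_spec {n : ℕ} (x : Fin n → ℝ) (hx : x ⬝ᵥ x = 1) (v : Fin n → ℝ) :
    CliffordAlgebra.ι (negSq n) x * CliffordAlgebra.ι (negSq n) v
      = CliffordAlgebra.ι (negSq n) (halfTurn x *ᵥ v) * CliffordAlgebra.ι (negSq n) x := by
  have hp : QuadraticMap.polar (negSq n) x v = -(2 * (x ⬝ᵥ v)) := by
    simp only [QuadraticMap.polar, negSq_apply, add_dotProduct, dotProduct_add]
    rw [dotProduct_comm v x]; ring
  have hsw := CliffordAlgebra.ι_mul_ι_add_swap (Q := negSq n) x v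
  have e : halfTurn x *ᵥ v = (2 * (x ⬝ᵥ v)) • x - v := by
    rw [halfTurn, sub_mulVec, smul_mulVec, vecMulVec_mulVec, one_mulVec]
    ext i
    simp [mul_comm, mul_assoc]
  have hxx : CliffordAlgebra.ι (negSq n) x * CliffordAlgebra.ι (negSq n) x = -1 := by
    rw [CliffordAlgebra.ι_sq_scalar, negSq_apply, hx]; simp
  rw [e, map_sub, map_smul, sub_mul, smul_mul_assoc, hxx, eq_sub_of_add_eq hsw, hp]
  rw [Algebra.algebraMap_eq_smul_one]
  simp

theorem halfTurn_orthogonal {n : ℕ} (x : Fin n → ℝ) (hx : x ⬝ᵥ x = 1) :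
    halfTurn x * halfTurn x = 1 := by
  have h : vecMulVec x x * vecMulVec x x = vecMulVec x x := by
    rw [vecMulVec_mul_vecMulVec, hx]; simp
  simp only [halfTurn, sub_mul, mul_sub, smul_mul_smul_comm, h, one_mul, mul_one]
  module

theorem halfTurn_transpose {n : ℕ} (x : Fin n → ℝ) : (halfTurn x)ᵀ = halfTurn x := by
  simp [halfTurn, transpose_vecMulVec]

theorem halfTurn_det {n : ℕ} (x : Fin n → ℝ) (hx : x ⬝ᵥ x = 1) :
    (halfTurn x).det = (-1) ^ n * (-1) := by
  have h : halfTurn x = -(1 + replicateCol Unit ((-2 : ℝ) • x) * replicateRow Unit x) := by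
    ext i j
    simp [halfTurn, vecMulVec_apply, Matrix.mul_apply, mul_assoc]
    ring
  rw [h, det_neg, det_one_add_replicateCol_mul_replicateRow, dotProduct_smul, hx]
  norm_num

theorem exists_rotation {n : ℕ} (g : Spin n) :
    ∃ A : Matrix.specialOrthogonalGroup (Fin n) ℝ, IsRotationOf g A := by
  obtain ⟨g, hg⟩ := g
  unfold Spin at hg
  induction hg using Subgroup.closure_induction with
  | mem u hu =>
    rcases hu with rfl | ⟨x, y, hx, hy, hu⟩
    · exact ⟨1, isRotationOf_negOne⟩
    · refine ⟨⟨halfTurn x * halfTurn y, ?_⟩, ?_⟩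
      · rw [Matrix.mem_specialOrthogonalGroup_iff, Matrix.mem_orthogonalGroup_iff]
        constructor
        · rw [transpose_mul,
            halfTurn_transpose, halfTurn_transpose, mul_assoc, ← mul_assoc (halfTurn y),
            halfTurn_orthogonal y hy, one_mul, halfTurn_orthogonal x hx]
        · rw [det_mul, halfTurn_det x hx, halfTurn_det y hy]
          have : ((-1 : ℝ) ^ n) * (-1) ^ n = 1 := by rw [← mul_pow]; simp
          linear_combination this
      · intro v
        change (u : Cl n) * _ = _ * (u : Cl n)
        rw [hu, mul_assoc, halfTurn_spec y hy, ← mul_assoc, halfTurn_spec x hx, mul_assoc,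
          Matrix.mulVec_mulVec]
  | one => exact ⟨1, isRotationOf_one⟩
  | mul a b ha hb iha ihb =>
    obtain ⟨A, hA⟩ := iha
    obtain ⟨B, hB⟩ := ihb
    exact ⟨A * B, IsRotationOf.mul (g := ⟨a, ha⟩) (h := ⟨b, hb⟩) hA hB⟩
  | inv a ha iha =>
    obtain ⟨A, hA⟩ := iha
    refine ⟨A⁻¹, fun v => ?_⟩
    have h := hA (((A⁻¹ : Matrix.specialOrthogonalGroup (Fin n) ℝ) : Matrix _ _ ℝ) *ᵥ v)
    have hAA : (A : Matrix (Fin n) (Fin n) ℝ)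
        * ((A⁻¹ : Matrix.specialOrthogonalGroup (Fin n) ℝ) : Matrix (Fin n) (Fin n) ℝ) = 1 := by
      rw [← Submonoid.coe_mul, mul_inv_cancel, Submonoid.coe_one]
    rw [Matrix.mulVec_mulVec, hAA, one_mulVec] at h
    change ((a⁻¹ : (Cl n)ˣ) : Cl n) * _ = _ * ((a⁻¹ : (Cl n)ˣ) : Cl n)
    change (a : Cl n) * _ = _ * (a : Cl n) at h
    rw [Units.inv_mul_eq_iff_eq_mul, ← mul_assoc, h, mul_assoc, Units.mul_inv, mul_one]

/-- The double covering `λ_n : Spin(n) → SO(n)`, `λ_n(g) v = g v g⁻¹`. -/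
def lam (n : ℕ) : Spin n →* Matrix.specialOrthogonalGroup (Fin n) ℝ where
  toFun g := (exists_rotation g).choose
  map_one' := Subtype.ext ((exists_rotation 1).choose_spec.unique isRotationOf_one)
  map_mul' g h := Subtype.ext ((exists_rotation (g * h)).choose_spec.unique
    ((exists_rotation g).choose_spec.mul (exists_rotation h).choose_spec))

theorem lam_spec {n : ℕ} (g : Spin n) : IsRotationOf g (lam n g) :=
  (exists_rotation g).choose_spec

theorem lam_negOne (n : ℕ) : lam n (negOne n) = 1 :=
  Subtype.ext ((lam_spec (negOne n)).unique isRotationOf_negOne)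

/-- The spin representation `κ_n` of `Spin(n)` on `Δ_n`. -/
def kappaSpin (n : ℕ) : Spin n →* Matrix (SpinIdx n) (SpinIdx n) ℂ :=
  ((kappa n : Cl n →* Matrix (SpinIdx n) (SpinIdx n) ℂ).comp (Units.coeHom (Cl n))).comp
    (Spin n).subtype

theorem kappaSpin_negOne (n : ℕ) : kappaSpin n (negOne n) = -1 := by
  simp [kappaSpin, negOne]

theorem negOne_comm {n : ℕ} (g : Spin n) : negOne n * g = g * negOne n := by
  ext; simp [negOne]

/-- The subgroup generated by a central element is normal. -/
theorem zpowers_normal_of_comm {G : Type*} [Group G] (z : G) (hz : ∀ g, z * g = g * z) :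
    (Subgroup.zpowers z).Normal :=
  ⟨fun a ha g => by
    obtain ⟨k, rfl⟩ := Subgroup.mem_zpowers_iff.mp ha
    have : Commute g (z ^ k) := Commute.zpow_right (hz g).symm k
    rw [this.eq]; simp⟩

/-- The subgroup `{±(1,1)}` of `Spin(r) × U(1)`. -/
def pmSpinc (r : ℕ) : Subgroup (Spin r × Circle) := Subgroup.zpowers (negOne r, -1)

instance (r : ℕ) : (pmSpinc r).Normal :=
  zpowers_normal_of_comm _ fun g => Prod.ext (negOne_comm g.1) (mul_comm _ _)

/-- `Spin^c(r) = (Spin(r) × U(1)) / {±(1,1)}`. -/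
abbrev Spinc (r : ℕ) := (Spin r × Circle) ⧸ pmSpinc r

/-- The element `-1 = [1, -1]` of `Spin^c(r)`. -/
def negOneSpinc (r : ℕ) : Spinc r := QuotientGroup.mk (1, -1)

/-- The subgroup `{±(1,1)}` of `Spin(n) × Spin^c(r)`. -/
def pmSpincr (n r : ℕ) : Subgroup (Spin n × Spinc r) := Subgroup.zpowers (negOne n, negOneSpinc r)

theorem negOneSpinc_comm {r : ℕ} (s : Spinc r) : negOneSpinc r * s = s * negOneSpinc r := by
  induction s using QuotientGroup.induction_on with
  | H s =>
    rw [negOneSpinc, ← QuotientGroup.mk_mul, ← QuotientGroup.mk_mul]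
    congr 1
    exact Prod.ext (by simp) (mul_comm _ _)

instance (n r : ℕ) : (pmSpincr n r).Normal :=
  zpowers_normal_of_comm _ fun g => Prod.ext (negOne_comm g.1) (negOneSpinc_comm g.2)

/-- `Spin^{c,r}(n) = (Spin(n) × Spin^c(r)) / {±(1,1)}`. -/
abbrev Spincr (n r : ℕ) := (Spin n × Spinc r) ⧸ pmSpincr n r

/-- `Spin^c(r) → SO(r)`, `[h, z] ↦ λ_r(h)`. -/
def spincToSO (r : ℕ) : Spinc r →* Matrix.specialOrthogonalGroup (Fin r) ℝ :=
  QuotientGroup.lift (pmSpinc r) ((lam r).comp (MonoidHom.fst _ _)) (by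
    rw [pmSpinc, Subgroup.zpowers_le, MonoidHom.mem_ker]
    exact lam_negOne r)

/-- `Spin^c(r) → U(1)`, `[h, z] ↦ z²`. -/
def spincToU (r : ℕ) : Spinc r →* Circle :=
  QuotientGroup.lift (pmSpinc r) ((powMonoidHom 2).comp (MonoidHom.snd _ _)) (by
    rw [pmSpinc, Subgroup.zpowers_le, MonoidHom.mem_ker]
    ext; simp)

/-- The representation `[h, z] ↦ z κ_r(h)` of `Spin^c(r)` on `Δ_r`. -/
def spincRep (r : ℕ) : Spinc r →* Matrix (SpinIdx r) (SpinIdx r) ℂ :=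
  QuotientGroup.lift (pmSpinc r)
    { toFun := fun p => (p.2 : ℂ) • kappaSpin r p.1
      map_one' := by simp
      map_mul' := fun p q => by
        simp only [Prod.snd_mul, Prod.fst_mul, Circle.coe_mul, map_mul, smul_mul_smul_comm] } (by
    rw [pmSpinc, Subgroup.zpowers_le, MonoidHom.mem_ker]
    simp [kappaSpin_negOne])

/-- First component of `λ_{n,r,2}`: `[g, [h, z]] ↦ λ_n(g)`. -/
def spincrToSOn (n r : ℕ) : Spincr n r →* Matrix.specialOrthogonalGroup (Fin n) ℝ :=
  QuotientGroup.lift (pmSpincr n r) ((lam n).comp (MonoidHom.fst _ _)) (by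
    rw [pmSpincr, Subgroup.zpowers_le, MonoidHom.mem_ker]
    exact lam_negOne n)

/-- Second component of `λ_{n,r,2}`: `[g, [h, z]] ↦ λ_r(h)`. -/
def spincrToSOr (n r : ℕ) : Spincr n r →* Matrix.specialOrthogonalGroup (Fin r) ℝ :=
  QuotientGroup.lift (pmSpincr n r) ((spincToSO r).comp (MonoidHom.snd _ _)) (by
    rw [pmSpincr, Subgroup.zpowers_le, MonoidHom.mem_ker]
    simp [negOneSpinc, spincToSO])

/-- Third component of `λ_{n,r,2}`: `[g, [h, z]] ↦ z²`. -/
def spincrToU (n r : ℕ) : Spincr n r →* Circle :=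
  QuotientGroup.lift (pmSpincr n r) ((spincToU r).comp (MonoidHom.snd _ _)) (by
    rw [pmSpincr, Subgroup.zpowers_le, MonoidHom.mem_ker]
    ext; simp [negOneSpinc, spincToU])

/-- The twisted spin representation `κ_n^{c,r}` on `Δ_r ⊗ Δ_n`,
`[g, [h, z]] ↦ z κ_r(h) ⊗ κ_n(g)`. -/
def spincrRep (n r : ℕ) :
    Spincr n r →* Matrix (SpinIdx r × SpinIdx n) (SpinIdx r × SpinIdx n) ℂ :=
  QuotientGroup.lift (pmSpincr n r)
    { toFun := fun p => spincRep r p.2 ⊗ₖ kappaSpin n p.1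
      map_one' := by simp
      map_mul' := fun p q => by simp [Matrix.mul_kronecker_mul] } (by
    rw [pmSpincr, Subgroup.zpowers_le, MonoidHom.mem_ker]
    simp only [MonoidHom.coe_mk, OneHom.coe_mk, kappaSpin_negOne, negOneSpinc, spincRep,
      QuotientGroup.lift_mk]
    ext a b
    simp [Matrix.kroneckerMap_apply, Matrix.one_apply, Prod.ext_iff]
    split_ifs <;> simp_all)

/-! ## Twisted spinors and partial purity -/

/-- The twisted spinor module `Δ_r ⊗ Δ_n`, as `ℂ^{a} ⊗ ℂ^{b} = ℂ^{a × b}`. -/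
abbrev TwSpinor (r n : ℕ) := SpinIdx r × SpinIdx n → ℂ

/-- The unitary basis `u_ε = (1, -ε i)/√2`, `ε = ±1`, of `ℂ²`. -/
def uVec (ε : ℤˣ) : Fin 2 → ℂ :=
  ![1 / (√2 : ℝ), -(((ε : ℤ) : ℂ) * Complex.I) / (√2 : ℝ)]

/-- The unitary basis `u_{ε_1,…,ε_k} = u_{ε_1} ⊗ ⋯ ⊗ u_{ε_k}` of `Δ_r`. -/
def uBasis {k : ℕ} (ε : Fin k → ℤˣ) : (Fin k → Fin 2) → ℂ := fun a => ∏ p, uVec (ε p) (a p)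

/-- The positive half-spin space `Δ_r⁺` (`r` even): the span of the `u_ε` in which `ε` has an even
number of entries `-1`. -/
def deltaPlus (r : ℕ) : Submodule ℂ (SpinIdx r → ℂ) :=
  Submodule.span ℂ {ψ | ∃ ε : Fin (r / 2) → ℤˣ, ∏ p, ε p = 1 ∧ ψ = uBasis ε}

open Classical in
/-- The twisting space `Σ_r`: it is `Δ_r` for `r` odd and for `r = 2, 4`, and `Δ_r⁺` for the other
even `r`. (On `Δ_2⁺` the element `f₁f₂`, on `Δ_4⁺` the element `f₁f₂f₃f₄` acts by a nonzero
scalar, so that these half-spin spaces admit no partially pure spinor.) -/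
def sigmaSpace (r : ℕ) : Submodule ℂ (SpinIdx r → ℂ) :=
  if Odd r ∨ r = 2 ∨ r = 4 then ⊤ else deltaPlus r

/-- The subspace `Σ_r ⊗ Δ_n` of `Δ_r ⊗ Δ_n`. -/
def sigmaTensor (r n : ℕ) : Submodule ℂ (TwSpinor r n) where
  carrier := {φ | ∀ b, (fun a => φ (a, b)) ∈ sigmaSpace r}
  add_mem' h h' b := (sigmaSpace r).add_mem (h b) (h' b)
  zero_mem' _ := (sigmaSpace r).zero_mem
  smul_mem' c _ h b := (sigmaSpace r).smul_mem c (h b)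

/-- Action of an endomorphism of `Δ_n` on `Δ_r ⊗ Δ_n`. -/
def actN {n r : ℕ} (A : Matrix (SpinIdx n) (SpinIdx n) ℂ) (φ : TwSpinor r n) : TwSpinor r n :=
  ((1 : Matrix (SpinIdx r) (SpinIdx r) ℂ) ⊗ₖ A) *ᵥ φ

/-- Action of an endomorphism of `Δ_r` on `Δ_r ⊗ Δ_n`. -/
def actR {n r : ℕ} (B : Matrix (SpinIdx r) (SpinIdx r) ℂ) (φ : TwSpinor r n) : TwSpinor r n :=
  (B ⊗ₖ (1 : Matrix (SpinIdx n) (SpinIdx n) ℂ)) *ᵥ φ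

/-- Clifford multiplication `X · φ` by a vector `X ∈ ℝⁿ`. -/
def cliff {n r : ℕ} (X : Fin n → ℝ) (φ : TwSpinor r n) : TwSpinor r n := actN (gammaVec n X) φ

/-- The Hermitian product on `Δ_r ⊗ Δ_n`. -/
def herm {n r : ℕ} (ψ φ : TwSpinor r n) : ℂ := ψ ⬝ᵥ star φ

/-- The `2`-form `η_{kl}^φ(X,Y) = Re ⟨X ∧ Y · κ(f_k f_l) · φ, φ⟩`, where `X ∧ Y` acts as
`(XY - YX)/2`. -/
def eta {n r : ℕ} (φ : TwSpinor r n) (k l : Fin r) (X Y : Fin n → ℝ) : ℝ :=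
  (herm (actN ((1 / 2 : ℝ) • (gammaVec n X * gammaVec n Y - gammaVec n Y * gammaVec n X))
    (actR (gamma r k * gamma r l) φ)) φ).re

/-- Clifford action of a `2`-form: `η · φ = ∑_{i<j} η(e_i, e_j) e_i e_j · φ`. -/
def twoFormAct {n r : ℕ} (η : (Fin n → ℝ) → (Fin n → ℝ) → ℝ) (φ : TwSpinor r n) : TwSpinor r n :=
  ∑ i, ∑ j ∈ Finset.Ioi i,
    η (Pi.single i 1) (Pi.single j 1) • actN (gamma n i * gamma n j) φ

theorem cliff_add {n r : ℕ} (X Y : Fin n → ℝ) (φ : TwSpinor r n) :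
    cliff (X + Y) φ = cliff X φ + cliff Y φ := by
  simp [cliff, actN, map_add, Matrix.kronecker_add, Matrix.add_mulVec]

theorem cliff_smul {n r : ℕ} (c : ℝ) (X : Fin n → ℝ) (φ : TwSpinor r n) :
    cliff (c • X) φ = c • cliff X φ := by
  simp [cliff, actN, map_smul, Matrix.kronecker_smul, Matrix.smul_mulVec]

/-- The space `V^φ ⊆ ℝⁿ` of all vectors `X` for which there is a vector `Y` with
`X · φ = i Y · φ`. Such a `Y` belongs to `V^φ` too, because `Y · φ = i (-X) · φ`. -/
def pureSpace {n r : ℕ} (φ : TwSpinor r n) : Submodule ℝ (Fin n → ℝ) where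
  carrier := {X | ∃ Y : Fin n → ℝ, cliff X φ = Complex.I • cliff Y φ}
  add_mem' := by
    rintro X X' ⟨Y, h⟩ ⟨Y', h'⟩
    exact ⟨Y + Y', by rw [cliff_add, cliff_add, h, h', smul_add]⟩
  zero_mem' := ⟨0, by
    have h := cliff_smul 0 (0 : Fin n → ℝ) φ
    rw [zero_smul, zero_smul] at h
    rw [h, smul_zero]⟩
  smul_mem' := by
    rintro c X ⟨Y, h⟩
    exact ⟨c • Y, by rw [cliff_smul, cliff_smul, h, smul_comm]⟩

/-- Twisted partially pure spinors. -/
structure IsPartiallyPure {n r : ℕ} (φ : TwSpinor r n) : Prop where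
  lt : r < n
  mem : φ ∈ sigmaTensor r n
  unit : herm φ φ = 1
  finrank_pureSpace : Module.finrank ℝ (pureSpace φ) = n - r
  eta_add : ∀ k l : Fin r, k < l →
    twoFormAct (eta φ k l) φ + actR (gamma r k * gamma r l) φ = 0
  herm_eq_zero : ∀ k l : Fin r, k < l → herm (actR (gamma r k * gamma r l) φ) φ = 0
  herm_four : r = 4 → herm (actR (List.ofFn (gamma r)).prod φ) φ = 0

/-! ## Riemannian geometry of the base manifold -/

section Manifold

variable {n : ℕ} {M : Type u} [TopologicalSpace M] [ChartedSpace (EuclideanSpace ℝ (Fin n)) M]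
  [IsManifold (𝓡 n) ∞ M]

/-- Smoothness of a vector field on a set. -/
def SmoothFieldOn (X : ∀ x : M, TangentSpace (𝓡 n) x) (U : Set M) : Prop :=
  ContMDiffOn (𝓡 n) ((𝓡 n).prod 𝓘(ℝ, EuclideanSpace ℝ (Fin n))) ∞
    (fun x => TotalSpace.mk' (EuclideanSpace ℝ (Fin n)) x (X x)) U

/-- An orientation of `M`: an orientation of every tangent space which is given near each point
by a smooth local frame. -/
structure ManifoldOrientation (n : ℕ) (M : Type u) [TopologicalSpace M]
    [ChartedSpace (EuclideanSpace ℝ (Fin n)) M] [IsManifold (𝓡 n) ∞ M] where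
  at' : ∀ x : M, Orientation ℝ (TangentSpace (𝓡 n) x) (Fin n)
  exists_frame : ∀ x : M, ∃ U ∈ 𝓝 x, ∃ e : Fin n → ∀ y : M, TangentSpace (𝓡 n) y,
    ∃ h : IsLocalFrameOn (𝓡 n) (EuclideanSpace ℝ (Fin n)) ∞ e U,
      ∀ (y : M) (hy : y ∈ U), (h.toBasisAt hy).orientation = at' y

variable [RiemannianBundle (fun x : M => TangentSpace (𝓡 n) x)]

/-- Koszul's expression for `⟨∇_X Y, Z⟩`. -/
def koszul (X Y Z : ∀ x : M, TangentSpace (𝓡 n) x) (x : M) : ℝ :=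
  (1 / 2) * (mvfderiv (𝓡 n) (fun y => inner ℝ (Y y) (Z y)) x (X x)
    + mvfderiv (𝓡 n) (fun y => inner ℝ (Z y) (X y)) x (Y x)
    - mvfderiv (𝓡 n) (fun y => inner ℝ (X y) (Y y)) x (Z x)
    + inner ℝ (VectorField.mlieBracket (𝓡 n) X Y x) (Z x)
    - inner ℝ (VectorField.mlieBracket (𝓡 n) Y Z x) (X x)
    + inner ℝ (VectorField.mlieBracket (𝓡 n) Z X x) (Y x))

instance (x : M) : FiniteDimensional ℝ (TangentSpace (𝓡 n) x) :=
  inferInstanceAs (FiniteDimensional ℝ (EuclideanSpace ℝ (Fin n)))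

/-- The Levi-Civita connection: `leviCivita Y x v = (∇_v Y)(x)`, for a vector field `Y` which is
smooth near `x`. It is given by Koszul's formula, evaluated on an orthonormal basis of `T_xM`; the
tangent vectors are extended to vector fields smooth near `x`. -/
def leviCivita (Y : ∀ x : M, TangentSpace (𝓡 n) x) (x : M) (v : TangentSpace (𝓡 n) x) :
    TangentSpace (𝓡 n) x :=
  ∑ a, koszul (FiberBundle.extend (EuclideanSpace ℝ (Fin n)) v) Y
      (FiberBundle.extend (EuclideanSpace ℝ (Fin n))
        (stdOrthonormalBasis ℝ (TangentSpace (𝓡 n) x) a)) x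
    • stdOrthonormalBasis ℝ (TangentSpace (𝓡 n) x) a

variable (D : ∀ x : M, Submodule ℝ (TangentSpace (𝓡 n) x))
  (J : ∀ x : M, TangentSpace (𝓡 n) x → TangentSpace (𝓡 n) x)

/-- The connection `∇^D_v Y = proj_D (∇_v Y)` on a distribution `D`. -/
def covD (Y : ∀ x : M, TangentSpace (𝓡 n) x) (x : M) (v : TangentSpace (𝓡 n) x) :
    TangentSpace (𝓡 n) x :=
  (D x).starProjection (leviCivita Y x v)

/-- `(∇^D_v J) Y = ∇^D_v (J Y) - J (∇^D_v Y)`. -/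
def covDJ (Y : ∀ x : M, TangentSpace (𝓡 n) x) (x : M) (v : TangentSpace (𝓡 n) x) :
    TangentSpace (𝓡 n) x :=
  covD D (fun y => J y (Y y)) x v - J x (covD D Y x v)

/-- The hermitian connection `∇̃^D_v Y = ∇^D_v Y + ½ (∇^D_v J)(J Y)` on `(D, J)`. -/
def hermCov (Y : ∀ x : M, TangentSpace (𝓡 n) x) (x : M) (v : TangentSpace (𝓡 n) x) :
    TangentSpace (𝓡 n) x :=
  covD D Y x v + (1 / 2 : ℝ) • covDJ D J (fun y => J y (Y y)) x v

/-- The unit vectors of the fibre at `x` of the anticanonical bundle `κ_D⁻¹`, the dual of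
`κ_D = Λ^m D^{1,0}`, i.e. (through the metric) `Λ^m D^{0,1}`, where `2m = rk D`: the alternating
forms of degree `m` on `D_x` which are complex multilinear for `J` and have absolute value `1` on
unitary bases of `(D_x, J)`. A form on `D_x` is regarded as a form on `T_xM` that vanishes as
soon as one of its arguments is orthogonal to `D_x`. -/
structure IsUnitAnticanonical {m : ℕ} (x : M) (α : TangentSpace (𝓡 n) x [⋀^Fin m]→ₗ[ℝ] ℂ) :
    Prop where
  normal : ∀ (w : Fin m → TangentSpace (𝓡 n) x) (i : Fin m), w i ∈ (D x)ᗮ → α w = 0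
  complex : ∀ w : Fin m → TangentSpace (𝓡 n) x, (∀ i, w i ∈ D x) → ∀ i : Fin m,
    α (Function.update w i (J x (w i))) = Complex.I * α w
  unit : ∀ w : Fin m → TangentSpace (𝓡 n) x, (∀ i, w i ∈ D x) →
    Orthonormal ℝ (Sum.elim w fun i => J x (w i)) → ‖α w‖ = 1

/-- The connection `1`-form `A` of the connection induced by `∇̃^D` on `κ_D⁻¹`, in the local
unit section `α`: the real number `A(v)` with `∇̃_v α = i A(v) α`, where
`(∇̃_v α)(Y_1, …, Y_m) = v(α(Y_1, …, Y_m)) - ∑_s α(Y_1, …, ∇̃_v Y_s, …, Y_m)`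
for all local sections `Y_1, …, Y_m` of `D`. -/
def anticanonicalForm {m : ℕ} (α : ∀ y : M, TangentSpace (𝓡 n) y [⋀^Fin m]→ₗ[ℝ] ℂ) (x : M)
    (v : TangentSpace (𝓡 n) x) : ℝ :=
  Classical.epsilon fun a : ℝ =>
    ∀ (U : Set M) (Y : Fin m → ∀ y : M, TangentSpace (𝓡 n) y), IsOpen U → x ∈ U →
      (∀ s, SmoothFieldOn (Y s) U ∧ ∀ y ∈ U, Y s y ∈ D y) →
      mvfderiv (𝓡 n) (fun y => α y fun s => Y s y) x v
          - ∑ s, α x (Function.update (fun s => Y s x) s (hermCov D J (Y s) x v))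
        = Complex.I * (a : ℂ) * α x fun s => Y s x

end Manifold

/-! ## CR structures -/

section CR

variable {n : ℕ} {M : Type u} [TopologicalSpace M] [ChartedSpace (EuclideanSpace ℝ (Fin n)) M]
  [IsManifold (𝓡 n) ∞ M]

/-- An almost CR structure of codimension `r`: a smooth subbundle `D` of rank `n - r` of the tangent
bundle, with a smooth bundle automorphism `J` such that `J² = -1`. -/
structure AlmostCR (n r : ℕ) (M : Type u) [TopologicalSpace M]
    [ChartedSpace (EuclideanSpace ℝ (Fin n)) M] [IsManifold (𝓡 n) ∞ M] where
  D : ∀ x : M, Submodule ℝ (TangentSpace (𝓡 n) x)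
  J : ∀ x : M, D x →ₗ[ℝ] D x
  codim : ∀ x, Module.finrank ℝ (D x) + r = n
  smooth_D : ∀ x : M, ∃ U : Set M, IsOpen U ∧ x ∈ U ∧
    ∃ e : Fin (n - r) → ∀ y : M, TangentSpace (𝓡 n) y, (∀ a, SmoothFieldOn (e a) U) ∧
      ∀ y ∈ U, LinearIndependent ℝ (fun a => e a y) ∧
        Submodule.span ℝ (Set.range fun a => e a y) = D y
  smooth_J : ∀ (U : Set M) (X : ∀ x, D x), IsOpen U →
    SmoothFieldOn (fun x => (X x : TangentSpace (𝓡 n) x)) U →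
    SmoothFieldOn (fun x => (J x (X x) : TangentSpace (𝓡 n) x)) U
  J_sq : ∀ (x : M) (v : D x), J x (J x v) = -v

namespace AlmostCR

variable {r : ℕ} (C : AlmostCR n r M)

/-- The structure is hermitian: `J` is orthogonal for the Riemannian metric. -/
def IsHermitian [RiemannianBundle (fun x : M => TangentSpace (𝓡 n) x)] : Prop :=
  ∀ (x : M) (v w : C.D x),
    inner ℝ (C.J x v : TangentSpace (𝓡 n) x) (C.J x w : TangentSpace (𝓡 n) x)
      = inner ℝ (v : TangentSpace (𝓡 n) x) (w : TangentSpace (𝓡 n) x)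

/-- The Lie bracket of two sections of `D`. -/
def bracket (X Y : ∀ x, C.D x) (x : M) : TangentSpace (𝓡 n) x :=
  VectorField.mlieBracket (𝓡 n) (fun y => (X y : TangentSpace (𝓡 n) y))
    (fun y => (Y y : TangentSpace (𝓡 n) y)) x

/-- The structure is a CR structure: for all `X, Y ∈ Γ(D)`, both `[X,Y] - [JX,JY]` and
`[JX,Y] + [X,JY]` are sections of `D`, and `J([X,Y] - [JX,JY]) = [JX,Y] + [X,JY]`. -/
def IsCR : Prop :=
  ∀ X Y : ∀ x, C.D x,
    SmoothFieldOn (fun x => (X x : TangentSpace (𝓡 n) x)) Set.univ →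
    SmoothFieldOn (fun x => (Y x : TangentSpace (𝓡 n) x)) Set.univ →
    ∀ x : M, ∃ (h₁ : C.bracket X Y x
          - C.bracket (fun y => C.J y (X y)) (fun y => C.J y (Y y)) x ∈ C.D x)
      (h₂ : C.bracket (fun y => C.J y (X y)) Y x
          + C.bracket X (fun y => C.J y (Y y)) x ∈ C.D x),
      C.J x ⟨_, h₁⟩ = ⟨_, h₂⟩

end AlmostCR

end CR

/-! ## Principal bundles and twisted spin structures -/

/-- A smooth principal `G`-bundle over `M`: fibres with a simply transitive right action of `G`, and
an atlas of local sections (equivalently, of equivariant local trivialisations) with smooth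
transition functions. Smoothness of a map into `G` is smoothness of its composite with `ρ`, the
embedding of the Lie group `G` in the normed space `E`. -/
structure SmoothPrincipalBundle (n : ℕ) (M : Type u) [TopologicalSpace M]
    [ChartedSpace (EuclideanSpace ℝ (Fin n)) M] (G : Type) [Group G]
    {E : Type} [NormedAddCommGroup E] [NormedSpace ℝ E] (ρ : G → E) where
  Fib : M → Type u
  act : ∀ {x : M}, Fib x → G → Fib x
  act_one : ∀ {x : M} (p : Fib x), act p 1 = p
  act_mul : ∀ {x : M} (p : Fib x) (g h : G), act p (g * h) = act (act p g) h
  simply_transitive : ∀ {x : M} (p q : Fib x), ∃! g, act p g = q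
  Index : Type u
  dom : Index → Set M
  isOpen_dom : ∀ i, IsOpen (dom i)
  exists_mem_dom : ∀ x, ∃ i, x ∈ dom i
  sec : Index → ∀ x, Fib x
  smooth_transition : ∀ i j, ∃ g : M → G,
    (∀ x ∈ dom i ∩ dom j, act (sec i x) (g x) = sec j x) ∧
      ContMDiffOn (𝓡 n) 𝓘(ℝ, E) ∞ (fun x => ρ (g x)) (dom i ∩ dom j)

/-- The embedding of `SO(r)` in the space of real matrices. -/
def embSO (r : ℕ) (A : Matrix.specialOrthogonalGroup (Fin r) ℝ) : Fin r → Fin r → ℝ :=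
  fun i j => (A : Matrix (Fin r) (Fin r) ℝ) i j

/-- The embedding of `U(1)` in `ℂ`. -/
def embU (z : Circle) : ℂ := z

/-- The embedding of the compact Lie group `Spin^{c,r}(n)`, `n ≥ 1`, in the space of complex matrices
given by its representation on `Δ_r ⊗ Δ_n`, which is faithful. -/
def embSpincr (n r : ℕ) (g : Spincr n r) :
    SpinIdx r × SpinIdx n → SpinIdx r × SpinIdx n → ℂ :=
  fun a b => spincrRep n r g a b

section SpinStructure

variable {n : ℕ} {M : Type u} [TopologicalSpace M] [ChartedSpace (EuclideanSpace ℝ (Fin n)) M]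
  [IsManifold (𝓡 n) ∞ M] [RiemannianBundle (fun x : M => TangentSpace (𝓡 n) x)]

/-- A `Spin^{c,r}(n)` structure on the oriented Riemannian manifold `M`: principal bundles `PSpin`,
`PSO`, `PU` with groups `Spin^{c,r}(n)`, `SO(r)`, `U(1)`, and a smooth map
`Λ = (frame, toSO, toU)` over `M` from `PSpin` to the fibre product of the bundle of positively
oriented orthonormal frames of `M` with `PSO` and `PU`, such that `Λ(p g) = Λ(p) λ_{n,r,2}(g)`.
As the fibres are simply transitive and `λ_{n,r,2}` is a twofold covering, so is `Λ`. -/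
structure SpincrStructure (r : ℕ) (o : ManifoldOrientation n M) where
  PSpin : SmoothPrincipalBundle n M (Spincr n r) (embSpincr n r)
  PSO : SmoothPrincipalBundle n M (Matrix.specialOrthogonalGroup (Fin r) ℝ) (embSO r)
  PU : SmoothPrincipalBundle n M Circle embU
  frame : ∀ {x : M}, PSpin.Fib x → OrthonormalBasis (Fin n) ℝ (TangentSpace (𝓡 n) x)
  frame_oriented : ∀ {x : M} (p : PSpin.Fib x), (frame p).toBasis.orientation = o.at' x
  frame_act : ∀ {x : M} (p : PSpin.Fib x) (g : Spincr n r) (a : Fin n),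
    frame (PSpin.act p g) a
      = ∑ b, (spincrToSOn n r g : Matrix (Fin n) (Fin n) ℝ) b a • frame p b
  smooth_frame : ∀ i a, SmoothFieldOn (fun x => frame (PSpin.sec i x) a) (PSpin.dom i)
  toSO : ∀ {x : M}, PSpin.Fib x → PSO.Fib x
  toSO_act : ∀ {x : M} (p : PSpin.Fib x) (g : Spincr n r),
    toSO (PSpin.act p g) = PSO.act (toSO p) (spincrToSOr n r g)
  smooth_toSO : ∀ i j, ∃ g : M → Matrix.specialOrthogonalGroup (Fin r) ℝ,
    (∀ x ∈ PSpin.dom i ∩ PSO.dom j, PSO.act (PSO.sec j x) (g x) = toSO (PSpin.sec i x)) ∧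
      ContMDiffOn (𝓡 n) 𝓘(ℝ, Fin r → Fin r → ℝ) ∞ (fun x => embSO r (g x))
        (PSpin.dom i ∩ PSO.dom j)
  toU : ∀ {x : M}, PSpin.Fib x → PU.Fib x
  toU_act : ∀ {x : M} (p : PSpin.Fib x) (g : Spincr n r),
    toU (PSpin.act p g) = PU.act (toU p) (spincrToU n r g)
  smooth_toU : ∀ i j, ∃ g : M → Circle,
    (∀ x ∈ PSpin.dom i ∩ PU.dom j, PU.act (PU.sec j x) (g x) = toU (PSpin.sec i x)) ∧
      ContMDiffOn (𝓡 n) 𝓘(ℝ, ℂ) ∞ (fun x => embU (g x)) (PSpin.dom i ∩ PU.dom j)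

namespace SpincrStructure

variable {r : ℕ} {o : ManifoldOrientation n M} (S : SpincrStructure r o)

/-- A smooth twisted spinor field, i.e. a smooth section of the bundle associated with `PSpin` and
`κ_n^{c,r}`, as an equivariant function on `PSpin`. -/
structure SpinorField where
  toFun : ∀ {x : M}, S.PSpin.Fib x → TwSpinor r n
  equivariant : ∀ {x : M} (p : S.PSpin.Fib x) (g : Spincr n r),
    toFun (S.PSpin.act p g) = spincrRep n r g⁻¹ *ᵥ toFun p
  smooth : ∀ i, ContMDiffOn (𝓡 n) 𝓘(ℝ, TwSpinor r n) ∞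
    (fun x => toFun (S.PSpin.sec i x)) (S.PSpin.dom i)

/-- Clifford multiplication by a tangent vector, in the frame given by `p`. -/
def tcliff {x : M} (p : S.PSpin.Fib x) (X : TangentSpace (𝓡 n) x) (ψ : TwSpinor r n) :
    TwSpinor r n :=
  cliff (fun a => inner ℝ (S.frame p a) X) ψ

namespace SpinorField

variable {S} (φ : S.SpinorField)

/-- The spinor field is partially pure at every point. -/
def IsPure : Prop := ∀ (x : M) (p : S.PSpin.Fib x), IsPartiallyPure (φ.toFun p)

/-- The distribution `V^φ`. -/
def V (x : M) : Submodule ℝ (TangentSpace (𝓡 n) x) :=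
  ⨅ p : S.PSpin.Fib x, (pureSpace (φ.toFun p)).comap
    (LinearMap.pi fun a => innerₛₗ ℝ (S.frame p a))

/-- The endomorphism `J^φ` of `V^φ`: `J^φ X` is the vector with `X · φ = i (J^φ X) · φ`. Its values
outside `V^φ` are irrelevant. -/
def J (x : M) (X : TangentSpace (𝓡 n) x) : TangentSpace (𝓡 n) x :=
  Classical.epsilon fun Y => ∀ p : S.PSpin.Fib x,
    S.tcliff p X (φ.toFun p) = Complex.I • S.tcliff p Y (φ.toFun p)

end SpinorField

/-- Let `(D, J)` be a distribution of corank `r` with an orthogonal complex structure. The spinor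
bundle of `S` is `[κ_D^{-1/2} ⊗ Σ(D^⊥)] ⊗ Δ(M)` when `PSO` is identified with the bundle
of orthonormal frames of `D^⊥` (for an orientation of `D^⊥`), and `PU` with the bundle
of unit vectors of the anticanonical bundle `κ_D⁻¹`. -/
structure AdaptedIdentification (D : ∀ x : M, Submodule ℝ (TangentSpace (𝓡 n) x))
    (J : ∀ x : M, TangentSpace (𝓡 n) x → TangentSpace (𝓡 n) x) where
  normalFrame : ∀ {x : M}, S.PSO.Fib x → Fin r → TangentSpace (𝓡 n) x
  normalFrame_mem : ∀ {x : M} (q : S.PSO.Fib x) (k : Fin r), normalFrame q k ∈ (D x)ᗮ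
  normalFrame_orthonormal : ∀ {x : M} (q : S.PSO.Fib x), Orthonormal ℝ (normalFrame q)
  normalFrame_act : ∀ {x : M} (q : S.PSO.Fib x) (A : Matrix.specialOrthogonalGroup (Fin r) ℝ)
    (k : Fin r), normalFrame (S.PSO.act q A) k
      = ∑ l, (A : Matrix (Fin r) (Fin r) ℝ) l k • normalFrame q l
  smooth_normalFrame : ∀ j k, SmoothFieldOn (fun x => normalFrame (S.PSO.sec j x) k) (S.PSO.dom j)
  anticanonical : ∀ {x : M}, S.PU.Fib x → TangentSpace (𝓡 n) x [⋀^Fin ((n - r) / 2)]→ₗ[ℝ] ℂ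
  anticanonical_unit : ∀ {x : M} (q : S.PU.Fib x), IsUnitAnticanonical D J x (anticanonical q)
  anticanonical_act : ∀ {x : M} (q : S.PU.Fib x) (z : Circle),
    anticanonical (S.PU.act q z) = (z : ℂ) • anticanonical q
  smooth_anticanonical : ∀ (j : S.PU.Index) (U : Set M)
    (Y : Fin ((n - r) / 2) → ∀ y : M, TangentSpace (𝓡 n) y), IsOpen U → U ⊆ S.PU.dom j →
    (∀ s, SmoothFieldOn (Y s) U ∧ ∀ y ∈ U, Y s y ∈ D y) →
    ContMDiffOn (𝓡 n) 𝓘(ℝ, ℂ) ∞ (fun y => anticanonical (S.PU.sec j y) fun s => Y s y) U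

variable {S}

/-- The adapted connection `∇^S` in the local section `s = PSpin.sec i` of the spin bundle. With
`(e_a)` the frame of `TM`, `(f_k)` the frame of `D^⊥` and `α` the section of `κ_D⁻¹` given by `s`,
`∇^S_v φ = v(φ) + ½ ∑_{a<b} ω_{ab}(v) e_a e_b · φ + ½ ∑_{k<l} θ_{kl}(v) f_k f_l · φ + (i/2) A(v) φ`,
where `ω_{ab} = ⟨∇e_a, e_b⟩`, `θ_{kl} = ⟨∇^{D^⊥} f_k, f_l⟩`, and `iA` is the form of the connection
on `κ_D⁻¹` induced by the hermitian connection of `(D, J)`. -/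
def nablaS {D : ∀ x : M, Submodule ℝ (TangentSpace (𝓡 n) x)}
    {J : ∀ x : M, TangentSpace (𝓡 n) x → TangentSpace (𝓡 n) x}
    (Ψ : S.AdaptedIdentification D J) (φ : S.SpinorField) (i : S.PSpin.Index) (x : M)
    (v : TangentSpace (𝓡 n) x) : TwSpinor r n :=
  let ψ : TwSpinor r n := φ.toFun (S.PSpin.sec i x)
  let e : Fin n → ∀ y : M, TangentSpace (𝓡 n) y := fun a y => S.frame (S.PSpin.sec i y) a
  let f : Fin r → ∀ y : M, TangentSpace (𝓡 n) y :=
    fun k y => Ψ.normalFrame (S.toSO (S.PSpin.sec i y)) k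
  let α : ∀ y : M, TangentSpace (𝓡 n) y [⋀^Fin ((n - r) / 2)]→ₗ[ℝ] ℂ :=
    fun y => Ψ.anticanonical (S.toU (S.PSpin.sec i y))
  mvfderiv (𝓡 n) (fun y => φ.toFun (S.PSpin.sec i y)) x v
    + (1 / 2 : ℝ) • ∑ a, ∑ b ∈ Finset.Ioi a,
        (inner ℝ (leviCivita (e a) x v) (e b x) : ℝ) • actN (gamma n a * gamma n b) ψ
    + (1 / 2 : ℝ) • ∑ k, ∑ l ∈ Finset.Ioi k,
        (inner ℝ (covD (fun y => (D y)ᗮ) (f k) x v) (f l x) : ℝ) •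
          actR (gamma r k * gamma r l) ψ
    + (Complex.I / 2 * (anticanonicalForm D J α x v : ℂ)) • ψ

/-- The complex linear extension `∇^S_{Y - iJY} φ = ∇^S_Y φ - i ∇^S_{JY} φ`. -/
def nablaC {D : ∀ x : M, Submodule ℝ (TangentSpace (𝓡 n) x)}
    {J : ∀ x : M, TangentSpace (𝓡 n) x → TangentSpace (𝓡 n) x}
    (Ψ : S.AdaptedIdentification D J) (φ : S.SpinorField) (i : S.PSpin.Index) (x : M)
    (Y : TangentSpace (𝓡 n) x) : TwSpinor r n :=
  nablaS Ψ φ i x Y - Complex.I • nablaS Ψ φ i x (J x Y)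

/-- Clifford multiplication by `X - iJX`, in the frame given by `p`. -/
def cliffC (J : ∀ x : M, TangentSpace (𝓡 n) x → TangentSpace (𝓡 n) x) {x : M}
    (p : S.PSpin.Fib x) (X : TangentSpace (𝓡 n) x) (ψ : TwSpinor r n) : TwSpinor r n :=
  S.tcliff p X ψ - Complex.I • S.tcliff p (J x X) ψ

/-- The spinor field `φ` satisfies
`(X - iJ^φX) · ∇^S_{Y - iJ^φY} φ = (Y - iJ^φY) · ∇^S_{X - iJ^φX} φ` for all `X, Y ∈ V^φ`.
Both sides are tensorial in `X` and `Y`. -/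
def IsIntegrable (φ : S.SpinorField) (Ψ : S.AdaptedIdentification φ.V φ.J) : Prop :=
  ∀ (i : S.PSpin.Index), ∀ x ∈ S.PSpin.dom i, ∀ X ∈ φ.V x, ∀ Y ∈ φ.V x,
    cliffC φ.J (S.PSpin.sec i x) X (nablaC Ψ φ i x Y)
      = cliffC φ.J (S.PSpin.sec i x) Y (nablaC Ψ φ i x X)

end SpincrStructure

end SpinStructure

end SpinCR

end

/-! Clifford multiplication by a real vector is injective on a nonzero spinor. Hence the complex
vectors that annihilate a partially pure spinor `φ` are exactly the `X - iJX` with `X ∈ V`, and the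
spinor records an almost CR hermitian structure through its annihilator.

From a spinor to a CR structure: differentiate `(X - iJX)·φ = 0` with the Leibniz rule
`spinCov_cliff`. This turns `(X - iJX)·∇_vφ` into minus the Clifford product of `∇_v(X - iJX)` with
`φ`. Antisymmetrising in `X` and `Y`, the Levi-Civita connection having no torsion, leaves `([X,Y] -
[JX,JY])·φ - i([JX,Y] + [X,JY])·φ` (`cliff_spinCov_sub`). The parts of `∇^S` coming from `D^⊥` and
from `κ_D⁻¹` act through `Δ_r` and through scalars; they commute with Clifford multiplication, so `X
- iJX` kills their contribution (`cliffC_nablaC_sub`). The spinor equation therefore says that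
`[X,Y] - [JX,JY]` lies in `V` and that `J` maps it to `[JX,Y] + [X,JY]`, which is the CR condition.
The same identity is used in both directions. What remains in this direction is that `V` and `J` are
smooth: `V` is the kernel of a smooth family of linear maps of constant rank
(`exists_smooth_frame_ker`).

From a CR structure to a spinor: the positively oriented orthonormal frames adapted to `(D, J)` have
transition functions in `U(m) × SO(r)`. There is a model spinor in `Σ_r ⊗ Δ_n` for `ℝⁿ = ℂᵐ ⊕ ℝʳ`
(`exists_isModelSpinor`): a tensor product of vectors `u_ε` for the `ℂᵐ` part, times an element of
`Δ_r ⊗ Δ_r` that intertwines the two actions of the Clifford algebra of `ℝʳ`. Every `(A, B) ∈ U(m) ×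
SO(r)` has a lift to `Spin^{c,r}(n)` that fixes the model spinor and whose image in `U(1)` is `(det
A)⁻¹` (`exists_isLift`, by writing `A` and `B` as products of reflections). These lifts glue a spin
structure, and the model spinor becomes a spinor field that is constant in adapted frames. The lifts
depend smoothly on the frames because a group element fixing a nonzero spinor is an explicit smooth
function of its images in `SO(n)` and `SO(r)` (`contMDiffOn_embSpincr`). The factor `(det A)⁻¹` is
the transition function of the complex volume forms, so the `U(1)` bundle is that of `κ_D⁻¹`.

The orientation of `M` is matched by reversing a normal vector if `r > 0`. If `r = 0` there is none,
and a sign `ε` conjugates one coordinate of `ℂᵐ` in the model instead. -/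

noncomputable section

namespace SpinCR

/-! ## Actions on twisted spinors -/

section Actions

variable {n r : ℕ}

theorem actN_mul (A B : Matrix (SpinIdx n) (SpinIdx n) ℂ) (φ : TwSpinor r n) :
    actN (A * B) φ = actN A (actN B φ) := by
  simp only [actN, Matrix.mulVec_mulVec, ← Matrix.mul_kronecker_mul, one_mul]

theorem actR_mul (A B : Matrix (SpinIdx r) (SpinIdx r) ℂ) (φ : TwSpinor r n) :
    actR (A * B) φ = actR A (actR B φ) := by
  simp only [actR, Matrix.mulVec_mulVec, ← Matrix.mul_kronecker_mul, one_mul]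

theorem actN_actR (A : Matrix (SpinIdx n) (SpinIdx n) ℂ) (B : Matrix (SpinIdx r) (SpinIdx r) ℂ)
    (φ : TwSpinor r n) : actN A (actR B φ) = actR B (actN A φ) := by
  simp only [actN, actR, Matrix.mulVec_mulVec, ← Matrix.mul_kronecker_mul, one_mul, mul_one]

@[simp] theorem actN_one (φ : TwSpinor r n) : actN 1 φ = φ := by simp [actN]
@[simp] theorem actR_one (φ : TwSpinor r n) : actR 1 φ = φ := by simp [actR]
@[simp] theorem actN_neg (A : Matrix (SpinIdx n) (SpinIdx n) ℂ) (φ : TwSpinor r n) :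
    actN (-A) φ = -actN A φ := by
  rw [← neg_one_smul ℂ A, actN, Matrix.kronecker_smul, Matrix.smul_mulVec, neg_one_smul, actN]
@[simp] theorem actR_neg (A : Matrix (SpinIdx r) (SpinIdx r) ℂ) (φ : TwSpinor r n) :
    actR (-A) φ = -actR A φ := by
  rw [← neg_one_smul ℂ A, actR, Matrix.smul_kronecker, Matrix.smul_mulVec, neg_one_smul, actR]
theorem actN_add (A B : Matrix (SpinIdx n) (SpinIdx n) ℂ) (φ : TwSpinor r n) :
    actN (A + B) φ = actN A φ + actN B φ := by
  simp only [actN, Matrix.kronecker_add, Matrix.add_mulVec]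
theorem actR_add (A B : Matrix (SpinIdx r) (SpinIdx r) ℂ) (φ : TwSpinor r n) :
    actR (A + B) φ = actR A φ + actR B φ := by
  simp only [actR, Matrix.add_kronecker, Matrix.add_mulVec]
theorem actN_smul (c : ℂ) (A : Matrix (SpinIdx n) (SpinIdx n) ℂ) (φ : TwSpinor r n) :
    actN (c • A) φ = c • actN A φ := by
  simp only [actN, Matrix.kronecker_smul, Matrix.smul_mulVec]
theorem actN_rsmul (c : ℝ) (A : Matrix (SpinIdx n) (SpinIdx n) ℂ) (φ : TwSpinor r n) :
    actN (c • A) φ = c • actN A φ := by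
  simp only [actN, Matrix.kronecker_smul, Matrix.smul_mulVec]
theorem actR_rsmul (c : ℝ) (A : Matrix (SpinIdx r) (SpinIdx r) ℂ) (φ : TwSpinor r n) :
    actR (c • A) φ = c • actR A φ := by
  simp only [actR, Matrix.smul_kronecker, Matrix.smul_mulVec]

@[simp] theorem actN_add_right (A : Matrix (SpinIdx n) (SpinIdx n) ℂ) (φ ψ : TwSpinor r n) :
    actN A (φ + ψ) = actN A φ + actN A ψ := Matrix.mulVec_add _ _ _
@[simp] theorem actN_sub_right (A : Matrix (SpinIdx n) (SpinIdx n) ℂ) (φ ψ : TwSpinor r n) :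
    actN A (φ - ψ) = actN A φ - actN A ψ := Matrix.mulVec_sub _ _ _
@[simp] theorem actN_neg_right (A : Matrix (SpinIdx n) (SpinIdx n) ℂ) (φ : TwSpinor r n) :
    actN A (-φ) = -actN A φ := Matrix.mulVec_neg _ _
@[simp] theorem actN_smul_right (A : Matrix (SpinIdx n) (SpinIdx n) ℂ) (c : ℂ)
    (φ : TwSpinor r n) : actN A (c • φ) = c • actN A φ := Matrix.mulVec_smul _ _ _
@[simp] theorem actN_rsmul_right (A : Matrix (SpinIdx n) (SpinIdx n) ℂ) (c : ℝ)
    (φ : TwSpinor r n) : actN A (c • φ) = c • actN A φ := Matrix.mulVec_smul _ _ _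
@[simp] theorem actN_zero_right (A : Matrix (SpinIdx n) (SpinIdx n) ℂ) :
    actN A (0 : TwSpinor r n) = 0 := Matrix.mulVec_zero _
@[simp] theorem actR_neg_right (A : Matrix (SpinIdx r) (SpinIdx r) ℂ) (φ : TwSpinor r n) :
    actR A (-φ) = -actR A φ := Matrix.mulVec_neg _ _
@[simp] theorem actR_smul_right (A : Matrix (SpinIdx r) (SpinIdx r) ℂ) (c : ℂ)
    (φ : TwSpinor r n) : actR A (c • φ) = c • actR A φ := Matrix.mulVec_smul _ _ _
theorem actN_sum_right {ι : Type*} (s : Finset ι) (A : Matrix (SpinIdx n) (SpinIdx n) ℂ)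
    (φ : ι → TwSpinor r n) : actN A (∑ i ∈ s, φ i) = ∑ i ∈ s, actN A (φ i) :=
  Matrix.mulVec_sum _ _ _
theorem actN_sum {ι : Type*} (s : Finset ι) (A : ι → Matrix (SpinIdx n) (SpinIdx n) ℂ)
    (φ : TwSpinor r n) : actN (∑ i ∈ s, A i) φ = ∑ i ∈ s, actN (A i) φ := by
  classical
  induction s using Finset.induction_on with
  | empty => simp [actN]
  | insert a s ha ih => rw [Finset.sum_insert ha, Finset.sum_insert ha, actN_add, ih]
theorem actR_sum {ι : Type*} (s : Finset ι) (A : ι → Matrix (SpinIdx r) (SpinIdx r) ℂ)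
    (φ : TwSpinor r n) : actR (∑ i ∈ s, A i) φ = ∑ i ∈ s, actR (A i) φ := by
  classical
  induction s using Finset.induction_on with
  | empty => simp [actR]
  | insert a s ha ih => rw [Finset.sum_insert ha, Finset.sum_insert ha, actR_add, ih]

/-! ### Clifford multiplication -/

theorem gammaVec_anticomm (X Y : Fin n → ℝ) :
    gammaVec n X * gammaVec n Y + gammaVec n Y * gammaVec n X
      = (-(2 * (X ⬝ᵥ Y)) : ℝ) • (1 : Matrix (SpinIdx n) (SpinIdx n) ℂ) := by
  have h := gammaVec_sq (X + Y)
  have hX := gammaVec_sq X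
  have hY := gammaVec_sq Y
  simp only [map_add, add_mul, mul_add, negSq_apply, Algebra.algebraMap_eq_smul_one] at h hX hY
  rw [hX, hY] at h
  simp only [add_dotProduct, dotProduct_add, dotProduct_comm Y X] at h
  have e : gammaVec n X * gammaVec n Y + gammaVec n Y * gammaVec n X
    = (-(X ⬝ᵥ X) • 1 + gammaVec n X * gammaVec n Y + (gammaVec n Y * gammaVec n X + -(Y ⬝ᵥ Y) • 1))
      - -(X ⬝ᵥ X) • 1 - -(Y ⬝ᵥ Y) • 1 := by abel
  rw [e, ]
  have h' : (-(X ⬝ᵥ X) • 1 + gammaVec n X * gammaVec n Y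
      + (gammaVec n Y * gammaVec n X + -(Y ⬝ᵥ Y) • 1))
      = (-(X ⬝ᵥ X + X ⬝ᵥ Y + (X ⬝ᵥ Y + Y ⬝ᵥ Y)) • (1 : Matrix (SpinIdx n) (SpinIdx n) ℂ)) := by
    rw [← h]; abel
  rw [h']; module

theorem gammaVec_single (i : Fin n) : gammaVec n (Pi.single i 1) = gamma n i := by
  rw [gammaVec_apply, Finset.sum_eq_single i]
  · simp
  · intro j _ hj; simp [hj]
  · simp

theorem cliff_single (i : Fin n) (φ : TwSpinor r n) :
    cliff (Pi.single i 1) φ = actN (gamma n i) φ := by rw [cliff, gammaVec_single]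

theorem cliff_cliff_add_swap (X Y : Fin n → ℝ) (φ : TwSpinor r n) :
    cliff X (cliff Y φ) + cliff Y (cliff X φ) = (-(2 * (X ⬝ᵥ Y)) : ℝ) • φ := by
  simp only [cliff, ← actN_mul, ← actN_add, gammaVec_anticomm, actN_rsmul, actN_one]

theorem cliff_cliff_self (X : Fin n → ℝ) (φ : TwSpinor r n) :
    cliff X (cliff X φ) = (-(X ⬝ᵥ X) : ℝ) • φ := by
  simp only [cliff, ← actN_mul, gammaVec_sq, negSq_apply, Algebra.algebraMap_eq_smul_one,
    actN_rsmul, actN_one]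

theorem cliff_cliff_swap {X Y : Fin n → ℝ} (h : X ⬝ᵥ Y = 0) (φ : TwSpinor r n) :
    cliff X (cliff Y φ) = -cliff Y (cliff X φ) := by
  rw [eq_neg_iff_add_eq_zero, cliff_cliff_add_swap, h]; simp

theorem cliff_actR (X : Fin n → ℝ) (B : Matrix (SpinIdx r) (SpinIdx r) ℂ) (φ : TwSpinor r n) :
    cliff X (actR B φ) = actR B (cliff X φ) := actN_actR _ _ _
@[simp] theorem cliff_add_right (X : Fin n → ℝ) (φ ψ : TwSpinor r n) :
    cliff X (φ + ψ) = cliff X φ + cliff X ψ := actN_add_right _ _ _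
@[simp] theorem cliff_sub_right (X : Fin n → ℝ) (φ ψ : TwSpinor r n) :
    cliff X (φ - ψ) = cliff X φ - cliff X ψ := actN_sub_right _ _ _
@[simp] theorem cliff_neg_right (X : Fin n → ℝ) (φ : TwSpinor r n) :
    cliff X (-φ) = -cliff X φ := actN_neg_right _ _
@[simp] theorem cliff_smul_right (X : Fin n → ℝ) (c : ℂ) (φ : TwSpinor r n) :
    cliff X (c • φ) = c • cliff X φ := actN_smul_right _ _ _
@[simp] theorem cliff_rsmul_right (X : Fin n → ℝ) (c : ℝ) (φ : TwSpinor r n) :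
    cliff X (c • φ) = c • cliff X φ := actN_rsmul_right _ _ _
@[simp] theorem cliff_zero_right (X : Fin n → ℝ) : cliff X (0 : TwSpinor r n) = 0 :=
  actN_zero_right _

/-- Clifford multiplication of a fixed spinor, as a linear map. -/
def cliffLin (φ : TwSpinor r n) : (Fin n → ℝ) →ₗ[ℝ] TwSpinor r n where
  toFun X := cliff X φ
  map_add' X Y := cliff_add X Y φ
  map_smul' c X := cliff_smul c X φ

theorem cliff_neg (X : Fin n → ℝ) (φ : TwSpinor r n) : cliff (-X) φ = -cliff X φ :=
  map_neg (cliffLin φ) X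
theorem cliff_sub (X Y : Fin n → ℝ) (φ : TwSpinor r n) :
    cliff (X - Y) φ = cliff X φ - cliff Y φ := map_sub (cliffLin φ) X Y
theorem cliff_zero (φ : TwSpinor r n) : cliff (0 : Fin n → ℝ) φ = 0 := map_zero (cliffLin φ)
theorem cliff_sum {ι : Type*} (s : Finset ι) (X : ι → Fin n → ℝ) (φ : TwSpinor r n) :
    cliff (∑ i ∈ s, X i) φ = ∑ i ∈ s, cliff (X i) φ := map_sum (cliffLin φ) X s
theorem cliff_eq_sum (X : Fin n → ℝ) (φ : TwSpinor r n) :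
    cliff X φ = ∑ a, X a • actN (gamma n a) φ := by
  simp only [cliff, gammaVec_apply, actN_sum, actN_rsmul]

/-! ### The Hermitian product -/

theorem tensorMat_conjTranspose {k : ℕ} (A : Fin k → Matrix (Fin 2) (Fin 2) ℂ) :
    (tensorMat A)ᴴ = tensorMat fun p => (A p)ᴴ := by
  ext a b; simp [tensorMat, Matrix.conjTranspose_apply]

theorem matT_conjTranspose : matTᴴ = matT := by
  ext i j; fin_cases i <;> fin_cases j <;> simp [matT]
theorem matG1_conjTranspose : matG1ᴴ = -matG1 := by
  ext i j; fin_cases i <;> fin_cases j <;> simp [matG1]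
theorem matG2_conjTranspose : matG2ᴴ = -matG2 := by
  ext i j; fin_cases i <;> fin_cases j <;> simp [matG2]

theorem gamma_conjTranspose (i : Fin n) : (gamma n i)ᴴ = -gamma n i := by
  unfold gamma
  rw [Matrix.conjTranspose_smul, tensorMat_conjTranspose]
  by_cases h : i.val / 2 < n / 2
  · simp only [if_pos h, star_one, one_smul]
    apply tensorMat_neg _ _ ⟨i.val / 2, h⟩
    · simp only [gammaFactor, lt_irrefl, if_false, if_true]
      split_ifs
      · exact matG1_conjTranspose
      · exact matG2_conjTranspose
    · intro p hp
      have hp' : (p : ℕ) ≠ i.val / 2 := fun h' => hp (Fin.ext h')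
      simp only [gammaFactor]
      split_ifs <;> first | exact matT_conjTranspose | simp
  · simp only [if_neg h]
    have : (fun p : Fin (n / 2) => (gammaFactor i p)ᴴ)
        = fun p : Fin (n / 2) => gammaFactor i p := by
      funext p
      have : (p : ℕ) < i.val / 2 := by omega
      simp only [gammaFactor, if_pos this, matT_conjTranspose]
    rw [this]; simp

theorem gammaVec_conjTranspose (X : Fin n → ℝ) : (gammaVec n X)ᴴ = -gammaVec n X := by
  simp only [gammaVec_apply, Matrix.conjTranspose_sum, Matrix.conjTranspose_smul,
    gamma_conjTranspose, star_trivial, smul_neg, Finset.sum_neg_distrib]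

theorem herm_mulVec (A : Matrix (SpinIdx r × SpinIdx n) (SpinIdx r × SpinIdx n) ℂ)
    (ψ φ : TwSpinor r n) : herm (A *ᵥ ψ) φ = herm ψ (Aᴴ *ᵥ φ) := by
  rw [herm, herm, Matrix.star_mulVec, Matrix.conjTranspose_conjTranspose, dotProduct_comm,
    Matrix.dotProduct_mulVec, dotProduct_comm]

theorem herm_actN (A : Matrix (SpinIdx n) (SpinIdx n) ℂ) (ψ φ : TwSpinor r n) :
    herm (actN A ψ) φ = herm ψ (actN Aᴴ φ) := by
  rw [actN, herm_mulVec, Matrix.conjTranspose_kronecker, Matrix.conjTranspose_one, actN]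
@[simp] theorem herm_add_left (ψ ψ' φ : TwSpinor r n) :
    herm (ψ + ψ') φ = herm ψ φ + herm ψ' φ := add_dotProduct _ _ _
@[simp] theorem herm_neg_left (ψ φ : TwSpinor r n) : herm (-ψ) φ = -herm ψ φ :=
  neg_dotProduct _ _
@[simp] theorem herm_smul_left (c : ℂ) (ψ φ : TwSpinor r n) :
    herm (c • ψ) φ = c * herm ψ φ := smul_dotProduct _ _ _
@[simp] theorem herm_rsmul_left (c : ℝ) (ψ φ : TwSpinor r n) :
    herm (c • ψ) φ = c * herm ψ φ := by
  rw [herm, smul_dotProduct, Complex.real_smul, herm]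
@[simp] theorem herm_zero_left (φ : TwSpinor r n) : herm 0 φ = 0 := zero_dotProduct _
@[simp] theorem herm_neg_right (ψ φ : TwSpinor r n) : herm ψ (-φ) = -herm ψ φ := by
  simp [herm]
@[simp] theorem herm_smul_right (c : ℂ) (ψ φ : TwSpinor r n) :
    herm ψ (c • φ) = star c * herm ψ φ := by simp [herm]
theorem herm_sum_left {ι : Type*} (s : Finset ι) (ψ : ι → TwSpinor r n) (φ : TwSpinor r n) :
    herm (∑ i ∈ s, ψ i) φ = ∑ i ∈ s, herm (ψ i) φ := sum_dotProduct _ _ _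
theorem herm_star (ψ φ : TwSpinor r n) : star (herm ψ φ) = herm φ ψ := by
  simp [herm, dotProduct, mul_comm]
theorem herm_self (φ : TwSpinor r n) : herm φ φ = ((∑ i, ‖φ i‖ ^ 2 : ℝ) : ℂ) := by
  simp [herm, dotProduct, Complex.mul_conj, Complex.normSq_eq_norm_sq]
open scoped ComplexOrder in
theorem herm_self_eq_zero {φ : TwSpinor r n} (h : herm φ φ = 0) : φ = 0 :=
  dotProduct_self_star_eq_zero.mp h
theorem herm_cliff (X : Fin n → ℝ) (ψ φ : TwSpinor r n) :
    herm (cliff X ψ) φ = -herm ψ (cliff X φ) := by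
  rw [cliff, herm_actN, gammaVec_conjTranspose, actN_neg, herm_neg_right, cliff]

/-- Polarisation of `X·X = -|X|²` together with skew-adjointness of Clifford multiplication. It
makes `J` orthogonal and lets the coordinates of a vector `Y` be recovered from `Y·φ`, which is how
`J` is seen to be smooth. -/
theorem herm_cliff_cliff_re {φ : TwSpinor r n} (h : herm φ φ = 1) (X Y : Fin n → ℝ) :
    (herm (cliff X φ) (cliff Y φ)).re = X ⬝ᵥ Y := by
  have h1 : herm (cliff X φ) (cliff Y φ) = -herm (cliff Y (cliff X φ)) φ := by
    rw [herm_cliff Y]; ring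
  have h2 : herm (cliff Y φ) (cliff X φ) = -herm (cliff X (cliff Y φ)) φ := by
    rw [herm_cliff X]; ring
  have h3 := congrArg (fun ψ => herm ψ φ) (cliff_cliff_add_swap X Y φ)
  simp only [herm_add_left, herm_rsmul_left, h] at h3
  have h4 : (herm (cliff Y φ) (cliff X φ)).re = (herm (cliff X φ) (cliff Y φ)).re := by
    rw [← herm_star (cliff X φ)]; simp
  have h5 := congrArg Complex.re h3
  have e1 := congrArg Complex.re h1
  have e2 := congrArg Complex.re h2
  simp only [Complex.add_re, Complex.neg_re, Complex.mul_re, Complex.ofReal_re, Complex.one_re,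
    Complex.ofReal_im, Complex.one_im] at h5 e1 e2
  rw [h4] at e2
  linarith

theorem cliff_eq_zero {φ : TwSpinor r n} (hφ : φ ≠ 0) {X : Fin n → ℝ} (h : cliff X φ = 0) :
    X = 0 := by
  have h1 := cliff_cliff_self X φ
  rw [h, cliff_zero_right] at h1
  have h2 := (smul_eq_zero.mp h1.symm).resolve_right hφ
  simpa using h2

theorem cliff_injective {φ : TwSpinor r n} (hφ : φ ≠ 0) : Function.Injective (cliffLin φ) := by
  rw [injective_iff_map_eq_zero]
  exact fun X h => cliff_eq_zero hφ h

theorem ne_zero_of_unit {φ : TwSpinor r n} (h : herm φ φ = 1) : φ ≠ 0 := by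
  rintro rfl; simp at h

end Actions

/-! ## The splitting `ℝⁿ = ℂᵐ ⊕ ℝʳ` and model spinors -/

section Model

variable {n m r : ℕ}

/-- The splitting of the index set of the standard basis of `ℝⁿ`, `n = 2m + r`, into the two
families spanning `ℂᵐ` and the family spanning `ℝʳ`. -/
def splitEquiv (h : 2 * m + r = n) : Fin m ⊕ Fin m ⊕ Fin r ≃ Fin n where
  toFun := Sum.elim (fun s => ⟨2 * s, by omega⟩)
    (Sum.elim (fun s => ⟨2 * s + 1, by omega⟩) fun k => ⟨2 * m + k, by omega⟩)
  invFun a := if h1 : a.val < 2 * m then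
      (if a.val % 2 = 0 then Sum.inl ⟨a / 2, by omega⟩ else Sum.inr (Sum.inl ⟨a / 2, by omega⟩))
    else Sum.inr (Sum.inr ⟨a - 2 * m, by omega⟩)
  left_inv x := by
    rcases x with s | s | k
    · have : 2 * s.val < 2 * m := by omega
      simp [this]
    · have h1 : 2 * s.val + 1 < 2 * m := by omega
      have h2 : (2 * s.val + 1) / 2 = s.val := by omega
      have h3 : ¬ (2 * s.val + 1) % 2 = 0 := by omega
      simp [h1, h2]
    · simp
  right_inv a := by
    by_cases h1 : a.val < 2 * m
    · by_cases h2 : a.val % 2 = 0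
      · simp only [h1, h2, dite_true, if_true, Sum.elim_inl]
        ext; simp; omega
      · simp only [h1, h2, dite_true, if_false, Sum.elim_inl, Sum.elim_inr]
        ext; simp; omega
    · simp only [h1, dite_false, Sum.elim_inr]
      ext; simp; omega

/-- The position in `Fin n` of the `k`-th basis vector of the summand `ℝʳ`. -/
def ixF (h : 2 * m + r = n) (k : Fin r) : Fin n := splitEquiv h (Sum.inr (Sum.inr k))

theorem ixF_lt {h : 2 * m + r = n} {k l : Fin r} : ixF h k < ixF h l ↔ k < l := by
  simp [ixF, splitEquiv, ← Fin.val_fin_lt]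

theorem ixF_injective (h : 2 * m + r = n) : Function.Injective (ixF h) := fun k l e => by
  simpa [ixF] using e

variable (h : 2 * m + r = n) (ε : Fin m → ℤˣ)

/-- The embedding `ℂᵐ → ℝⁿ`; the complex structure of `ℂᵐ` is given by the signs `ε`. -/
def embD : (Fin m → ℂ) →ₗ[ℝ] (Fin n → ℝ) where
  toFun z a := Sum.elim (fun s => (z s).re) (Sum.elim (fun s => ((ε s : ℤ) : ℝ) * (z s).im) 0)
    ((splitEquiv h).symm a)
  map_add' z w := by
    ext a; simp only [Pi.add_apply]
    rcases (splitEquiv h).symm a with s | s | k <;> simp [mul_add]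
  map_smul' c z := by
    ext a; simp only [Pi.smul_apply]
    rcases (splitEquiv h).symm a with s | s | k <;> simp
    ring

/-- The embedding `ℝʳ → ℝⁿ`. -/
def embF : (Fin r → ℝ) →ₗ[ℝ] (Fin n → ℝ) where
  toFun t a := Sum.elim 0 (Sum.elim 0 t) ((splitEquiv h).symm a)
  map_add' z w := by
    ext a; simp only [Pi.add_apply]
    rcases (splitEquiv h).symm a with s | s | k <;> simp
  map_smul' c z := by
    ext a; simp only [Pi.smul_apply]
    rcases (splitEquiv h).symm a with s | s | k <;> simp

theorem unit_sq_cast (e : ℤˣ) : ((e : ℤ) : ℝ) * ((e : ℤ) : ℝ) = 1 := by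
  rcases Int.units_eq_one_or e with rfl | rfl <;> simp

theorem dotProduct_split (x y : Fin n → ℝ) : x ⬝ᵥ y
    = ∑ s, x (splitEquiv h (Sum.inl s)) * y (splitEquiv h (Sum.inl s))
      + (∑ s, x (splitEquiv h (Sum.inr (Sum.inl s))) * y (splitEquiv h (Sum.inr (Sum.inl s)))
      + ∑ k, x (ixF h k) * y (ixF h k)) := by
  rw [dotProduct, ← Equiv.sum_comp (splitEquiv h), Fintype.sum_sum_type, Fintype.sum_sum_type]
  rfl

@[simp] theorem embD_inl (z : Fin m → ℂ) (s : Fin m) :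
    embD h ε z (splitEquiv h (Sum.inl s)) = (z s).re := by simp [embD]
@[simp] theorem embD_inr_inl (z : Fin m → ℂ) (s : Fin m) :
    embD h ε z (splitEquiv h (Sum.inr (Sum.inl s))) = ((ε s : ℤ) : ℝ) * (z s).im := by simp [embD]
@[simp] theorem embD_ixF (z : Fin m → ℂ) (k : Fin r) : embD h ε z (ixF h k) = 0 := by
  simp [embD, ixF]
@[simp] theorem embF_inl (t : Fin r → ℝ) (s : Fin m) :
    embF h t (splitEquiv h (Sum.inl s)) = 0 := by simp [embF]
@[simp] theorem embF_inr_inl (t : Fin r → ℝ) (s : Fin m) :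
    embF h t (splitEquiv h (Sum.inr (Sum.inl s))) = 0 := by simp [embF]
@[simp] theorem embF_ixF (t : Fin r → ℝ) (k : Fin r) : embF h t (ixF h k) = t k := by
  simp [embF, ixF]

theorem embD_dot_embD (z w : Fin m → ℂ) : embD h ε z ⬝ᵥ embD h ε w = (star z ⬝ᵥ w).re := by
  rw [dotProduct_split h]
  simp only [embD_inl, embD_inr_inl, embD_ixF, mul_zero, Finset.sum_const_zero, add_zero,
    dotProduct, ← Finset.sum_add_distrib, Complex.re_sum]
  refine Finset.sum_congr rfl fun s _ => ?_
  simp only [Pi.star_apply, Complex.star_def, Complex.mul_re, Complex.conj_re, Complex.conj_im]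
  linear_combination (z s).im * (w s).im * unit_sq_cast (ε s)

theorem embD_dot_embF (z : Fin m → ℂ) (t : Fin r → ℝ) : embD h ε z ⬝ᵥ embF h t = 0 := by
  rw [dotProduct_split h]; simp
theorem embF_dot_embD (z : Fin m → ℂ) (t : Fin r → ℝ) : embF h t ⬝ᵥ embD h ε z = 0 := by
  rw [dotProduct_split h]; simp
theorem embF_dot_embF (t u : Fin r → ℝ) : embF h t ⬝ᵥ embF h u = t ⬝ᵥ u := by
  rw [dotProduct_split h]; simp [dotProduct]

theorem exists_embD_add_embF (v : Fin n → ℝ) : ∃ z t, v = embD h ε z + embF h t := by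
  refine ⟨fun s => ⟨v (splitEquiv h (Sum.inl s)),
    ((ε s : ℤ) : ℝ) * v (splitEquiv h (Sum.inr (Sum.inl s)))⟩, fun k => v (ixF h k), ?_⟩
  ext a
  obtain ⟨a, rfl⟩ := (splitEquiv h).surjective a
  rcases a with s | s | k
  · simp
  · simp [← mul_assoc, unit_sq_cast]
  · change v (ixF h k) = embD h ε _ (ixF h k) + embF h _ (ixF h k)
    rw [embD_ixF, embF_ixF, zero_add]

theorem embD_injective : Function.Injective (embD h ε) := by
  intro z w e
  ext s
  apply Complex.ext
  · simpa using congrFun e (splitEquiv h (Sum.inl s))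
  · have := congrFun e (splitEquiv h (Sum.inr (Sum.inl s)))
    simpa using this

theorem embF_single (k : Fin r) : embF h (Pi.single k 1) = Pi.single (ixF h k) 1 := by
  ext a
  obtain ⟨a, rfl⟩ := (splitEquiv h).surjective a
  rcases a with s | s | l
  · simp [ixF]
  · simp [ixF]
  · change embF h _ (ixF h l) = (Pi.single (ixF h k) 1 : Fin n → ℝ) (ixF h l)
    simp [Pi.single_apply, (ixF_injective h).eq_iff]

theorem finrank_range_embD :
    Module.finrank ℝ (LinearMap.range (embD h ε)) = n - r := by
  rw [LinearMap.finrank_range_of_inj (embD_injective h ε), Module.finrank_pi_fintype]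
  simp [Complex.finrank_real_complex]
  omega

/-- The spinor `ψ` is annihilated by the isotropic vectors `X - iJX`, `X ∈ ℂᵐ`. -/
def IsVacuum (ψ : TwSpinor r n) : Prop :=
  ∀ z, cliff (embD h ε z) ψ = Complex.I • cliff (embD h ε (Complex.I • z)) ψ

/-- A model of a partially pure spinor with `V = ℂᵐ`. -/
structure IsModelSpinor (φ : TwSpinor r n) : Prop where
  mem : φ ∈ sigmaTensor r n
  unit : herm φ φ = 1
  vacuum : IsVacuum h ε φ
  twist : ∀ k l : Fin r, k ≠ l →
    actN (gamma n (ixF h k) * gamma n (ixF h l)) φ = -actR (gamma r k * gamma r l) φ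
  herm_two : ∀ k l : Fin r, k ≠ l → herm (actR (gamma r k * gamma r l) φ) φ = 0
  herm_four : ∀ k l i j : Fin r, k ≠ l → k ≠ i → k ≠ j → l ≠ i → l ≠ j → i ≠ j →
    herm (actR (gamma r k * gamma r l * (gamma r i * gamma r j)) φ) φ = 0

variable {h ε}

theorem IsVacuum.actR {ψ : TwSpinor r n} (hψ : IsVacuum h ε ψ)
    (B : Matrix (SpinIdx r) (SpinIdx r) ℂ) : IsVacuum h ε (actR B ψ) := fun z => by
  rw [cliff_actR, cliff_actR, hψ z, actR_smul_right]

theorem IsVacuum.cliff_I {ψ : TwSpinor r n} (hψ : IsVacuum h ε ψ) (z : Fin m → ℂ) :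
    cliff (embD h ε (Complex.I • z)) ψ = -Complex.I • cliff (embD h ε z) ψ := by
  rw [hψ z, smul_smul]; simp

/-- Move `z` to the right factor, replace it there by `i` times `Iz`, move it back to the left and
apply the vacuum relation again. The anticommutations cancel in pairs and the powers of `i` leave a
sign, so the number equals its own negative. -/
theorem IsVacuum.herm_eq_zero {ψ φ : TwSpinor r n} (hψ : IsVacuum h ε ψ) (hφ : IsVacuum h ε φ)
    {X : Fin n → ℝ} {z : Fin m → ℂ} (h1 : X ⬝ᵥ embD h ε z = 0)
    (h2 : X ⬝ᵥ embD h ε (Complex.I • z) = 0) : herm (cliff X (cliff (embD h ε z) ψ)) φ = 0 := by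
  have e1 : herm (cliff X (cliff (embD h ε z) ψ)) φ
      = -herm (cliff X (cliff (embD h ε z) ψ)) φ := by
    calc herm (cliff X (cliff (embD h ε z) ψ)) φ
        = herm (cliff X ψ) (cliff (embD h ε z) φ) := by
          rw [cliff_cliff_swap h1, herm_neg_left, herm_cliff, neg_neg]
      _ = -Complex.I * herm (cliff X ψ) (cliff (embD h ε (Complex.I • z)) φ) := by
          rw [hφ z, herm_smul_right]; simp
      _ = -Complex.I * herm (cliff X (cliff (embD h ε (Complex.I • z)) ψ)) φ := by
          rw [cliff_cliff_swap h2, herm_neg_left, herm_cliff (embD h ε _), neg_neg]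
      _ = _ := by
          rw [hψ.cliff_I, cliff_smul_right, herm_smul_left, ← mul_assoc]; simp
  exact self_eq_neg.mp e1

theorem star_dot_I (z : Fin m → ℂ) : star (Complex.I • z) ⬝ᵥ (Complex.I • z) = star z ⬝ᵥ z := by
  rw [star_smul, smul_dotProduct, dotProduct_smul, smul_smul]; simp

theorem embD_dot_I (z : Fin m → ℂ) : embD h ε z ⬝ᵥ embD h ε (Complex.I • z) = 0 := by
  rw [embD_dot_embD, dotProduct_smul, smul_eq_mul, Complex.mul_re]
  have : (star z ⬝ᵥ z).im = 0 := by
    rw [dotProduct, Complex.im_sum]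
    exact Finset.sum_eq_zero fun s _ => by simp [mul_comm]
  simp [this]

/-- Here `X` may have a component along `Iz`. That component contributes a multiple of `⟨ψ, φ⟩`,
since `z` acts on `ψ` as `i` times `Iz` and the square of `Iz` is a scalar. -/
theorem IsVacuum.herm_eq_zero_of_orthogonal {ψ φ : TwSpinor r n} (hψ : IsVacuum h ε ψ)
    (hφ : IsVacuum h ε φ) (hψφ : herm ψ φ = 0) {X : Fin n → ℝ} {z : Fin m → ℂ}
    (h1 : X ⬝ᵥ embD h ε z = 0) (hz : embD h ε z ⬝ᵥ embD h ε z = 1) :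
    herm (cliff X (cliff (embD h ε z) ψ)) φ = 0 := by
  set c := X ⬝ᵥ embD h ε (Complex.I • z) with hc
  have hz' : embD h ε (Complex.I • z) ⬝ᵥ embD h ε (Complex.I • z) = 1 := by
    rw [embD_dot_embD, star_dot_I, ← embD_dot_embD h ε, hz]
  have e : X = (X - c • embD h ε (Complex.I • z)) + c • embD h ε (Complex.I • z) := by simp
  rw [e, cliff_add, herm_add_left, hψ.herm_eq_zero hφ, cliff_smul, hψ z, cliff_smul_right,
    cliff_cliff_self]
  · simp [hψφ]
  · rw [sub_dotProduct, h1, smul_dotProduct, dotProduct_comm, embD_dot_I]; simp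
  · rw [sub_dotProduct, ← hc, smul_dotProduct, hz']; simp

theorem exists_embD_eq_single {a : Fin n} (ha : ∀ k, a ≠ ixF h k) :
    ∃ z, embD h ε z = Pi.single a 1 := by
  obtain ⟨z, t, e⟩ := exists_embD_add_embF h ε (Pi.single a 1 : Fin n → ℝ)
  have : t = 0 := by
    ext k
    have := congrFun e (ixF h k)
    simpa [Pi.single_apply, (ha k).symm] using this.symm
  exact ⟨z, by rw [e, this]; simp⟩

namespace IsModelSpinor

variable {φ : TwSpinor r n} (hφ : IsModelSpinor h ε φ)
include hφ

/-- Two normal vectors act on the model spinor as the same two vectors of `ℝʳ` acting on `Δ_r` in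
the opposite order. For distinct basis vectors the reversal is the minus sign in `twist`; for equal
ones both sides are `-φ`. -/
theorem cliff_embF (t u : Fin r → ℝ) : cliff (embF h t) (cliff (embF h u) φ)
    = actR (gammaVec r u * gammaVec r t) φ := by
  have e : ∀ t : Fin r → ℝ, embF h t = ∑ k, t k • Pi.single (ixF h k) 1 := fun t => by
    conv_lhs => rw [pi_eq_sum_univ' t]
    simp [map_sum, map_smul, embF_single]
  rw [gammaVec_apply, gammaVec_apply, Finset.sum_mul_sum, Finset.sum_comm, e t, e u]
  simp only [cliff_sum, cliff_smul, cliff_single, actR_sum]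
  refine Finset.sum_congr rfl fun k _ => ?_
  rw [actN_sum_right, Finset.smul_sum]
  refine Finset.sum_congr rfl fun l _ => ?_
  rw [smul_mul_smul_comm, actR_rsmul, actN_rsmul_right, smul_smul, mul_comm,
    ← actN_mul]
  congr 1
  by_cases hkl : k = l
  · subst hkl; rw [gamma_sq, gamma_sq, actN_neg, actR_neg, actN_one, actR_one]
  · rw [hφ.twist k l hkl, gamma_anticomm (Ne.symm hkl), actR_neg]

theorem herm_actR_gammaVec (t u : Fin r → ℝ) :
    herm (actR (gammaVec r u * gammaVec r t) φ) φ = -((u ⬝ᵥ t : ℝ) : ℂ) := by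
  rw [gammaVec_apply, gammaVec_apply, Finset.sum_mul_sum, actR_sum, herm_sum_left, dotProduct,
    Complex.ofReal_sum, ← Finset.sum_neg_distrib]
  refine Finset.sum_congr rfl fun k _ => ?_
  rw [actR_sum, herm_sum_left, Finset.sum_eq_single k]
  · rw [smul_mul_smul_comm, gamma_sq, actR_rsmul, actR_neg, actR_one]
    simp [hφ.unit]
  · intro l _ hl
    rw [smul_mul_smul_comm, actR_rsmul, herm_rsmul_left, hφ.herm_two k l hl.symm, mul_zero]
  · simp

/-- Multiply the relation for the normal part `t` by `t` and pair with `φ`. The left side gives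
`-|t|²`, the mixed term with `ℂᵐ` vanishes, and the term with a normal vector is `i` times a real
number. Real parts force `t = 0`. -/
theorem pureSpace_eq : pureSpace φ = LinearMap.range (embD h ε) := by
  apply le_antisymm
  · rintro X ⟨Y, hXY⟩
    obtain ⟨z, t, rfl⟩ := exists_embD_add_embF h ε X
    -- Subtracting `Iz` from `Y` removes the contribution of `z`, which belongs to the pure space
    -- anyway, so that only `t` stays on the left.
    obtain ⟨w, u, hY⟩ := exists_embD_add_embF h ε (Y - embD h ε (Complex.I • z))
    have e1 : cliff (embF h t) φ = Complex.I • cliff (embD h ε w + embF h u) φ := by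
      rw [← hY, cliff_sub, smul_sub, ← hXY, ← hφ.vacuum z, cliff_add]; abel
    have e2 := congrArg (fun ψ => herm (cliff (embF h t) ψ) φ) e1
    simp only [cliff_smul_right, cliff_add, cliff_add_right, herm_smul_left,
      herm_add_left, hφ.cliff_embF, hφ.herm_actR_gammaVec] at e2
    rw [hφ.vacuum.herm_eq_zero hφ.vacuum (embF_dot_embD _ _ _ _) (embF_dot_embD _ _ _ _)] at e2
    have e3 := congrArg Complex.re e2
    simp at e3
    rw [e3]
    exact ⟨z, by simp⟩
  · rintro _ ⟨z, rfl⟩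
    exact ⟨_, hφ.vacuum z⟩

/-- All coefficients of the form `η_{kl}` vanish except the one at the positions of `f_k` and `f_l`.
-/
theorem herm_pair (k l : Fin r) (hkl : k < l) {a b : Fin n} (hab : a < b)
    (h' : ¬ (a = ixF h k ∧ b = ixF h l)) :
    herm (actN (gamma n a * gamma n b) (actR (gamma r k * gamma r l) φ)) φ = 0 := by
  have hψ := hφ.vacuum.actR (gamma r k * gamma r l)
  have h0 := hφ.herm_two k l hkl.ne
  -- One index in `ℂᵐ` suffices: the vacuum relation applies to both `φ` and its image under `f_k
  -- f_l`, and these two are orthogonal.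
  have D : ∀ a b : Fin n, a ≠ b → (∀ k, b ≠ ixF h k) →
      herm (actN (gamma n a * gamma n b) (actR (gamma r k * gamma r l) φ)) φ = 0 := by
    intro a b hab hb
    obtain ⟨z, hz⟩ := exists_embD_eq_single (ε := ε) hb
    rw [actN_mul, ← cliff_single, ← cliff_single, ← hz]
    apply hψ.herm_eq_zero_of_orthogonal hφ.vacuum h0 <;> rw [hz]
    · simp [hab]
    · simp
  by_cases hb : ∀ k, b ≠ ixF h k
  · exact D a b hab.ne hb
  by_cases ha : ∀ k, a ≠ ixF h k
  · rw [gamma_anticomm hab.ne, actN_neg, herm_neg_left, D b a hab.ne' ha, neg_zero]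
  push Not at ha hb
  obtain ⟨i, rfl⟩ := ha
  obtain ⟨j, rfl⟩ := hb
  rw [ixF_lt] at hab
  rw [actN_actR, hφ.twist i j hab.ne, actR_neg_right, ← actR_mul, herm_neg_left, neg_eq_zero]
  have h'' : ¬ (i = k ∧ j = l) := fun e => h' (by rw [e.1, e.2]; exact ⟨rfl, rfl⟩)
  have sq := fun i => gamma_sq (n := r) i
  -- Both indices are now normal, and `twist` has produced a product of four gammas on `Δ_r`. A
  -- repeated index reduces it to a product of two, handled by `herm_two`; four distinct indices are
  -- `herm_four`.
  by_cases h1 : i = k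
  · subst h1
    have hj : j ≠ l := fun e => h'' ⟨rfl, e⟩
    have : gamma r i * gamma r l * (gamma r i * gamma r j) = gamma r l * gamma r j := by
      rw [gamma_anticomm hkl.ne, neg_mul, mul_assoc, ← mul_assoc (gamma r i), sq]; simp
    rw [this, hφ.herm_two _ _ hj.symm]
  by_cases h2 : i = l
  · subst h2
    have : gamma r k * gamma r i * (gamma r i * gamma r j) = -(gamma r k * gamma r j) := by
      rw [mul_assoc, ← mul_assoc (gamma r i), sq]; simp
    rw [this, actR_neg, herm_neg_left, hφ.herm_two _ _ (hkl.trans hab).ne, neg_zero]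
  by_cases h3 : j = k
  · subst h3
    have : gamma r j * gamma r l * (gamma r i * gamma r j) = -(gamma r l * gamma r i) := by
      rw [gamma_anticomm hab.ne, gamma_anticomm hkl.ne, neg_mul_neg, mul_assoc,
        ← mul_assoc (gamma r j), sq]; simp
    rw [this, actR_neg, herm_neg_left, hφ.herm_two _ _ (hab.trans hkl).ne', neg_zero]
  by_cases h4 : j = l
  · subst h4
    have : gamma r k * gamma r j * (gamma r i * gamma r j) = gamma r k * gamma r i := by
      rw [gamma_anticomm hab.ne, mul_neg, mul_assoc, ← mul_assoc (gamma r j), sq]; simp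
    rw [this, hφ.herm_two _ _ (Ne.symm h1)]
  exact hφ.herm_four k l i j hkl.ne (Ne.symm h1) (Ne.symm h3) (Ne.symm h2) (Ne.symm h4) hab.ne

omit hφ in
theorem eta_single (k l : Fin r) {a b : Fin n} (hab : a ≠ b) :
    eta φ k l (Pi.single a 1) (Pi.single b 1)
      = (herm (actN (gamma n a * gamma n b) (actR (gamma r k * gamma r l) φ)) φ).re := by
  rw [eta, gammaVec_single, gammaVec_single, gamma_anticomm hab.symm]
  congr 4
  module

/-- By `herm_pair` the form has a single coefficient. It equals `1`, because `twist` and `(f_k f_l)²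
= -1` turn it into `⟨φ, φ⟩`; the assertion is then `twist` once more. -/
theorem eta_add (k l : Fin r) (hkl : k < l) :
    twoFormAct (eta φ k l) φ + actR (gamma r k * gamma r l) φ = 0 := by
  have hkl' : ixF h k < ixF h l := ixF_lt.mpr hkl
  rw [twoFormAct, Finset.sum_eq_single (ixF h k), Finset.sum_eq_single (ixF h l)]
  · rw [eta_single k l hkl'.ne, hφ.twist k l hkl.ne, actN_actR, hφ.twist k l hkl.ne,
      actR_neg_right, ← actR_mul]
    have : gamma r k * gamma r l * (gamma r k * gamma r l) = -1 := by
      nth_rw 2 [gamma_anticomm hkl.ne]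
      rw [mul_neg, mul_assoc, ← mul_assoc (gamma r l), gamma_sq, neg_one_mul, mul_neg, gamma_sq,
        neg_neg]
    rw [this]
    simp [hφ.unit]
  · intro b hb hb'
    rw [eta_single k l (Finset.mem_Ioi.mp hb).ne,
      hφ.herm_pair k l hkl (Finset.mem_Ioi.mp hb) fun e => hb' e.2]
    simp
  · exact fun h' => absurd (Finset.mem_Ioi.mpr hkl') h'
  · intro a _ ha
    refine Finset.sum_eq_zero fun b hb => ?_
    rw [eta_single k l (Finset.mem_Ioi.mp hb).ne,
      hφ.herm_pair k l hkl (Finset.mem_Ioi.mp hb) fun e => ha e.1]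
    simp
  · simp

theorem isPartiallyPure (hm : 0 < m) : IsPartiallyPure φ where
  lt := by omega
  mem := hφ.mem
  unit := hφ.unit
  finrank_pureSpace := by rw [hφ.pureSpace_eq, finrank_range_embD]
  eta_add := hφ.eta_add
  herm_eq_zero k l hkl := hφ.herm_two k l hkl.ne
  herm_four hr := by
    subst hr
    have := hφ.herm_four 0 1 2 3 (by decide) (by decide) (by decide) (by decide) (by decide)
      (by decide)
    simpa [List.ofFn_succ, mul_assoc] using this

end IsModelSpinor

end Model

/-! ## The algebra generated by the gamma matrices -/

section Generation

variable {k n r : ℕ}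

theorem tensorMat_update_apply (A : Matrix (Fin 2) (Fin 2) ℂ) (q : Fin k) (a b : Fin k → Fin 2) :
    tensorMat (Function.update (fun _ => 1) q A) a b
      = A (a q) (b q) * ∏ p ∈ {q}ᶜ, (1 : Matrix (Fin 2) (Fin 2) ℂ) (a p) (b p) := by
  simp only [tensorMat, Matrix.of_apply]
  rw [Fintype.prod_eq_mul_prod_compl q, Function.update_self]
  congr 1
  exact Finset.prod_congr rfl fun p hp => by
    rw [Function.update_of_ne (by simpa using hp)]

/-- A `2 × 2` matrix acting on the tensor factor in position `q`. -/
def posHom (q : Fin k) :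
    Matrix (Fin 2) (Fin 2) ℂ →ₐ[ℂ] Matrix (Fin k → Fin 2) (Fin k → Fin 2) ℂ :=
  AlgHom.ofLinearMap
    { toFun := fun A => tensorMat (Function.update (fun _ => 1) q A)
      map_add' := fun A B => by
        ext a b; simp only [tensorMat_update_apply, Matrix.add_apply, add_mul]
      map_smul' := fun c A => by
        ext a b
        simp only [tensorMat_update_apply, Matrix.smul_apply, smul_eq_mul, mul_assoc,
          RingHom.id_apply] }
    (by
      simp only [LinearMap.coe_mk, AddHom.coe_mk]
      rw [← tensorMat_one]
      congr 1
      exact Function.update_eq_self q _)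
    (fun A B => by
      simp only [LinearMap.coe_mk, AddHom.coe_mk, tensorMat_mul]
      congr 1
      funext p
      by_cases hp : p = q
      · subst hp; simp
      · simp [hp])

theorem posHom_apply (q : Fin k) (A : Matrix (Fin 2) (Fin 2) ℂ) :
    posHom q A = tensorMat (Function.update (fun _ => 1) q A) := rfl

/-- The matrices `1`, `g₁`, `T` and `g₁T` form a basis of the `2 × 2` matrices. -/
theorem subalgebra_mat_two_eq_top (S : Subalgebra ℂ (Matrix (Fin 2) (Fin 2) ℂ))
    (h1 : matG1 ∈ S) (h2 : matT ∈ S) : S = ⊤ := by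
  rw [eq_top_iff]
  rintro A -
  have e : A = ((A 0 0 + A 1 1) / 2) • (1 : Matrix (Fin 2) (Fin 2) ℂ)
      + ((A 0 0 - A 1 1) / (2 * Complex.I)) • matG1
      + ((A 1 0 - A 0 1) / (2 * Complex.I)) • matT
      + ((A 0 1 + A 1 0) / 2) • (matG1 * matT) := by
    ext i j
    fin_cases i <;> fin_cases j <;> simp [matG1, matT] <;> field_simp <;> ring
  rw [e]
  exact S.add_mem (S.add_mem (S.add_mem (S.smul_mem S.one_mem _) (S.smul_mem h1 _))
    (S.smul_mem h2 _)) (S.smul_mem (S.mul_mem h1 h2) _)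

/-- A pure tensor is the product of its factors placed one position at a time; `j` counts the
positions already filled. -/
theorem tensorMat_mem (S : Subalgebra ℂ (Matrix (Fin k → Fin 2) (Fin k → Fin 2) ℂ))
    (A : Fin k → Matrix (Fin 2) (Fin 2) ℂ) (j : ℕ)
    (hA : ∀ q : Fin k, q.val < j → posHom q (A q) ∈ S) :
    tensorMat (fun p : Fin k => if p.val < j then A p else 1) ∈ S := by
  induction j with
  | zero => simp only [Nat.not_lt_zero, if_false, tensorMat_one]; exact S.one_mem
  | succ j ih =>
    have ih := ih fun q hq => hA q (by omega)
    by_cases hj : j < k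
    · have e : tensorMat (fun p : Fin k => if p.val < j + 1 then A p else 1)
          = tensorMat (fun p : Fin k => if p.val < j then A p else 1)
            * posHom ⟨j, hj⟩ (A ⟨j, hj⟩) := by
        rw [posHom_apply, tensorMat_mul]
        congr 1
        funext p
        by_cases hp : p = ⟨j, hj⟩
        · subst hp; simp
        · have : p.val ≠ j := fun e => hp (Fin.ext e)
          rw [Function.update_of_ne hp, mul_one]
          congr 1
          exact propext ⟨by omega, by omega⟩
      rw [e]
      exact S.mul_mem ih (hA _ (by simp))
    · have e : (fun p : Fin k => if p.val < j + 1 then A p else 1)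
          = fun p : Fin k => if p.val < j then A p else 1 := by
        funext p
        congr 1
        exact propext ⟨by omega, by omega⟩
      rw [e]; exact ih

theorem matG1_mul_matG2_eq : matG1 * matG2 = (-Complex.I) • matT := by
  ext i j; fin_cases i <;> fin_cases j <;> simp [matG1, matG2, matT]

/-- The product of the two gammas of one pair is a multiple of `T` in that position alone. These
copies of `T` cancel the tail of `T`s in the first gamma of the pair and leave `g₁` alone, so every
single tensor position carries a full matrix algebra. The matrix units are pure tensors. -/
theorem adjoin_gamma (n : ℕ) : Algebra.adjoin ℂ (Set.range (gamma n)) = ⊤ := by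
  set S := Algebra.adjoin ℂ (Set.range (gamma n)) with hS
  have hg : ∀ i, gamma n i ∈ S := fun i => Algebra.subset_adjoin ⟨i, rfl⟩
  have hT : ∀ q : Fin (n / 2), posHom q matT ∈ S := by
    intro q
    have e : posHom q matT
        = Complex.I • (gamma n ⟨2 * q, by omega⟩ * gamma n ⟨2 * q + 1, by omega⟩) := by
      have h1 : 2 * q.val / 2 < n / 2 := by omega
      have h2 : (2 * q.val + 1) / 2 < n / 2 := by omega
      have e' : gamma n ⟨2 * q, by omega⟩ * gamma n ⟨2 * q + 1, by omega⟩
          = posHom q (matG1 * matG2) := by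
        simp only [gamma, if_pos h1, if_pos h2, one_smul]
        rw [posHom_apply, tensorMat_mul]
        congr 1
        funext p
        have h3 : 2 * q.val / 2 = q := by omega
        have h4 : (2 * q.val + 1) / 2 = q := by omega
        have h5 : ¬ (2 * q.val + 1) % 2 = 0 := by omega
        have h6 : 2 * q.val % 2 = 0 := by omega
        simp only [gammaFactor, h3, h4, h5, h6, if_true, if_false]
        by_cases hp : p = q
        · subst hp; simp
        · have hp' : p.val ≠ q.val := fun e => hp (Fin.ext e)
          rw [Function.update_of_ne hp]
          by_cases hlt : p.val < q.val
          · simp only [hlt, if_true, matT_sq]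
          · simp [hlt, hp']
      rw [e', matG1_mul_matG2_eq, map_smul, smul_smul]
      simp
    rw [e]
    exact S.smul_mem (S.mul_mem (hg _) (hg _)) _
  have hG : ∀ q : Fin (n / 2), posHom q matG1 ∈ S := by
    intro q
    have e : posHom q matG1 = tensorMat (fun p : Fin (n / 2) => if p.val < q.val then matT else 1)
        * gamma n ⟨2 * q, by omega⟩ := by
      have h1 : 2 * q.val / 2 < n / 2 := by omega
      simp only [gamma, if_pos h1, one_smul]
      rw [posHom_apply, tensorMat_mul]
      congr 1
      funext p
      have h3 : 2 * q.val / 2 = q := by omega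
      have h6 : 2 * q.val % 2 = 0 := by omega
      simp only [gammaFactor, h3, h6, if_true]
      by_cases hp : p = q
      · subst hp; simp
      · have hp' : p.val ≠ q.val := fun e => hp (Fin.ext e)
        rw [Function.update_of_ne hp]
        by_cases hlt : p.val < q.val
        · simp only [hlt, if_true, matT_sq]
        · simp [hlt, hp']
    rw [e]
    exact S.mul_mem (tensorMat_mem S (fun _ => matT) q fun p _ => hT p) (hg _)
  have hall : ∀ (q : Fin (n / 2)) (A : Matrix (Fin 2) (Fin 2) ℂ), posHom q A ∈ S := by
    intro q A
    have := subalgebra_mat_two_eq_top (S.comap (posHom q)) (hG q) (hT q)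
    have hA : A ∈ S.comap (posHom q) := this ▸ Algebra.mem_top
    exact hA
  rw [eq_top_iff]
  rintro M -
  rw [Matrix.matrix_eq_sum_single M]
  refine S.sum_mem fun a _ => S.sum_mem fun b _ => ?_
  have e : Matrix.single a b (M a b)
      = M a b • tensorMat (fun p : Fin (n / 2) => if p.val < n / 2 then
          Matrix.single (a p) (b p) (1 : ℂ) else 1) := by
    ext c d
    simp only [Matrix.smul_apply, tensorMat, Matrix.of_apply, Fin.is_lt, if_true,
      Matrix.single_apply, smul_eq_mul]
    by_cases hc : a = c ∧ b = d
    · obtain ⟨rfl, rfl⟩ := hc; simp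
    · rw [if_neg hc]
      symm
      rw [mul_eq_zero]
      right
      rw [not_and_or] at hc
      rcases hc with hc | hc
      · obtain ⟨p, hp⟩ := Function.ne_iff.mp hc
        exact Finset.prod_eq_zero (Finset.mem_univ p) (by simp [hp])
      · obtain ⟨p, hp⟩ := Function.ne_iff.mp hc
        exact Finset.prod_eq_zero (Finset.mem_univ p) (by simp [hp])
  rw [e]
  exact S.smul_mem (tensorMat_mem S _ _ fun q _ => hall q _) _

/-- The action of the gamma matrices of both factors generates all endomorphisms of
`Δ_r ⊗ Δ_n`. -/
theorem twisted_induction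
    {p : Matrix (SpinIdx r × SpinIdx n) (SpinIdx r × SpinIdx n) ℂ → Prop}
    (hN : ∀ a, p (1 ⊗ₖ gamma n a)) (hR : ∀ k, p (gamma r k ⊗ₖ 1))
    (hadd : ∀ A B, p A → p B → p (A + B)) (hmul : ∀ A B, p A → p B → p (A * B))
    (hsc : ∀ c : ℂ, p (c • 1)) (A) : p A := by
  have h1 : ∀ B : Matrix (SpinIdx n) (SpinIdx n) ℂ, p (1 ⊗ₖ B) := by
    intro B
    have hB : B ∈ Algebra.adjoin ℂ (Set.range (gamma n)) := adjoin_gamma n ▸ Algebra.mem_top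
    induction hB using Algebra.adjoin_induction with
    | mem x hx => obtain ⟨a, rfl⟩ := hx; exact hN a
    | algebraMap c =>
      rw [Algebra.algebraMap_eq_smul_one, Matrix.kronecker_smul, Matrix.one_kronecker_one]
      exact hsc c
    | add x y _ _ hx hy => rw [Matrix.kronecker_add]; exact hadd _ _ hx hy
    | mul x y _ _ hx hy =>
      rw [show (1 : Matrix (SpinIdx r) (SpinIdx r) ℂ) = 1 * 1 from (one_mul 1).symm,
        Matrix.mul_kronecker_mul]
      exact hmul _ _ hx hy
  have h2 : ∀ B : Matrix (SpinIdx r) (SpinIdx r) ℂ, p (B ⊗ₖ 1) := by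
    intro B
    have hB : B ∈ Algebra.adjoin ℂ (Set.range (gamma r)) := adjoin_gamma r ▸ Algebra.mem_top
    induction hB using Algebra.adjoin_induction with
    | mem x hx => obtain ⟨a, rfl⟩ := hx; exact hR a
    | algebraMap c =>
      rw [Algebra.algebraMap_eq_smul_one, Matrix.smul_kronecker, Matrix.one_kronecker_one]
      exact hsc c
    | add x y _ _ hx hy => rw [Matrix.add_kronecker]; exact hadd _ _ hx hy
    | mul x y _ _ hx hy =>
      rw [show (1 : Matrix (SpinIdx n) (SpinIdx n) ℂ) = 1 * 1 from (one_mul 1).symm,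
        Matrix.mul_kronecker_mul]
      exact hmul _ _ hx hy
  have hsum : ∀ {ι : Type} (s : Finset ι)
      (f : ι → Matrix (SpinIdx r × SpinIdx n) (SpinIdx r × SpinIdx n) ℂ),
      (∀ i, p (f i)) → p (∑ i ∈ s, f i) := by
    intro ι s f hf
    classical
    induction s using Finset.induction_on with
    | empty => simpa using hsc 0
    | insert a s ha ih => rw [Finset.sum_insert ha]; exact hadd _ _ (hf a) ih
  rw [Matrix.matrix_eq_sum_single A]
  refine hsum _ _ fun a => hsum _ _ fun b => ?_
  have e : Matrix.single a b (A a b)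
      = (Matrix.single a.1 b.1 (A a b) ⊗ₖ 1) * (1 ⊗ₖ Matrix.single a.2 b.2 (1 : ℂ)) := by
    rw [← Matrix.mul_kronecker_mul, mul_one, one_mul, Matrix.single_kronecker_single, mul_one]
  rw [e]
  exact hmul _ _ (h2 _) (h1 _)

theorem exists_mulVec_eq {φ : TwSpinor r n} (hφ : φ ≠ 0) (ψ : TwSpinor r n) :
    ∃ C : Matrix (SpinIdx r × SpinIdx n) (SpinIdx r × SpinIdx n) ℂ, C *ᵥ φ = ψ := by
  have h : star φ ⬝ᵥ φ ≠ 0 := fun e => hφ (herm_self_eq_zero (by rw [herm, dotProduct_comm, e]))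
  refine ⟨(star φ ⬝ᵥ φ)⁻¹ • vecMulVec ψ (star φ), ?_⟩
  rw [Matrix.smul_mulVec, Matrix.vecMulVec_mulVec]
  ext i
  simp only [Pi.smul_apply, MulOpposite.smul_eq_mul_unop, smul_eq_mul, MulOpposite.unop_op]
  field_simp

end Generation

/-! ## The representation of `Spin^{c,r}(n)` -/

section Rep

variable {n r : ℕ}

/-- The element `[g, [h, z]]` of `Spin^{c,r}(n)`. -/
def mkSpincr (g : Spin n) (h : Spin r) (z : Circle) : Spincr n r :=
  QuotientGroup.mk (g, QuotientGroup.mk (h, z))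

theorem exists_mkSpincr (G : Spincr n r) : ∃ g h z, G = mkSpincr g h z := by
  induction G using QuotientGroup.induction_on with
  | H p =>
    obtain ⟨g, s⟩ := p
    induction s using QuotientGroup.induction_on with
    | H q => exact ⟨g, q.1, q.2, rfl⟩

theorem spincrToSOn_mk (g : Spin n) (h : Spin r) (z : Circle) :
    spincrToSOn n r (mkSpincr g h z) = lam n g := rfl
theorem spincrToSOr_mk (g : Spin n) (h : Spin r) (z : Circle) :
    spincrToSOr n r (mkSpincr g h z) = lam r h := rfl
theorem spincrToU_mk (g : Spin n) (h : Spin r) (z : Circle) :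
    spincrToU n r (mkSpincr g h z) = z ^ 2 := rfl
theorem spincrRep_mk (g : Spin n) (h : Spin r) (z : Circle) :
    spincrRep n r (mkSpincr g h z) = ((z : ℂ) • kappaSpin r h) ⊗ₖ kappaSpin n g := rfl

theorem spincrRep_mk_mulVec (g : Spin n) (h : Spin r) (z : Circle) (φ : TwSpinor r n) :
    spincrRep n r (mkSpincr g h z) *ᵥ φ
      = (z : ℂ) • actR (kappaSpin r h) (actN (kappaSpin n g) φ) := by
  rw [spincrRep_mk, Matrix.smul_kronecker, Matrix.smul_mulVec, actR, actN, Matrix.mulVec_mulVec,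
    ← Matrix.mul_kronecker_mul, one_mul, mul_one]

theorem kappaSpin_mul_gammaVec (g : Spin n) (X : Fin n → ℝ) :
    kappaSpin n g * gammaVec n X
      = gammaVec n ((lam n g : Matrix (Fin n) (Fin n) ℝ) *ᵥ X) * kappaSpin n g := by
  have h := congrArg (kappa n) (lam_spec g X)
  rw [map_mul, map_mul, kappa_ι, kappa_ι] at h
  exact h

theorem spincrRep_mul_left (G : Spincr n r) (X : Fin n → ℝ) :
    spincrRep n r G * (1 ⊗ₖ gammaVec n X)
      = (1 ⊗ₖ gammaVec n ((spincrToSOn n r G : Matrix (Fin n) (Fin n) ℝ) *ᵥ X))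
        * spincrRep n r G := by
  obtain ⟨g, h, z, rfl⟩ := exists_mkSpincr G
  rw [spincrRep_mk, spincrToSOn_mk, ← Matrix.mul_kronecker_mul, ← Matrix.mul_kronecker_mul,
    mul_one, one_mul, kappaSpin_mul_gammaVec]

theorem spincrRep_mul_right (G : Spincr n r) (X : Fin r → ℝ) :
    spincrRep n r G * (gammaVec r X ⊗ₖ 1)
      = (gammaVec r ((spincrToSOr n r G : Matrix (Fin r) (Fin r) ℝ) *ᵥ X) ⊗ₖ 1)
        * spincrRep n r G := by
  obtain ⟨g, h, z, rfl⟩ := exists_mkSpincr G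
  rw [spincrRep_mk, spincrToSOr_mk, ← Matrix.mul_kronecker_mul, ← Matrix.mul_kronecker_mul,
    mul_one, one_mul, smul_mul_assoc, mul_smul_comm, kappaSpin_mul_gammaVec]

theorem cliff_spincrRep (G : Spincr n r) (X : Fin n → ℝ) (φ : TwSpinor r n) :
    cliff ((spincrToSOn n r G : Matrix (Fin n) (Fin n) ℝ) *ᵥ X) (spincrRep n r G *ᵥ φ)
      = spincrRep n r G *ᵥ cliff X φ := by
  rw [cliff, cliff, actN, actN, Matrix.mulVec_mulVec, Matrix.mulVec_mulVec, spincrRep_mul_left]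

theorem spincrRep_mul_inv (G : Spincr n r) : spincrRep n r G * spincrRep n r G⁻¹ = 1 := by
  rw [← map_mul, mul_inv_cancel, map_one]

theorem spincrRep_inv_mul (G : Spincr n r) : spincrRep n r G⁻¹ * spincrRep n r G = 1 := by
  rw [← map_mul, inv_mul_cancel, map_one]

end Rep

/-! ## Smoothness of lifts that fix a spinor -/

section SmoothLift

variable {n r : ℕ} {M : Type u} [TopologicalSpace M] [ChartedSpace (EuclideanSpace ℝ (Fin n)) M]

theorem contMDiffOn_complex_mul {f g : M → ℂ} {U : Set M} (hf : ContMDiffOn (𝓡 n) 𝓘(ℝ, ℂ) ∞ f U)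
    (hg : ContMDiffOn (𝓡 n) 𝓘(ℝ, ℂ) ∞ g U) :
    ContMDiffOn (𝓡 n) 𝓘(ℝ, ℂ) ∞ (fun x => f x * g x) U :=
  (contDiff_mul (𝕜 := ℝ) (𝔸 := ℂ)).contMDiff.comp_contMDiffOn (hf.prodMk_space hg)

/-- Conjugation by the represented group element is determined by its two rotations, and a fixed
nonzero spinor removes the remaining scalar freedom. A lift chosen pointwise is thus automatically
smooth, with no separate hypothesis on the `U(1)` component. -/
theorem contMDiffOn_embSpincr {G : M → Spincr n r} {U : Set M} {φ : TwSpinor r n} (hφ : φ ≠ 0)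
    (hn : ∀ a b, ContMDiffOn (𝓡 n) 𝓘(ℝ, ℝ) ∞
      (fun x => (spincrToSOn n r (G x) : Matrix (Fin n) (Fin n) ℝ) a b) U)
    (hr : ∀ a b, ContMDiffOn (𝓡 n) 𝓘(ℝ, ℝ) ∞
      (fun x => (spincrToSOr n r (G x) : Matrix (Fin r) (Fin r) ℝ) a b) U)
    (hfix : ∀ x ∈ U, spincrRep n r (G x) *ᵥ φ = φ) :
    ContMDiffOn (𝓡 n) 𝓘(ℝ, SpinIdx r × SpinIdx n → SpinIdx r × SpinIdx n → ℂ) ∞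
      (fun x => embSpincr n r (G x)) U := by
  have real_smul : ∀ (f : M → ℝ) (c : ℂ), ContMDiffOn (𝓡 n) 𝓘(ℝ, ℝ) ∞ f U →
      ContMDiffOn (𝓡 n) 𝓘(ℝ, ℂ) ∞ (fun x => (f x : ℂ) * c) U := fun f c hf => by
    have h1 : ContDiff ℝ ∞ (fun t : ℝ => (t : ℂ) * c) :=
      (Complex.ofRealCLM.contDiff).mul contDiff_const
    exact h1.contMDiff.comp_contMDiffOn hf
  -- On the generators, conjugation is given by the entries of the rotations. It is multiplicative,
  -- so smoothness passes to everything they generate, which is the whole matrix algebra.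
  have key : ∀ C : Matrix (SpinIdx r × SpinIdx n) (SpinIdx r × SpinIdx n) ℂ, ∀ a b,
      ContMDiffOn (𝓡 n) 𝓘(ℝ, ℂ) ∞
        (fun x => (spincrRep n r (G x) * C * spincrRep n r (G x)⁻¹) a b) U := by
    intro C
    induction C using twisted_induction with
    | hN i =>
      intro a b
      have e : ∀ x, spincrRep n r (G x) * (1 ⊗ₖ gamma n i) * spincrRep n r (G x)⁻¹
          = ∑ j, (((spincrToSOn n r (G x) : Matrix (Fin n) (Fin n) ℝ) j i : ℝ) : ℂ)
            • (1 ⊗ₖ gamma n j) := fun x => by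
        rw [← gammaVec_single, spincrRep_mul_left, mul_assoc, spincrRep_mul_inv, mul_one,
          gammaVec_apply]
        simp only [Matrix.mulVec_single_one, Matrix.col_apply]
        ext c d
        simp [Matrix.kroneckerMap_apply, Matrix.sum_apply, Finset.mul_sum, mul_left_comm]
      simp only [e, Matrix.sum_apply, Matrix.smul_apply, smul_eq_mul]
      exact contMDiffOn_finsetSum fun j _ => real_smul _ _ (hn j i)
    | hR i =>
      intro a b
      have e : ∀ x, spincrRep n r (G x) * (gamma r i ⊗ₖ 1) * spincrRep n r (G x)⁻¹
          = ∑ j, (((spincrToSOr n r (G x) : Matrix (Fin r) (Fin r) ℝ) j i : ℝ) : ℂ)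
            • (gamma r j ⊗ₖ 1) := fun x => by
        rw [← gammaVec_single, spincrRep_mul_right, mul_assoc, spincrRep_mul_inv, mul_one,
          gammaVec_apply]
        simp only [Matrix.mulVec_single_one, Matrix.col_apply]
        ext c d
        simp [Matrix.kroneckerMap_apply, Matrix.sum_apply, Finset.sum_mul, mul_assoc]
      simp only [e, Matrix.sum_apply, Matrix.smul_apply, smul_eq_mul]
      exact contMDiffOn_finsetSum fun j _ => real_smul _ _ (hr j i)
    | hadd A B hA hB =>
      intro a b
      simp only [mul_add, add_mul, Matrix.add_apply]
      exact (hA a b).add (hB a b)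
    | hmul A B hA hB =>
      intro a b
      have e : ∀ x, spincrRep n r (G x) * (A * B) * spincrRep n r (G x)⁻¹
          = (spincrRep n r (G x) * A * spincrRep n r (G x)⁻¹)
            * (spincrRep n r (G x) * B * spincrRep n r (G x)⁻¹) := fun x => by
        have h := spincrRep_inv_mul (G x)
        calc _ = spincrRep n r (G x) * A * 1 * B * spincrRep n r (G x)⁻¹ := by
              simp only [mul_assoc, one_mul]
          _ = _ := by rw [← h]; simp only [mul_assoc]
      simp only [e, Matrix.mul_apply (M := spincrRep n r _ * A * _)]
      exact contMDiffOn_finsetSum fun j _ => contMDiffOn_complex_mul (hA a j) (hB j b)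
    | hsc c =>
      intro a b
      have e : ∀ x, spincrRep n r (G x) * (c • 1) * spincrRep n r (G x)⁻¹ = c • 1 := fun x => by
        rw [mul_smul_comm, mul_one, smul_mul_assoc, spincrRep_mul_inv]
      simp only [e]
      exact contMDiffOn_const
  rw [contMDiffOn_pi_space]
  intro a
  rw [contMDiffOn_pi_space]
  intro b
  -- With `C φ = e_b` and `G φ = φ`, the column `G e_b` equals `(G C G⁻¹) φ`, which involves `G`
  -- only through conjugation.
  obtain ⟨C, hC⟩ := exists_mulVec_eq hφ (Pi.single b 1)
  have e : ∀ x ∈ U, embSpincr n r (G x) a b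
      = ∑ c, (spincrRep n r (G x) * C * spincrRep n r (G x)⁻¹) a c * φ c := fun x hx => by
    have h1 : (spincrRep n r (G x) * C * spincrRep n r (G x)⁻¹) *ᵥ φ
        = spincrRep n r (G x) *ᵥ Pi.single b 1 := by
      have h2 := hfix x hx
      nth_rw 1 [← h2]
      rw [Matrix.mulVec_mulVec, mul_assoc, spincrRep_inv_mul, mul_one, ← Matrix.mulVec_mulVec, hC]
    have h3 := congrFun h1 a
    rw [Matrix.mulVec_single_one] at h3
    exact h3.symm
  refine ContMDiffOn.congr ?_ e
  exact contMDiffOn_finsetSum fun c _ => contMDiffOn_complex_mul (key C a c) contMDiffOn_const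

end SmoothLift

/-! ## Unitary matrices are products of reflections -/

section Householder

variable {𝕜 : Type*} [RCLike 𝕜] {k : ℕ}

/-- The map which multiplies the unit vector `x` by `c` and fixes its orthogonal complement. -/
def reflMat (x : Fin k → 𝕜) (c : 𝕜) : Matrix (Fin k) (Fin k) 𝕜 :=
  1 + (c - 1) • vecMulVec x (star x)

theorem reflMat_mulVec (x z : Fin k → 𝕜) (c : 𝕜) :
    reflMat x c *ᵥ z = z + ((c - 1) * (star x ⬝ᵥ z)) • x := by
  rw [reflMat, add_mulVec, one_mulVec, smul_mulVec, vecMulVec_mulVec]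
  ext i
  simp [mul_comm, mul_left_comm]

theorem reflMat_mul (x : Fin k → 𝕜) (hx : star x ⬝ᵥ x = 1) (c d : 𝕜) :
    reflMat x c * reflMat x d = reflMat x (c * d) := by
  have h : vecMulVec x (star x) * vecMulVec x (star x) = vecMulVec x (star x) := by
    rw [vecMulVec_mul_vecMulVec, hx]; simp
  simp only [reflMat, add_mul, mul_add, one_mul, mul_one, smul_mul_smul_comm, h]
  module

theorem reflMat_one (x : Fin k → 𝕜) : reflMat x 1 = 1 := by simp [reflMat]

theorem reflMat_det (x : Fin k → 𝕜) (hx : star x ⬝ᵥ x = 1) (c : 𝕜) : (reflMat x c).det = c := by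
  have h : reflMat x c = 1 + replicateCol Unit ((c - 1) • x) * replicateRow Unit (star x) := by
    ext i j
    simp [reflMat, vecMulVec_apply, Matrix.mul_apply]
  rw [h, det_one_add_replicateCol_mul_replicateRow, dotProduct_smul, hx]
  simp

theorem reflMat_conjTranspose (x : Fin k → 𝕜) (c : 𝕜) : (reflMat x c)ᴴ = reflMat x (star c) := by
  simp [reflMat, Matrix.conjTranspose_vecMulVec]

/-- Two distinct vectors of the same length are exchanged by a reflection along their
difference. -/
theorem exists_reflMat {u w : Fin k → 𝕜} (hu : star u ⬝ᵥ u = 1) (hw : star w ⬝ᵥ w = 1)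
    (huw : u ≠ w) : ∃ (x : Fin k → 𝕜) (c : 𝕜), star x ⬝ᵥ x = 1 ∧ star c * c = 1 ∧
      reflMat x c *ᵥ u = w ∧ ∀ v, star u ⬝ᵥ v = 0 → star w ⬝ᵥ v = 0 → star x ⬝ᵥ v = 0 := by
  set y := u - w with hy
  have hy0 : y ≠ 0 := sub_ne_zero.mpr huw
  set d : 𝕜 := star y ⬝ᵥ u with hd
  have hwu : star w ⬝ᵥ u = star (star u ⬝ᵥ w) := by
    simp [dotProduct, mul_comm]
  have hd1 : d = 1 - star w ⬝ᵥ u := by rw [hd, hy, star_sub, sub_dotProduct, hu]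
  have hyy : star y ⬝ᵥ y = d + star d := by
    rw [hd1]
    simp only [hy, star_sub, sub_dotProduct, dotProduct_sub, hu, hw, hwu, star_star, star_one]
    ring
  obtain ⟨ρ, hρ⟩ : ∃ ρ : ℝ, star y ⬝ᵥ y = (ρ : 𝕜) ∧ 0 < ρ := by
    refine ⟨∑ i, ‖y i‖ ^ 2, ?_, ?_⟩
    · simp [dotProduct, RCLike.conj_mul]
    · obtain ⟨i, hi⟩ := Function.ne_iff.mp hy0
      exact Finset.sum_pos' (fun _ _ => by positivity) ⟨i, Finset.mem_univ _, by
        have : 0 < ‖y i‖ := norm_pos_iff.mpr hi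
        positivity⟩
  obtain ⟨hρ, hρ0⟩ := hρ
  have hd0 : d ≠ 0 := by
    intro h
    rw [hyy, h] at hρ
    simp at hρ
    exact hρ0.ne' (by exact_mod_cast hρ.symm)
  have hsd0 : star d ≠ 0 := star_ne_zero.mpr hd0
  have hs : ((√ρ : ℝ) : 𝕜) * ((√ρ : ℝ) : 𝕜) = d + star d := by
    rw [← hyy, hρ, ← RCLike.ofReal_mul, Real.mul_self_sqrt hρ0.le]
  have hs0 : ((√ρ : ℝ) : 𝕜) ≠ 0 := by
    rw [RCLike.ofReal_ne_zero]; exact (Real.sqrt_pos.mpr hρ0).ne'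
  -- With `y = u - w` and `d = ⟨y, u⟩` one has `|y|² = d + d̄`. The factor `c = -d̄/d` is the one
  -- for which `(c - 1) d / |y|² = -1`, so that `u` is moved by `-y`. Over `ℝ` it is `-1`.
  refine ⟨((√ρ : ℝ) : 𝕜)⁻¹ • y, -(star d / d), ?_, ?_, ?_, ?_⟩
  · rw [star_smul, smul_dotProduct, dotProduct_smul, smul_smul, hyy, ← hs]
    simp only [RCLike.star_def, map_inv₀, RCLike.conj_ofReal, smul_eq_mul]
    field_simp
  · rw [star_neg, star_div₀, star_star]
    field_simp
  · rw [reflMat_mulVec, star_smul, smul_dotProduct, ← hd, smul_smul]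
    have : (-(star d / d) - 1) * star ((√ρ : ℝ) : 𝕜)⁻¹ • d * ((√ρ : ℝ) : 𝕜)⁻¹ = -1 := by
      simp only [RCLike.star_def, map_inv₀, RCLike.conj_ofReal, smul_eq_mul]
      have h2 : (-(star d / d) - 1) = -((((√ρ : ℝ) : 𝕜) * ((√ρ : ℝ) : 𝕜)) / d) := by
        rw [hs]; field_simp; ring
      rw [RCLike.star_def] at h2
      rw [h2]; field_simp
    rw [this, hy]; simp
  · intro v h1 h2
    rw [star_smul, smul_dotProduct, hy, star_sub, sub_dotProduct, h1, h2]; simp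

/-- Householder's argument: one reflection after another makes the matrix fix one more standard
basis vector, without disturbing those already fixed. -/
theorem unitary_induction {p : Matrix (Fin k) (Fin k) 𝕜 → Prop} (one : p 1)
    (refl : ∀ x c A, star x ⬝ᵥ x = 1 → star c * c = 1 → p A → p (reflMat x c * A))
    {A : Matrix (Fin k) (Fin k) 𝕜} (hA : Aᴴ * A = 1) : p A := by
  -- The first `j` basis vectors are fixed already; `d` counts the others.
  have step : ∀ d j : ℕ, j + d = k → ∀ A : Matrix (Fin k) (Fin k) 𝕜, Aᴴ * A = 1 →
      (∀ i : Fin k, i.val < j → A *ᵥ Pi.single i 1 = Pi.single i 1) → p A := by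
    intro d
    induction d with
    | zero =>
      intro j hj A _ hfix
      have : A = 1 := by
        apply Matrix.ext_of_mulVec_single
        intro i
        rw [hfix i (by omega), Matrix.one_mulVec]
      rw [this]; exact one
    | succ d ih =>
      intro j hj A hA hfix
      have hjk : j < k := by omega
      have hdot : ∀ v w : Fin k → 𝕜, star (A *ᵥ v) ⬝ᵥ (A *ᵥ w) = star v ⬝ᵥ w := fun v w => by
        rw [Matrix.star_mulVec, Matrix.dotProduct_mulVec, Matrix.vecMul_vecMul, hA,
          Matrix.vecMul_one]
      set e : Fin k → 𝕜 := Pi.single ⟨j, hjk⟩ 1 with he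
      have hee : star e ⬝ᵥ e = 1 := by simp [he]
      by_cases hu : A *ᵥ e = e
      · refine ih (j + 1) (by omega) A hA fun i hi => ?_
        rcases Nat.lt_succ_iff_lt_or_eq.mp hi with h | h
        · exact hfix i h
        · have : i = ⟨j, hjk⟩ := Fin.ext h
          subst this; exact hu
      -- The reflection takes `A e` to `e`. An earlier basis vector is fixed by `A` and orthogonal
      -- to `e`, hence orthogonal to `A e` too, and so the reflection leaves it alone.
      · obtain ⟨x, c, hx, hc, hR, hv⟩ := exists_reflMat
          (show star (A *ᵥ e) ⬝ᵥ (A *ᵥ e) = 1 by rw [hdot, hee]) hee hu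
        have hinv : reflMat x (star c) * reflMat x c = 1 := by
          rw [reflMat_mul x hx, hc, reflMat_one]
        have hc' : star (star c) * star c = 1 := by rw [star_star, mul_comm, hc]
        have e1 : A = reflMat x (star c) * (reflMat x c * A) := by
          rw [← mul_assoc, hinv, one_mul]
        rw [e1]
        refine refl x (star c) _ hx hc' (ih (j + 1) (by omega) _ ?_ fun i hi => ?_)
        · rw [Matrix.conjTranspose_mul, reflMat_conjTranspose, mul_assoc,
            ← mul_assoc (reflMat x (star c)), hinv, one_mul, hA]
        · rw [← Matrix.mulVec_mulVec]
          rcases Nat.lt_succ_iff_lt_or_eq.mp hi with h | h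
          · have hne : i ≠ ⟨j, hjk⟩ := fun h' => by rw [h'] at h; exact lt_irrefl _ h
            rw [hfix i h, reflMat_mulVec, hv]
            · simp
            · rw [← hfix i h, hdot]; simp [he, hne]
            · simp [he, hne]
          · have : i = ⟨j, hjk⟩ := Fin.ext h
            subst this; exact hR
  exact step k 0 (by omega) A hA fun i hi => absurd hi (Nat.not_lt_zero _)

/-- Real reflections are negatives of half-turns, so a pair of them is a product of two half-turns,
which is the form in which elements of `Spin` are given. -/
theorem specialOrthogonal_induction {p : Matrix (Fin k) (Fin k) ℝ → Prop} (one : p 1)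
    (refl : ∀ x y A, x ⬝ᵥ x = 1 → y ⬝ᵥ y = 1 → p A → p (halfTurn x * halfTurn y * A))
    {A : Matrix (Fin k) (Fin k) ℝ} (hA : Aᵀ * A = 1) (hdet : A.det = 1) : p A := by
  have ht : ∀ x : Fin k → ℝ, reflMat x (-1) = -halfTurn x := fun x => by
    rw [reflMat, halfTurn]; simp only [star_trivial]; module
  -- The strengthened predicate groups reflections in pairs: at determinant `-1` the statement is
  -- postponed until one more reflection has been multiplied on.
  have h := unitary_induction (𝕜 := ℝ)
    (p := fun A => (A.det = 1 → p A) ∧ (A.det = -1 → ∀ x, x ⬝ᵥ x = 1 → p (reflMat x (-1) * A))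
      ∧ (A.det = 1 ∨ A.det = -1))
    ⟨fun _ => one, fun h => by rw [det_one] at h; norm_num at h, Or.inl det_one⟩
    (fun x c A hx hc ⟨h1, h2, h3⟩ => by
      rw [star_trivial] at hx hc
      rcases mul_self_eq_one_iff.mp hc with rfl | rfl
      · rw [reflMat_one, one_mul]; exact ⟨h1, h2, h3⟩
      · rw [det_mul, reflMat_det x (by rwa [star_trivial])]
        refine ⟨fun h => h2 (by linarith) x hx, fun h y hy => ?_, ?_⟩
        · rw [ht, ht, ← mul_assoc, neg_mul_neg]
          exact refl y x A hy hx (h1 (by linarith))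
        · rcases h3 with h3 | h3 <;> rw [h3] <;> norm_num)
    (A := A) (by rwa [Matrix.conjTranspose_eq_transpose_of_trivial])
  exact h.1 hdet

end Householder

/-! ## Lifting `U(m) × SO(r)` to `Spin^{c,r}(n)` -/

section Lift

variable {n m r : ℕ}

/-- The product of two unit vectors, as an element of `Spin(n)`. -/
def spinMul (x y : Fin n → ℝ) (hx : x ⬝ᵥ x = 1) (hy : y ⬝ᵥ y = 1) : Spin n :=
  ⟨⟨CliffordAlgebra.ι (negSq n) x * CliffordAlgebra.ι (negSq n) y,
    CliffordAlgebra.ι (negSq n) y * CliffordAlgebra.ι (negSq n) x,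
    by
      rw [mul_assoc, ← mul_assoc (CliffordAlgebra.ι (negSq n) y), CliffordAlgebra.ι_sq_scalar,
        negSq_apply, hy, map_neg, map_one, neg_one_mul, mul_neg, CliffordAlgebra.ι_sq_scalar,
        negSq_apply, hx]
      simp,
    by
      rw [mul_assoc, ← mul_assoc (CliffordAlgebra.ι (negSq n) x), CliffordAlgebra.ι_sq_scalar,
        negSq_apply, hx, map_neg, map_one, neg_one_mul, mul_neg, CliffordAlgebra.ι_sq_scalar,
        negSq_apply, hy]
      simp⟩,
    Subgroup.subset_closure (Or.inr ⟨x, y, hx, hy, rfl⟩)⟩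

theorem kappaSpin_spinMul (x y : Fin n → ℝ) (hx : x ⬝ᵥ x = 1) (hy : y ⬝ᵥ y = 1) :
    kappaSpin n (spinMul x y hx hy) = gammaVec n x * gammaVec n y := by
  change kappa n (CliffordAlgebra.ι (negSq n) x * CliffordAlgebra.ι (negSq n) y) = _
  rw [map_mul, kappa_ι, kappa_ι]

theorem lam_spinMul (x y : Fin n → ℝ) (hx : x ⬝ᵥ x = 1) (hy : y ⬝ᵥ y = 1) :
    (lam n (spinMul x y hx hy) : Matrix (Fin n) (Fin n) ℝ) = halfTurn x * halfTurn y := by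
  refine (lam_spec _).unique fun v => ?_
  change CliffordAlgebra.ι (negSq n) x * CliffordAlgebra.ι (negSq n) y * _
    = _ * (CliffordAlgebra.ι (negSq n) x * CliffordAlgebra.ι (negSq n) y)
  rw [mul_assoc, halfTurn_spec y hy, ← mul_assoc, halfTurn_spec x hx, mul_assoc,
    Matrix.mulVec_mulVec]

theorem halfTurn_mulVec (x v : Fin n → ℝ) : halfTurn x *ᵥ v = (2 * (x ⬝ᵥ v)) • x - v := by
  rw [halfTurn, sub_mulVec, smul_mulVec, vecMulVec_mulVec, one_mulVec]
  ext i
  simp [mul_comm, mul_assoc]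

/-- `G ∈ Spin^{c,r}(n)` is a lift of `(A, B)` which fixes `φ`. -/
structure IsLift (h : 2 * m + r = n) (ε : Fin m → ℤˣ) (φ : TwSpinor r n)
    (A : Matrix (Fin m) (Fin m) ℂ) (B : Matrix (Fin r) (Fin r) ℝ) (G : Spincr n r) : Prop where
  onD : ∀ z, (spincrToSOn n r G : Matrix (Fin n) (Fin n) ℝ) *ᵥ embD h ε z = embD h ε (A *ᵥ z)
  onF : ∀ t, (spincrToSOn n r G : Matrix (Fin n) (Fin n) ℝ) *ᵥ embF h t = embF h (B *ᵥ t)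
  toSOr : (spincrToSOr n r G : Matrix (Fin r) (Fin r) ℝ) = B
  toU : (spincrToU n r G : ℂ) * A.det = 1
  fix : spincrRep n r G *ᵥ φ = φ

variable {h : 2 * m + r = n} {ε : Fin m → ℤˣ} {φ : TwSpinor r n}

theorem IsLift.one : IsLift h ε φ 1 1 1 where
  onD z := by simp
  onF t := by simp
  toSOr := by simp
  toU := by simp
  fix := by simp

theorem IsLift.mul {A A' : Matrix (Fin m) (Fin m) ℂ} {B B' : Matrix (Fin r) (Fin r) ℝ}
    {G G' : Spincr n r} (hG : IsLift h ε φ A B G) (hG' : IsLift h ε φ A' B' G') :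
    IsLift h ε φ (A * A') (B * B') (G * G') where
  onD z := by
    rw [map_mul, Submonoid.coe_mul, ← mulVec_mulVec, hG'.onD, hG.onD, mulVec_mulVec]
  onF t := by
    rw [map_mul, Submonoid.coe_mul, ← mulVec_mulVec, hG'.onF, hG.onF, mulVec_mulVec]
  toSOr := by rw [map_mul, Submonoid.coe_mul, hG.toSOr, hG'.toSOr]
  toU := by
    rw [map_mul, det_mul, Circle.coe_mul]
    linear_combination (spincrToU n r G' * A'.det) * hG.toU + hG'.toU
  fix := by rw [map_mul, ← mulVec_mulVec, hG'.fix, hG.fix]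

/-- Take the product `xy` simultaneously in `Spin(n)` and in `Spin(r)`, with scalar `1`. By
`cliff_embF` the first acts on `φ` as `yx` on `Δ_r`, which the second undoes. -/
theorem isLift_rotation (hφ : IsModelSpinor h ε φ) (x y : Fin r → ℝ) (hx : x ⬝ᵥ x = 1)
    (hy : y ⬝ᵥ y = 1) : ∃ G, IsLift h ε φ 1 (halfTurn x * halfTurn y) G := by
  have hx' : embF h x ⬝ᵥ embF h x = 1 := by rw [embF_dot_embF, hx]
  have hy' : embF h y ⬝ᵥ embF h y = 1 := by rw [embF_dot_embF, hy]
  refine ⟨mkSpincr (spinMul _ _ hx' hy') (spinMul x y hx hy) 1, ?_, ?_, ?_, ?_, ?_⟩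
  · intro z
    rw [spincrToSOn_mk, lam_spinMul, ← mulVec_mulVec, halfTurn_mulVec, halfTurn_mulVec,
      embF_dot_embD, dotProduct_sub, dotProduct_smul, embF_dot_embD]
    simp
  · intro t
    rw [spincrToSOn_mk, lam_spinMul, ← mulVec_mulVec, ← mulVec_mulVec]
    have : ∀ x t : Fin r → ℝ, halfTurn (embF h x) *ᵥ embF h t = embF h (halfTurn x *ᵥ t) := by
      intro x t
      rw [halfTurn_mulVec, halfTurn_mulVec, embF_dot_embF, map_sub, map_smul]
    rw [this, this]
  · rw [spincrToSOr_mk, lam_spinMul]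
  · rw [spincrToU_mk]; simp
  · rw [spincrRep_mk_mulVec, kappaSpin_spinMul, kappaSpin_spinMul, actN_mul]
    have e := hφ.cliff_embF x y
    rw [cliff, cliff] at e
    rw [e, ← actR_mul]
    have e2 : gammaVec r x * gammaVec r y * (gammaVec r y * gammaVec r x) = 1 := by
      rw [mul_assoc, ← mul_assoc (gammaVec r y), gammaVec_sq, negSq_apply, hy, map_neg, map_one,
        neg_one_mul, mul_neg, gammaVec_sq, negSq_apply, hx]
      simp
    rw [e2]; simp

/-- Let `μ² = c`. The half-turns about `x` and then `μx` compose to multiplication by `c` on the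
complex line of `x`, and to the identity on its complement. By the vacuum relation the Clifford
product of `μx` and `x` acts on `φ` as `-μ`. -/
theorem isLift_reflMat (hφ : IsVacuum h ε φ) (x : Fin m → ℂ) (c : ℂ) (hx : star x ⬝ᵥ x = 1)
    (hc : star c * c = 1) : ∃ G, IsLift h ε φ (reflMat x c) 1 G := by
  obtain ⟨μ, hμ⟩ := IsAlgClosed.exists_pow_nat_eq c (n := 2) (by norm_num)
  have hcn : ‖c‖ = 1 := by
    have : ‖c‖ * ‖c‖ = 1 := by
      have := congrArg norm hc
      simpa using this
    nlinarith [norm_nonneg c]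
  have hμn : ‖μ‖ = 1 := by
    have : ‖μ‖ ^ 2 = 1 := by rw [← norm_pow, hμ, hcn]
    nlinarith [norm_nonneg μ]
  have hμ1 : (starRingEnd ℂ) μ * μ = 1 := by
    rw [mul_comm, Complex.mul_conj, Complex.normSq_eq_norm_sq, hμn]; simp
  have hv : embD h ε x ⬝ᵥ embD h ε x = 1 := by rw [embD_dot_embD, hx]; simp
  have hw : embD h ε (μ • x) ⬝ᵥ embD h ε (μ • x) = 1 := by
    rw [embD_dot_embD, star_smul, smul_dotProduct, dotProduct_smul, hx]
    simp [hμ1]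
  -- The scalar `-μ̄` cancels the factor `-μ` on `φ`, and its square is `c̄ = c⁻¹`, the inverse of
  -- the determinant of the reflection.
  let ζ : Circle := ⟨-(starRingEnd ℂ) μ, by
    rw [Submonoid.unitSphere, Submonoid.mem_mk]; simp [hμn]⟩
  have hζ : (ζ : ℂ) = -(starRingEnd ℂ) μ := rfl
  have hre : ∀ (u : ℝ) (z : Fin m → ℂ), u • embD h ε z = embD h ε ((u : ℂ) • z) := by
    intro u z
    rw [← map_smul]
    congr 1
  refine ⟨mkSpincr (spinMul _ _ hw hv) 1 ζ, ?_, ?_, ?_, ?_, ?_⟩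
  · intro z
    rw [spincrToSOn_mk, lam_spinMul, ← mulVec_mulVec, reflMat_mulVec]
    have hT : ∀ x z : Fin m → ℂ, halfTurn (embD h ε x) *ᵥ embD h ε z
        = embD h ε (((star x ⬝ᵥ z) + (starRingEnd ℂ) (star x ⬝ᵥ z)) • x - z) := by
      intro x z
      rw [halfTurn_mulVec, embD_dot_embD, hre, ← map_sub, Complex.add_conj]
    rw [hT, hT]
    congr 1
    rw [dotProduct_sub, dotProduct_smul, star_smul, smul_dotProduct, smul_dotProduct, hx]
    set b := star x ⬝ᵥ z
    simp only [smul_eq_mul, Complex.star_def, mul_one, map_sub, map_mul, map_add,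
      smul_smul, RingHomCompTriple.comp_apply, RingHom.id_apply]
    -- Real parts are written as sums with conjugates. The conjugates of `b` cancel because `μ̄μ =
    -- 1`, and `μ² - 1 = c - 1` remains.
    have e : ((b + (starRingEnd ℂ) b) * (starRingEnd ℂ) μ - (starRingEnd ℂ) μ * b
        + (((starRingEnd ℂ) b + b) * μ - μ * (starRingEnd ℂ) b)) * μ - (b + (starRingEnd ℂ) b)
        = (c - 1) * b := by
      rw [← hμ]; linear_combination (starRingEnd ℂ) b * hμ1
    rw [← e]
    ext i
    simp only [Pi.sub_apply, Pi.smul_apply, Pi.add_apply, smul_eq_mul]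
    ring
  · intro t
    rw [spincrToSOn_mk, lam_spinMul, ← mulVec_mulVec, halfTurn_mulVec, halfTurn_mulVec,
      embD_dot_embF, dotProduct_sub, dotProduct_smul, embD_dot_embF]
    simp
  · rw [spincrToSOr_mk, map_one]; rfl
  · rw [spincrToU_mk, reflMat_det x hx, Circle.coe_pow, hζ, ← hμ]
    linear_combination ((starRingEnd ℂ) μ * μ + 1) * hμ1
  · rw [spincrRep_mk_mulVec, kappaSpin_spinMul, map_one, actR_one, actN_mul]
    change (ζ : ℂ) • cliff (embD h ε (μ • x)) (cliff (embD h ε x) φ) = φ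
    have e1 : embD h ε (μ • x) = μ.re • embD h ε x + μ.im • embD h ε (Complex.I • x) := by
      rw [hre, hre, ← map_add]
      congr 1
      ext i
      simp only [Pi.smul_apply, Pi.add_apply, smul_eq_mul]
      nth_rw 1 [← Complex.re_add_im μ]; ring
    have e2 : cliff (embD h ε (Complex.I • x)) (cliff (embD h ε x) φ) = -Complex.I • φ := by
      rw [cliff_cliff_swap (by rw [dotProduct_comm, embD_dot_I]), hφ.cliff_I, cliff_smul_right,
        cliff_cliff_self, hv]
      simp
    rw [e1, cliff_add, cliff_smul, cliff_smul, cliff_cliff_self, hv, e2, hζ]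
    have : (μ.re • (-1 : ℝ) • φ + μ.im • -Complex.I • φ) = (-μ) • φ := by
      rw [← Complex.coe_smul, ← Complex.coe_smul, ← Complex.coe_smul, smul_smul, smul_smul,
        ← add_smul]
      congr 1
      nth_rw 3 [← Complex.re_add_im μ]; push_cast; ring
    rw [this, smul_smul, neg_mul_neg, hμ1, one_smul]

theorem exists_isLift (hφ : IsModelSpinor h ε φ) {A : Matrix (Fin m) (Fin m) ℂ}
    {B : Matrix (Fin r) (Fin r) ℝ} (hA : Aᴴ * A = 1) (hB : Bᵀ * B = 1) (hdet : B.det = 1) :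
    ∃ G, IsLift h ε φ A B G := by
  have h1 : ∃ G, IsLift h ε φ A 1 G := by
    refine unitary_induction (p := fun A => ∃ G, IsLift h ε φ A 1 G) ⟨1, IsLift.one⟩ ?_ hA
    rintro x c A hx hc ⟨G, hG⟩
    obtain ⟨G', hG'⟩ := isLift_reflMat hφ.vacuum x c hx hc
    exact ⟨G' * G, by simpa using hG'.mul hG⟩
  have h2 : ∃ G, IsLift h ε φ 1 B G := by
    refine specialOrthogonal_induction (p := fun B => ∃ G, IsLift h ε φ 1 B G) ⟨1, IsLift.one⟩ ?_
      hB hdet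
    rintro x y A hx hy ⟨G, hG⟩
    obtain ⟨G', hG'⟩ := isLift_rotation hφ x y hx hy
    exact ⟨G' * G, by simpa using hG'.mul hG⟩
  obtain ⟨G, hG⟩ := h1
  obtain ⟨G', hG'⟩ := h2
  exact ⟨G * G', by simpa using hG.mul hG'⟩

end Lift

/-! ## Projections onto the twisting space -/

section TwistProj

variable {k r : ℕ}

theorem tensorMat_smul (c : Fin k → ℂ) (A : Fin k → Matrix (Fin 2) (Fin 2) ℂ) :
    tensorMat (fun p => c p • A p) = (∏ p, c p) • tensorMat A := by
  ext a b; simp [tensorMat, Finset.prod_mul_distrib]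

theorem tensorMat_mulVec_prod (A : Fin k → Matrix (Fin 2) (Fin 2) ℂ) (v : Fin k → Fin 2 → ℂ) :
    tensorMat A *ᵥ (fun a => ∏ p, v p (a p)) = fun a => ∏ p, (A p *ᵥ v p) (a p) := by
  ext a
  simp only [Matrix.mulVec, dotProduct, tensorMat, Matrix.of_apply]
  rw [Finset.prod_univ_sum]
  simp [Finset.prod_mul_distrib]

theorem sqrt_two_sq : ((√2 : ℝ) : ℂ) * ((√2 : ℝ) : ℂ) = 2 := by
  rw [← Complex.ofReal_mul, Real.mul_self_sqrt (by norm_num)]; simp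

theorem matT_mulVec_uVec (e : ℤˣ) : matT *ᵥ uVec e = (-((e : ℤ) : ℂ)) • uVec e := by
  rcases Int.units_eq_one_or e with rfl | rfl
  all_goals
    ext i
    fin_cases i <;> simp [matT, uVec, Matrix.mulVec, dotProduct] <;> field_simp <;> simp

theorem matG1_mulVec_uVec (e : ℤˣ) :
    matG1 *ᵥ uVec e = (Complex.I * ((e : ℤ) : ℂ)) • (matG2 *ᵥ uVec e) := by
  rcases Int.units_eq_one_or e with rfl | rfl
  all_goals
    ext i
    fin_cases i <;> simp [matG1, matG2, uVec, Matrix.mulVec, dotProduct] <;>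
      field_simp <;> simp

theorem uVec_normalized (e : ℤˣ) : uVec e ⬝ᵥ star (uVec e) = 1 := by
  rcases Int.units_eq_one_or e with rfl | rfl <;>
  · simp [uVec, dotProduct]
    field_simp
    simp [pow_two, sqrt_two_sq]
    norm_num

theorem uVec_complete (a b : Fin 2) :
    ∑ e : ℤˣ, star (uVec e a) * uVec e b = if a = b then 1 else 0 := by
  have h : (Finset.univ : Finset ℤˣ) = {1, -1} := by decide
  rw [h, Finset.sum_pair (by decide)]
  fin_cases a <;> fin_cases b <;> simp [uVec] <;> field_simp <;>
    simp [pow_two, sqrt_two_sq] <;> norm_num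

theorem span_uBasis : Submodule.span ℂ (Set.range (uBasis : (Fin k → ℤˣ) → _)) = ⊤ := by
  rw [eq_top_iff]
  rintro ψ -
  rw [pi_eq_sum_univ' ψ]
  refine Submodule.sum_mem _ fun a _ => Submodule.smul_mem _ _ ?_
  have e : (Pi.single a 1 : (Fin k → Fin 2) → ℂ)
      = ∑ ε : Fin k → ℤˣ, (∏ p, star (uVec (ε p) (a p))) • uBasis ε := by
    ext b
    simp only [Finset.sum_apply, Pi.smul_apply, uBasis, smul_eq_mul, ← Finset.prod_mul_distrib]
    have h := Finset.prod_univ_sum (fun _ : Fin k => (Finset.univ : Finset ℤˣ))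
      (fun p e => star (uVec e (a p)) * uVec e (b p))
    rw [Fintype.piFinset_univ] at h
    rw [← h]
    simp only [uVec_complete]
    by_cases hab : a = b
    · subst hab; simp
    · obtain ⟨p, hp⟩ := Function.ne_iff.mp hab
      rw [Pi.single_eq_of_ne (Ne.symm hab)]
      exact (Finset.prod_eq_zero (Finset.mem_univ p) (by simp [hp])).symm
  rw [e]
  exact Submodule.sum_mem _ fun ε _ => Submodule.smul_mem _ _ (Submodule.subset_span ⟨ε, rfl⟩)

/-- Compute the trace of `γ_i N γ_i` once by anticommuting and once cyclically: since `γ_i² = -1`,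
the results differ by a sign. -/
theorem trace_eq_zero_of_anticomm {i : Fin r} {N : Matrix (SpinIdx r) (SpinIdx r) ℂ}
    (h : gamma r i * N = -(N * gamma r i)) : N.trace = 0 := by
  have h1 : (gamma r i * N * gamma r i).trace = N.trace := by
    rw [h, neg_mul, mul_assoc, gamma_sq]; simp
  have h2 : (gamma r i * N * gamma r i).trace = -N.trace := by
    rw [mul_assoc, Matrix.trace_mul_comm, mul_assoc, gamma_sq]; simp
  exact self_eq_neg.mp (h1.symm.trans h2)

theorem gamma_comm_pair {i k l : Fin r} (hk : i ≠ k) (hl : i ≠ l) :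
    gamma r i * (gamma r k * gamma r l) = gamma r k * gamma r l * gamma r i := by
  rw [← mul_assoc, gamma_anticomm hk, neg_mul, mul_assoc, gamma_anticomm hl]
  simp [mul_assoc]

/-- A projection onto a subspace of `Σ_r` on which the products of two or four gamma matrices
have trace zero. -/
structure IsTwistProj (P : Matrix (SpinIdx r) (SpinIdx r) ℂ) : Prop where
  herm : Pᴴ = P
  idem : P * P = P
  ne_zero : P ≠ 0
  comm : ∀ k l, P * (gamma r k * gamma r l) = gamma r k * gamma r l * P
  trace_two : ∀ k l, k ≠ l → (gamma r k * gamma r l * P).trace = 0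
  trace_four : ∀ k l i j : Fin r, k ≠ l → k ≠ i → k ≠ j → l ≠ i → l ≠ j → i ≠ j →
    (gamma r k * gamma r l * (gamma r i * gamma r j) * P).trace = 0
  mem : ∀ ψ, P *ᵥ ψ ∈ sigmaSpace r

theorem trace_gamma_two {k l : Fin r} (hkl : k ≠ l) : (gamma r k * gamma r l).trace = 0 :=
  trace_eq_zero_of_anticomm (i := k) (by
    rw [mul_assoc (gamma r k) (gamma r l), gamma_anticomm hkl.symm, mul_neg, neg_neg])

theorem trace_gamma_four {k l i j : Fin r} (hkl : k ≠ l) (hki : k ≠ i) (hkj : k ≠ j) :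
    (gamma r k * gamma r l * (gamma r i * gamma r j)).trace = 0 :=
  trace_eq_zero_of_anticomm (i := k) (by
    have h1 := gamma_comm_pair hki hkj
    have h2 := gamma_anticomm hkl
    have h3 : gamma r k * gamma r l * gamma r k = -(gamma r k * gamma r k * gamma r l) := by
      rw [mul_assoc, gamma_anticomm hkl.symm]; simp [mul_assoc]
    rw [mul_assoc (gamma r k * gamma r l) (gamma r i * gamma r j), ← h1,
      ← mul_assoc (gamma r k * gamma r l) (gamma r k), h3]
    simp [mul_assoc])

/-- The complex volume element of `Cl_r`, `r` even. -/
def omegaMat (r : ℕ) : Matrix (SpinIdx r) (SpinIdx r) ℂ := tensorMat fun _ => matT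

theorem omegaMat_sq (r : ℕ) : omegaMat r * omegaMat r = 1 := by
  rw [omegaMat, tensorMat_mul]; simp only [matT_sq]; exact tensorMat_one

theorem omegaMat_anticomm (hr : Even r) (i : Fin r) :
    gamma r i * omegaMat r = -(omegaMat r * gamma r i) := by
  have hi : i.val / 2 < r / 2 := by obtain ⟨c, hc⟩ := hr; omega
  simp only [gamma, omegaMat, if_pos hi, one_smul, tensorMat_mul]
  apply tensorMat_neg _ _ ⟨i.val / 2, hi⟩
  · simp only [gammaFactor, lt_irrefl, if_false, if_true]
    split_ifs
    · exact matG1_mul_matT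
    · exact matG2_mul_matT
  · intro p hp
    have hp' : (p : ℕ) ≠ i.val / 2 := fun h' => hp (Fin.ext h')
    simp only [gammaFactor]
    split_ifs <;> simp

theorem omegaMat_mulVec_uBasis (ε : Fin (r / 2) → ℤˣ) :
    omegaMat r *ᵥ uBasis ε = ((-1) ^ (r / 2) * (((∏ p, ε p : ℤˣ) : ℤ) : ℂ)) • uBasis ε := by
  unfold uBasis omegaMat
  rw [tensorMat_mulVec_prod]
  ext a
  simp only [matT_mulVec_uVec, Pi.smul_apply, smul_eq_mul, Finset.prod_mul_distrib,
    Units.coe_prod, Int.cast_prod, Finset.prod_neg, Finset.card_univ, Fintype.card_fin]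

theorem isTwistProj_one (h : Odd r ∨ r = 2 ∨ r = 4) :
    IsTwistProj (1 : Matrix (SpinIdx r) (SpinIdx r) ℂ) where
  herm := by simp
  idem := by simp
  ne_zero := one_ne_zero
  comm := by simp
  trace_two k l hkl := by rw [mul_one, trace_gamma_two hkl]
  trace_four k l i j hkl hki hkj _ _ _ := by rw [mul_one, trace_gamma_four hkl hki hkj]
  mem ψ := by rw [sigmaSpace, if_pos h]; exact Submodule.mem_top

theorem exists_notMem_of_card_lt (s : Finset (Fin r)) (hs : s.card < r) : ∃ i, i ∉ s := by
  by_contra hcon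
  push Not at hcon
  have : s = Finset.univ := Finset.eq_univ_iff_forall.mpr hcon
  rw [this, Finset.card_univ, Fintype.card_fin] at hs
  exact lt_irrefl _ hs

/-- This is the projection onto `Δ_r⁺`, which is an eigenspace of the volume element. The trace of a
product of gammas with the volume element vanishes as soon as one index does not occur in the
product; `r = 2` and `r = 4` are the cases where none may be left. -/
theorem isTwistProj_half (h : ¬ (Odd r ∨ r = 2 ∨ r = 4)) :
    IsTwistProj ((1 / 2 : ℂ) • (1 + ((-1 : ℂ) ^ (r / 2)) • omegaMat r)) := by
  push Not at h
  obtain ⟨h1, h2, h4⟩ := h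
  have hr : Even r := Nat.not_odd_iff_even.mp h1
  have hsq : ((-1 : ℂ) ^ (r / 2)) * ((-1 : ℂ) ^ (r / 2)) = 1 := by
    rw [← mul_pow]; simp
  have hcomm : ∀ k l, omegaMat r * (gamma r k * gamma r l)
      = gamma r k * gamma r l * omegaMat r := fun k l => by
    have A : ∀ i, omegaMat r * gamma r i = -(gamma r i * omegaMat r) := fun i => by
      rw [omegaMat_anticomm hr, neg_neg]
    rw [← mul_assoc, A, neg_mul, mul_assoc, A, mul_neg, neg_neg, mul_assoc]
  have hu : ∀ ε : Fin (r / 2) → ℤˣ, ((1 / 2 : ℂ) • (1 + ((-1 : ℂ) ^ (r / 2)) • omegaMat r))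
      *ᵥ uBasis ε = ((1 / 2) * (1 + (((∏ p, ε p : ℤˣ) : ℤ) : ℂ))) • uBasis ε := fun ε => by
    rw [Matrix.smul_mulVec, Matrix.add_mulVec, Matrix.one_mulVec, Matrix.smul_mulVec,
      omegaMat_mulVec_uBasis, smul_smul, ← mul_assoc, hsq, one_mul, mul_smul, add_smul, one_smul]
  have htr : ∀ N : Matrix (SpinIdx r) (SpinIdx r) ℂ, N.trace = 0 → (N * omegaMat r).trace = 0 →
      (N * ((1 / 2 : ℂ) • (1 + ((-1 : ℂ) ^ (r / 2)) • omegaMat r))).trace = 0 := fun N e1 e2 => by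
    rw [mul_smul_comm, mul_add, mul_one, mul_smul_comm, Matrix.trace_smul, Matrix.trace_add,
      Matrix.trace_smul, e1, e2]; simp
  have hω : (omegaMat r)ᴴ = omegaMat r := by
    simp only [omegaMat, tensorMat_conjTranspose, matT_conjTranspose]
  refine ⟨?_, ?_, ?_, ?_, ?_, ?_, ?_⟩
  · simp only [Matrix.conjTranspose_smul, Matrix.conjTranspose_add, Matrix.conjTranspose_one, hω]
    simp
  · simp only [smul_mul_smul_comm, add_mul, mul_add, one_mul, mul_one, omegaMat_sq, hsq]
    module
  -- The basis vector with all signs `+1` is fixed by the projection.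
  · intro h0
    have := hu fun _ => 1
    rw [h0] at this
    have h3 := congrFun this 0
    have h5 : (∏ _p : Fin (r / 2), uVec 1 0) ≠ 0 := by
      rw [Finset.prod_ne_zero_iff]; intro _ _; simp [uVec]
    simp [uBasis] at h3
    simp [uVec] at h3
  · intro k l
    simp only [smul_mul_assoc, mul_smul_comm, add_mul, mul_add, one_mul, mul_one, hcomm]
  · intro k l hkl
    refine htr _ (trace_gamma_two hkl) ?_
    -- Two distinct indices give `r ≥ 2`, and `r = 2` is excluded, so a third index exists.
    have hr2 : 2 < r := by
      have := k.isLt; have := l.isLt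
      have : k.val ≠ l.val := fun e => hkl (Fin.ext e)
      omega
    obtain ⟨i, hi⟩ := exists_notMem_of_card_lt {k, l} (lt_of_le_of_lt Finset.card_le_two hr2)
    simp only [Finset.mem_insert, Finset.mem_singleton, not_or] at hi
    apply trace_eq_zero_of_anticomm (i := i)
    rw [← mul_assoc, gamma_comm_pair hi.1 hi.2, mul_assoc, omegaMat_anticomm hr]
    simp [mul_assoc]
  · intro k l i j hkl hki hkj hli hlj hij
    refine htr _ (trace_gamma_four hkl hki hkj) ?_
    -- Likewise, four distinct indices and `r ≠ 4` leave a fifth index.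
    have hr2 : 4 < r := by
      have hc : ({k, l, i, j} : Finset (Fin r)).card = 4 := by
        rw [Finset.card_insert_of_notMem (by simp [hkl, hki, hkj]),
          Finset.card_insert_of_notMem (by simp [hli, hlj]), Finset.card_pair hij]
      have := Finset.card_le_univ ({k, l, i, j} : Finset (Fin r))
      rw [hc, Fintype.card_fin] at this
      omega
    obtain ⟨q, hq⟩ := exists_notMem_of_card_lt {k, l, i, j} (lt_of_le_of_lt Finset.card_le_four hr2)
    simp only [Finset.mem_insert, Finset.mem_singleton, not_or] at hq
    apply trace_eq_zero_of_anticomm (i := q)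
    rw [← mul_assoc, ← mul_assoc, gamma_comm_pair hq.1 hq.2.1, mul_assoc _ (gamma r q),
      gamma_comm_pair hq.2.2.1 hq.2.2.2, mul_assoc, mul_assoc, mul_assoc, mul_assoc,
      omegaMat_anticomm hr]
    simp [mul_assoc]
  · intro ψ
    have hψ : ψ ∈ Submodule.span ℂ (Set.range (uBasis : (Fin (r / 2) → ℤˣ) → _)) :=
      span_uBasis ▸ Submodule.mem_top
    rw [sigmaSpace, if_neg (by push Not; exact ⟨h1, h2, h4⟩)]
    induction hψ using Submodule.span_induction with
    | mem x hx =>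
      obtain ⟨ε, rfl⟩ := hx
      rw [hu]
      rcases Int.units_eq_one_or (∏ p, ε p) with he | he
      · exact Submodule.smul_mem _ _ (Submodule.subset_span ⟨ε, he, rfl⟩)
      · rw [he]; simp
    | zero => rw [Matrix.mulVec_zero]; exact zero_mem _
    | add x y _ _ hx hy => rw [Matrix.mulVec_add]; exact add_mem hx hy
    | smul c x _ hx => rw [Matrix.mulVec_smul]; exact Submodule.smul_mem _ _ hx

theorem exists_isTwistProj (r : ℕ) : ∃ P : Matrix (SpinIdx r) (SpinIdx r) ℂ, IsTwistProj P := by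
  by_cases h : Odd r ∨ r = 2 ∨ r = 4
  · exact ⟨1, isTwistProj_one h⟩
  · exact ⟨_, isTwistProj_half h⟩

/-! ### The charge conjugation matrix -/

/-- Accumulates the signs over the tensor positions for a gamma whose distinguished position is `q`.
The case `q ≥ k` covers the last gamma in odd dimension, which has only `T`s. -/
theorem prod_sign (c : ℂ) (q k : ℕ) : ∏ p ∈ Finset.range k,
    (if p < q then (-1 : ℂ) else if p = q then c else 1)
      = if q < k then (-1) ^ q * c else (-1) ^ k := by
  induction k with
  | zero => simp
  | succ k ih =>
    rw [Finset.prod_range_succ, ih]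
    rcases lt_trichotomy q k with h | h | h
    · simp [h, h.ne', Nat.lt_succ_of_lt h, Nat.not_lt.mpr h.le]
    · subst h; simp
    · simp [h, Nat.not_lt.mpr h.le, Nat.not_lt.mpr (Nat.succ_le_of_lt h), pow_succ]

/-- The matrix intertwining the gamma matrices with their transposes. -/
def chargeMat (r : ℕ) : Matrix (SpinIdx r) (SpinIdx r) ℂ :=
  tensorMat fun p : Fin (r / 2) => matT ^ (p.val + r / 2)

theorem tensorMat_transpose (A : Fin k → Matrix (Fin 2) (Fin 2) ℂ) :
    (tensorMat A)ᵀ = tensorMat fun p => (A p)ᵀ := by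
  ext a b; simp [tensorMat]

theorem matT_transpose : matTᵀ = -matT := by
  ext i j; fin_cases i <;> fin_cases j <;> simp [matT]
theorem matG1_transpose : matG1ᵀ = matG1 := by
  ext i j; fin_cases i <;> fin_cases j <;> simp [matG1]
theorem matG2_transpose : matG2ᵀ = matG2 := by
  ext i j; fin_cases i <;> fin_cases j <;> simp [matG2]

theorem matT_pow_mul {G : Matrix (Fin 2) (Fin 2) ℂ} (hG : G * matT = -(matT * G)) (e : ℕ) :
    matT ^ e * G = ((-1 : ℂ) ^ e) • (G * matT ^ e) := by
  induction e with
  | zero => simp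
  | succ e ih =>
    have hG' : matT * G = -(G * matT) := by rw [hG, neg_neg]
    rw [pow_succ, mul_assoc, hG', mul_neg, ← mul_assoc, ih, pow_succ]
    simp [mul_assoc]

/-- Transposition changes the sign of each `T` in the tail, and the distinguished factor passes `T ^
(q + r/2)`, giving `(-1)^(q + r/2)`. Together with the `q` signs of the tail this is `(-1)^(r/2)`,
independent of the gamma; the exponent in `chargeMat` is chosen so that the last gamma for odd `r`
has this sign too. -/
theorem chargeMat_mul_gamma (i : Fin r) :
    chargeMat r * (gamma r i)ᵀ = ((-1 : ℂ) ^ (r / 2)) • (gamma r i * chargeMat r) := by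
  rw [gamma, Matrix.transpose_smul, tensorMat_transpose, chargeMat, mul_smul_comm, smul_mul_assoc,
    tensorMat_mul, tensorMat_mul, smul_comm]
  congr 1
  have hs : (-1 : ℂ) ^ (r / 2) = ∏ p : Fin (r / 2), (if p.val < i.val / 2 then (-1 : ℂ) else
      if p.val = i.val / 2 then (-1) ^ (i.val / 2 + r / 2) else 1) := by
    rw [Fin.prod_univ_eq_prod_range (fun p => if p < i.val / 2 then (-1 : ℂ) else
      if p = i.val / 2 then (-1) ^ (i.val / 2 + r / 2) else 1), prod_sign]
    split_ifs
    · rw [← pow_add, ← add_assoc, pow_add, ← two_mul, pow_mul]; simp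
    · rfl
  rw [hs, ← tensorMat_smul]
  congr 1
  funext p
  simp only [gammaFactor]
  by_cases h1 : p.val < i.val / 2
  · simp only [if_pos h1, matT_transpose]
    rw [mul_neg, neg_one_smul, ← pow_succ, ← pow_succ']
  · by_cases h2 : p.val = i.val / 2
    · simp only [h2, lt_irrefl, if_false, if_true]
      split_ifs
      · rw [matG1_transpose, matT_pow_mul matG1_mul_matT]
      · rw [matG2_transpose, matT_pow_mul matG2_mul_matT]
    · simp [h1, h2]

theorem chargeMat_unitary (r : ℕ) : chargeMat r * (chargeMat r)ᴴ = 1 := by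
  rw [chargeMat, tensorMat_conjTranspose, tensorMat_mul, ← tensorMat_one]
  congr 1
  funext p
  rw [Matrix.conjTranspose_pow, matT_conjTranspose, ← (Commute.refl matT).mul_pow, matT_sq, one_pow]

end TwistProj

/-! ## Existence of model spinors -/

section Join

variable {n m r : ℕ}

/-- The splitting of the tensor factors of `Δ_n`, `n = 2m + r`, into `m` factors and those of
`Δ_r`. -/
def factorEquiv (h : 2 * m + r = n) : Fin m ⊕ Fin (r / 2) ≃ Fin (n / 2) :=
  finSumFinEquiv.trans (finCongr (by omega))

theorem factorEquiv_inl (h : 2 * m + r = n) (s : Fin m) :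
    (factorEquiv h (Sum.inl s)).val = s := rfl
theorem factorEquiv_inr (h : 2 * m + r = n) (p : Fin (r / 2)) :
    (factorEquiv h (Sum.inr p)).val = m + p := rfl

/-- The twisted spinor `v_1 ⊗ ⋯ ⊗ v_m ⊗ X`, with `X ∈ Δ_r ⊗ Δ_r` regarded as a matrix. -/
def joinSpinor (h : 2 * m + r = n) (v : Fin m → Fin 2 → ℂ)
    (X : Matrix (SpinIdx r) (SpinIdx r) ℂ) : TwSpinor r n := fun ab =>
  (∏ s, v s (ab.2 (factorEquiv h (Sum.inl s)))) * X ab.1 fun p => ab.2 (factorEquiv h (Sum.inr p))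

variable (h : 2 * m + r = n) (v : Fin m → Fin 2 → ℂ)

theorem sum_spinIdx_split (f : (Fin m → Fin 2) → SpinIdx r → ℂ) :
    ∑ b : SpinIdx n, f (fun s => b (factorEquiv h (Sum.inl s)))
        (fun p => b (factorEquiv h (Sum.inr p)))
      = ∑ x, ∑ y, f x y := by
  rw [← Fintype.sum_prod_type']
  refine Fintype.sum_equiv ((Equiv.arrowCongr (factorEquiv h).symm (Equiv.refl _)).trans
    (Equiv.sumArrowEquivProdArrow _ _ _)) _ _ fun b => rfl

/-- The first `m` factors act on the vectors `v_s`; the others act on the second factor of `Δ_r ⊗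
Δ_r`, which for a matrix is right multiplication by the transpose. -/
theorem actN_tensorMat_joinSpinor (B : Fin (n / 2) → Matrix (Fin 2) (Fin 2) ℂ)
    (X : Matrix (SpinIdx r) (SpinIdx r) ℂ) :
    actN (tensorMat B) (joinSpinor h v X)
      = joinSpinor h (fun s => B (factorEquiv h (Sum.inl s)) *ᵥ v s)
        (X * (tensorMat fun p => B (factorEquiv h (Sum.inr p)))ᵀ) := by
  ext ⟨a, b⟩
  have e1 : actN (tensorMat B) (joinSpinor h v X) (a, b)
      = ∑ b', tensorMat B b b' * joinSpinor h v X (a, b') := by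
    simp [actN, Matrix.mulVec, dotProduct, Fintype.sum_prod_type, Matrix.kroneckerMap_apply,
      Matrix.one_apply, ite_mul]
  let f : (Fin m → Fin 2) → SpinIdx r → ℂ := fun x y =>
    (∏ s, B (factorEquiv h (Sum.inl s)) (b (factorEquiv h (Sum.inl s))) (x s) * v s (x s))
      * (X a y * ∏ p, B (factorEquiv h (Sum.inr p)) (b (factorEquiv h (Sum.inr p))) (y p))
  have e2 : ∀ b', tensorMat B b b' * joinSpinor h v X (a, b')
      = f (fun s => b' (factorEquiv h (Sum.inl s)))
          (fun p => b' (factorEquiv h (Sum.inr p))) := by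
    intro b'
    simp only [tensorMat, Matrix.of_apply, joinSpinor, f]
    rw [← Equiv.prod_comp (factorEquiv h), Fintype.prod_sum_type, Finset.prod_mul_distrib]
    ring
  refine (e1.trans ((Finset.sum_congr rfl fun b' _ => e2 b').trans
    (sum_spinIdx_split h f))).trans ?_
  simp only [f]
  rw [← Finset.sum_mul_sum]
  simp only [joinSpinor, Matrix.mulVec, dotProduct, Matrix.mul_apply, Matrix.transpose_apply,
    tensorMat, Matrix.of_apply]
  congr 1
  rw [Finset.prod_univ_sum, Fintype.piFinset_univ]

theorem actR_joinSpinor (C X : Matrix (SpinIdx r) (SpinIdx r) ℂ) :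
    actR C (joinSpinor h v X) = joinSpinor h v (C * X) := by
  ext ⟨a, b⟩
  simp [actR, Matrix.mulVec, dotProduct, Fintype.sum_prod_type, Matrix.kroneckerMap_apply,
    Matrix.one_apply, joinSpinor, Matrix.mul_apply, Finset.mul_sum, mul_left_comm]

theorem joinSpinor_smul (c : ℂ) (X : Matrix (SpinIdx r) (SpinIdx r) ℂ) :
    joinSpinor h v (c • X) = c • joinSpinor h v X := by
  ext ⟨a, b⟩; simp [joinSpinor, mul_left_comm]

theorem joinSpinor_smul_left (c : Fin m → ℂ) (X : Matrix (SpinIdx r) (SpinIdx r) ℂ) :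
    joinSpinor h (fun s => c s • v s) X = (∏ s, c s) • joinSpinor h v X := by
  ext ⟨a, b⟩; simp [joinSpinor, Finset.prod_mul_distrib, mul_assoc]

/-- Unit vectors `v_s` contribute `1`, so only the Frobenius product of the matrices is left.
Expectation values in the model spinor become traces. -/
theorem herm_joinSpinor (hv : ∀ s, v s ⬝ᵥ star (v s) = 1)
    (X Y : Matrix (SpinIdx r) (SpinIdx r) ℂ) :
    herm (joinSpinor h v X) (joinSpinor h v Y) = (X * Yᴴ).trace := by
  rw [herm, dotProduct, Fintype.sum_prod_type, Matrix.trace]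
  refine Finset.sum_congr rfl fun a _ => ?_
  let f : (Fin m → Fin 2) → SpinIdx r → ℂ := fun x y =>
    (∏ s, v s (x s) * star (v s) (x s)) * (X a y * star (Y a y))
  have e : ∀ b : SpinIdx n, joinSpinor h v X (a, b) * star (joinSpinor h v Y) (a, b)
      = f (fun s => b (factorEquiv h (Sum.inl s)))
          (fun p => b (factorEquiv h (Sum.inr p))) := by
    intro b
    simp only [f, joinSpinor, Pi.star_apply, star_mul', Finset.prod_mul_distrib, star_prod]
    ring
  refine ((Finset.sum_congr rfl fun b _ => e b).trans (sum_spinIdx_split h f)).trans ?_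
  simp only [f]
  rw [← Finset.sum_mul_sum]
  have h1 := Finset.prod_univ_sum (fun _ : Fin m => (Finset.univ : Finset (Fin 2)))
    (fun s x => v s x * star (v s) x)
  rw [Fintype.piFinset_univ] at h1
  rw [← h1]
  have h2 : ∀ s, ∑ x, v s x * star (v s) x = 1 := hv
  rw [Finset.prod_congr rfl fun s _ => h2 s]
  simp [Matrix.mul_apply, Matrix.conjTranspose_apply]

variable (ε : Fin m → ℤˣ)

/-- In the first `m` positions a normal gamma has factors `T`, which act on `u_ε` by `-ε`; in the
others it is the gamma of `ℝʳ`. -/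
theorem actN_gamma_ixF (k : Fin r) (X : Matrix (SpinIdx r) (SpinIdx r) ℂ) :
    actN (gamma n (ixF h k)) (joinSpinor h (fun s => uVec (ε s)) X)
      = (∏ s, -((ε s : ℤ) : ℂ)) • joinSpinor h (fun s => uVec (ε s)) (X * (gamma r k)ᵀ) := by
  have hv : (ixF h k).val = 2 * m + k := rfl
  have h1 : (2 * m + k.val) / 2 = m + k / 2 := by omega
  have h2 : (2 * m + k.val) % 2 = k % 2 := by omega
  have h3 : (m + k.val / 2 < n / 2) ↔ k.val / 2 < r / 2 := by omega
  rw [gamma, gamma, actN_smul, actN_tensorMat_joinSpinor, Matrix.transpose_smul, mul_smul_comm,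
    joinSpinor_smul, smul_comm, ← joinSpinor_smul_left]
  simp only [hv, h1, h3]
  congr 2
  · funext s
    have : s.val < m + k / 2 := by omega
    simp only [gammaFactor, factorEquiv_inl, h1, this, if_true, matT_mulVec_uVec]
  · congr 3
    funext p
    simp only [gammaFactor, factorEquiv_inr, h1, h2, add_lt_add_iff_left, add_right_inj]

/-- The vacuum relation on one complex coordinate line. It rests on `g₁ u_ε = iε g₂ u_ε` in position
`s`. -/
theorem actN_gamma_even (s : Fin m) (X : Matrix (SpinIdx r) (SpinIdx r) ℂ) :
    actN (gamma n (splitEquiv h (Sum.inl s))) (joinSpinor h (fun s => uVec (ε s)) X)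
      = (Complex.I * ((ε s : ℤ) : ℂ)) •
        actN (gamma n (splitEquiv h (Sum.inr (Sum.inl s))))
          (joinSpinor h (fun s => uVec (ε s)) X) := by
  have hv : (splitEquiv h (Sum.inl s)).val = 2 * s := rfl
  have hv' : (splitEquiv h (Sum.inr (Sum.inl s))).val = 2 * s + 1 := rfl
  have h1 : 2 * s.val / 2 = s := by omega
  have h2 : (2 * s.val + 1) / 2 = s := by omega
  have h3 : s.val < n / 2 := by omega
  have h5 : ¬ (2 * s.val + 1) % 2 = 0 := by omega
  have h6 : 2 * s.val % 2 = 0 := by omega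
  simp only [gamma, hv, hv', h1, h2, if_pos h3, one_smul]
  rw [actN_tensorMat_joinSpinor, actN_tensorMat_joinSpinor]
  have e : (Complex.I * ((ε s : ℤ) : ℂ))
      = ∏ t : Fin m, if t = s then (Complex.I * ((ε s : ℤ) : ℂ)) else 1 := by
    rw [Finset.prod_ite_eq']; simp
  rw [e, ← joinSpinor_smul_left]
  congr 1
  · funext t
    simp only [gammaFactor, factorEquiv_inl, h1, h2, h5, h6, if_true, if_false]
    by_cases hts : t = s
    · subst hts
      simp only [if_true, lt_irrefl, if_false, matG1_mulVec_uVec]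
    · have : t.val ≠ s.val := fun e => hts (Fin.ext e)
      simp [hts, this]
  · congr 3
    funext p
    have h7 : ¬ (m + p.val < s.val) := by omega
    have h8 : ¬ (m + p.val = s.val) := by omega
    simp only [gammaFactor, factorEquiv_inr, h1, h2, h7, h8, if_false]

theorem cliff_embD (φ : TwSpinor r n) (z : Fin m → ℂ) : cliff (embD h ε z) φ
    = ∑ s, ((z s).re • actN (gamma n (splitEquiv h (Sum.inl s))) φ
      + (((ε s : ℤ) : ℝ) * (z s).im) • actN (gamma n (splitEquiv h (Sum.inr (Sum.inl s)))) φ) := by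
  rw [cliff_eq_sum, ← Equiv.sum_comp (splitEquiv h), Fintype.sum_sum_type, Fintype.sum_sum_type,
    Finset.sum_add_distrib, ← add_assoc]
  simp only [embD_inl, embD_inr_inl]
  rw [add_eq_left]
  refine Finset.sum_eq_zero fun k _ => ?_
  change embD h ε z (ixF h k) • _ = _
  rw [embD_ixF, zero_smul]

theorem isVacuum_joinSpinor (X : Matrix (SpinIdx r) (SpinIdx r) ℂ) :
    IsVacuum h ε (joinSpinor h (fun s => uVec (ε s)) X) := by
  intro z
  rw [cliff_embD, cliff_embD, Finset.smul_sum]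
  refine Finset.sum_congr rfl fun s _ => ?_
  rw [actN_gamma_even]
  generalize actN _ _ = ψ
  ext i
  have hε : ((ε s : ℤ) : ℂ) * ((ε s : ℤ) : ℂ) = 1 := by exact_mod_cast unit_sq_cast (ε s)
  simp only [Pi.add_apply, Pi.smul_apply, smul_eq_mul, Complex.real_smul, Complex.mul_re,
    Complex.mul_im, Complex.I_re, Complex.I_im]
  push_cast
  linear_combination (-((ε s : ℤ) : ℂ) * (z s).re * ψ i - (z s).im * ψ i * ((ε s : ℤ) : ℂ)
    * Complex.I + (z s).re * ψ i * ((ε s : ℤ) : ℂ) +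
      Complex.I * (z s).im * ((ε s : ℤ) : ℂ) * ψ i) * hε
    + ((ε s : ℤ) : ℂ) * ψ i * (z s).im * Complex.I_mul_I

/-- The spinor is `u_ε ⊗ X` with `X = P C`, where `P` is a twisting projection and `C` the charge
conjugation matrix, followed by normalisation. Since `C` intertwines the gammas with their
transposes, up to a sign that disappears in pairs, right multiplication by two transposed gammas
becomes left multiplication by their reversed product; this is `twist`. As `X Xᴴ = P`, the
expectation values are traces against `P` and vanish by the choice of `P`. -/
theorem exists_isModelSpinor : ∃ φ : TwSpinor r n, IsModelSpinor h ε φ := by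
  obtain ⟨P, hP⟩ := exists_isTwistProj r
  set u : Fin m → Fin 2 → ℂ := fun s => uVec (ε s) with hu
  have hun : ∀ s, u s ⬝ᵥ star (u s) = 1 := fun s => uVec_normalized _
  set X := P * chargeMat r with hX
  have hXX : X * Xᴴ = P := by
    rw [hX, Matrix.conjTranspose_mul, mul_assoc, ← mul_assoc (chargeMat r), chargeMat_unitary,
      one_mul, hP.herm, hP.idem]
  have hX0 : X ≠ 0 := fun e => hP.ne_zero (by rw [← hXX, e, zero_mul])
  have hherm : ∀ B, herm (actR B (joinSpinor h u X)) (joinSpinor h u X) = (B * P).trace :=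
    fun B => by rw [actR_joinSpinor, herm_joinSpinor h u hun, mul_assoc, hXX]
  obtain ⟨ρ, hρ⟩ : ∃ ρ : ℝ, herm (joinSpinor h u X) (joinSpinor h u X) = (ρ : ℂ) ∧ 0 < ρ := by
    refine ⟨_, herm_self _, ?_⟩
    refine lt_of_le_of_ne (Finset.sum_nonneg fun _ _ => by positivity) fun e => ?_
    have h1 : herm (joinSpinor h u X) (joinSpinor h u X) = 0 := by rw [herm_self, ← e]; simp
    rw [herm_joinSpinor h u hun] at h1
    exact hX0 (by
      open scoped ComplexOrder in
      exact Matrix.trace_mul_conjTranspose_self_eq_zero_iff.mp h1)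
  obtain ⟨hρ, hρ0⟩ := hρ
  set c : ℝ := (√ρ)⁻¹ with hc
  have hcc : c * c * ρ = 1 := by
    rw [hc, ← mul_inv, Real.mul_self_sqrt hρ0.le]; field_simp
  have hherm' : ∀ B, herm (actR B ((c : ℂ) • joinSpinor h u X)) ((c : ℂ) • joinSpinor h u X)
      = (c : ℂ) * ((c : ℂ) * (B * P).trace) := fun B => by
    rw [actR_smul_right, herm_smul_left, herm_smul_right, hherm]; simp
  refine ⟨(c : ℂ) • joinSpinor h u X, ?_, ?_, ?_, ?_, ?_, ?_⟩
  · intro b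
    have e : (fun a => ((c : ℂ) • joinSpinor h u X) (a, b))
        = (c * ∏ s, u s (b (factorEquiv h (Sum.inl s)))) •
          (P *ᵥ fun a => chargeMat r a fun p => b (factorEquiv h (Sum.inr p))) := by
      ext a
      simp [joinSpinor, hX, Matrix.mul_apply, Matrix.mulVec, dotProduct, mul_assoc]
    rw [e]
    exact Submodule.smul_mem _ _ (hP.mem _)
  · rw [herm_smul_left, herm_smul_right, hρ]
    simp only [Complex.star_def, Complex.conj_ofReal]
    rw [← mul_assoc]
    exact_mod_cast hcc
  · intro z
    rw [cliff_smul_right, cliff_smul_right, isVacuum_joinSpinor h ε X z, smul_comm]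
  · intro k l _
    -- The sign which each normal gamma acquires from the `ℂᵐ` factors occurs twice.
    have hσ : (∏ s, -((ε s : ℤ) : ℂ)) * (∏ s, -((ε s : ℤ) : ℂ)) = 1 := by
      rw [← Finset.prod_mul_distrib]
      refine Finset.prod_eq_one fun s _ => ?_
      rw [neg_mul_neg]; exact_mod_cast unit_sq_cast (ε s)
    have hs : ((-1 : ℂ) ^ (r / 2)) * ((-1 : ℂ) ^ (r / 2)) = 1 := by rw [← mul_pow]; simp
    rw [actN_smul_right, actR_smul_right, actN_mul, actN_gamma_ixF, actN_smul_right,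
      actN_gamma_ixF, smul_smul (∏ s, -((ε s : ℤ) : ℂ)), hσ, one_smul, actR_joinSpinor, ← smul_neg]
    congr 1
    have e : X * (gamma r l)ᵀ * (gamma r k)ᵀ = gamma r l * gamma r k * X := by
      calc X * (gamma r l)ᵀ * (gamma r k)ᵀ
          = P * (chargeMat r * (gamma r l)ᵀ) * (gamma r k)ᵀ := by rw [hX]; simp only [mul_assoc]
        _ = ((-1 : ℂ) ^ (r / 2)) • (P * gamma r l * (chargeMat r * (gamma r k)ᵀ)) := by
            rw [chargeMat_mul_gamma]; simp [mul_assoc]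
        _ = P * (gamma r l * gamma r k) * chargeMat r := by
            rw [chargeMat_mul_gamma, mul_smul_comm, smul_smul, hs, one_smul]
            simp only [mul_assoc]
        _ = _ := by rw [hP.comm, hX, mul_assoc]
    rw [e]
    have e2 := joinSpinor_smul h u (-1) (gamma r k * gamma r l * X)
    rw [neg_one_smul, neg_one_smul] at e2
    rw [← e2]
    by_cases hkl : k = l
    · contradiction
    · rw [gamma_anticomm (Ne.symm hkl), neg_mul]
  · intro k l hkl
    rw [hherm', hP.trace_two k l hkl]; simp
  · intro k l i j h1 h2 h3 h4 h5 h6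
    rw [hherm', hP.trace_four k l i j h1 h2 h3 h4 h5 h6]; simp

end Join

/-! ## The Levi-Civita connection -/

set_option linter.unusedSectionVars false

section LeviCivita

variable {n : ℕ} {M : Type u} [TopologicalSpace M] [ChartedSpace (EuclideanSpace ℝ (Fin n)) M]
  [IsManifold (𝓡 n) ∞ M]

/-- Differentiability of a vector field at a point. -/
abbrev DiffFieldAt (X : ∀ x : M, TangentSpace (𝓡 n) x) (x : M) : Prop :=
  MDifferentiableAt (𝓡 n) ((𝓡 n).prod 𝓘(ℝ, EuclideanSpace ℝ (Fin n)))
    (fun y => TotalSpace.mk' (EuclideanSpace ℝ (Fin n)) y (X y)) x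

variable [RiemannianBundle (fun x : M => TangentSpace (𝓡 n) x)]
  [IsContMDiffRiemannianBundle (𝓡 n) ∞ (EuclideanSpace ℝ (Fin n))
    (fun x : M => TangentSpace (𝓡 n) x)]

theorem DiffFieldAt.inner {X Y : ∀ x : M, TangentSpace (𝓡 n) x} {x : M} (hX : DiffFieldAt X x)
    (hY : DiffFieldAt Y x) :
    MDifferentiableAt (𝓡 n) 𝓘(ℝ, ℝ) (fun y => inner ℝ (X y) (Y y)) x :=
  have : IsContMDiffRiemannianBundle (𝓡 n) 1 (EuclideanSpace ℝ (Fin n))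
      (fun x : M => TangentSpace (𝓡 n) x) :=
    IsContMDiffRiemannianBundle.of_le (n := ∞) (by norm_cast)
  MDifferentiableAt.inner_bundle hX hY

/-- The derivatives of `f` coming from the metric terms cancel those coming from the brackets.
Tensoriality in the outer two arguments makes `leviCivita` independent of the extensions used to
define it. -/
theorem koszul_tensorialAt_left {Y Z : ∀ x : M, TangentSpace (𝓡 n) x} {x : M}
    (hY : DiffFieldAt Y x) (hZ : DiffFieldAt Z x) :
    TensorialAt (𝓡 n) (EuclideanSpace ℝ (Fin n)) (fun X => koszul X Y Z x) x where
  smul {f X} hf hX := by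
    have h1 := mvfderiv_mul hf (DiffFieldAt.inner hZ hX)
    have h2 := mvfderiv_mul hf (DiffFieldAt.inner hX hY)
    have e1 : (fun y => inner ℝ (Z y) ((f • X) y)) = f * fun y => inner ℝ (Z y) (X y) := by
      funext y; simp [inner_smul_right]
    have e2 : (fun y => inner ℝ ((f • X) y) (Y y)) = f * fun y => inner ℝ (X y) (Y y) := by
      funext y; simp [inner_smul_left]
    simp only [koszul, e1, e2, h1, h2, VectorField.mlieBracket_smul_left hf hX,
      VectorField.mlieBracket_smul_right hf hX]
    simp [inner_add_left, inner_smul_left, inner_smul_right, real_inner_comm (Z x) (X x)]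
    ring
  add {X X'} hX hX' := by
    have h1 := mvfderiv_add (DiffFieldAt.inner hZ hX) (DiffFieldAt.inner hZ hX')
    have h2 := mvfderiv_add (DiffFieldAt.inner hX hY) (DiffFieldAt.inner hX' hY)
    have e1 : (fun y => inner ℝ (Z y) ((X + X') y))
        = (fun y => inner ℝ (Z y) (X y)) + fun y => inner ℝ (Z y) (X' y) := by
      funext y; simp [inner_add_right]
    have e2 : (fun y => inner ℝ ((X + X') y) (Y y))
        = (fun y => inner ℝ (X y) (Y y)) + fun y => inner ℝ (X' y) (Y y) := by
      funext y; simp [inner_add_left]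
    simp only [koszul, e1, e2, h1, h2, VectorField.mlieBracket_add_left hX hX',
      VectorField.mlieBracket_add_right hX hX']
    simp [inner_add_left, inner_add_right]
    ring

theorem koszul_add_swap_right {X Y Z : ∀ x : M, TangentSpace (𝓡 n) x} {x : M} :
    koszul X Y Z x + koszul X Z Y x
      = mvfderiv (𝓡 n) (fun y => inner ℝ (Y y) (Z y)) x (X x) := by
  have e1 : (fun y => inner ℝ (Z y) (Y y)) = fun y => inner ℝ (Y y) (Z y) :=
    funext fun y => real_inner_comm _ _
  have e2 : (fun y => inner ℝ (X y) (Z y)) = fun y => inner ℝ (Z y) (X y) :=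
    funext fun y => real_inner_comm _ _
  have e3 : (fun y => inner ℝ (X y) (Y y)) = fun y => inner ℝ (Y y) (X y) :=
    funext fun y => real_inner_comm _ _
  simp only [koszul, e1, e2, e3, VectorField.mlieBracket_swap_apply (V := X) (W := Z),
    VectorField.mlieBracket_swap_apply (V := Y) (W := X),
    VectorField.mlieBracket_swap_apply (V := Z) (W := Y)]
  simp only [inner_neg_left]
  ring

theorem koszul_sub_swap_left {X Y Z : ∀ x : M, TangentSpace (𝓡 n) x} {x : M} :
    koszul X Y Z x - koszul Y X Z x
      = inner ℝ (VectorField.mlieBracket (𝓡 n) X Y x) (Z x) := by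
  have e1 : (fun y => inner ℝ (Y y) (X y)) = fun y => inner ℝ (X y) (Y y) :=
    funext fun y => real_inner_comm _ _
  have e2 : (fun y => inner ℝ (X y) (Z y)) = fun y => inner ℝ (Z y) (X y) :=
    funext fun y => real_inner_comm _ _
  have e3 : (fun y => inner ℝ (Y y) (Z y)) = fun y => inner ℝ (Z y) (Y y) :=
    funext fun y => real_inner_comm _ _
  simp only [koszul, e1, e2, e3, VectorField.mlieBracket_swap_apply (V := X) (W := Z),
    VectorField.mlieBracket_swap_apply (V := Y) (W := X),
    VectorField.mlieBracket_swap_apply (V := Z) (W := Y)]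
  simp only [inner_neg_left]
  ring

theorem koszul_tensorialAt_right {X Y : ∀ x : M, TangentSpace (𝓡 n) x} {x : M}
    (hX : DiffFieldAt X x) (hY : DiffFieldAt Y x) :
    TensorialAt (𝓡 n) (EuclideanSpace ℝ (Fin n)) (fun Z => koszul X Y Z x) x where
  smul {f Z} hf hZ := by
    have h1 := mvfderiv_mul hf (DiffFieldAt.inner hY hZ)
    have h2 := mvfderiv_mul hf (DiffFieldAt.inner hZ hX)
    have e1 : (fun y => inner ℝ (Y y) ((f • Z) y)) = f * fun y => inner ℝ (Y y) (Z y) := by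
      funext y; simp [inner_smul_right]
    have e2 : (fun y => inner ℝ ((f • Z) y) (X y)) = f * fun y => inner ℝ (Z y) (X y) := by
      funext y; simp [inner_smul_left]
    simp only [koszul, e1, e2, h1, h2, VectorField.mlieBracket_smul_left hf hZ,
      VectorField.mlieBracket_smul_right hf hZ]
    simp [inner_add_left, inner_smul_left, inner_smul_right, real_inner_comm (Z x) (Y x)]
    ring
  add {Z Z'} hZ hZ' := by
    have h1 := mvfderiv_add (DiffFieldAt.inner hY hZ) (DiffFieldAt.inner hY hZ')
    have h2 := mvfderiv_add (DiffFieldAt.inner hZ hX) (DiffFieldAt.inner hZ' hX)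
    have e1 : (fun y => inner ℝ (Y y) ((Z + Z') y))
        = (fun y => inner ℝ (Y y) (Z y)) + fun y => inner ℝ (Y y) (Z' y) := by
      funext y; simp [inner_add_right]
    have e2 : (fun y => inner ℝ ((Z + Z') y) (X y))
        = (fun y => inner ℝ (Z y) (X y)) + fun y => inner ℝ (Z' y) (X y) := by
      funext y; simp [inner_add_left]
    simp only [koszul, e1, e2, h1, h2, VectorField.mlieBracket_add_left hZ hZ',
      VectorField.mlieBracket_add_right hZ hZ']
    simp [inner_add_left, inner_add_right]
    ring

theorem diffFieldAt_extend {x : M} (v : TangentSpace (𝓡 n) x) :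
    DiffFieldAt (FiberBundle.extend (EuclideanSpace ℝ (Fin n)) v) x :=
  FiberBundle.mdifferentiableAt_extend ..

/-- Koszul's formula for arbitrary fields differentiable at the point, from which metric
compatibility and vanishing torsion are read off. -/
theorem inner_leviCivita {X Y Z : ∀ x : M, TangentSpace (𝓡 n) x} {x : M} (hX : DiffFieldAt X x)
    (hY : DiffFieldAt Y x) (hZ : DiffFieldAt Z x) :
    inner ℝ (leviCivita Y x (X x)) (Z x) = koszul X Y Z x := by
  have h1 := koszul_tensorialAt_right (diffFieldAt_extend (X x)) hY
  have h2 : ∀ w, koszul (FiberBundle.extend (EuclideanSpace ℝ (Fin n)) (X x)) Y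
      (FiberBundle.extend (EuclideanSpace ℝ (Fin n)) w) x = TensorialAt.mkHom _ x h1 w := fun w =>
    (TensorialAt.mkHom_apply_eq_extend h1 w).symm
  simp only [leviCivita, h2]
  rw [sum_inner]
  have e : ∑ a, inner ℝ ((TensorialAt.mkHom _ x h1) (stdOrthonormalBasis ℝ (TangentSpace (𝓡 n) x) a)
      • stdOrthonormalBasis ℝ (TangentSpace (𝓡 n) x) a) (Z x)
      = TensorialAt.mkHom _ x h1 (Z x) := by
    conv_rhs => rw [← (stdOrthonormalBasis ℝ (TangentSpace (𝓡 n) x)).sum_repr' (Z x)]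
    rw [map_sum]
    refine Finset.sum_congr rfl fun a _ => ?_
    rw [map_smul, inner_smul_left]
    simp [mul_comm]
  rw [e, TensorialAt.mkHom_apply h1 hZ]
  exact (koszul_tensorialAt_left hY hZ).pointwise (diffFieldAt_extend (X x)) hX (by simp)

theorem inner_leviCivita_add {Y Z : ∀ x : M, TangentSpace (𝓡 n) x} {x : M}
    (hY : DiffFieldAt Y x) (hZ : DiffFieldAt Z x) (v : TangentSpace (𝓡 n) x) :
    inner ℝ (leviCivita Y x v) (Z x) + inner ℝ (Y x) (leviCivita Z x v)
      = mvfderiv (𝓡 n) (fun y => inner ℝ (Y y) (Z y)) x v := by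
  have hv : FiberBundle.extend (EuclideanSpace ℝ (Fin n)) v x = v := by simp
  have h1 := inner_leviCivita (diffFieldAt_extend v) hY hZ
  have h2 := inner_leviCivita (diffFieldAt_extend v) hZ hY
  have h3 := koszul_add_swap_right (X := FiberBundle.extend (EuclideanSpace ℝ (Fin n)) v)
    (Y := Y) (Z := Z) (x := x)
  rw [hv] at h1 h2 h3
  rw [real_inner_comm _ (Y x), h1, h2, h3]

theorem leviCivita_sub_swap {X Y : ∀ x : M, TangentSpace (𝓡 n) x} {x : M}
    (hX : DiffFieldAt X x) (hY : DiffFieldAt Y x) :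
    leviCivita Y x (X x) - leviCivita X x (Y x) = VectorField.mlieBracket (𝓡 n) X Y x := by
  refine ext_inner_right ℝ fun w => ?_
  have hw : FiberBundle.extend (EuclideanSpace ℝ (Fin n)) w x = w := by simp
  have h1 := inner_leviCivita hX hY (diffFieldAt_extend w)
  have h2 := inner_leviCivita hY hX (diffFieldAt_extend w)
  have h3 := koszul_sub_swap_left (X := X) (Y := Y)
    (Z := FiberBundle.extend (EuclideanSpace ℝ (Fin n)) w) (x := x)
  rw [hw] at h1 h2 h3
  rw [inner_sub_left, h1, h2, h3]

end LeviCivita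

/-! ## The spin connection -/

set_option linter.unusedSectionVars false

section Commutator

variable {n r : ℕ}

/-- Clifford multiplication as a bilinear map. -/
def cliffBilin (r n : ℕ) : (Fin n → ℝ) →ₗ[ℝ] TwSpinor r n →ₗ[ℝ] TwSpinor r n :=
  LinearMap.mk₂ ℝ cliff cliff_add cliff_smul cliff_add_right fun c X φ => cliff_rsmul_right X c φ

theorem gamma_mul_add_swap (i j : Fin n) :
    gamma n i * gamma n j + gamma n j * gamma n i = (if i = j then (-2 : ℝ) else 0) • 1 := by
  split_ifs with h
  · rw [h, gamma_sq]; module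
  · rw [gamma_anticomm h]; simp

/-- The matrix `½ ∑_{a<b} q_{ab} e_a e_b`. -/
def spinMat (q : Fin n → Fin n → ℝ) : Matrix (SpinIdx n) (SpinIdx n) ℂ :=
  (1 / 2 : ℝ) • ∑ a, ∑ b ∈ Finset.Ioi a, q a b • (gamma n a * gamma n b)

/-- The sum over all pairs counts each pair `a < b` twice, since both factors are skew off the
diagonal; the other factor `2` undoes the `½` of `spinMat`. -/
theorem four_smul_spinMat {q : Fin n → Fin n → ℝ} (hq : ∀ a b, q a b = -q b a) :
    (4 : ℝ) • spinMat q = ∑ a, ∑ b, q a b • (gamma n a * gamma n b) := by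
  have h0 : ∀ a, q a a = 0 := fun a => by linarith [hq a a]
  have hs : ∀ a b : Fin n, a ≠ b →
      q b a • (gamma n b * gamma n a) = q a b • (gamma n a * gamma n b) := fun a b hab => by
    rw [hq b a, gamma_anticomm hab.symm, neg_smul_neg]
  have h1 := Finset.sum_sum_Ioi_add_eq_sum_sum_off_diag
    (fun a b : Fin n => q a b • (gamma n a * gamma n b))
  have h2 : ∀ a : Fin n, ∑ b, q a b • (gamma n a * gamma n b)
      = ∑ b ∈ {a}ᶜ, q b a • (gamma n b * gamma n a) := fun a => by
    rw [Fintype.sum_eq_add_sum_compl a, h0, zero_smul, zero_add]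
    exact Finset.sum_congr rfl fun b hb => (hs a b (by simpa [eq_comm] using hb)).symm
  rw [Finset.sum_congr rfl fun a _ => h2 a, ← h1, spinMat, smul_smul, Finset.smul_sum]
  refine Finset.sum_congr rfl fun a _ => ?_
  rw [Finset.smul_sum]
  refine Finset.sum_congr rfl fun b hb => ?_
  rw [hs a b (by simpa using (Finset.mem_Ioi.mp hb).ne)]
  module

/-- The commutator with `½ ∑ q_{ab} e_a e_b` is the infinitesimal rotation `q` on vectors. This is
what makes the spin connection compatible with Clifford multiplication. -/
theorem spinMat_mul_gamma {q : Fin n → Fin n → ℝ} (hq : ∀ a b, q a b = -q b a) (c : Fin n) :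
    spinMat q * gamma n c = gamma n c * spinMat q + ∑ b, q c b • gamma n b := by
  have h4 : Function.Injective fun A : Matrix (SpinIdx n) (SpinIdx n) ℂ => (4 : ℝ) • A :=
    smul_right_injective _ (by norm_num)
  apply h4
  have e : ∀ a b : Fin n, gamma n a * gamma n b * gamma n c
      = gamma n c * (gamma n a * gamma n b) + (if b = c then (-2 : ℝ) else 0) • gamma n a
        + (if a = c then (2 : ℝ) else 0) • gamma n b := by
    intro a b
    have h1 := gamma_mul_add_swap b c
    have h2 := gamma_mul_add_swap a c
    have e1 : gamma n a * gamma n b * gamma n c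
        = gamma n a * (gamma n b * gamma n c + gamma n c * gamma n b)
          - (gamma n a * gamma n c + gamma n c * gamma n a) * gamma n b
          + gamma n c * (gamma n a * gamma n b) := by noncomm_ring
    rw [e1, h1, h2, mul_smul_comm, mul_one, smul_mul_assoc, one_mul]
    split_ifs <;> module
  have e0 : (4 : ℝ) • (gamma n c * spinMat q)
      = ∑ a, ∑ b, q a b • (gamma n c * (gamma n a * gamma n b)) := by
    rw [← mul_smul_comm, four_smul_spinMat hq]
    simp only [Finset.mul_sum, mul_smul_comm]
  beta_reduce
  rw [smul_add, ← smul_mul_assoc, four_smul_spinMat hq, e0]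
  simp only [Finset.sum_mul, smul_mul_assoc, e, smul_add, Finset.sum_add_distrib]
  simp only [ite_smul, zero_smul, smul_ite, smul_zero, Finset.sum_ite_eq', Finset.mem_univ, if_true,
    smul_smul, Finset.smul_sum]
  rw [add_assoc]
  congr 1
  have e2 : ∑ x : Fin n, ∑ y : Fin n, (if x = c then (q x y * 2) • gamma n y else 0)
      = ∑ y, (q c y * 2) • gamma n y := by
    rw [Finset.sum_comm]; simp
  rw [e2, ← Finset.sum_add_distrib]
  refine Finset.sum_congr rfl fun b _ => ?_
  rw [hq b c]; module

end Commutator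

/-! ### Leibniz rule for Clifford multiplication and the bracket identity -/

section SpinConnection

variable {n r : ℕ} {M : Type u} [TopologicalSpace M] [ChartedSpace (EuclideanSpace ℝ (Fin n)) M]
  [IsManifold (𝓡 n) ∞ M] [RiemannianBundle (fun x : M => TangentSpace (𝓡 n) x)]

/-- The coordinates of a tangent vector with respect to a frame. -/
def coords (e : Fin n → ∀ y : M, TangentSpace (𝓡 n) y) (y : M) (X : TangentSpace (𝓡 n) y) :
    Fin n → ℝ := fun a => inner ℝ (e a y) X

/-- The covariant derivative of a spinor in the frame `e`. -/
def spinCov (e : Fin n → ∀ y : M, TangentSpace (𝓡 n) y) (ψ : M → TwSpinor r n) (x : M)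
    (v : TangentSpace (𝓡 n) x) : TwSpinor r n :=
  mvfderiv (𝓡 n) ψ x v
    + actN (spinMat fun a b => inner ℝ (leviCivita (e a) x v) (e b x)) (ψ x)

theorem coords_sub (e : Fin n → ∀ y : M, TangentSpace (𝓡 n) y) (y : M)
    (X Y : TangentSpace (𝓡 n) y) : coords e y (X - Y) = coords e y X - coords e y Y := by
  funext a; simp [coords, inner_sub_right]

theorem coords_add (e : Fin n → ∀ y : M, TangentSpace (𝓡 n) y) (y : M)
    (X Y : TangentSpace (𝓡 n) y) : coords e y (X + Y) = coords e y X + coords e y Y := by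
  funext a; simp [coords, inner_add_right]

theorem mvfderiv_bilin {E F G : Type*} [NormedAddCommGroup E] [NormedSpace ℝ E]
    [NormedAddCommGroup F] [NormedSpace ℝ F] [NormedAddCommGroup G] [NormedSpace ℝ G]
    (B : E →L[ℝ] F →L[ℝ] G) {f : M → E} {g : M → F} {x : M}
    (hf : MDifferentiableAt (𝓡 n) 𝓘(ℝ, E) f x) (hg : MDifferentiableAt (𝓡 n) 𝓘(ℝ, F) g x)
    (v : TangentSpace (𝓡 n) x) :
    mvfderiv (𝓡 n) (fun y => B (f y) (g y)) x v
      = B (f x) (mvfderiv (𝓡 n) g x v) + B (mvfderiv (𝓡 n) f x v) (g x) := by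
  have h1 : HasMFDerivAt (𝓡 n) 𝓘(ℝ, E × F) (fun y => (f y, g y)) x _ :=

    ⟨hf.hasMFDerivAt.1.prodMk hg.hasMFDerivAt.1, hf.hasMFDerivAt.2.prodMk hg.hasMFDerivAt.2⟩
  have h2 := (B.isBoundedBilinearMap.hasFDerivAt (f x, g x)).hasMFDerivAt
  have h3 := HasMFDerivAt.comp x h2 h1
  have h4 := h3.mfderiv
  have h5 : mvfderiv (𝓡 n) (fun y => B (f y) (g y)) x v
      = mfderiv (𝓡 n) 𝓘(ℝ, G) (fun y => B (f y) (g y)) x v := rfl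
  rw [h5]
  erw [h4]
  rfl

theorem mdifferentiableAt_pi {ι : Type*} [Fintype ι] {f : M → ι → ℝ} {x : M}
    (hf : ∀ i, MDifferentiableAt (𝓡 n) 𝓘(ℝ, ℝ) (fun y => f y i) x) :
    MDifferentiableAt (𝓡 n) 𝓘(ℝ, ι → ℝ) f x := by
  rw [mdifferentiableAt_iff]
  exact ⟨continuousAt_pi.mpr fun i => (hf i).continuousAt,
    differentiableWithinAt_pi.mpr fun i => ((mdifferentiableAt_iff _ _).mp (hf i)).2⟩

theorem mvfderiv_congr {F : Type*} [NormedAddCommGroup F] [NormedSpace ℝ F] {f g : M → F} {x : M}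
    (h : f =ᶠ[𝓝 x] g) : mvfderiv (𝓡 n) f x = mvfderiv (𝓡 n) g x := by
  ext v
  have := h.mfderiv_eq (I := 𝓡 n) (I' := 𝓘(ℝ, F))
  exact DFunLike.congr_fun this v

theorem mvfderiv_clm {F G : Type*} [NormedAddCommGroup F] [NormedSpace ℝ F]
    [NormedAddCommGroup G] [NormedSpace ℝ G] (L : F →L[ℝ] G) {f : M → F} {x : M}
    (hf : MDifferentiableAt (𝓡 n) 𝓘(ℝ, F) f x) (v : TangentSpace (𝓡 n) x) :
    mvfderiv (𝓡 n) (fun y => L (f y)) x v = L (mvfderiv (𝓡 n) f x v) := by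
  have h3 := HasMFDerivAt.comp x (L.hasFDerivAt (x := f x)).hasMFDerivAt hf.hasMFDerivAt
  have h5 : mvfderiv (𝓡 n) (fun y => L (f y)) x v
      = mfderiv (𝓡 n) 𝓘(ℝ, G) (fun y => L (f y)) x v := rfl
  rw [h5]
  erw [h3.mfderiv]
  rfl

theorem spinCov_congr {e : Fin n → ∀ y : M, TangentSpace (𝓡 n) y} {ψ ψ' : M → TwSpinor r n} {x : M}
    (h : ψ =ᶠ[𝓝 x] ψ') (v : TangentSpace (𝓡 n) x) : spinCov e ψ x v = spinCov e ψ' x v := by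
  rw [spinCov, spinCov, mvfderiv_congr h, h.self_of_nhds]

theorem spinCov_I_smul {e : Fin n → ∀ y : M, TangentSpace (𝓡 n) y} {ψ : M → TwSpinor r n} {x : M}
    (hψ : MDifferentiableAt (𝓡 n) 𝓘(ℝ, TwSpinor r n) ψ x) (v : TangentSpace (𝓡 n) x) :
    spinCov e (fun y => Complex.I • ψ y) x v = Complex.I • spinCov e ψ x v := by
  have := mvfderiv_clm ((Complex.I • ContinuousLinearMap.id ℂ (TwSpinor r n)).restrictScalars ℝ)
    hψ v
  rw [spinCov, spinCov, smul_add, actN_smul_right]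
  congr 1

variable [IsContMDiffRiemannianBundle (𝓡 n) ∞ (EuclideanSpace ℝ (Fin n))
    (fun x : M => TangentSpace (𝓡 n) x)]

/-- In an orthonormal frame the derivative of the coordinates of `X` is that of `∇X` plus a rotation
by the connection matrix `q`. The commutator of `spinMat q` with Clifford multiplication by `X` is
the opposite rotation. -/
theorem spinCov_cliff {e : Fin n → ∀ y : M, TangentSpace (𝓡 n) y} {ψ : M → TwSpinor r n} {x : M}
    (he : ∀ a, DiffFieldAt (e a) x)
    (heo : ∀ᶠ y in 𝓝 x, ∀ a b, inner ℝ (e a y) (e b y) = if a = b then (1 : ℝ) else 0)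
    (hex : ∀ v w : TangentSpace (𝓡 n) x, inner ℝ v w = coords e x v ⬝ᵥ coords e x w)
    (hψ : MDifferentiableAt (𝓡 n) 𝓘(ℝ, TwSpinor r n) ψ x)
    {X : ∀ y : M, TangentSpace (𝓡 n) y} (hX : DiffFieldAt X x) (v : TangentSpace (𝓡 n) x) :
    spinCov e (fun y => cliff (coords e y (X y)) (ψ y)) x v
      = cliff (coords e x (leviCivita X x v)) (ψ x)
        + cliff (coords e x (X x)) (spinCov e ψ x v) := by
  set q : Fin n → Fin n → ℝ := fun a b => inner ℝ (leviCivita (e a) x v) (e b x) with hqd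
  have hq : ∀ a b, q a b = -q b a := fun a b => by
    have h1 := inner_leviCivita_add (he a) (he b) v
    have h2 : (fun y => inner ℝ (e a y) (e b y)) =ᶠ[𝓝 x] fun _ => if a = b then (1 : ℝ) else 0 :=
      heo.mono fun y hy => hy a b
    rw [mvfderiv_congr h2, mvfderiv_const, real_inner_comm _ (e a x)] at h1
    exact eq_neg_of_add_eq_zero_left h1
  have hc : MDifferentiableAt (𝓡 n) 𝓘(ℝ, Fin n → ℝ) (fun y => coords e y (X y)) x :=
    mdifferentiableAt_pi fun a => (he a).inner hX
  have hd := mvfderiv_bilin (LinearMap.toContinuousBilinearMap (cliffBilin r n)) hc hψ v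
  have hdc : mvfderiv (𝓡 n) (fun y => coords e y (X y)) x v
      = coords e x (leviCivita X x v) + fun b => ∑ a, q b a * coords e x (X x) a := by
    funext a
    have h1 := inner_leviCivita_add (he a) hX v
    have h2 := mvfderiv_clm (ContinuousLinearMap.proj (R := ℝ) a) hc v
    have h3 : mvfderiv (𝓡 n) (fun y => coords e y (X y)) x v a
      = mvfderiv (𝓡 n) (fun y => inner ℝ (e a y) (X y)) x v := h2.symm
    rw [h3, ← h1, add_comm, Pi.add_apply, hex (leviCivita (e a) x v)]
    simp only [coords, dotProduct, hqd]
    congr 1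
    refine Finset.sum_congr rfl fun b _ => ?_
    rw [real_inner_comm]
  have hcomm : actN (spinMat q) (cliff (coords e x (X x)) (ψ x))
      = cliff (coords e x (X x)) (actN (spinMat q) (ψ x))
        + cliff (fun b => ∑ a, coords e x (X x) a * q a b) (ψ x) := by
    rw [cliff, cliff, cliff, ← actN_mul, ← actN_mul, ← actN_add]
    congr 1
    simp only [gammaVec_apply, Finset.mul_sum, mul_smul_comm, spinMat_mul_gamma hq, smul_add,
      Finset.sum_add_distrib, Finset.sum_mul, smul_mul_assoc, Finset.sum_smul, Finset.smul_sum,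
      smul_smul]
    congr 1
    exact Finset.sum_comm
  -- The two rotation terms cancel because `q` is skew.
  have hz : (fun b => ∑ a, q b a * coords e x (X x) a)
      + (fun b => ∑ a, coords e x (X x) a * q a b) = 0 := by
    funext b
    simp only [Pi.add_apply, Pi.zero_apply, ← Finset.sum_add_distrib]
    refine Finset.sum_eq_zero fun a _ => ?_
    rw [hq b a]; ring
  have hd' : mvfderiv (𝓡 n) (fun y => cliff (coords e y (X y)) (ψ y)) x v
      = cliff (coords e x (X x)) (mvfderiv (𝓡 n) ψ x v)
        + cliff (mvfderiv (𝓡 n) (fun y => coords e y (X y)) x v) (ψ x) := hd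
  rw [spinCov, hd', hdc, cliff_add, spinCov, cliff_add_right]
  rw [show (spinMat fun a b => inner ℝ (leviCivita (e a) x v) (e b x)) = spinMat q from rfl, hcomm]
  have hz' := congrArg (fun c => cliff c (ψ x)) hz
  simp only [cliff_add, cliff_zero] at hz'
  linear_combination (exp := 1) hz'

/-- If `X · ψ = i X' · ψ` near `x`, then `(X - iX') · ∇_v ψ = -(∇_v X - i ∇_v X') · ψ`. -/
theorem cliff_spinCov_of_eq {e : Fin n → ∀ y : M, TangentSpace (𝓡 n) y} {ψ : M → TwSpinor r n}
    {x : M} (he : ∀ a, DiffFieldAt (e a) x)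
    (heo : ∀ᶠ y in 𝓝 x, ∀ a b, inner ℝ (e a y) (e b y) = if a = b then (1 : ℝ) else 0)
    (hex : ∀ v w : TangentSpace (𝓡 n) x, inner ℝ v w = coords e x v ⬝ᵥ coords e x w)
    (hψ : MDifferentiableAt (𝓡 n) 𝓘(ℝ, TwSpinor r n) ψ x)
    {X X' : ∀ y : M, TangentSpace (𝓡 n) y} (hX : DiffFieldAt X x) (hX' : DiffFieldAt X' x)
    (hXX : ∀ᶠ y in 𝓝 x, cliff (coords e y (X y)) (ψ y)
      = Complex.I • cliff (coords e y (X' y)) (ψ y)) (v : TangentSpace (𝓡 n) x) :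
    cliff (coords e x (X x)) (spinCov e ψ x v)
        - Complex.I • cliff (coords e x (X' x)) (spinCov e ψ x v)
      = Complex.I • cliff (coords e x (leviCivita X' x v)) (ψ x)
        - cliff (coords e x (leviCivita X x v)) (ψ x) := by
  have hc : MDifferentiableAt (𝓡 n) 𝓘(ℝ, Fin n → ℝ) (fun y => coords e y (X' y)) x :=
    mdifferentiableAt_pi fun a => (he a).inner hX'
  have hd : MDifferentiableAt (𝓡 n) 𝓘(ℝ, TwSpinor r n)
      (fun y => cliff (coords e y (X' y)) (ψ y)) x := by
    have hB := (LinearMap.toContinuousBilinearMap (cliffBilin r n)).isBoundedBilinearMap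
    exact (hB.differentiableAt (coords e x (X' x), ψ x)).mdifferentiableAt.comp x
      (hc.prodMk_space hψ)
  have h := spinCov_congr (e := e) hXX v
  rw [spinCov_cliff he heo hex hψ hX, spinCov_I_smul hd, spinCov_cliff he heo hex hψ hX',
    smul_add] at h
  linear_combination (exp := 1) h

/-- The antisymmetrised derivative of a spinor annihilated by `X - iX'` and `Y - iY'` is given by
the bracket `[X - iX', Y - iY']`. -/
theorem cliff_spinCov_sub {e : Fin n → ∀ y : M, TangentSpace (𝓡 n) y} {ψ : M → TwSpinor r n}
    {x : M} (he : ∀ a, DiffFieldAt (e a) x)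
    (heo : ∀ᶠ y in 𝓝 x, ∀ a b, inner ℝ (e a y) (e b y) = if a = b then (1 : ℝ) else 0)
    (hex : ∀ v w : TangentSpace (𝓡 n) x, inner ℝ v w = coords e x v ⬝ᵥ coords e x w)
    (hψ : MDifferentiableAt (𝓡 n) 𝓘(ℝ, TwSpinor r n) ψ x)
    {X X' Y Y' : ∀ y : M, TangentSpace (𝓡 n) y} (hX : DiffFieldAt X x) (hX' : DiffFieldAt X' x)
    (hY : DiffFieldAt Y x) (hY' : DiffFieldAt Y' x)
    (hXX : ∀ᶠ y in 𝓝 x, cliff (coords e y (X y)) (ψ y)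
      = Complex.I • cliff (coords e y (X' y)) (ψ y))
    (hYY : ∀ᶠ y in 𝓝 x, cliff (coords e y (Y y)) (ψ y)
      = Complex.I • cliff (coords e y (Y' y)) (ψ y)) :
    (cliff (coords e x (X x)) (spinCov e ψ x (Y x) - Complex.I • spinCov e ψ x (Y' x))
        - Complex.I • cliff (coords e x (X' x))
          (spinCov e ψ x (Y x) - Complex.I • spinCov e ψ x (Y' x)))
      - (cliff (coords e x (Y x)) (spinCov e ψ x (X x) - Complex.I • spinCov e ψ x (X' x))
        - Complex.I • cliff (coords e x (Y' x))
          (spinCov e ψ x (X x) - Complex.I • spinCov e ψ x (X' x)))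
      = cliff (coords e x (VectorField.mlieBracket (𝓡 n) X Y x
          - VectorField.mlieBracket (𝓡 n) X' Y' x)) (ψ x)
        - Complex.I • cliff (coords e x (VectorField.mlieBracket (𝓡 n) X' Y x
          + VectorField.mlieBracket (𝓡 n) X Y' x)) (ψ x) := by
  have h1 := cliff_spinCov_of_eq he heo hex hψ hX hX' hXX (Y x)
  have h2 := cliff_spinCov_of_eq he heo hex hψ hX hX' hXX (Y' x)
  have h3 := cliff_spinCov_of_eq he heo hex hψ hY hY' hYY (X x)
  have h4 := cliff_spinCov_of_eq he heo hex hψ hY hY' hYY (X' x)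
  rw [← leviCivita_sub_swap hX hY, ← leviCivita_sub_swap hX' hY', ← leviCivita_sub_swap hX' hY,
    ← leviCivita_sub_swap hX hY']
  simp only [coords_sub, coords_add, cliff_sub, cliff_add, cliff_sub_right, cliff_smul_right]
  have hI : ∀ χ : TwSpinor r n, Complex.I • Complex.I • χ = -χ := fun χ => by
    rw [smul_smul, Complex.I_mul_I, neg_one_smul]
  have h2' := congrArg (Complex.I • ·) h2
  have h4' := congrArg (Complex.I • ·) h4
  simp only [smul_sub, hI] at h2' h4'
  simp only [smul_sub, smul_add, hI]
  linear_combination (exp := 1) h1 - h2' - h3 + h4'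

end SpinConnection

/-! ### The adapted connection on twisted spinors -/

section Adapted

variable {n r : ℕ} {M : Type u} [TopologicalSpace M] [ChartedSpace (EuclideanSpace ℝ (Fin n)) M]
  [IsManifold (𝓡 n) ∞ M] [RiemannianBundle (fun x : M => TangentSpace (𝓡 n) x)]
  [IsContMDiffRiemannianBundle (𝓡 n) ∞ (EuclideanSpace ℝ (Fin n))
    (fun x : M => TangentSpace (𝓡 n) x)]
  {o : ManifoldOrientation n M} {S : SpincrStructure r o}
  {D : ∀ x : M, Submodule ℝ (TangentSpace (𝓡 n) x)}
  {J : ∀ x : M, TangentSpace (𝓡 n) x → TangentSpace (𝓡 n) x}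

namespace SpincrStructure

/-- The frame of `TM` given by a local section of the spin bundle. -/
abbrev secFrame (S : SpincrStructure r o) (i : S.PSpin.Index) :
    Fin n → ∀ y : M, TangentSpace (𝓡 n) y := fun a y => S.frame (S.PSpin.sec i y) a

/-- Only the kind of the extra terms matters later: an endomorphism of `Δ_r` and a scalar applied to
the spinor. Their connection forms never have to be computed. -/
theorem nablaS_eq (Ψ : S.AdaptedIdentification D J) (φ : S.SpinorField) (i : S.PSpin.Index) (x : M)
    (v : TangentSpace (𝓡 n) x) :
    ∃ (B : Matrix (SpinIdx r) (SpinIdx r) ℂ) (c : ℂ),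
      nablaS Ψ φ i x v = spinCov (S.secFrame i) (fun y => φ.toFun (S.PSpin.sec i y)) x v
        + (actR B (φ.toFun (S.PSpin.sec i x)) + c • φ.toFun (S.PSpin.sec i x)) := by
  refine ⟨(1 / 2 : ℝ) • ∑ k, ∑ l ∈ Finset.Ioi k,
        (inner ℝ (covD (fun y => (D y)ᗮ)
          (fun y => Ψ.normalFrame (S.toSO (S.PSpin.sec i y)) k) x v)
          (Ψ.normalFrame (S.toSO (S.PSpin.sec i x)) l) : ℝ) • (gamma r k * gamma r l),
      Complex.I / 2 * (anticanonicalForm D J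
        (fun y => Ψ.anticanonical (S.toU (S.PSpin.sec i y))) x v : ℂ), ?_⟩
  rw [nablaS, spinCov, ← add_assoc]
  congr 2
  · rw [spinMat, actN_rsmul, actN_sum]
    simp only [actN_sum, actN_rsmul]
  · rw [actR_rsmul, actR_sum]
    simp only [actR_sum, actR_rsmul]

/-- The spinor equation measures exactly the failure of the CR condition. It is the identity
`cliff_spinCov_sub`, after the extra terms of `∇^S` have been seen to drop out. -/
theorem cliffC_nablaC_sub (Ψ : S.AdaptedIdentification D J) (φ : S.SpinorField)
    (i : S.PSpin.Index) {x : M} (hx : x ∈ S.PSpin.dom i)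
    {X Y : ∀ y : M, TangentSpace (𝓡 n) y} (hX : DiffFieldAt X x)
    (hX' : DiffFieldAt (fun y => J y (X y)) x)
    (hY : DiffFieldAt Y x) (hY' : DiffFieldAt (fun y => J y (Y y)) x)
    (hXX : ∀ᶠ y in 𝓝 x, S.tcliff (S.PSpin.sec i y) (X y) (φ.toFun (S.PSpin.sec i y))
      = Complex.I • S.tcliff (S.PSpin.sec i y) (J y (X y)) (φ.toFun (S.PSpin.sec i y)))
    (hYY : ∀ᶠ y in 𝓝 x, S.tcliff (S.PSpin.sec i y) (Y y) (φ.toFun (S.PSpin.sec i y))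
      = Complex.I • S.tcliff (S.PSpin.sec i y) (J y (Y y)) (φ.toFun (S.PSpin.sec i y))) :
    cliffC J (S.PSpin.sec i x) (X x) (nablaC Ψ φ i x (Y x))
      - cliffC J (S.PSpin.sec i x) (Y x) (nablaC Ψ φ i x (X x))
      = S.tcliff (S.PSpin.sec i x) (VectorField.mlieBracket (𝓡 n) X Y x
          - VectorField.mlieBracket (𝓡 n) (fun y => J y (X y)) (fun y => J y (Y y)) x)
          (φ.toFun (S.PSpin.sec i x))
        - Complex.I • S.tcliff (S.PSpin.sec i x)
          (VectorField.mlieBracket (𝓡 n) (fun y => J y (X y)) Y x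
          + VectorField.mlieBracket (𝓡 n) X (fun y => J y (Y y)) x)
          (φ.toFun (S.PSpin.sec i x)) := by
  have he : ∀ a, DiffFieldAt (S.secFrame i a) x := fun a =>
    ((S.smooth_frame i a).contMDiffAt ((S.PSpin.isOpen_dom i).mem_nhds hx)).mdifferentiableAt
      (by simp)
  have heo : ∀ᶠ y in 𝓝 x, ∀ a b,
      inner ℝ (S.secFrame i a y) (S.secFrame i b y) = if a = b then (1 : ℝ) else 0 :=
    Filter.Eventually.of_forall fun y a b =>
      orthonormal_iff_ite.mp (S.frame (S.PSpin.sec i y)).orthonormal a b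
  have hex : ∀ v w : TangentSpace (𝓡 n) x,
      inner ℝ v w = coords (S.secFrame i) x v ⬝ᵥ coords (S.secFrame i) x w := fun v w => by
    rw [← (S.frame (S.PSpin.sec i x)).sum_inner_mul_inner v w]
    simp only [coords, dotProduct]
    exact Finset.sum_congr rfl fun a _ => by rw [real_inner_comm v]
  have hψ : MDifferentiableAt (𝓡 n) 𝓘(ℝ, TwSpinor r n) (fun y => φ.toFun (S.PSpin.sec i y)) x :=
    ((φ.smooth i).contMDiffAt ((S.PSpin.isOpen_dom i).mem_nhds hx)).mdifferentiableAt (by simp)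
  have key := cliff_spinCov_sub he heo hex hψ hX hX' hY hY' hXX hYY
  refine Eq.trans ?_ key
  have hZ := hXX.self_of_nhds
  have hW := hYY.self_of_nhds
  simp only [SpincrStructure.tcliff] at hZ hW
  have hco : ∀ v : TangentSpace (𝓡 n) x, coords (S.secFrame i) x v
      = fun a => inner ℝ (S.frame (S.PSpin.sec i x) a) v := fun v => rfl
  obtain ⟨B₁, c₁, h₁⟩ := nablaS_eq Ψ φ i x (X x)
  obtain ⟨B₂, c₂, h₂⟩ := nablaS_eq Ψ φ i x (J x (X x))
  obtain ⟨B₃, c₃, h₃⟩ := nablaS_eq Ψ φ i x (Y x)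
  obtain ⟨B₄, c₄, h₄⟩ := nablaS_eq Ψ φ i x (J x (Y x))
  -- Clifford multiplication passes through `B` and `c` to the spinor itself, where `X` acts as
  -- `iJX` and `Y` as `iJY`; all extra terms cancel in pairs.
  simp only [cliffC, nablaC, SpincrStructure.tcliff, h₁, h₂, h₃, h₄, hco, cliff_sub_right,
    cliff_smul_right, cliff_add_right, cliff_actR, hZ, hW, actR_smul_right]
  module

end SpincrStructure

end Adapted

/-! ## Smooth vector fields -/

set_option linter.unusedSectionVars false

section SmoothFields

variable {n : ℕ} {M : Type u} [TopologicalSpace M] [ChartedSpace (EuclideanSpace ℝ (Fin n)) M]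
  [IsManifold (𝓡 n) ∞ M] {X Y : ∀ x : M, TangentSpace (𝓡 n) x} {U : Set M}

theorem SmoothFieldOn.mono {W : Set M} (hX : SmoothFieldOn X U) (h : W ⊆ U) : SmoothFieldOn X W :=
  ContMDiffOn.mono hX h

theorem SmoothFieldOn.congr (hX : SmoothFieldOn X U) (h : ∀ y ∈ U, Y y = X y) :
    SmoothFieldOn Y U :=
  ContMDiffOn.congr hX fun y hy => by simp only [h y hy]

theorem SmoothFieldOn.smul {f : M → ℝ} (hf : ContMDiffOn (𝓡 n) 𝓘(ℝ, ℝ) ∞ f U)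
    (hX : SmoothFieldOn X U) : SmoothFieldOn (fun y => f y • X y) U :=
  ContMDiffOn.smul_section hf hX

theorem SmoothFieldOn.sub (hX : SmoothFieldOn X U) (hY : SmoothFieldOn Y U) :
    SmoothFieldOn (fun y => X y - Y y) U :=
  ContMDiffOn.sub_section hX hY

theorem SmoothFieldOn.sum {ι : Type*} {s : Finset ι} {X : ι → ∀ x : M, TangentSpace (𝓡 n) x}
    (hX : ∀ a ∈ s, SmoothFieldOn (X a) U) : SmoothFieldOn (fun y => ∑ a ∈ s, X a y) U :=
  ContMDiffOn.sum_section hX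

theorem SmoothFieldOn.inner [RiemannianBundle (fun x : M => TangentSpace (𝓡 n) x)]
    [IsContMDiffRiemannianBundle (𝓡 n) ∞ (EuclideanSpace ℝ (Fin n))
      (fun x : M => TangentSpace (𝓡 n) x)] (hX : SmoothFieldOn X U) (hY : SmoothFieldOn Y U) :
    ContMDiffOn (𝓡 n) 𝓘(ℝ, ℝ) ∞ (fun y => inner ℝ (X y) (Y y)) U :=
  ContMDiffOn.inner_bundle hX hY

theorem SmoothFieldOn.diffFieldAt {x : M} (h : SmoothFieldOn X U) (hU : U ∈ 𝓝 x) :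
    DiffFieldAt X x :=
  (h.contMDiffAt hU).mdifferentiableAt (by simp)

theorem smoothFieldOn_of_locally (h : ∀ x ∈ U, ∃ W, IsOpen W ∧ x ∈ W ∧ SmoothFieldOn X (U ∩ W)) :
    SmoothFieldOn X U :=
  contMDiffOn_of_locally_contMDiffOn h

/-- A local vector field can be cut off to a global one. -/
theorem SmoothFieldOn.exists_cutoff [T2Space M] (hU : IsOpen U) (hX : SmoothFieldOn X U) {x : M}
    (hx : x ∈ U) : ∃ f : M → ℝ, f x = 1 ∧ (∀ y ∉ U, f y = 0) ∧
      SmoothFieldOn (fun y => f y • X y) Set.univ := by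
  obtain ⟨f, -, hf⟩ := (SmoothBumpFunction.nhds_basis_tsupport (I := 𝓡 n) x).mem_iff.mp
    (hU.mem_nhds hx)
  refine ⟨f, f.eq_one, fun y hy => image_eq_zero_of_notMem_tsupport fun h => hy (hf h), ?_⟩
  have := ContMDiffOn.smul_section_of_tsupport (V := fun x : M => TangentSpace (𝓡 n) x)
    f.contMDiff.contMDiffOn hU hf hX
  exact ContMDiff.contMDiffOn this

/-- The kernels of a smooth family of linear maps of constant rank have smooth local frames. -/
theorem exists_smooth_frame_ker {E F : Type*} [NormedAddCommGroup E] [NormedSpace ℝ E]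
    [FiniteDimensional ℝ E] [NormedAddCommGroup F] [NormedSpace ℝ F] [FiniteDimensional ℝ F]
    {d : ℕ} {L : M → E →L[ℝ] F} (hU : IsOpen U) (hL : ContMDiffOn (𝓡 n) 𝓘(ℝ, E →L[ℝ] F) ∞ L U)
    (hd : ∀ y ∈ U, Module.finrank ℝ (LinearMap.ker (L y : E →ₗ[ℝ] F)) = d) {x : M} (hx : x ∈ U) :
    ∃ W ⊆ U, IsOpen W ∧ x ∈ W ∧ ∃ k : Fin d → M → E,
      (∀ a, ContMDiffOn (𝓡 n) 𝓘(ℝ, E) ∞ (k a) W) ∧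
      ∀ y ∈ W, LinearIndependent ℝ (fun a => k a y) ∧
        Submodule.span ℝ (Set.range fun a => k a y) = LinearMap.ker (L y : E →ₗ[ℝ] F) := by
  have : CompleteSpace E := FiniteDimensional.complete ℝ E
  set K := LinearMap.ker (L x : E →ₗ[ℝ] F) with hK
  obtain ⟨P, hP⟩ := K.subtype.exists_leftInverse_of_injective K.ker_subtype
  have hP' : ∀ k : K, P k = k := fun k => DFunLike.congr_fun hP k
  have hinj : LinearMap.ker (P.prod (L x : E →ₗ[ℝ] F)) = ⊥ := by
    rw [LinearMap.ker_eq_bot']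
    intro e he
    have h1 : P e = 0 := congrArg Prod.fst he
    have h2 : e ∈ K := congrArg Prod.snd he
    have h3 := hP' ⟨e, h2⟩
    rw [h1] at h3
    exact (congrArg Subtype.val h3).symm
  obtain ⟨R, hR⟩ := LinearMap.exists_leftInverse_of_injective _ hinj
  have hR' : ∀ e, R (P e, L x e) = e := fun e => DFunLike.congr_fun hR e
  let Q : M → E →L[ℝ] E := fun y =>
    LinearMap.toContinuousLinearMap (R ∘ₗ LinearMap.inl ℝ K F ∘ₗ P)
      + (LinearMap.toContinuousLinearMap (R ∘ₗ LinearMap.inr ℝ K F)).comp (L y)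
  have hQ : ∀ y e, Q y e = R (P e, L y e) := fun y e => by
    have : R (P e, L y e) = R (P e, 0) + R (0, L y e) := by rw [← map_add]; simp
    rw [this]; rfl
  have hQx : Q x = 1 := by
    ext e; rw [hQ, hR']; rfl
  have hQs : ContMDiffOn (𝓡 n) 𝓘(ℝ, E →L[ℝ] E) ∞ Q U := by
    have : ContDiff ℝ ∞ fun T : E →L[ℝ] F =>
        LinearMap.toContinuousLinearMap (R ∘ₗ LinearMap.inl ℝ K F ∘ₗ P)
        + (LinearMap.toContinuousLinearMap (R ∘ₗ LinearMap.inr ℝ K F)).comp T :=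
      contDiff_const.add (contDiff_const.clm_comp contDiff_id)
    exact this.contMDiff.comp_contMDiffOn hL
  have hKd : Module.finrank ℝ K = d := hd x hx
  let b : Module.Basis (Fin d) ℝ K := Module.finBasisOfFinrankEq ℝ K hKd
  refine ⟨U ∩ Q ⁻¹' {T | IsUnit T}, Set.inter_subset_left,
    hQs.continuousOn.isOpen_inter_preimage hU Units.isOpen, ⟨hx, ?_⟩,
    fun a y => Ring.inverse (Q y) (b a : E), ?_, ?_⟩
  · simp [hQx]
  · intro a
    have h1 : ContMDiffOn (𝓡 n) 𝓘(ℝ, E →L[ℝ] E) ∞ (fun y => Ring.inverse (Q y))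
        (U ∩ Q ⁻¹' {T | IsUnit T}) := by
      intro y hy
      obtain ⟨u, hu⟩ := hy.2
      have h2 : ContDiffAt ℝ ∞ Ring.inverse (Q y) := by
        rw [← hu]; exact contDiffAt_ringInverse ℝ u
      exact h2.contMDiffAt.comp_contMDiffWithinAt y ((hQs y hy.1).mono Set.inter_subset_left)
    exact h1.clm_apply contMDiffOn_const
  · rintro y ⟨hy, hyu⟩
    have h1 : ∀ e, Ring.inverse (Q y) (Q y e) = e := fun e =>
      DFunLike.congr_fun (Ring.inverse_mul_cancel (Q y) hyu) e
    have h2 : ∀ e, Q y (Ring.inverse (Q y) e) = e := fun e =>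
      DFunLike.congr_fun (Ring.mul_inverse_cancel (Q y) hyu) e
    have hli : LinearIndependent ℝ (fun a => Ring.inverse (Q y) (b a : E)) := by
      have h3 : LinearIndependent ℝ (fun a => (b a : E)) :=
        b.linearIndependent.map' K.subtype K.ker_subtype
      exact h3.map' ((Ring.inverse (Q y) : E →L[ℝ] E) : E →ₗ[ℝ] E)
        (LinearMap.ker_eq_bot_of_injective (Function.LeftInverse.injective h2))
    refine ⟨hli, (Submodule.eq_of_le_of_finrank_eq ?_ ?_).symm⟩
    · intro e he
      -- On `ker L_y` the map `Q y` agrees with `P` and has values in `K`. So `ker L_y` lies in the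
      -- preimage of `K` under `Q y`, and equality follows from equal dimensions.
      have h3 : Q y e = P e := by
        have h4 : L y e = 0 := he
        have h5 := hR' (P e : E)
        have h6 : L x (P e : E) = 0 := (P e).2
        rw [hP', h6] at h5
        rw [hQ, h4, h5]
      have h7 : e = Ring.inverse (Q y) (P e : E) := by rw [← h3, h1]
      have h8 := b.sum_repr (P e)
      rw [h7, ← h8, Submodule.coe_sum, map_sum]
      refine Submodule.sum_mem _ fun a _ => ?_
      rw [Submodule.coe_smul, map_smul]
      exact Submodule.smul_mem _ _ (Submodule.subset_span ⟨a, rfl⟩)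
    · rw [hd y hy, finrank_span_eq_card hli, Fintype.card_fin]

end SmoothFields

/-! ## The CR structure of a partially pure spinor field -/

set_option linter.unusedSectionVars false

section PureSpinorField

variable {n r : ℕ} {M : Type u} [TopologicalSpace M] [ChartedSpace (EuclideanSpace ℝ (Fin n)) M]
  [IsManifold (𝓡 n) ∞ M] [RiemannianBundle (fun x : M => TangentSpace (𝓡 n) x)]
  {o : ManifoldOrientation n M}

namespace SpincrStructure

variable (S : SpincrStructure r o)

/-- The coordinates of tangent vectors in the frame given by a point of the spin bundle. -/
def coordsLin {x : M} (p : S.PSpin.Fib x) : TangentSpace (𝓡 n) x →ₗ[ℝ] (Fin n → ℝ) :=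
  LinearMap.pi fun a => innerₛₗ ℝ (S.frame p a)

theorem coordsLin_apply {x : M} (p : S.PSpin.Fib x) (X : TangentSpace (𝓡 n) x) :
    S.coordsLin p X = fun a => inner ℝ (S.frame p a) X := rfl

theorem tcliff_eq {x : M} (p : S.PSpin.Fib x) (X : TangentSpace (𝓡 n) x) (ψ : TwSpinor r n) :
    S.tcliff p X ψ = cliff (S.coordsLin p X) ψ := rfl

theorem coordsLin_sum {x : M} (p : S.PSpin.Fib x) (c : Fin n → ℝ) :
    S.coordsLin p (∑ a, c a • S.frame p a) = c := by
  classical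
  funext a
  simp only [coordsLin_apply]
  rw [inner_sum]
  simp [inner_smul_right, orthonormal_iff_ite.mp (S.frame p).orthonormal]

theorem sum_coordsLin {x : M} (p : S.PSpin.Fib x) (X : TangentSpace (𝓡 n) x) :
    ∑ a, S.coordsLin p X a • S.frame p a = X := (S.frame p).sum_repr' X

theorem coordsLin_injective {x : M} (p : S.PSpin.Fib x) : Function.Injective (S.coordsLin p) :=
  Function.LeftInverse.injective (g := fun c : Fin n → ℝ => ∑ a, c a • S.frame p a)
    (S.sum_coordsLin p)

theorem coordsLin_dot {x : M} (p : S.PSpin.Fib x) (X Y : TangentSpace (𝓡 n) x) :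
    S.coordsLin p X ⬝ᵥ S.coordsLin p Y = inner ℝ X Y := by
  rw [← (S.frame p).sum_inner_mul_inner X Y]
  exact Finset.sum_congr rfl fun a _ => by rw [real_inner_comm (S.frame p a) X]; rfl

theorem coordsLin_act {x : M} (p : S.PSpin.Fib x) (g : Spincr n r) (X : TangentSpace (𝓡 n) x) :
    (spincrToSOn n r g : Matrix (Fin n) (Fin n) ℝ) *ᵥ S.coordsLin (S.PSpin.act p g) X
      = S.coordsLin p X := by
  have h : S.coordsLin (S.PSpin.act p g) X
      = (spincrToSOn n r g : Matrix (Fin n) (Fin n) ℝ)ᵀ *ᵥ S.coordsLin p X := by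
    funext a
    simp [coordsLin_apply, S.frame_act, sum_inner, inner_smul_left, Matrix.mulVec, dotProduct]
  have h2 := (Matrix.mem_specialOrthogonalGroup_iff.mp (spincrToSOn n r g).2).1
  rw [Matrix.mem_orthogonalGroup_iff] at h2
  rw [h, mulVec_mulVec]
  erw [h2]
  rw [one_mulVec]

theorem tcliff_act {x : M} (p : S.PSpin.Fib x) (g : Spincr n r) (X : TangentSpace (𝓡 n) x)
    (ψ : TwSpinor r n) : S.tcliff (S.PSpin.act p g) X (spincrRep n r g⁻¹ *ᵥ ψ)
      = spincrRep n r g⁻¹ *ᵥ S.tcliff p X ψ := by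
  have h := cliff_spincrRep g (S.coordsLin (S.PSpin.act p g) X) (spincrRep n r g⁻¹ *ᵥ ψ)
  rw [coordsLin_act, mulVec_mulVec, spincrRep_mul_inv, one_mulVec] at h
  rw [tcliff_eq, tcliff_eq, h, mulVec_mulVec, spincrRep_inv_mul, one_mulVec]

namespace SpinorField

variable {S} (φ : S.SpinorField)

/-- `X · φ = i Y · φ` at `p`. -/
def IsPair {x : M} (p : S.PSpin.Fib x) (X Y : TangentSpace (𝓡 n) x) : Prop :=
  S.tcliff p X (φ.toFun p) = Complex.I • S.tcliff p Y (φ.toFun p)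

variable {φ}

theorem IsPair.of_fib {x : M} {p : S.PSpin.Fib x} {X Y : TangentSpace (𝓡 n) x}
    (h : φ.IsPair p X Y) (q : S.PSpin.Fib x) : φ.IsPair q X Y := by
  obtain ⟨g, rfl, -⟩ := S.PSpin.simply_transitive p q
  rw [IsPair, φ.equivariant, tcliff_act, tcliff_act, h, mulVec_smul]

theorem IsPair.add {x : M} {p : S.PSpin.Fib x} {X Y X' Y' : TangentSpace (𝓡 n) x}
    (h : φ.IsPair p X Y) (h' : φ.IsPair p X' Y') : φ.IsPair p (X + X') (Y + Y') := by
  simp only [IsPair, tcliff_eq] at *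
  rw [map_add, cliff_add, h, h', map_add, cliff_add, smul_add]

theorem IsPair.smul {x : M} {p : S.PSpin.Fib x} {X Y : TangentSpace (𝓡 n) x}
    (h : φ.IsPair p X Y) (c : ℝ) : φ.IsPair p (c • X) (c • Y) := by
  simp only [IsPair, tcliff_eq] at *
  rw [map_smul, cliff_smul, h, map_smul, cliff_smul, smul_comm]

theorem IsPair.symm {x : M} {p : S.PSpin.Fib x} {X Y : TangentSpace (𝓡 n) x}
    (h : φ.IsPair p X Y) : φ.IsPair p Y (-X) := by
  rw [IsPair] at *
  rw [tcliff_eq S p (-X), map_neg, cliff_neg, ← tcliff_eq, h, smul_neg, smul_smul, Complex.I_mul_I]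
  simp

theorem IsPair.unique {x : M} {p : S.PSpin.Fib x} (hφ : φ.toFun p ≠ 0)
    {X Y Y' : TangentSpace (𝓡 n) x} (h : φ.IsPair p X Y) (h' : φ.IsPair p X Y') : Y = Y' := by
  have h1 : Complex.I • S.tcliff p Y (φ.toFun p) = Complex.I • S.tcliff p Y' (φ.toFun p) :=
    (Eq.symm h).trans h'
  exact S.coordsLin_injective p
    (cliff_injective hφ (smul_right_injective _ Complex.I_ne_zero h1))

/-- Both inner products are real parts of Hermitian products of the spinors `X·φ` and `X'·φ`, and
the factors `i` cancel. Hence `J` is orthogonal. -/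
theorem IsPair.inner_eq {x : M} {p : S.PSpin.Fib x} (hφ : herm (φ.toFun p) (φ.toFun p) = 1)
    {X Y X' Y' : TangentSpace (𝓡 n) x} (h : φ.IsPair p X Y) (h' : φ.IsPair p X' Y') :
    inner ℝ Y Y' = (inner ℝ X X' : ℝ) := by
  rw [← S.coordsLin_dot p, ← S.coordsLin_dot p, ← herm_cliff_cliff_re hφ, ← herm_cliff_cliff_re hφ,
    ← tcliff_eq, ← tcliff_eq, ← tcliff_eq, ← tcliff_eq, h, h', herm_smul_left, herm_smul_right]
  simp

/-- `V` is an intersection over all points of the fibre, but by equivariance the condition is the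
same at each of them. -/
theorem mem_V_iff {x : M} (p : S.PSpin.Fib x) {X : TangentSpace (𝓡 n) x} :
    X ∈ φ.V x ↔ ∃ Y, φ.IsPair p X Y := by
  rw [V, Submodule.mem_iInf]
  constructor
  · intro h
    obtain ⟨c, hc⟩ := h p
    refine ⟨∑ a, c a • S.frame p a, ?_⟩
    rw [IsPair, tcliff_eq, tcliff_eq, coordsLin_sum]
    exact hc
  · rintro ⟨Y, hY⟩ q
    exact ⟨S.coordsLin q Y, hY.of_fib q⟩

theorem isPair_J {x : M} (p : S.PSpin.Fib x) {X : TangentSpace (𝓡 n) x} (hX : X ∈ φ.V x) :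
    φ.IsPair p X (φ.J x X) := by
  obtain ⟨Y, hY⟩ := (mem_V_iff p).mp hX
  exact Classical.epsilon_spec (p := fun Y => ∀ p : S.PSpin.Fib x,
    S.tcliff p X (φ.toFun p) = Complex.I • S.tcliff p Y (φ.toFun p)) ⟨Y, fun q => hY.of_fib q⟩ p

theorem IsPair.mem_V {x : M} {p : S.PSpin.Fib x} {X Y : TangentSpace (𝓡 n) x}
    (h : φ.IsPair p X Y) : X ∈ φ.V x := (mem_V_iff p).mpr ⟨Y, h⟩

theorem IsPair.J_eq {x : M} {p : S.PSpin.Fib x} (hφ : φ.toFun p ≠ 0) {X Y : TangentSpace (𝓡 n) x}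
    (h : φ.IsPair p X Y) : φ.J x X = Y := (isPair_J p h.mem_V).unique hφ h

theorem J_mem_V {x : M} (p : S.PSpin.Fib x) {X : TangentSpace (𝓡 n) x} (hX : X ∈ φ.V x) :
    φ.J x X ∈ φ.V x := (isPair_J p hX).symm.mem_V

end SpinorField

end SpincrStructure

/-- The matrix of the endomorphism `X ↦ ∑_a Re⟨-i X · ψ, e_a · ψ⟩ e_a`, which extends `J`. -/
def extJ (ψ : TwSpinor r n) : Matrix (Fin n) (Fin n) ℝ :=
  Matrix.of fun a b => (herm (-Complex.I • cliff (Pi.single b 1) ψ) (cliff (Pi.single a 1) ψ)).re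

/-- Pairing `-iX·ψ = Y·ψ` with `e_a·ψ` and taking real parts recovers the coordinates of `Y`. So `J`
on the pure space is the restriction of a matrix depending smoothly on the spinor. -/
theorem extJ_mulVec {ψ : TwSpinor r n} (hψ : herm ψ ψ = 1) {X Y : Fin n → ℝ}
    (h : cliff X ψ = Complex.I • cliff Y ψ) : extJ ψ *ᵥ X = Y := by
  funext a
  have h1 : (extJ ψ *ᵥ X) a
      = (herm (-Complex.I • cliff X ψ) (cliff (Pi.single a 1) ψ)).re := by
    have : cliff X ψ = ∑ b, X b • cliff (Pi.single b 1) ψ := by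
      rw [cliff_eq_sum]; simp only [cliff_single]
    rw [this, Finset.smul_sum, herm_sum_left, Complex.re_sum]
    simp only [smul_comm (-Complex.I), herm_rsmul_left]
    simp only [Matrix.mulVec, dotProduct, extJ, Matrix.of_apply]
    refine Finset.sum_congr rfl fun b _ => ?_
    simp [mul_comm]
  rw [h1, h, smul_smul]
  simp [herm_cliff_cliff_re hψ]

theorem contDiff_herm {E : Type*} [NormedAddCommGroup E] [NormedSpace ℝ E] {f g : E → TwSpinor r n}
    (hf : ContDiff ℝ ∞ f) (hg : ContDiff ℝ ∞ g) : ContDiff ℝ ∞ fun x => herm (f x) (g x) := by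
  have : ∀ i, ContDiff ℝ ∞ fun x => f x i * star (g x i) := fun i =>
    (contDiff_pi.mp hf i).mul (Complex.conjCLE.contDiff.comp (contDiff_pi.mp hg i))
  exact ContDiff.sum fun i _ => this i

theorem contDiff_cliff (X : Fin n → ℝ) : ContDiff ℝ ∞ fun ψ : TwSpinor r n => cliff X ψ :=
  (LinearMap.toContinuousLinearMap (cliffBilin r n X)).contDiff

theorem contDiff_extJ (a b : Fin n) : ContDiff ℝ ∞ fun ψ : TwSpinor r n => extJ ψ a b :=
  Complex.reCLM.contDiff.comp
    (contDiff_herm ((contDiff_cliff _).const_smul _) (contDiff_cliff _))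

/-- The linear map `X ↦ X · ψ - i (J X) · ψ`, whose kernel is the pure space of `ψ`. -/
def pureMap (ψ : TwSpinor r n) : (Fin n → ℝ) →L[ℝ] TwSpinor r n :=
  LinearMap.toContinuousLinearMap
    (cliffLin ψ - Complex.I • (cliffLin ψ ∘ₗ Matrix.mulVecLin (extJ ψ)))

theorem pureMap_apply (ψ : TwSpinor r n) (X : Fin n → ℝ) :
    pureMap ψ X = cliff X ψ - Complex.I • cliff (extJ ψ *ᵥ X) ψ := rfl

theorem ker_pureMap {ψ : TwSpinor r n} (hψ : herm ψ ψ = 1) :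
    LinearMap.ker (pureMap ψ : (Fin n → ℝ) →ₗ[ℝ] TwSpinor r n) = pureSpace ψ := by
  ext X
  rw [LinearMap.mem_ker, ContinuousLinearMap.coe_coe, pureMap_apply, sub_eq_zero]
  constructor
  · exact fun h => ⟨_, h⟩
  · rintro ⟨Y, hY⟩
    rw [extJ_mulVec hψ hY, hY]

theorem contDiff_pureMap : ContDiff ℝ ∞ fun ψ : TwSpinor r n => pureMap ψ := by
  rw [contDiff_clm_apply_iff]
  intro X
  simp only [pureMap_apply]
  refine (contDiff_cliff X).sub (ContDiff.const_smul _ ?_)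
  have : (fun ψ : TwSpinor r n => cliff (extJ ψ *ᵥ X) ψ)
      = fun ψ => ∑ a, (∑ b, extJ ψ a b * X b) • cliff (Pi.single a 1) ψ := by
    funext ψ
    rw [cliff_eq_sum]; simp only [cliff_single]; rfl
  rw [this]
  refine ContDiff.sum fun a _ =>
    ContDiff.smul (f := fun ψ => ∑ b, extJ ψ a b * X b) (ContDiff.sum fun b _ => ?_)
      (contDiff_cliff _)
  exact (contDiff_extJ a b).mul contDiff_const

end PureSpinorField

set_option linter.unusedSectionVars false

/-! ### The CR structure from the integrability equation -/

section ToAlmostCR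

variable {n r : ℕ} {M : Type u} [TopologicalSpace M] [ChartedSpace (EuclideanSpace ℝ (Fin n)) M]
  [IsManifold (𝓡 n) ∞ M] [RiemannianBundle (fun x : M => TangentSpace (𝓡 n) x)]
  [IsContMDiffRiemannianBundle (𝓡 n) ∞ (EuclideanSpace ℝ (Fin n))
    (fun x : M => TangentSpace (𝓡 n) x)]
  {o : ManifoldOrientation n M} {S : SpincrStructure r o}

namespace SpincrStructure

/-- Some point of the spin bundle over `x`. -/
def point (S : SpincrStructure r o) (x : M) : S.PSpin.Fib x :=
  S.PSpin.sec (S.PSpin.exists_mem_dom x).choose x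

namespace SpinorField

variable {φ : S.SpinorField}

theorem map_V {x : M} (p : S.PSpin.Fib x) :
    (φ.V x).map (S.coordsLin p) = pureSpace (φ.toFun p) := by
  ext c
  rw [Submodule.mem_map]
  constructor
  · rintro ⟨X, hX, rfl⟩
    obtain ⟨Y, hY⟩ := (mem_V_iff p).mp hX
    exact ⟨S.coordsLin p Y, hY⟩
  · rintro ⟨d, hd⟩
    refine ⟨∑ a, c a • S.frame p a, (mem_V_iff p).mpr ⟨∑ a, d a • S.frame p a, ?_⟩,
      S.coordsLin_sum p c⟩
    rw [IsPair, tcliff_eq, tcliff_eq, coordsLin_sum, coordsLin_sum, hd]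

theorem smooth_coords {X : ∀ x : M, TangentSpace (𝓡 n) x} {U : Set M} (i : S.PSpin.Index)
    (hX : SmoothFieldOn X U) :
    ContMDiffOn (𝓡 n) 𝓘(ℝ, Fin n → ℝ) ∞ (fun y => S.coordsLin (S.PSpin.sec i y) (X y))
      (U ∩ S.PSpin.dom i) :=
  contMDiffOn_pi_space.mpr fun a =>
    ((S.smooth_frame i a).mono Set.inter_subset_right).inner (hX.mono Set.inter_subset_left)

/-- Partial purity prescribes the dimension of the kernel of `pureMap`, so the constant rank lemma
gives smooth frames in coordinates. -/
theorem smooth_V (hφ : φ.IsPure) (x : M) : ∃ U : Set M, IsOpen U ∧ x ∈ U ∧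
    ∃ e : Fin (n - r) → ∀ y : M, TangentSpace (𝓡 n) y, (∀ a, SmoothFieldOn (e a) U) ∧
      ∀ y ∈ U, LinearIndependent ℝ (fun a => e a y) ∧
        Submodule.span ℝ (Set.range fun a => e a y) = φ.V y := by
  obtain ⟨i, hi⟩ := S.PSpin.exists_mem_dom x
  have hL : ContMDiffOn (𝓡 n) 𝓘(ℝ, (Fin n → ℝ) →L[ℝ] TwSpinor r n) ∞
      (fun y => pureMap (φ.toFun (S.PSpin.sec i y))) (S.PSpin.dom i) :=
    contDiff_pureMap.contMDiff.comp_contMDiffOn (φ.smooth i)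
  obtain ⟨W, hW, hWo, hxW, k, hk, hkW⟩ := exists_smooth_frame_ker (S.PSpin.isOpen_dom i) hL
    (d := n - r) (fun y _ => by
      rw [ker_pureMap (hφ y _).unit]; exact (hφ y _).finrank_pureSpace) hi
  refine ⟨W, hWo, hxW, fun a y => ∑ b, k a y b • S.frame (S.PSpin.sec i y) b, ?_, ?_⟩
  · exact fun a => SmoothFieldOn.sum fun b _ => SmoothFieldOn.smul
      (contMDiffOn_pi_space.mp (hk a) b) ((S.smooth_frame i b).mono hW)
  · intro y hy
    obtain ⟨h1, h2⟩ := hkW y hy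
    rw [ker_pureMap (hφ y _).unit] at h2
    have h3 : (S.coordsLin (S.PSpin.sec i y)) ∘
        (fun a => ∑ b, k a y b • S.frame (S.PSpin.sec i y) b) = fun a => k a y :=
      funext fun a => S.coordsLin_sum _ _
    refine ⟨LinearIndependent.of_comp (S.coordsLin (S.PSpin.sec i y)) (by rw [h3]; exact h1), ?_⟩
    apply Submodule.map_injective_of_injective (S.coordsLin_injective (S.PSpin.sec i y))
    rw [map_V, Submodule.map_span, ← Set.range_comp, h3, h2]

theorem smooth_J_of_mem (hφ : φ.IsPure) {U : Set M} {X : ∀ x : M, TangentSpace (𝓡 n) x}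
    (hXV : ∀ x, X x ∈ φ.V x) (hX : SmoothFieldOn X U) :
    SmoothFieldOn (fun x => φ.J x (X x)) U := by
  refine smoothFieldOn_of_locally fun x hx => ?_
  obtain ⟨i, hi⟩ := S.PSpin.exists_mem_dom x
  refine ⟨S.PSpin.dom i, S.PSpin.isOpen_dom i, hi, ?_⟩
  have h1 : ∀ a, ContMDiffOn (𝓡 n) 𝓘(ℝ, ℝ) ∞ (fun y => ∑ b,
      extJ (φ.toFun (S.PSpin.sec i y)) a b * S.coordsLin (S.PSpin.sec i y) (X y) b)
      (U ∩ S.PSpin.dom i) := fun a => by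
    refine contMDiffOn_finsetSum fun b _ => ContMDiffOn.mul ?_ ?_
    · exact (contDiff_extJ a b).contMDiff.comp_contMDiffOn
        ((φ.smooth i).mono Set.inter_subset_right)
    · exact contMDiffOn_pi_space.mp (smooth_coords i hX) b
  refine SmoothFieldOn.congr (SmoothFieldOn.sum (s := Finset.univ) fun a _ => SmoothFieldOn.smul
    (h1 a) ((S.smooth_frame i a).mono Set.inter_subset_right)) fun y hy => ?_
  have h2 := extJ_mulVec (hφ y (S.PSpin.sec i y)).unit (isPair_J (S.PSpin.sec i y) (hXV y))
  have h3 := S.sum_coordsLin (S.PSpin.sec i y) (φ.J y (X y))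
  have h4 : S.coordsLin (S.PSpin.sec i y) (φ.J y (X y)) = extJ (φ.toFun (S.PSpin.sec i y)) *ᵥ
    S.coordsLin (S.PSpin.sec i y) (X y) := h2.symm
  rw [h4] at h3
  exact h3.symm

/-- The almost CR structure `(V^φ, J^φ)`. -/
def toAlmostCR (hφ : φ.IsPure) : AlmostCR n r M where
  D := φ.V
  J x :=
    { toFun := fun v => ⟨φ.J x v, J_mem_V (S.point x) v.2⟩
      map_add' := fun v w => Subtype.ext
        (((isPair_J (S.point x) v.2).add (isPair_J (S.point x) w.2)).J_eq
          (ne_zero_of_unit (hφ x _).unit))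
      map_smul' := fun c v => Subtype.ext
        (((isPair_J (S.point x) v.2).smul c).J_eq (ne_zero_of_unit (hφ x _).unit)) }
  codim x := by
    have h1 := (hφ x (S.point x)).finrank_pureSpace
    have h2 := (hφ x (S.point x)).lt
    rw [← map_V, ← (Submodule.equivMapOfInjective _ (S.coordsLin_injective (S.point x))
      (φ.V x)).finrank_eq] at h1
    omega
  smooth_D := smooth_V hφ
  smooth_J U X _ hX := smooth_J_of_mem hφ (fun x => (X x).2) hX
  J_sq x v := Subtype.ext
    ((isPair_J (S.point x) v.2).symm.J_eq (ne_zero_of_unit (hφ x _).unit))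

theorem isHermitian_toAlmostCR (hφ : φ.IsPure) : (toAlmostCR hφ).IsHermitian := fun x v w =>
  (isPair_J (S.point x) v.2).inner_eq (hφ x _).unit (isPair_J (S.point x) w.2)

theorem isCR_toAlmostCR (hφ : φ.IsPure) (Ψ : S.AdaptedIdentification φ.V φ.J)
    (hi : IsIntegrable φ Ψ) : (toAlmostCR hφ).IsCR := by
  intro X Y hX hY x
  obtain ⟨i, hx⟩ := S.PSpin.exists_mem_dom x
  have hX' := (toAlmostCR hφ).smooth_J _ X isOpen_univ hX
  have hY' := (toAlmostCR hφ).smooth_J _ Y isOpen_univ hY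
  have key := cliffC_nablaC_sub Ψ φ i hx (X := fun y => X y) (Y := fun y => Y y)
    (hX.diffFieldAt Filter.univ_mem) (hX'.diffFieldAt Filter.univ_mem)
    (hY.diffFieldAt Filter.univ_mem) (hY'.diffFieldAt Filter.univ_mem)
    (Filter.Eventually.of_forall fun y => isPair_J _ (X y).2)
    (Filter.Eventually.of_forall fun y => isPair_J _ (Y y).2)
  -- What is left says that the two bracket combinations form a pair `Z·φ = iZ'·φ`; membership in
  -- `V` and `JZ = Z'` are contained in that.
  rw [hi i x hx _ (X x).2 _ (Y x).2, sub_self] at key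
  have hp : φ.IsPair (S.PSpin.sec i x) _ _ := sub_eq_zero.mp key.symm
  exact ⟨hp.mem_V, hp.symm.mem_V, Subtype.ext (hp.J_eq (ne_zero_of_unit (hφ x _).unit))⟩

end SpinorField

end SpincrStructure

end ToAlmostCR

/-! ## Invariance of partial purity under the spin group -/

section Invariance

variable {n r : ℕ}

theorem kappaSpin_conjTranspose_mul (g : Spin n) : (kappaSpin n g)ᴴ * kappaSpin n g = 1 := by
  obtain ⟨g, hg⟩ := g
  unfold Spin at hg
  induction hg using Subgroup.closure_induction with
  | mem u hu =>
    rcases hu with rfl | ⟨x, y, hx, hy, hu⟩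
    · change (kappaSpin n (negOne n))ᴴ * kappaSpin n (negOne n) = 1
      rw [kappaSpin_negOne]; simp
    · change (kappa n (u : Cl n))ᴴ * kappa n (u : Cl n) = 1
      have h1 : gammaVec n x * gammaVec n x = -1 := by
        rw [gammaVec_sq, negSq_apply, hx]; simp
      have h2 : gammaVec n y * gammaVec n y = -1 := by
        rw [gammaVec_sq, negSq_apply, hy]; simp
      rw [hu, map_mul, kappa_ι, kappa_ι, conjTranspose_mul, gammaVec_conjTranspose,
        gammaVec_conjTranspose, neg_mul_neg, mul_assoc, ← mul_assoc (gammaVec n x), h1,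
        neg_one_mul, mul_neg, h2, neg_neg]
  | one =>
    change (kappaSpin n 1)ᴴ * kappaSpin n 1 = 1
    simp
  | mul a b ha hb iha ihb =>
    change (kappaSpin n (⟨a, ha⟩ * ⟨b, hb⟩))ᴴ * kappaSpin n (⟨a, ha⟩ * ⟨b, hb⟩) = 1
    rw [map_mul, conjTranspose_mul, mul_assoc, ← mul_assoc (_ᴴ) (kappaSpin n ⟨a, ha⟩), iha, one_mul,
      ihb]
  | inv a ha iha =>
    change (kappaSpin n (⟨a, ha⟩⁻¹))ᴴ * kappaSpin n (⟨a, ha⟩⁻¹) = 1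
    have h1 : kappaSpin n ⟨a, ha⟩⁻¹ * kappaSpin n ⟨a, ha⟩ = 1 := by
      rw [← map_mul, inv_mul_cancel, map_one]
    have h2 : kappaSpin n ⟨a, ha⟩⁻¹ = (kappaSpin n ⟨a, ha⟩)ᴴ :=
      left_inv_eq_right_inv h1 (mul_eq_one_comm.mp iha)
    rw [h2, conjTranspose_conjTranspose]
    exact mul_eq_one_comm.mp iha

theorem spincrRep_conjTranspose_mul (G : Spincr n r) :
    (spincrRep n r G)ᴴ * spincrRep n r G = 1 := by
  obtain ⟨g, h, z, rfl⟩ := exists_mkSpincr G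
  have hz : star (z : ℂ) * (z : ℂ) = 1 := by
    rw [mul_comm, ← starRingEnd_apply, Complex.mul_conj, Circle.normSq_coe]; simp
  rw [spincrRep_mk, conjTranspose_kronecker, ← mul_kronecker_mul, kappaSpin_conjTranspose_mul,
    conjTranspose_smul, smul_mul_smul_comm, hz, kappaSpin_conjTranspose_mul, one_smul,
    one_kronecker_one]

theorem herm_spincrRep (G : Spincr n r) (ψ φ : TwSpinor r n) :
    herm (spincrRep n r G *ᵥ ψ) (spincrRep n r G *ᵥ φ) = herm ψ φ := by
  rw [herm_mulVec, mulVec_mulVec, spincrRep_conjTranspose_mul, one_mulVec]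

theorem comm_of_mul_eq_one {R : Type*} [Monoid R] {a b N : R} (h : a * b = 1) (h' : b * a = 1)
    (hb : b * N = N * b) : a * N = N * a := by
  have e : a * N * (b * a) = a * b * (N * a) := by
    rw [mul_assoc a b, ← mul_assoc b, hb]; simp only [mul_assoc]
  rwa [h, h', mul_one, one_mul] at e

/-- Elements of `Spin` are even. Applied to the volume element, this shows that the half-spin spaces
and the quantity in `herm_four` are respected. -/
theorem kappaSpin_comm_of_anticomm {N : Matrix (SpinIdx n) (SpinIdx n) ℂ}
    (hN : ∀ i, gamma n i * N = -(N * gamma n i)) (g : Spin n) :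
    kappaSpin n g * N = N * kappaSpin n g := by
  have hX : ∀ X, gammaVec n X * N = -(N * gammaVec n X) := fun X => by
    simp only [gammaVec_apply, Finset.sum_mul, Finset.mul_sum, smul_mul_assoc, mul_smul_comm, hN,
      smul_neg, Finset.sum_neg_distrib]
  obtain ⟨g, hg⟩ := g
  unfold Spin at hg
  induction hg using Subgroup.closure_induction with
  | mem u hu =>
    rcases hu with rfl | ⟨x, y, hx, hy, hu⟩
    · change kappaSpin n (negOne n) * N = N * kappaSpin n (negOne n)
      rw [kappaSpin_negOne, neg_one_mul, mul_neg_one]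
    · change kappa n (u : Cl n) * N = N * kappa n (u : Cl n)
      rw [hu, map_mul, kappa_ι, kappa_ι, mul_assoc, hX, mul_neg, ← mul_assoc, hX,
        neg_mul, neg_neg, mul_assoc]
  | one =>
    change kappaSpin n 1 * N = N * kappaSpin n 1
    rw [map_one, one_mul, mul_one]
  | mul a b ha hb iha ihb =>
    change kappaSpin n (⟨a, ha⟩ * ⟨b, hb⟩) * N = N * kappaSpin n (⟨a, ha⟩ * ⟨b, hb⟩)
    rw [map_mul, mul_assoc, ihb, ← mul_assoc, iha, mul_assoc]
  | inv a ha iha =>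
    change kappaSpin n (⟨a, ha⟩⁻¹) * N = N * kappaSpin n (⟨a, ha⟩⁻¹)
    have h1 : kappaSpin n ⟨a, ha⟩⁻¹ * kappaSpin n ⟨a, ha⟩ = 1 := by
      rw [← map_mul, inv_mul_cancel, map_one]
    exact comm_of_mul_eq_one h1 (mul_eq_one_comm.mp h1) iha

theorem spincrRep_actR_of_anticomm {N : Matrix (SpinIdx r) (SpinIdx r) ℂ}
    (hN : ∀ i, gamma r i * N = -(N * gamma r i)) (G : Spincr n r) (φ : TwSpinor r n) :
    actR N (spincrRep n r G *ᵥ φ) = spincrRep n r G *ᵥ actR N φ := by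
  obtain ⟨g, h, z, rfl⟩ := exists_mkSpincr G
  rw [spincrRep_mk_mulVec, spincrRep_mk_mulVec, actR_smul_right, ← actR_mul,
    ← kappaSpin_comm_of_anticomm hN h, actN_actR, ← actR_mul]

theorem actR_spincrRep (G : Spincr n r) (u v : Fin r → ℝ) (φ : TwSpinor r n) :
    actR (gammaVec r ((spincrToSOr n r G : Matrix (Fin r) (Fin r) ℝ) *ᵥ u)
        * gammaVec r ((spincrToSOr n r G : Matrix (Fin r) (Fin r) ℝ) *ᵥ v)) (spincrRep n r G *ᵥ φ)
      = spincrRep n r G *ᵥ actR (gammaVec r u * gammaVec r v) φ := by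
  have h : ∀ u (φ : TwSpinor r n),
      actR (gammaVec r ((spincrToSOr n r G : Matrix (Fin r) (Fin r) ℝ) *ᵥ u))
        (spincrRep n r G *ᵥ φ) = spincrRep n r G *ᵥ actR (gammaVec r u) φ := fun u φ => by
    rw [actR, actR, mulVec_mulVec, mulVec_mulVec, spincrRep_mul_right]
  rw [actR_mul, h, h, ← actR_mul]

/-- The volume element acts on `u_ε` by `(-1)^(r/2)` times the product of the signs, because `T u_ε
= -ε u_ε`. -/
theorem mem_deltaPlus_iff (h : ¬ (Odd r ∨ r = 2 ∨ r = 4)) (ψ : SpinIdx r → ℂ) :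
    ψ ∈ deltaPlus r ↔ omegaMat r *ᵥ ψ = ((-1 : ℂ) ^ (r / 2)) • ψ := by
  constructor
  · intro hψ
    induction hψ using Submodule.span_induction with
    | mem x hx =>
      obtain ⟨ε, he, rfl⟩ := hx
      rw [omegaMat_mulVec_uBasis, he]; simp
    | zero => simp
    | add x y _ _ hx hy => rw [mulVec_add, hx, hy, smul_add]
    | smul c x _ hx => rw [mulVec_smul, hx, smul_comm]
  · intro hψ
    have h1 := (isTwistProj_half h).mem ψ
    rw [sigmaSpace, if_neg h] at h1
    have hs : ((-1 : ℂ) ^ (r / 2)) * ((-1 : ℂ) ^ (r / 2)) = 1 := by rw [← mul_pow]; simp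
    rw [smul_mulVec, add_mulVec, one_mulVec, smul_mulVec, hψ, smul_smul, hs] at h1
    convert h1 using 1
    module

theorem kappaSpin_mulVec_mem_sigmaSpace (g : Spin r) {ψ : SpinIdx r → ℂ} (hψ : ψ ∈ sigmaSpace r) :
    kappaSpin r g *ᵥ ψ ∈ sigmaSpace r := by
  rw [sigmaSpace] at *
  split_ifs at * with h
  · exact Submodule.mem_top
  · rw [mem_deltaPlus_iff h] at *
    have hr : Even r := Nat.not_odd_iff_even.mp fun ho => h (Or.inl ho)
    rw [mulVec_mulVec, ← kappaSpin_comm_of_anticomm (omegaMat_anticomm hr) g, ← mulVec_mulVec,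
      hψ, mulVec_smul]

theorem spincrRep_mem_sigmaTensor (G : Spincr n r) {φ : TwSpinor r n} (hφ : φ ∈ sigmaTensor r n) :
    spincrRep n r G *ᵥ φ ∈ sigmaTensor r n := by
  obtain ⟨g, h, z, rfl⟩ := exists_mkSpincr G
  rw [spincrRep_mk_mulVec]
  refine Submodule.smul_mem _ _ fun b => ?_
  have e : (fun a => actR (kappaSpin r h) (actN (kappaSpin n g) φ) (a, b))
      = kappaSpin r h *ᵥ ∑ b', kappaSpin n g b b' • fun a => φ (a, b') := by
    funext a
    simp [actR, actN, mulVec, dotProduct, Fintype.sum_prod_type, kroneckerMap_apply, one_apply]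
  rw [e]
  exact kappaSpin_mulVec_mem_sigmaSpace h
    (Submodule.sum_mem _ fun b' _ => Submodule.smul_mem _ _ (hφ b'))

/-- The form `(X, Y) ↦ Re⟨X Y u v φ, φ⟩`. -/
def pairForm (φ : TwSpinor r n) (u v : Fin r → ℝ) (X Y : Fin n → ℝ) : ℝ :=
  (herm (cliff X (cliff Y (actR (gammaVec r u * gammaVec r v) φ))) φ).re

/-- The spinor `∑ Re⟨e_i e_j u v φ, φ⟩ e_i e_j φ`. -/
def contraction (φ : TwSpinor r n) (u v : Fin r → ℝ) : TwSpinor r n :=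
  ∑ i, ∑ j, pairForm φ u v (Pi.single i 1) (Pi.single j 1) •
    cliff (Pi.single i 1) (cliff (Pi.single j 1) φ)

theorem pairForm_eq_sum (φ : TwSpinor r n) (u v : Fin r → ℝ) (X Y : Fin n → ℝ) :
    pairForm φ u v X Y
      = ∑ i, ∑ j, X i * Y j * pairForm φ u v (Pi.single i 1) (Pi.single j 1) := by
  rw [pairForm, cliff_eq_sum X, herm_sum_left, Complex.re_sum]
  refine Finset.sum_congr rfl fun i _ => ?_
  rw [cliff_eq_sum Y, actN_sum_right, Finset.smul_sum, herm_sum_left, Complex.re_sum]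
  refine Finset.sum_congr rfl fun j _ => ?_
  rw [actN_rsmul_right, herm_rsmul_left, herm_rsmul_left, Complex.re_ofReal_mul,
    Complex.re_ofReal_mul, pairForm, cliff_single, cliff_single]
  ring

theorem pairForm_spincrRep (G : Spincr n r) (φ : TwSpinor r n) (u v : Fin r → ℝ)
    (X Y : Fin n → ℝ) :
    pairForm (spincrRep n r G *ᵥ φ) ((spincrToSOr n r G : Matrix (Fin r) (Fin r) ℝ) *ᵥ u)
      ((spincrToSOr n r G : Matrix (Fin r) (Fin r) ℝ) *ᵥ v)
      ((spincrToSOn n r G : Matrix (Fin n) (Fin n) ℝ) *ᵥ X)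
      ((spincrToSOn n r G : Matrix (Fin n) (Fin n) ℝ) *ᵥ Y) = pairForm φ u v X Y := by
  rw [pairForm, actR_spincrRep, cliff_spincrRep, cliff_spincrRep, herm_spincrRep, pairForm]

/-- The sum over the standard basis is unchanged when the basis is rotated. Unlike `η_{kl}`, which
refers to basis vectors, `contraction` is bilinear in `u` and `v`, so a rotation of `ℝʳ` can be
followed. -/
theorem contraction_spincrRep (G : Spincr n r) (φ : TwSpinor r n) (u v : Fin r → ℝ) :
    contraction (spincrRep n r G *ᵥ φ) ((spincrToSOr n r G : Matrix (Fin r) (Fin r) ℝ) *ᵥ u)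
      ((spincrToSOr n r G : Matrix (Fin r) (Fin r) ℝ) *ᵥ v)
      = spincrRep n r G *ᵥ contraction φ u v := by
  set R := (spincrToSOn n r G : Matrix (Fin n) (Fin n) ℝ) with hR
  have hRR : R * Rᵀ = 1 := (Matrix.mem_orthogonalGroup_iff (A := R)).mp
    (Matrix.mem_specialOrthogonalGroup_iff.mp (spincrToSOn n r G).2).1
  have h1 : ∀ a b : Fin n, pairForm (spincrRep n r G *ᵥ φ)
      ((spincrToSOr n r G : Matrix (Fin r) (Fin r) ℝ) *ᵥ u)
      ((spincrToSOr n r G : Matrix (Fin r) (Fin r) ℝ) *ᵥ v) (Pi.single a 1) (Pi.single b 1)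
      = ∑ i, ∑ j, R a i * R b j * pairForm φ u v (Pi.single i 1) (Pi.single j 1) := fun a b => by
    have h2 : ∀ a : Fin n, Pi.single a 1 = R *ᵥ (Rᵀ *ᵥ Pi.single a 1) := fun a => by
      rw [mulVec_mulVec, hRR, one_mulVec]
    rw [h2 a, h2 b, pairForm_spincrRep, pairForm_eq_sum]
    simp
  have h3 : ∀ (i : Fin n) (χ : TwSpinor r n), cliff (R *ᵥ Pi.single i 1) χ
      = ∑ a, R a i • cliff (Pi.single a 1) χ := fun i χ => by
    rw [cliff_eq_sum]; simp [cliff_single]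
  have h4 : ∀ (i j : Fin n) (χ : TwSpinor r n),
      cliff (R *ᵥ Pi.single i 1) (cliff (R *ᵥ Pi.single j 1) χ)
      = ∑ a, ∑ b, (R a i * R b j) • cliff (Pi.single a 1) (cliff (Pi.single b 1) χ) :=
    fun i j χ => by
      rw [h3]
      refine Finset.sum_congr rfl fun a _ => ?_
      rw [h3, cliff, actN_sum_right, Finset.smul_sum]
      refine Finset.sum_congr rfl fun b _ => ?_
      rw [actN_rsmul_right, smul_smul]; rfl
  have h5 : ∀ (G : Spincr n r) (χ : TwSpinor r n) (c : ℝ),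
      spincrRep n r G *ᵥ (c • χ) = c • spincrRep n r G *ᵥ χ := fun G χ c => mulVec_smul _ _ _
  simp only [contraction, mulVec_sum, h5, ← cliff_spincrRep, h1]
  rw [← hR]
  simp only [h4, Finset.smul_sum, Finset.sum_smul, smul_smul]
  calc _ = ∑ a, ∑ i, ∑ b, ∑ j, (R a i * R b j * pairForm φ u v (Pi.single i 1) (Pi.single j 1)) •
        cliff (Pi.single a 1) (cliff (Pi.single b 1) (spincrRep n r G *ᵥ φ)) :=
        Finset.sum_congr rfl fun a _ => Finset.sum_comm
    _ = ∑ i, ∑ a, ∑ b, ∑ j, (R a i * R b j * pairForm φ u v (Pi.single i 1) (Pi.single j 1)) •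
        cliff (Pi.single a 1) (cliff (Pi.single b 1) (spincrRep n r G *ᵥ φ)) := Finset.sum_comm
    _ = ∑ i, ∑ a, ∑ j, ∑ b, (R a i * R b j * pairForm φ u v (Pi.single i 1) (Pi.single j 1)) •
        cliff (Pi.single a 1) (cliff (Pi.single b 1) (spincrRep n r G *ᵥ φ)) :=
        Finset.sum_congr rfl fun i _ => Finset.sum_congr rfl fun a _ => Finset.sum_comm
    _ = ∑ i, ∑ j, ∑ a, ∑ b, (R a i * R b j * pairForm φ u v (Pi.single i 1) (Pi.single j 1)) •
        cliff (Pi.single a 1) (cliff (Pi.single b 1) (spincrRep n r G *ᵥ φ)) :=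
        Finset.sum_congr rfl fun i _ => Finset.sum_comm
    _ = _ := by
        refine Finset.sum_congr rfl fun i _ => Finset.sum_congr rfl fun j _ =>
          Finset.sum_congr rfl fun a _ => Finset.sum_congr rfl fun b _ => ?_
        rw [mul_comm]

theorem contraction_eq_sum (φ : TwSpinor r n) (u v : Fin r → ℝ) :
    contraction φ u v
      = ∑ k, ∑ l, (u k * v l) • contraction φ (Pi.single k 1) (Pi.single l 1) := by
  have h1 : ∀ X Y, pairForm φ u v X Y
      = ∑ k, ∑ l, (u k * v l) * pairForm φ (Pi.single k 1) (Pi.single l 1) X Y := fun X Y => by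
    rw [pairForm, gammaVec_apply u, gammaVec_apply v, Finset.sum_mul_sum, actR_sum, cliff,
      cliff, actN_sum_right, actN_sum_right, herm_sum_left, Complex.re_sum]
    refine Finset.sum_congr rfl fun k _ => ?_
    rw [actR_sum, actN_sum_right, actN_sum_right, herm_sum_left, Complex.re_sum]
    refine Finset.sum_congr rfl fun l _ => ?_
    rw [smul_mul_smul_comm, actR_rsmul, actN_rsmul_right, actN_rsmul_right, herm_rsmul_left,
      Complex.re_ofReal_mul, pairForm, gammaVec_single, gammaVec_single, cliff, cliff]
  simp only [contraction, h1, Finset.sum_smul, Finset.smul_sum, smul_smul]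
  calc _ = ∑ i, ∑ k, ∑ j, ∑ l, _ := Finset.sum_congr rfl fun i _ => Finset.sum_comm
    _ = ∑ k, ∑ i, ∑ j, ∑ l, _ := Finset.sum_comm
    _ = ∑ k, ∑ i, ∑ l, ∑ j, _ :=
        Finset.sum_congr rfl fun i _ => Finset.sum_congr rfl fun j _ => Finset.sum_comm
    _ = ∑ k, ∑ l, ∑ i, ∑ j, _ := Finset.sum_congr rfl fun i _ => Finset.sum_comm

theorem contraction_single_self {φ : TwSpinor r n} (hφ : herm φ φ = 1) (k : Fin r) :
    contraction φ (Pi.single k 1) (Pi.single k 1) = -((n : ℝ) • φ) := by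
  have h1 : ∀ X Y : Fin n → ℝ, pairForm φ (Pi.single k 1) (Pi.single k 1) X Y = X ⬝ᵥ Y :=
    fun X Y => by
      rw [pairForm, gammaVec_single, gamma_sq, actR_neg, actR_one, cliff_neg_right,
        cliff_neg_right, herm_neg_left, herm_cliff, neg_neg, herm_cliff_cliff_re hφ,
        dotProduct_comm]
  have h2 : ∀ i : Fin n, (∑ j, (Pi.single i 1 ⬝ᵥ Pi.single j 1 : ℝ) •
      cliff (Pi.single i 1) (cliff (Pi.single j 1) φ)) = -φ := fun i => by
    rw [Finset.sum_eq_single i]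
    · rw [cliff_cliff_self]; simp
    · intro j _ hj; simp [hj]
    · simp
  simp only [contraction, h1, h2]
  rw [Finset.sum_const, Finset.card_univ, Fintype.card_fin, smul_neg, Nat.cast_smul_eq_nsmul]

theorem sum_eq_two_smul_sum_Ioi {E : Type*} [AddCommGroup E] [Module ℝ E] (c : Fin n → Fin n → E)
    (hd : ∀ i, c i i = 0) (hs : ∀ i j, c i j = c j i) :
    ∑ i, ∑ j, c i j = (2 : ℝ) • ∑ i, ∑ j ∈ Finset.Ioi i, c i j := by
  have h1 : ∑ i, ∑ j, c i j
      = ∑ i, (∑ j ∈ Finset.Ioi i, c i j + ∑ j ∈ Finset.Iio i, c i j) := by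
    refine Finset.sum_congr rfl fun i _ => ?_
    have hu : (Finset.univ : Finset (Fin n)) = insert i (Finset.Ioi i ∪ Finset.Iio i) := by
      ext j; rcases lt_trichotomy i j with h | h | h <;> simp [h]
    rw [← Finset.sum_union, hu, Finset.sum_insert (by simp), hd, zero_add]
    rw [Finset.disjoint_left]; intro j; simp; exact fun h => h.le
  have h2 : ∑ i, ∑ j ∈ Finset.Iio i, c i j = ∑ i, ∑ j ∈ Finset.Ioi i, c i j := by
    rw [Finset.sum_comm' (t' := Finset.univ) (s' := fun j => Finset.Ioi j) (by simp)]
    exact Finset.sum_congr rfl fun i _ => Finset.sum_congr rfl fun j _ => hs j i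
  rw [h1, Finset.sum_add_distrib, h2, two_smul]

theorem contraction_single {φ : TwSpinor r n} {k l : Fin r}
    (h0 : herm (actR (gamma r k * gamma r l) φ) φ = 0) :
    contraction φ (Pi.single k 1) (Pi.single l 1) = (2 : ℝ) • twoFormAct (eta φ k l) φ := by
  rw [contraction, sum_eq_two_smul_sum_Ioi, twoFormAct]
  · refine congrArg _ (Finset.sum_congr rfl fun i _ => Finset.sum_congr rfl fun j hj => ?_)
    have e : (1 / 2 : ℝ) • (gamma n i * gamma n j + gamma n i * gamma n j)
        = gamma n i * gamma n j := by module
    rw [eta, pairForm, gammaVec_single, gammaVec_single, gammaVec_single, gammaVec_single,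
      gamma_anticomm (Finset.mem_Ioi.mp hj).ne', sub_neg_eq_add, e, cliff_single, cliff_single,
      cliff_single, cliff_single, actN_mul, actN_mul]
  · intro i
    have : pairForm φ (Pi.single k 1) (Pi.single l 1) (Pi.single i 1) (Pi.single i 1) = 0 := by
      rw [pairForm, cliff_cliff_self, gammaVec_single, gammaVec_single, herm_rsmul_left, h0,
        mul_zero, Complex.zero_re]
    rw [this, zero_smul]
  · intro i j
    by_cases hij : i = j
    · rw [hij]
    · have h1 : (Pi.single i 1 : Fin n → ℝ) ⬝ᵥ Pi.single j 1 = 0 := by simp [hij]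
      rw [pairForm, pairForm, cliff_cliff_swap h1, cliff_cliff_swap h1, herm_neg_left,
        Complex.neg_re, neg_smul_neg]

/-- The term with `u ⬝ᵥ v` only corrects the diagonal: for `u = v = f_k` the contraction is `-nφ`,
whereas `-2 f_k f_k φ` is `2φ`. It makes the formula bilinear and disappears for orthogonal vectors.
-/
theorem IsModelSpinor.contraction_eq {m : ℕ} {h : 2 * m + r = n} {ε : Fin m → ℤˣ}
    {φ : TwSpinor r n} (hφ : IsModelSpinor h ε φ) (u v : Fin r → ℝ) :
    contraction φ u v
      = -((2 : ℝ) • actR (gammaVec r u * gammaVec r v) φ + ((n + 2) * (u ⬝ᵥ v) : ℝ) • φ) := by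
  have h1 : ∀ k l, contraction φ (Pi.single k 1) (Pi.single l 1)
      = -((2 : ℝ) • actR (gamma r k * gamma r l) φ
        + ((n + 2) * ((Pi.single k 1 : Fin r → ℝ) ⬝ᵥ Pi.single l 1) : ℝ) • φ) := fun k l => by
    by_cases hkl : k = l
    · subst hkl
      rw [contraction_single_self hφ.unit, gamma_sq, actR_neg, actR_one]
      simp only [single_dotProduct, Pi.single_eq_same]
      module
    · have h0 : ∀ k l, k < l → twoFormAct (eta φ k l) φ = -actR (gamma r k * gamma r l) φ :=
        fun k l hkl => eq_neg_of_add_eq_zero_left (hφ.eta_add k l hkl)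
      rcases lt_or_gt_of_ne hkl with hlt | hlt
      · rw [contraction_single (hφ.herm_two k l hkl), h0 k l hlt]
        simp [hkl]
      · have e : contraction φ (Pi.single k 1) (Pi.single l 1)
            = -contraction φ (Pi.single l 1) (Pi.single k 1) := by
          simp only [contraction, ← Finset.sum_neg_distrib, ← neg_smul]
          refine Finset.sum_congr rfl fun i _ => Finset.sum_congr rfl fun j _ => ?_
          rw [pairForm, pairForm, gammaVec_single, gammaVec_single, gamma_anticomm hkl, actR_neg,
            cliff_neg_right, cliff_neg_right, herm_neg_left, Complex.neg_re]
        rw [e, contraction_single (hφ.herm_two l k hlt.ne), h0 l k hlt, gamma_anticomm hkl]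
        simp [hkl]
  rw [contraction_eq_sum, gammaVec_apply u, gammaVec_apply v, Finset.sum_mul_sum, actR_sum,
    dotProduct, Finset.mul_sum, Finset.sum_smul, Finset.smul_sum, ← Finset.sum_add_distrib,
    ← Finset.sum_neg_distrib]
  refine Finset.sum_congr rfl fun k _ => ?_
  have e : ((n + 2) * (u k * v k) : ℝ) • φ
      = ∑ l, (u k * v l * ((n + 2) * ((Pi.single k 1 : Fin r → ℝ) ⬝ᵥ Pi.single l 1))) • φ := by
    rw [Finset.sum_eq_single k]
    · simp only [single_dotProduct, Pi.single_eq_same]; congr 1; ring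
    · intro l _ hl; simp [hl.symm]
    · simp
  rw [e, actR_sum, Finset.smul_sum, ← Finset.sum_add_distrib, ← Finset.sum_neg_distrib]
  refine Finset.sum_congr rfl fun l _ => ?_
  rw [h1, smul_mul_smul_comm, actR_rsmul]
  module

theorem pureSpace_spincrRep (G : Spincr n r) (φ : TwSpinor r n) :
    pureSpace (spincrRep n r G *ᵥ φ) = (pureSpace φ).map
      (Matrix.toLin' (spincrToSOn n r G : Matrix (Fin n) (Fin n) ℝ)) := by
  ext X
  constructor
  · rintro ⟨Y, hY⟩
    have hR : (spincrToSOn n r G : Matrix (Fin n) (Fin n) ℝ)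
        * (spincrToSOn n r G⁻¹ : Matrix (Fin n) (Fin n) ℝ) = 1 := by
      rw [map_inv]; exact congrArg Subtype.val (mul_inv_cancel (spincrToSOn n r G))
    have h2 : ∀ X : Fin n → ℝ, spincrRep n r G⁻¹ *ᵥ cliff X (spincrRep n r G *ᵥ φ)
        = cliff ((spincrToSOn n r G⁻¹ : Matrix (Fin n) (Fin n) ℝ) *ᵥ X) φ := fun X => by
      rw [← cliff_spincrRep, mulVec_mulVec (v := φ), ← map_mul, inv_mul_cancel, map_one, one_mulVec]
    refine ⟨_, ⟨(spincrToSOn n r G⁻¹ : Matrix (Fin n) (Fin n) ℝ) *ᵥ Y, ?_⟩, (by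
      rw [Matrix.toLin'_apply, mulVec_mulVec, hR, one_mulVec] : Matrix.toLin' _
        ((spincrToSOn n r G⁻¹ : Matrix (Fin n) (Fin n) ℝ) *ᵥ X) = X)⟩
    rw [← h2, hY, mulVec_smul, h2]
  · rintro ⟨X, ⟨Y, hY⟩, rfl⟩
    exact ⟨(spincrToSOn n r G : Matrix (Fin n) (Fin n) ℝ) *ᵥ Y, by
      rw [Matrix.toLin'_apply, cliff_spincrRep, cliff_spincrRep, hY, mulVec_smul]⟩

/-- `γ_i` commutes with itself and anticommutes with the three others. -/
theorem gamma_mul_prod_four (i : Fin 4) :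
    gamma 4 i * (List.ofFn (gamma 4)).prod = -((List.ofFn (gamma 4)).prod * gamma 4 i) := by
  have h : ∀ a b : Fin 4, a ≠ b →
      ∀ N, gamma 4 a * (gamma 4 b * N) = -(gamma 4 b * (gamma 4 a * N)) :=
    fun a b hab N => by rw [← mul_assoc, gamma_anticomm hab, neg_mul, mul_assoc]
  have e : (List.ofFn (gamma 4)).prod = gamma 4 0 * (gamma 4 1 * (gamma 4 2 * gamma 4 3)) := by
    simp [List.ofFn_succ]
  have s : ∀ (a : Fin 4) N, gamma 4 a * (gamma 4 a * N) = -N := fun a N => by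
    rw [← mul_assoc, gamma_sq, neg_one_mul]
  have g := fun (a b : Fin 4) (hab : a ≠ b) => gamma_anticomm hab
  rw [e]
  fin_cases i
  · simp [mul_assoc, g 3 0, h 2 0, h 1 0, s]
  · simp [mul_assoc, g 3 1, h 2 1, h 0 1, s]
  · simp [mul_assoc, g 3 2, h 0 2, h 1 2, s]
  · simp [mul_assoc, h 0 3, h 1 3, g 2 3, s]

/-- A spinor field is tested at every point of the spin bundle, so purity is needed along the whole
orbit of the model spinor. -/
theorem IsModelSpinor.isPartiallyPure_spincrRep {m : ℕ} {h : 2 * m + r = n} {ε : Fin m → ℤˣ}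
    {φ : TwSpinor r n} (hφ : IsModelSpinor h ε φ) (hm : 0 < m) (G : Spincr n r) :
    IsPartiallyPure (spincrRep n r G *ᵥ φ) := by
  set B := (spincrToSOr n r G : Matrix (Fin r) (Fin r) ℝ) with hB
  have hBB : B * Bᵀ = 1 := (Matrix.mem_orthogonalGroup_iff (A := B)).mp
    (Matrix.mem_specialOrthogonalGroup_iff.mp (spincrToSOr n r G).2).1
  have hs : ∀ k : Fin r, Pi.single k 1 = B *ᵥ (Bᵀ *ᵥ Pi.single k 1) := fun k => by
    rw [mulVec_mulVec, hBB, one_mulVec]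
  have hdot : ∀ k l, k ≠ l → (Bᵀ *ᵥ Pi.single k 1) ⬝ᵥ (Bᵀ *ᵥ Pi.single l 1) = 0 :=
    fun k l hkl => by
      rw [dotProduct_mulVec, vecMul_transpose, mulVec_mulVec, hBB, one_mulVec]; simp [hkl]
  have hg : ∀ k l, gamma r k * gamma r l
      = gammaVec r (B *ᵥ (Bᵀ *ᵥ Pi.single k 1)) * gammaVec r (B *ᵥ (Bᵀ *ᵥ Pi.single l 1)) :=
    fun k l => by rw [← hs, ← hs, gammaVec_single, gammaVec_single]
  have h2 : ∀ k l, k ≠ l → herm (actR (gamma r k * gamma r l) (spincrRep n r G *ᵥ φ))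
      (spincrRep n r G *ᵥ φ) = 0 := fun k l hkl => by
    rw [hg, actR_spincrRep, herm_spincrRep, hφ.herm_actR_gammaVec, hdot k l hkl]; simp
  refine ⟨(hφ.isPartiallyPure hm).lt, spincrRep_mem_sigmaTensor G hφ.mem, ?_, ?_, ?_, ?_, ?_⟩
  · rw [herm_spincrRep, hφ.unit]
  · rw [pureSpace_spincrRep, ← (hφ.isPartiallyPure hm).finrank_pureSpace]
    have hi : Function.Injective (spincrToSOn n r G : Matrix (Fin n) (Fin n) ℝ).toLin' := by
      refine Function.LeftInverse.injective
        (g := (spincrToSOn n r G⁻¹ : Matrix (Fin n) (Fin n) ℝ).toLin') fun X => ?_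
      rw [Matrix.toLin'_apply, Matrix.toLin'_apply, mulVec_mulVec]
      have : (spincrToSOn n r G⁻¹ : Matrix (Fin n) (Fin n) ℝ)
          * (spincrToSOn n r G : Matrix (Fin n) (Fin n) ℝ) = 1 := by
        rw [map_inv]; exact congrArg Subtype.val (inv_mul_cancel (spincrToSOn n r G))
      rw [this, one_mulVec]
    exact (Submodule.equivMapOfInjective _ hi _).finrank_eq.symm
  · intro k l hkl
    -- These two vectors are orthogonal and `B` rotates them to `f_k` and `f_l`. The formula for the
    -- model spinor at this pair is carried to the required relation for its image.
    have e := contraction_spincrRep G φ (Bᵀ *ᵥ Pi.single k 1) (Bᵀ *ᵥ Pi.single l 1)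
    rw [← hB, ← hs, ← hs, hφ.contraction_eq, contraction_single (h2 k l hkl.ne),
      hdot k l hkl.ne, mul_zero, zero_smul, add_zero, mulVec_neg] at e
    have e2 : spincrRep n r G *ᵥ ((2 : ℝ) • actR (gammaVec r (Bᵀ *ᵥ Pi.single k 1)
        * gammaVec r (Bᵀ *ᵥ Pi.single l 1)) φ)
        = (2 : ℝ) • actR (gamma r k * gamma r l) (spincrRep n r G *ᵥ φ) := by
      rw [hg, actR_spincrRep]; exact mulVec_smul _ _ _
    rw [e2, ← smul_neg] at e
    rw [(smul_right_injective _ (two_ne_zero' ℝ)) e, neg_add_cancel]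
  · exact fun k l hkl => h2 k l hkl.ne
  · intro hr
    subst hr
    rw [spincrRep_actR_of_anticomm gamma_mul_prod_four, herm_spincrRep]
    exact (hφ.isPartiallyPure hm).herm_four rfl

end Invariance

/-! ## Orthonormal bases adapted to a complex structure on a subspace -/

set_option linter.unusedSectionVars false

section Adapted

variable {n m r : ℕ} {T : Type*} [NormedAddCommGroup T] [InnerProductSpace ℝ T]

/-- The isometry `ℝⁿ → T` given by an orthonormal basis. -/
def frameMap (b : OrthonormalBasis (Fin n) ℝ T) : (Fin n → ℝ) ≃ₗ[ℝ] T := b.toBasis.equivFun.symm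

theorem frameMap_apply (b : OrthonormalBasis (Fin n) ℝ T) (u : Fin n → ℝ) :
    frameMap b u = ∑ a, u a • b a := by
  rw [frameMap, Module.Basis.equivFun_symm_apply, OrthonormalBasis.coe_toBasis]

theorem frameMap_single (b : OrthonormalBasis (Fin n) ℝ T) (a : Fin n) :
    frameMap b (Pi.single a 1) = b a := by
  rw [frameMap_apply, Finset.sum_eq_single a] <;> simp +contextual

theorem inner_frameMap (b : OrthonormalBasis (Fin n) ℝ T) (u w : Fin n → ℝ) :
    inner ℝ (frameMap b u) (frameMap b w) = u ⬝ᵥ w := by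
  rw [frameMap_apply, frameMap_apply, b.orthonormal.inner_sum]
  simp [dotProduct]

theorem frameMap_symm_apply (b : OrthonormalBasis (Fin n) ℝ T) (X : T) (a : Fin n) :
    (frameMap b).symm X a = inner ℝ (b a) X := by
  obtain ⟨u, rfl⟩ := (frameMap b).surjective X
  rw [LinearEquiv.symm_apply_apply, ← frameMap_single b a, inner_frameMap]; simp

theorem orthonormalBasis_ext {b b' : OrthonormalBasis (Fin n) ℝ T}
    (h : ∀ u, frameMap b u = frameMap b' u) : b = b' := by
  refine DFunLike.ext _ _ fun a => ?_
  rw [← frameMap_single, h, frameMap_single]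

variable [FiniteDimensional ℝ T]

/-- The orthonormal basis given by an orthonormal family of the right size. -/
def onbOf (v : Fin n → T) (hv : Orthonormal ℝ v) (hT : Module.finrank ℝ T = n) :
    OrthonormalBasis (Fin n) ℝ T :=
  OrthonormalBasis.mk hv
    (hv.linearIndependent.span_eq_top_of_card_eq_finrank' (by simp [hT])).ge

@[simp] theorem coe_onbOf (v : Fin n → T) (hv : Orthonormal ℝ v) (hT : Module.finrank ℝ T = n) :
    ⇑(onbOf v hv hT) = v := OrthonormalBasis.coe_mk _ _

/-- The orthonormal basis obtained from `b` by a rotation. -/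
def rotateBasis (b : OrthonormalBasis (Fin n) ℝ T) (R : Matrix.specialOrthogonalGroup (Fin n) ℝ) :
    OrthonormalBasis (Fin n) ℝ T :=
  onbOf (fun a => frameMap b ((R : Matrix (Fin n) (Fin n) ℝ) *ᵥ Pi.single a 1)) (by
    rw [orthonormal_iff_ite]
    intro i j
    have hR : (R : Matrix (Fin n) (Fin n) ℝ)ᵀ * (R : Matrix (Fin n) (Fin n) ℝ) = 1 :=
      (Matrix.mem_orthogonalGroup_iff' (A := (R : Matrix (Fin n) (Fin n) ℝ))).mp
        (Matrix.mem_specialOrthogonalGroup_iff.mp R.2).1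
    rw [inner_frameMap, dotProduct_mulVec, ← mulVec_transpose, mulVec_mulVec, hR, one_mulVec]
    simp [Pi.single_apply, eq_comm])
    (by rw [Module.finrank_eq_card_basis b.toBasis, Fintype.card_fin])

theorem frameMap_rotateBasis (b : OrthonormalBasis (Fin n) ℝ T)
    (R : Matrix.specialOrthogonalGroup (Fin n) ℝ) (u : Fin n → ℝ) :
    frameMap (rotateBasis b R) u = frameMap b ((R : Matrix (Fin n) (Fin n) ℝ) *ᵥ u) := by
  rw [frameMap_apply, rotateBasis, coe_onbOf]
  simp only [← map_smul, ← map_sum, ← mulVec_smul, ← mulVec_sum]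
  congr 2
  ext a; simp [Finset.sum_apply, Pi.single_apply]

theorem toMatrix_eq_of_frameMap {b b' : OrthonormalBasis (Fin n) ℝ T}
    {R : Matrix (Fin n) (Fin n) ℝ} (h : ∀ u, frameMap b' u = frameMap b (R *ᵥ u)) :
    b.toBasis.toMatrix b'.toBasis = R := by
  ext a c
  rw [Module.Basis.toMatrix_apply, OrthonormalBasis.coe_toBasis, ← frameMap_single, h]
  have : b.toBasis.repr (frameMap b (R *ᵥ Pi.single c 1)) a
      = b.toBasis.equivFun (frameMap b (R *ᵥ Pi.single c 1)) a := rfl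
  rw [this, frameMap, LinearEquiv.apply_symm_apply]; simp

theorem orientation_rotateBasis (b : OrthonormalBasis (Fin n) ℝ T)
    (R : Matrix.specialOrthogonalGroup (Fin n) ℝ) :
    (rotateBasis b R).toBasis.orientation = b.toBasis.orientation := by
  symm
  rw [Module.Basis.orientation_eq_iff_det_pos, Module.Basis.det_apply,
    toMatrix_eq_of_frameMap (frameMap_rotateBasis b R),
    (Matrix.mem_specialOrthogonalGroup_iff.mp R.2).2]
  exact one_pos

variable {D : Submodule ℝ T} {J : D →ₗ[ℝ] D} (h : 2 * m + r = n)

variable (D J) in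
/-- The isometry given by `b` maps `ℂᵐ` complex linearly to `(D, J)`, and `ℝʳ` to `Dᗮ`. -/
structure IsAdapted (ε : Fin m → ℤˣ) (b : OrthonormalBasis (Fin n) ℝ T) : Prop where
  J_eq : ∀ z, ∃ hz : frameMap b (embD h ε z) ∈ D,
    (J ⟨_, hz⟩ : T) = frameMap b (embD h ε (Complex.I • z))
  mem_F : ∀ t, frameMap b (embF h t) ∈ Dᗮ

namespace IsAdapted

variable {h} {ε ε' : Fin m → ℤˣ} {b b' : OrthonormalBasis (Fin n) ℝ T}

theorem mem_D (hb : IsAdapted D J h ε b) (z : Fin m → ℂ) : frameMap b (embD h ε z) ∈ D :=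
  (hb.J_eq z).1

theorem exists_of_mem (hb : IsAdapted D J h ε b) {X : T} (hX : X ∈ D) :
    ∃ z, X = frameMap b (embD h ε z) := by
  obtain ⟨u, rfl⟩ := (frameMap b).surjective X
  obtain ⟨z, t, rfl⟩ := exists_embD_add_embF h ε u
  have h1 := Submodule.inner_right_of_mem_orthogonal hX (hb.mem_F t)
  rw [inner_frameMap, add_dotProduct, embD_dot_embF, zero_add, embF_dot_embF,
    dotProduct_self_eq_zero] at h1
  exact ⟨z, by rw [h1, map_zero, add_zero]⟩

theorem exists_of_mem_orthogonal (hb : IsAdapted D J h ε b) {X : T} (hX : X ∈ Dᗮ) :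
    ∃ t, X = frameMap b (embF h t) := by
  obtain ⟨u, rfl⟩ := (frameMap b).surjective X
  obtain ⟨z, t, rfl⟩ := exists_embD_add_embF h ε u
  have h1 := Submodule.inner_right_of_mem_orthogonal (hb.mem_D z) hX
  rw [inner_frameMap, dotProduct_add, embD_dot_embF, add_zero, dotProduct_self_eq_zero] at h1
  exact ⟨t, by rw [h1, zero_add]⟩

/-- Comparing two adapted frames preserves `D`, `Dᗮ`, `J` and the metric. On `ℂᵐ` it is therefore
complex linear and isometric, on `ℝʳ` isometric. -/
theorem exists_transition (hb : IsAdapted D J h ε b) (hb' : IsAdapted D J h ε' b') :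
    ∃ (A : Matrix (Fin m) (Fin m) ℂ) (B : Matrix (Fin r) (Fin r) ℝ), Aᴴ * A = 1 ∧ Bᵀ * B = 1 ∧
      (∀ z, frameMap b' (embD h ε' z) = frameMap b (embD h ε (A *ᵥ z))) ∧
      ∀ t, frameMap b' (embF h t) = frameMap b (embF h (B *ᵥ t)) := by
  choose f hf using fun z => hb.exists_of_mem (hb'.mem_D z)
  choose g hg using fun t => hb.exists_of_mem_orthogonal (hb'.mem_F t)
  have hi : ∀ {z w}, frameMap b (embD h ε z) = frameMap b (embD h ε w) → z = w := fun e =>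
    embD_injective h ε ((frameMap b).injective e)
  have hi' : ∀ {z w}, frameMap b (embF h z) = frameMap b (embF h w) → z = w := fun {z w} e => by
    have e1 := (frameMap b).injective e
    ext k
    have := congrFun e1 (ixF h k)
    rwa [embF_ixF, embF_ixF] at this
  have fI : ∀ z, f (Complex.I • z) = Complex.I • f z := fun z => by
    apply hi
    obtain ⟨h1, h2⟩ := hb'.J_eq z
    obtain ⟨h3, h4⟩ := hb.J_eq (f z)
    rw [← hf, ← h2, ← h4]
    simp only [hf z]
  have fadd : ∀ z w, f (z + w) = f z + f w := fun z w => by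
    apply hi; rw [← hf]; simp only [map_add, hf]
  have fsmul : ∀ (c : ℝ) z, f (c • z) = c • f z := fun c z => by
    apply hi; rw [← hf]; simp only [map_smul, hf]
  let L : (Fin m → ℂ) →ₗ[ℂ] (Fin m → ℂ) :=
    { toFun := f
      map_add' := fadd
      map_smul' := fun c z => by
        have e : ∀ z : Fin m → ℂ, c • z = c.re • z + c.im • (Complex.I • z) := fun z => by
          ext s; simp [Complex.ext_iff, sub_eq_add_neg]
        rw [e, fadd, fsmul, fsmul, fI, RingHom.id_apply, e] }
  let L' : (Fin r → ℝ) →ₗ[ℝ] (Fin r → ℝ) :=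
    { toFun := g
      map_add' := fun z w => by apply hi'; rw [← hg]; simp only [map_add, hg]
      map_smul' := fun c z => by
        apply hi'; rw [← hg]; simp only [map_smul, hg, RingHom.id_apply] }
  have hL : ∀ z, LinearMap.toMatrix' L *ᵥ z = f z := fun z => LinearMap.toMatrix'_mulVec L z
  have hL' : ∀ z, LinearMap.toMatrix' L' *ᵥ z = g z := fun z => LinearMap.toMatrix'_mulVec L' z
  refine ⟨LinearMap.toMatrix' L, LinearMap.toMatrix' L', ?_, ?_, fun z => ?_, fun t => ?_⟩
  · have h1 : ∀ z w, (star (f z) ⬝ᵥ f w).re = (star z ⬝ᵥ w).re := fun z w => by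
      rw [← embD_dot_embD h ε, ← inner_frameMap b, ← hf, ← hf, inner_frameMap, embD_dot_embD]
    -- The real part is the metric; the imaginary part is the real part with `iw` in place of `w`.
    have h2 : ∀ z w, star (f z) ⬝ᵥ f w = star z ⬝ᵥ w := fun z w => by
      apply Complex.ext (h1 z w)
      have := h1 z (Complex.I • w)
      rw [fI, dotProduct_smul, dotProduct_smul] at this
      simpa using this
    ext i j
    have h3 := h2 (Pi.single i 1) (Pi.single j 1)
    rw [← hL, ← hL, star_mulVec, ← dotProduct_mulVec, mulVec_mulVec] at h3
    simpa [one_apply, Pi.single_apply, eq_comm] using h3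
  · ext i j
    have h3 : g (Pi.single i 1) ⬝ᵥ g (Pi.single j 1) = Pi.single i 1 ⬝ᵥ Pi.single j 1 := by
      rw [← embF_dot_embF h, ← inner_frameMap b, ← hg, ← hg, inner_frameMap, embF_dot_embF]
    rw [← hL', ← hL', dotProduct_mulVec, vecMul_mulVec,
      ← dotProduct_mulVec] at h3
    simpa [one_apply, Pi.single_apply, eq_comm] using h3
  · rw [hL, hf]
  · rw [hL', hg]

end IsAdapted

/-- The isomorphism `ℂᵐ × ℝʳ ≃ ℝⁿ`. -/
def embDF (ε : Fin m → ℤˣ) : ((Fin m → ℂ) × (Fin r → ℝ)) ≃ₗ[ℝ] (Fin n → ℝ) :=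
  LinearEquiv.ofBijective ((embD h ε).coprod (embF h)) (by
    constructor
    · rw [injective_iff_map_eq_zero]
      rintro ⟨z, t⟩ e
      have e : embD h ε z + embF h t = 0 := e
      have e1 : t = 0 := by
        ext k
        have := congrFun e (ixF h k)
        rwa [Pi.add_apply, embD_ixF, embF_ixF, zero_add] at this
      rw [e1, map_zero, add_zero] at e
      rw [e1, embD_injective h ε (e.trans (map_zero _).symm)]; rfl
    · intro u
      obtain ⟨z, t, rfl⟩ := exists_embD_add_embF h ε u
      exact ⟨(z, t), rfl⟩)

theorem embDF_apply (ε : Fin m → ℤˣ) (z : Fin m → ℂ) (t : Fin r → ℝ) :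
    embDF h ε (z, t) = embD h ε z + embF h t := rfl

variable {h} in
-- After the conjugations recorded by the signs are undone, `R` is block diagonal, and the real
-- determinant of a complex matrix is the squared modulus of its complex determinant.
theorem det_mul_prod_signs {R : Matrix (Fin n) (Fin n) ℝ} {ε ε' : Fin m → ℤˣ}
    {A : Matrix (Fin m) (Fin m) ℂ} {B : Matrix (Fin r) (Fin r) ℝ}
    (hA : ∀ z, R *ᵥ embD h ε' z = embD h ε (A *ᵥ z))
    (hB : ∀ t, R *ᵥ embF h t = embF h (B *ᵥ t)) :
    R.det * ((∏ s, (ε s * ε' s) : ℤˣ) : ℤ) = Complex.normSq A.det * B.det := by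
  set d : Fin n → ℝ := fun a =>
    Sum.elim 1 (Sum.elim (fun s => (((ε s * ε' s : ℤˣ) : ℤ) : ℝ)) 1) ((splitEquiv h).symm a) with hd
  have hd1 : (Matrix.diagonal d).det = ((∏ s, (ε s * ε' s) : ℤˣ) : ℤ) := by
    rw [det_diagonal, ← Equiv.prod_comp (splitEquiv h)]
    simp [hd, Fintype.prod_sum_type, Units.coe_prod]
  have hdD : ∀ z, Matrix.diagonal d *ᵥ embD h ε z = embD h ε' z := fun z => by
    ext a
    obtain ⟨a, rfl⟩ := (splitEquiv h).surjective a
    rw [mulVec_diagonal]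
    rcases a with s | s | k
    · simp [hd]
    · simp only [hd, embD_inr_inl, Equiv.symm_apply_apply, Sum.elim_inr, Sum.elim_inl]
      push_cast
      linear_combination ((ε' s : ℤ) : ℝ) * (z s).im * unit_sq_cast (ε s)
    · change _ * embD h ε z (ixF h k) = embD h ε' z (ixF h k)
      simp
  have hdF : ∀ t, Matrix.diagonal d *ᵥ embF h t = embF h t := fun t => by
    ext a
    obtain ⟨a, rfl⟩ := (splitEquiv h).surjective a
    rw [mulVec_diagonal]
    rcases a with s | s | k
    · simp
    · simp
    · simp [hd]
  have key : (R * Matrix.diagonal d).toLin' = (embDF h ε).toLinearMap ∘ₗ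
      (LinearMap.prodMap (A.toLin'.restrictScalars ℝ) B.toLin') ∘ₗ
        (embDF h ε).symm.toLinearMap := by
    refine LinearMap.ext fun u => ?_
    obtain ⟨⟨z, t⟩, rfl⟩ := (embDF h ε).surjective u
    rw [LinearMap.comp_apply, LinearMap.comp_apply, LinearEquiv.coe_coe, LinearEquiv.coe_coe,
      LinearEquiv.symm_apply_apply, LinearMap.prodMap_apply, LinearMap.coe_restrictScalars,
      Matrix.toLin'_apply, Matrix.toLin'_apply, Matrix.toLin'_apply, embDF_apply, embDF_apply,
      mulVec_add, ← mulVec_mulVec, ← mulVec_mulVec, hdD, hdF, hA, hB]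
  have h2 := congrArg LinearMap.det key
  rw [LinearMap.det_toLin', det_mul, hd1, LinearMap.det_conj, LinearMap.det_prodMap,
    LinearMap.det_restrictScalars, LinearMap.det_toLin', LinearMap.det_toLin',
    Algebra.norm_complex_apply] at h2
  exact h2

/-- The signs used to adjust the orientation. -/
def signVec (m r : ℕ) (τ : ℤˣ) : Fin m → ℤˣ := fun s => if r = 0 ∧ s.val = 0 then τ else 1

variable {h} in
-- Equal orientations make the determinant of the transition positive. If `r = 0` there is no normal
-- block and the two signs must agree; if `r > 0` all signs are `1` and positivity falls on `det B`.
theorem IsAdapted.eq_of_orientation {τ τ' : ℤˣ} {b b' : OrthonormalBasis (Fin n) ℝ T}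
    (ho : b.toBasis.orientation = b'.toBasis.orientation)
    {A : Matrix (Fin m) (Fin m) ℂ} {B : Matrix (Fin r) (Fin r) ℝ} (hBB : Bᵀ * B = 1)
    (hA : ∀ z, frameMap b' (embD h (signVec m r τ') z)
      = frameMap b (embD h (signVec m r τ) (A *ᵥ z)))
    (hB : ∀ t, frameMap b' (embF h t) = frameMap b (embF h (B *ᵥ t))) :
    signVec m r τ = signVec m r τ' ∧ B.det = 1 := by
  set R := LinearMap.toMatrix' ((frameMap b').trans (frameMap b).symm).toLinearMap with hR
  have hRu : ∀ u, R *ᵥ u = (frameMap b).symm (frameMap b' u) := fun u => by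
    rw [hR, LinearMap.toMatrix'_mulVec]; rfl
  have h0 : 0 < R.det := by
    rw [Module.Basis.orientation_eq_iff_det_pos, Module.Basis.det_apply,
      toMatrix_eq_of_frameMap (R := R) fun u => by rw [hRu, LinearEquiv.apply_symm_apply]] at ho
    exact ho
  have h1 := det_mul_prod_signs (h := h) (R := R) (ε := signVec m r τ) (ε' := signVec m r τ')
    (A := A) (B := B) (fun z => by rw [hRu, hA, LinearEquiv.symm_apply_apply])
    (fun t => by rw [hRu, hB, LinearEquiv.symm_apply_apply])
  have hdet : B.det = 1 ∨ B.det = -1 := by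
    have := congrArg Matrix.det hBB
    rw [det_mul, det_transpose, det_one] at this
    exact mul_self_eq_one_iff.mp this
  have hn := Complex.normSq_nonneg A.det
  by_cases hr : r = 0
  · subst hr
    have hB1 : B.det = 1 := det_isEmpty
    refine ⟨?_, hB1⟩
    by_cases hm : m = 0
    · subst hm; exact Subsingleton.elim _ _
    · obtain ⟨m, rfl⟩ := Nat.exists_eq_succ_of_ne_zero hm
      rw [Fin.prod_univ_succ, Finset.prod_eq_one (by simp [signVec]), hB1] at h1
      simp only [signVec, Fin.val_zero, and_self, if_true, mul_one] at h1
      rcases Int.units_eq_one_or τ with rfl | rfl <;> rcases Int.units_eq_one_or τ' with rfl | rfl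
      · rfl
      · norm_num at h1; linarith
      · norm_num at h1; linarith
      · rfl
  · have e : ∀ τ, signVec m r τ = 1 := fun τ => by ext s; simp [signVec, hr]
    refine ⟨by rw [e, e], hdet.resolve_right fun hd => ?_⟩
    rw [e, e, hd] at h1
    simp at h1
    linarith

/-- The projection `ℝⁿ → ℂᵐ`. -/
def coordD (ε : Fin m → ℤˣ) : (Fin n → ℝ) →ₗ[ℝ] (Fin m → ℂ) where
  toFun v s := ⟨v (splitEquiv h (Sum.inl s)),
    ((ε s : ℤ) : ℝ) * v (splitEquiv h (Sum.inr (Sum.inl s)))⟩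
  map_add' v w := by ext s; simp [Complex.ext_iff, mul_add]
  map_smul' c v := by ext s; simp [Complex.ext_iff]; ring

@[simp] theorem coordD_embD (ε : Fin m → ℤˣ) (z : Fin m → ℂ) : coordD h ε (embD h ε z) = z := by
  ext s; apply Complex.ext <;> simp [coordD, ← mul_assoc, unit_sq_cast]

@[simp] theorem coordD_embF (ε : Fin m → ℤˣ) (t : Fin r → ℝ) : coordD h ε (embF h t) = 0 := by
  ext s; simp [coordD, Complex.ext_iff]

/-- The complex coordinates of the `D`-component of a vector. -/
def complexCoord (ε : Fin m → ℤˣ) (b : OrthonormalBasis (Fin n) ℝ T) : T →ₗ[ℝ] (Fin m → ℂ) :=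
  coordD h ε ∘ₗ (frameMap b).symm.toLinearMap

theorem complexCoord_frameMap (ε : Fin m → ℤˣ) (b : OrthonormalBasis (Fin n) ℝ T)
    (u : Fin n → ℝ) : complexCoord h ε b (frameMap b u) = coordD h ε u := by
  simp [complexCoord]

theorem complexCoord_apply (ε : Fin m → ℤˣ) (b : OrthonormalBasis (Fin n) ℝ T) (X : T)
    (s : Fin m) : complexCoord h ε b X s = (inner ℝ (b (splitEquiv h (Sum.inl s))) X : ℝ)
      + (((ε s : ℤ) : ℝ) * inner ℝ (b (splitEquiv h (Sum.inr (Sum.inl s)))) X : ℝ)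
        * Complex.I := by
  simp only [complexCoord, LinearMap.comp_apply, LinearEquiv.coe_coe, coordD, LinearMap.coe_mk,
    AddHom.coe_mk, frameMap_symm_apply]
  exact Complex.mk_eq_add_mul_I _ _

/-- The complex volume form of `(D, J)` defined by an adapted basis. -/
def volForm (ε : Fin m → ℤˣ) (b : OrthonormalBasis (Fin n) ℝ T) : T [⋀^Fin m]→ₗ[ℝ] ℂ :=
  { (Matrix.detRowAlternating (n := Fin m) (R := ℂ)).toMultilinearMap.restrictScalars ℝ with
    map_eq_zero_of_eq' := fun v _ _ hv hij =>
      (Matrix.detRowAlternating (n := Fin m) (R := ℂ)).map_eq_zero_of_eq v hv hij :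
    (Fin m → ℂ) [⋀^Fin m]→ₗ[ℝ] ℂ }.compLinearMap (complexCoord h ε b)

theorem volForm_apply (ε : Fin m → ℤˣ) (b : OrthonormalBasis (Fin n) ℝ T) (w : Fin m → T) :
    volForm h ε b w = (Matrix.of fun t => complexCoord h ε b (w t)).det := rfl

variable {h} in
-- Volume forms change by `det A`. The lifts have image `(det A)⁻¹` in `U(1)`, so the `U(1)` bundle
-- is the bundle of unit volume forms.
theorem volForm_transition {ε : Fin m → ℤˣ} {b b' : OrthonormalBasis (Fin n) ℝ T}
    {A : Matrix (Fin m) (Fin m) ℂ} {B : Matrix (Fin r) (Fin r) ℝ}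
    (hA : ∀ z, frameMap b' (embD h ε z) = frameMap b (embD h ε (A *ᵥ z)))
    (hB : ∀ t, frameMap b' (embF h t) = frameMap b (embF h (B *ᵥ t))) (w : Fin m → T) :
    volForm h ε b w = A.det * volForm h ε b' w := by
  have key : ∀ X, complexCoord h ε b X = A *ᵥ complexCoord h ε b' X := fun X => by
    obtain ⟨u, rfl⟩ := (frameMap b').surjective X
    obtain ⟨z, t, rfl⟩ := exists_embD_add_embF h ε u
    rw [complexCoord_frameMap, map_add, hA, hB, ← map_add, complexCoord_frameMap]
    simp
  rw [volForm_apply, volForm_apply, ← det_transpose A, mul_comm, ← det_mul]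
  congr 1
  ext t s
  simp [key, mulVec, dotProduct, Matrix.mul_apply, mul_comm]

namespace IsAdapted

variable {h} {ε : Fin m → ℤˣ} {b : OrthonormalBasis (Fin n) ℝ T}

theorem complexCoord_orthogonal (hb : IsAdapted D J h ε b) {X : T} (hX : X ∈ Dᗮ) :
    complexCoord h ε b X = 0 := by
  obtain ⟨t, rfl⟩ := hb.exists_of_mem_orthogonal hX
  rw [complexCoord_frameMap, coordD_embF]

theorem complexCoord_J (hb : IsAdapted D J h ε b) {X : T} (hX : X ∈ D) :
    complexCoord h ε b (J ⟨X, hX⟩) = Complex.I • complexCoord h ε b X := by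
  obtain ⟨z, rfl⟩ := hb.exists_of_mem hX
  rw [(hb.J_eq z).2, complexCoord_frameMap, complexCoord_frameMap, coordD_embD, coordD_embD]

theorem volForm_orthogonal (hb : IsAdapted D J h ε b) (w : Fin m → T) (i : Fin m)
    (hw : w i ∈ Dᗮ) : volForm h ε b w = 0 := by
  rw [volForm_apply]
  exact det_eq_zero_of_row_eq_zero i fun s => congrFun (hb.complexCoord_orthogonal hw) s

theorem volForm_update (hb : IsAdapted D J h ε b) (w : Fin m → T) (i : Fin m)
    (hw : w i ∈ D) :
    volForm h ε b (Function.update w i (J ⟨w i, hw⟩)) = Complex.I * volForm h ε b w := by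
  have e : (Matrix.of fun t => complexCoord h ε b (Function.update w i (J ⟨w i, hw⟩ : T) t))
      = (Matrix.of fun t => complexCoord h ε b (w t)).updateRow i
        (Complex.I • (Matrix.of fun t => complexCoord h ε b (w t)) i) := by
    ext t s
    by_cases ht : t = i
    · subst ht
      simp [hb.complexCoord_J hw]
    · simp [ht]
  rw [volForm_apply, volForm_apply, e, det_updateRow_smul, updateRow_eq_self]

/-- If the vectors and their images under `J` are orthonormal, the matrix of complex coordinates is
unitary and its determinant has modulus one. -/
theorem norm_volForm (hb : IsAdapted D J h ε b) (w : Fin m → T) (hw : ∀ i, w i ∈ D)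
    (ho : Orthonormal ℝ (Sum.elim w fun i => (J ⟨w i, hw i⟩ : T))) : ‖volForm h ε b w‖ = 1 := by
  choose z hz using fun i => hb.exists_of_mem (hw i)
  have hJ : ∀ i, (J ⟨w i, hw i⟩ : T) = frameMap b (embD h ε (Complex.I • z i)) := fun i => by
    rw [← (hb.J_eq (z i)).2]; simp only [hz i]
  have h1 : ∀ i j, star (z i) ⬝ᵥ z j = if i = j then 1 else 0 := fun i j => by
    have e1 := (orthonormal_iff_ite.mp ho) (Sum.inl i) (Sum.inl j)
    have e2 := (orthonormal_iff_ite.mp ho) (Sum.inl i) (Sum.inr j)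
    simp only [Sum.elim_inl, Sum.elim_inr, hJ] at e1 e2
    rw [hz i, hz j, inner_frameMap, embD_dot_embD] at e1
    rw [hz i, inner_frameMap, embD_dot_embD, dotProduct_smul] at e2
    simp at e1 e2
    apply Complex.ext
    · rw [e1]; split_ifs <;> simp
    · rw [e2]; split_ifs <;> simp
  set N : Matrix (Fin m) (Fin m) ℂ := Matrix.of fun t => complexCoord h ε b (w t) with hN
  have hNz : ∀ t s, N t s = z t s := fun t s => by
    rw [hN, of_apply, hz t, complexCoord_frameMap, coordD_embD]
  have h2 : N * Nᴴ = 1 := by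
    ext i j
    have := h1 j i
    rw [dotProduct] at this
    rw [Matrix.mul_apply, one_apply]
    simp only [conjTranspose_apply, hNz]
    rw [Finset.sum_congr rfl fun s _ => mul_comm _ _]
    simpa [eq_comm] using this
  have h3 := congrArg Matrix.det h2
  rw [det_mul, det_conjTranspose, det_one] at h3
  have h4 : ‖N.det‖ * ‖N.det‖ = 1 := by simpa using congrArg norm h3
  rw [volForm_apply, ← hN]
  nlinarith [norm_nonneg N.det]

end IsAdapted

end Adapted

/-! ## Local adapted frames -/

set_option linter.unusedSectionVars false

section PointwiseFrames

variable {n m r : ℕ} {T : Type*} [NormedAddCommGroup T] [InnerProductSpace ℝ T]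
  {D : Submodule ℝ T} {J : D →ₗ[ℝ] D}

/-- `(det J)² = (-1)^(rank D)` excludes odd rank. -/
theorem exists_rank_eq_two_mul [FiniteDimensional ℝ T] (hJ : ∀ v, J (J v) = -v) :
    ∃ m, Module.finrank ℝ D = 2 * m := by
  rcases Nat.even_or_odd (Module.finrank ℝ D) with ⟨m, hm⟩ | hd
  · exact ⟨m, by omega⟩
  · have h1 : J ∘ₗ J = (-1 : ℝ) • LinearMap.id := LinearMap.ext fun v => by simp [hJ]
    have h2 := congrArg LinearMap.det h1
    rw [LinearMap.det_comp, LinearMap.det_smul, LinearMap.det_id, hd.neg_one_pow] at h2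
    nlinarith [mul_self_nonneg (LinearMap.det J)]

theorem isAdapted_of_eq {h : 2 * m + r = n} {ε : Fin m → ℤˣ} {b : OrthonormalBasis (Fin n) ℝ T}
    (hJ : ∀ v, J (J v) = -v) (e : Fin m → D) (h1 : ∀ s, b (splitEquiv h (Sum.inl s)) = e s)
    (h2 : ∀ s, b (splitEquiv h (Sum.inr (Sum.inl s))) = ((ε s : ℤ) : ℝ) • (J (e s) : T))
    (h3 : ∀ k, b (ixF h k) ∈ Dᗮ) : IsAdapted D J h ε b := by
  have key : ∀ z : Fin m → ℂ, frameMap b (embD h ε z)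
      = (∑ s, ((z s).re • e s + (z s).im • J (e s)) : D) := fun z => by
    rw [frameMap_apply, ← Equiv.sum_comp (splitEquiv h), Fintype.sum_sum_type,
      Fintype.sum_sum_type, Submodule.coe_sum]
    have e0 : ∀ k : Fin r, embD h ε z (splitEquiv h (Sum.inr (Sum.inr k))) = 0 :=
      fun k => embD_ixF h ε z k
    simp only [embD_inl, embD_inr_inl, e0, h1, h2, zero_smul, Finset.sum_const_zero, add_zero,
      ← Finset.sum_add_distrib, Submodule.coe_add, Submodule.coe_smul]
    refine Finset.sum_congr rfl fun s _ => ?_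
    rw [smul_smul]
    congr 2
    linear_combination (z s).im * unit_sq_cast (ε s)
  refine ⟨fun z => ⟨by rw [key]; exact Subtype.prop _, ?_⟩, fun t => ?_⟩
  · have e1 : ∀ hz : frameMap b (embD h ε z) ∈ D,
        (⟨_, hz⟩ : D) = ∑ s, ((z s).re • e s + (z s).im • J (e s)) := fun hz =>
      Subtype.ext (key z)
    rw [e1, key, map_sum]
    congr 1
    refine Finset.sum_congr rfl fun s _ => ?_
    simp only [map_add, map_smul, hJ, Pi.smul_apply, smul_eq_mul, Complex.mul_re, Complex.mul_im,
      Complex.I_re, Complex.I_im]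
    module
  · rw [frameMap_apply, ← Equiv.sum_comp (splitEquiv h), Fintype.sum_sum_type,
      Fintype.sum_sum_type]
    simp only [embF_inl, embF_inr_inl, zero_smul, Finset.sum_const_zero, zero_add]
    exact Submodule.sum_mem _ fun k _ => Submodule.smul_mem _ _ (h3 k)

theorem mem_orthogonal_of_orthonormal [FiniteDimensional ℝ T] {ι : Type*} [Fintype ι] {v : ι → T}
    (hv : Orthonormal ℝ v) (hD : ∀ i, v i ∈ D) (hc : Module.finrank ℝ D = Fintype.card ι) {Y : T}
    (hY : ∀ i, inner ℝ (v i) Y = 0) : Y ∈ Dᗮ := by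
  have h1 : Submodule.span ℝ (Set.range v) = D := by
    refine Submodule.eq_of_le_of_finrank_eq (Submodule.span_le.mpr ?_) ?_
    · rintro _ ⟨i, rfl⟩; exact hD i
    · rw [finrank_span_eq_card hv.linearIndependent, hc]
  rw [← h1, Submodule.mem_orthogonal]
  intro u hu
  induction hu using Submodule.span_induction with
  | mem x hx => obtain ⟨i, rfl⟩ := hx; exact hY i
  | zero => simp
  | add x y _ _ hx hy => rw [inner_add_left, hx, hy, add_zero]
  | smul c x _ hx => rw [real_inner_smul_left, hx, mul_zero]

theorem orthonormal_sum_snoc {ι : Type*} {k : ℕ} {v : ι → T} {F : Fin k → T} {Y : T}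
    (h : Orthonormal ℝ (Sum.elim v F)) (hY : ‖Y‖ = 1)
    (h0 : ∀ i, inner ℝ (Sum.elim v F i) Y = 0) :
    Orthonormal ℝ (Sum.elim v (Fin.snoc (α := fun _ => T) F Y)) := by
  have hv : ∀ i, inner ℝ (v i) Y = 0 := fun i => h0 (Sum.inl i)
  have hF : ∀ i, inner ℝ (F i) Y = 0 := fun i => h0 (Sum.inr i)
  refine ⟨?_, ?_⟩
  · rintro (i | i)
    · exact h.1 (Sum.inl i)
    · induction i using Fin.lastCases with
      | last => simpa using hY
      | cast i => simpa using h.1 (Sum.inr i)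
  · rintro (i | i) (j | j) hij
    · exact h.2 (i := Sum.inl i) (j := Sum.inl j) (by simpa using hij)
    · induction j using Fin.lastCases with
      | last => simpa using hv i
      | cast j => simpa using h.2 (i := Sum.inl i) (j := Sum.inr j) (by simp)
    · induction i using Fin.lastCases with
      | last => simpa [real_inner_comm] using hv j
      | cast i => simpa using h.2 (i := Sum.inr i) (j := Sum.inl j) (by simp)
    · induction i using Fin.lastCases with
      | last =>
        induction j using Fin.lastCases with
        | last => exact absurd rfl hij
        | cast j => simpa [real_inner_comm] using hF j
      | cast i =>
        induction j using Fin.lastCases with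
        | last => simpa using hF i
        | cast j => simpa using h.2 (i := Sum.inr i) (j := Sum.inr j) (by simpa using hij)

end PointwiseFrames

/-! ### Smooth Gram-Schmidt and unitary frames -/

section LocalFrames

variable {n m r : ℕ} {M : Type u} [TopologicalSpace M]
  [ChartedSpace (EuclideanSpace ℝ (Fin n)) M]
  [IsManifold (𝓡 n) ∞ M] [RiemannianBundle (fun x : M => TangentSpace (𝓡 n) x)]
  [IsContMDiffRiemannianBundle (𝓡 n) ∞ (EuclideanSpace ℝ (Fin n))
    (fun x : M => TangentSpace (𝓡 n) x)]

theorem finrank_tangentSpace (x : M) : Module.finrank ℝ (TangentSpace (𝓡 n) x) = n :=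
  finrank_euclideanSpace_fin (𝕜 := ℝ) (n := n)

/-- One step of the Gram-Schmidt process for vector fields. -/
theorem exists_smooth_unit {ι : Type*} [Fintype ι] {U : Set M} (hU : IsOpen U)
    {v : ι → ∀ y : M, TangentSpace (𝓡 n) y} (hv : ∀ i, SmoothFieldOn (v i) U)
    (ho : ∀ y ∈ U, Orthonormal ℝ (fun i => v i y)) {X : ∀ y : M, TangentSpace (𝓡 n) y}
    (hX : SmoothFieldOn X U) {x : M} (hx : x ∈ U)
    (hXx : X x ∉ Submodule.span ℝ (Set.range fun i => v i x)) :
    ∃ W ⊆ U, IsOpen W ∧ x ∈ W ∧ ∃ Y : ∀ y : M, TangentSpace (𝓡 n) y, SmoothFieldOn Y W ∧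
      ∀ y ∈ W, ‖Y y‖ = 1 ∧ (∀ i, inner ℝ (v i y) (Y y) = 0) ∧
        Y y ∈ Submodule.span ℝ (insert (X y) (Set.range fun i => v i y)) := by
  set Z : ∀ y : M, TangentSpace (𝓡 n) y :=
    fun y => X y - ∑ i, (inner ℝ (v i y) (X y) : ℝ) • v i y with hZ
  have hZs : SmoothFieldOn Z U :=
    hX.sub (SmoothFieldOn.sum fun i _ => SmoothFieldOn.smul ((hv i).inner hX) (hv i))
  have hZZ := hZs.inner hZs
  have hf : ContMDiffOn (𝓡 n) 𝓘(ℝ, ℝ) ∞ (fun y => (√(inner ℝ (Z y) (Z y)))⁻¹)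
      (U ∩ (fun y => (inner ℝ (Z y) (Z y) : ℝ)) ⁻¹' {t | t ≠ 0}) := by
    intro y hy
    have h1 : ContDiffAt ℝ ∞ (fun t : ℝ => (√t)⁻¹) (inner ℝ (Z y) (Z y)) :=
      (Real.contDiffAt_sqrt hy.2).inv
        (Real.sqrt_ne_zero'.mpr (lt_of_le_of_ne real_inner_self_nonneg (Ne.symm hy.2)))
    exact ContMDiffAt.comp_contMDiffWithinAt (g := fun t : ℝ => (√t)⁻¹) y h1.contMDiffAt
      ((hZZ y hy.1).mono Set.inter_subset_left)
  refine ⟨U ∩ (fun y => (inner ℝ (Z y) (Z y) : ℝ)) ⁻¹' {t | t ≠ 0}, Set.inter_subset_left,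
    hZZ.continuousOn.isOpen_inter_preimage hU isOpen_ne, ⟨hx, ?_⟩,
    fun y => (√(inner ℝ (Z y) (Z y)))⁻¹ • Z y, hf.smul_section (hZs.mono Set.inter_subset_left),
    ?_⟩
  · intro h0
    apply hXx
    have h1 : Z x = 0 := inner_self_eq_zero.mp h0
    rw [sub_eq_zero.mp h1]
    exact Submodule.sum_mem _ fun i _ => Submodule.smul_mem _ _ (Submodule.subset_span ⟨i, rfl⟩)
  · rintro y ⟨hy, hy0⟩
    have hZ0 : Z y ≠ 0 := fun h => hy0 (by
      change (inner ℝ (Z y) (Z y) : ℝ) = 0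
      rw [h, inner_zero_left])
    refine ⟨?_, fun i => ?_, ?_⟩
    · change ‖(√(inner ℝ (Z y) (Z y)))⁻¹ • Z y‖ = 1
      rw [real_inner_self_eq_norm_sq, Real.sqrt_sq (norm_nonneg _), norm_smul, norm_inv, norm_norm,
        inv_mul_cancel₀ (norm_ne_zero_iff.mpr hZ0)]
    · have h1 := (ho y hy).inner_right_fintype (fun i => (inner ℝ (v i y) (X y) : ℝ)) i
      simp only [hZ, inner_smul_right, inner_sub_right, h1, sub_self, mul_zero]
    -- This span condition is what keeps the new vector inside `D` when the given vectors and `X`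
    -- lie there.
    · refine Submodule.smul_mem _ _ (Submodule.sub_mem _ (Submodule.subset_span (Or.inl rfl)) ?_)
      exact Submodule.sum_mem _ fun i _ => Submodule.smul_mem _ _
        (Submodule.subset_span (Or.inr ⟨i, rfl⟩))

/-- Orthonormal systems of vector fields can be completed locally. -/
theorem exists_smooth_complement {ι : Type*} [Fintype ι] {U : Set M} (hU : IsOpen U)
    {v : ι → ∀ y : M, TangentSpace (𝓡 n) y} (hv : ∀ i, SmoothFieldOn (v i) U)
    (ho : ∀ y ∈ U, Orthonormal ℝ (fun i => v i y)) {e : Fin n → ∀ y : M, TangentSpace (𝓡 n) y}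
    (he : ∀ a, SmoothFieldOn (e a) U) {x : M} (hx : x ∈ U)
    (hex : Submodule.span ℝ (Set.range fun a => e a x) = ⊤) (k : ℕ)
    (hk : Fintype.card ι + k ≤ n) :
    ∃ W ⊆ U, IsOpen W ∧ x ∈ W ∧ ∃ F : Fin k → ∀ y : M, TangentSpace (𝓡 n) y,
      (∀ a, SmoothFieldOn (F a) W) ∧
        ∀ y ∈ W, Orthonormal ℝ (Sum.elim (fun i => v i y) fun a => F a y) := by
  induction k with
  | zero =>
    refine ⟨U, subset_rfl, hU, hx, fun a => a.elim0, fun a => a.elim0, fun y hy => ?_⟩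
    refine ⟨?_, ?_⟩
    · rintro (i | i)
      · exact (ho y hy).1 i
      · exact i.elim0
    · rintro (i | i) (j | j) hij
      · exact (ho y hy).2 (by simpa using hij)
      all_goals first | exact i.elim0 | exact j.elim0
  | succ k ih =>
    obtain ⟨W, hWU, hW, hxW, F, hF, hFo⟩ := ih (by omega)
    -- Fewer than `n` orthonormal vectors do not span the tangent space, so some vector of the frame
    -- `e` lies outside their span.
    have hs : ∃ a, e a x ∉ Submodule.span ℝ (Set.range
        (Sum.elim (fun i => v i x) fun a => F a x)) := by
      by_contra! hcon
      have h1 : Submodule.span ℝ (Set.range (Sum.elim (fun i => v i x) fun a => F a x)) = ⊤ := by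
        rw [eq_top_iff, ← hex, Submodule.span_le]
        rintro _ ⟨a, rfl⟩; exact hcon a
      have h2 := finrank_span_eq_card (hFo x hxW).linearIndependent
      rw [h1, finrank_top, finrank_tangentSpace, Fintype.card_sum, Fintype.card_fin] at h2
      omega
    obtain ⟨a, ha⟩ := hs
    obtain ⟨W', hW'W, hW', hxW', Y, hY, hYo⟩ := exists_smooth_unit hW
      (v := Sum.elim v F) (fun i => by
        rcases i with i | i
        · exact (hv i).mono hWU
        · exact hF i)
      (fun y hy => by convert hFo y hy using 1; ext i; rcases i with i | i <;> rfl)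
      ((he a).mono hWU) hxW (by convert ha using 4; ext i; rcases i with i | i <;> rfl)
    refine ⟨W', hW'W.trans hWU, hW', hxW',
      Fin.snoc (α := fun _ => ∀ y : M, TangentSpace (𝓡 n) y) F Y, fun a => ?_, fun y hy => ?_⟩
    · induction a using Fin.lastCases with
      | last => simpa using hY
      | cast a => simpa using (hF a).mono hW'W
    · have h1 := orthonormal_sum_snoc (hFo y (hW'W hy)) (hYo y hy).1 (fun i => by
        rcases i with i | i
        · exact (hYo y hy).2.1 (Sum.inl i)
        · exact (hYo y hy).2.1 (Sum.inr i))
      convert h1 using 2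
      ext a
      induction a using Fin.lastCases <;> simp

namespace AlmostCR

variable (C : AlmostCR n r M)

open Classical in
/-- The complex structure of `D`, extended by zero. -/
def Jtot (x : M) (X : TangentSpace (𝓡 n) x) : TangentSpace (𝓡 n) x :=
  if hX : X ∈ C.D x then C.J x ⟨X, hX⟩ else 0

variable {C}

theorem Jtot_of_mem {x : M} {X : TangentSpace (𝓡 n) x} (hX : X ∈ C.D x) :
    C.Jtot x X = C.J x ⟨X, hX⟩ := dif_pos hX

theorem Jtot_coe {x : M} (X : C.D x) : C.Jtot x X = C.J x X := Jtot_of_mem X.2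

theorem smooth_Jtot {U : Set M} (hU : IsOpen U) {X : ∀ x : M, TangentSpace (𝓡 n) x}
    (hX : SmoothFieldOn X U) (hD : ∀ y ∈ U, X y ∈ C.D y) :
    SmoothFieldOn (fun y => C.Jtot y (X y)) U := by
  classical
  have h1 := C.smooth_J U (fun y => if hy : X y ∈ C.D y then ⟨X y, hy⟩ else 0) hU
    (hX.congr fun y hy => by rw [dif_pos (hD y hy)])
  exact h1.congr fun y hy => by rw [dif_pos (hD y hy), Jtot_of_mem (hD y hy)]

theorem IsHermitian.inner_J (hC : C.IsHermitian) {x : M} (v w : C.D x) :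
    inner ℝ (C.J x v : TangentSpace (𝓡 n) x) (w : TangentSpace (𝓡 n) x)
      = -inner ℝ (v : TangentSpace (𝓡 n) x) (C.J x w : TangentSpace (𝓡 n) x) := by
  have h1 := hC x v (C.J x w)
  rw [C.J_sq, Submodule.coe_neg, inner_neg_right] at h1
  linarith

theorem IsHermitian.inner_J_self (hC : C.IsHermitian) {x : M} (v : C.D x) :
    inner ℝ (v : TangentSpace (𝓡 n) x) (C.J x v : TangentSpace (𝓡 n) x) = 0 := by
  have h1 := hC.inner_J v v
  rw [real_inner_comm] at h1
  linarith

theorem IsHermitian.orthonormal (hC : C.IsHermitian) {x : M} {k : ℕ} {e : Fin k → C.D x}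
    (h1 : Orthonormal ℝ e)
    (h2 : ∀ s t, inner ℝ (e s : TangentSpace (𝓡 n) x) (C.J x (e t) : TangentSpace (𝓡 n) x) = 0) :
    Orthonormal ℝ (Sum.elim (fun s => (e s : TangentSpace (𝓡 n) x)) fun s => C.J x (e s)) := by
  have h1' : ∀ s t, inner ℝ (e s : TangentSpace (𝓡 n) x) (e t : TangentSpace (𝓡 n) x)
      = if s = t then (1 : ℝ) else 0 := orthonormal_iff_ite.mp h1
  rw [orthonormal_iff_ite]
  rintro (s | s) (t | t)
  · simpa using h1' s t
  · simpa using h2 s t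
  · simpa [real_inner_comm] using h2 t s
  · simpa [hC x] using h1' s t

/-- Smooth local unitary frames. -/
theorem IsHermitian.exists_unitary_frame (hC : C.IsHermitian) (hm : 2 * m + r = n) (x : M) (k : ℕ)
    (hk : k ≤ m) : ∃ W, IsOpen W ∧ x ∈ W ∧ ∃ E : Fin k → ∀ y : M, TangentSpace (𝓡 n) y,
      (∀ s, SmoothFieldOn (E s) W) ∧ (∀ s, ∀ y ∈ W, E s y ∈ C.D y) ∧
      ∀ y ∈ W, Orthonormal ℝ
        (Sum.elim (fun s => E s y) fun s => C.Jtot y (E s y)) := by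
  induction k with
  | zero =>
    refine ⟨Set.univ, isOpen_univ, trivial, fun a => a.elim0, fun a => a.elim0, fun a => a.elim0,
      fun y hy => ⟨?_, ?_⟩⟩
    · rintro (i | i) <;> exact i.elim0
    · rintro (i | i) <;> exact i.elim0
  | succ k ih =>
    obtain ⟨W₁, hW₁, hxW₁, E, hE, hED, hEo⟩ := ih (by omega)
    obtain ⟨W₂, hW₂, hxW₂, e, he, heW⟩ := C.smooth_D x
    -- The `2k` vectors found so far do not fill `D`, whose rank is `2m > 2k`.
    have hs : ∃ a, e a x ∉ Submodule.span ℝ (Set.range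
        (Sum.elim (fun s => E s x) fun s => C.Jtot x (E s x))) := by
      by_contra! hcon
      have h1 : C.D x ≤ Submodule.span ℝ (Set.range
          (Sum.elim (fun s => E s x) fun s => C.Jtot x (E s x))) := by
        rw [← (heW x hxW₂).2, Submodule.span_le]
        rintro _ ⟨a, rfl⟩; exact hcon a
      have h2 := finrank_span_eq_card (hEo x hxW₁).linearIndependent
      have h3 := Submodule.finrank_mono h1
      have h4 := C.codim x
      rw [h2, Fintype.card_sum, Fintype.card_fin] at h3
      omega
    obtain ⟨a, ha⟩ := hs
    have hJE : ∀ s, SmoothFieldOn (fun y => C.Jtot y (E s y)) W₁ := fun s =>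
      smooth_Jtot hW₁ (hE s) (hED s)
    obtain ⟨W, hWs, hW, hxW, Y, hY, hYo⟩ := exists_smooth_unit (hW₁.inter hW₂)
      (v := Sum.elim E fun s y => C.Jtot y (E s y)) (fun i => by
        rcases i with i | i
        · exact (hE i).mono Set.inter_subset_left
        · exact (hJE i).mono Set.inter_subset_left)
      (fun y hy => by convert hEo y hy.1 using 1; ext i; rcases i with i | i <;> rfl)
      ((he a).mono Set.inter_subset_right) ⟨hxW₁, hxW₂⟩
      (by convert ha using 4; ext i; rcases i with i | i <;> rfl)
    have hYD : ∀ y ∈ W, Y y ∈ C.D y := fun y hy => by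
      refine Submodule.span_le.mpr ?_ (hYo y hy).2.2
      rintro _ (rfl | ⟨i, rfl⟩)
      · rw [← (heW y (hWs hy).2).2]; exact Submodule.subset_span ⟨a, rfl⟩
      · rcases i with i | i
        · exact hED i y (hWs hy).1
        · change C.Jtot y (E i y) ∈ C.D y
          rw [Jtot_of_mem (hED i y (hWs hy).1)]; exact Subtype.prop _
    refine ⟨W, hW, hxW, Fin.snoc (α := fun _ => ∀ y : M, TangentSpace (𝓡 n) y) E Y,
      fun s => ?_, fun s => ?_, fun y hy => ?_⟩
    · induction s using Fin.lastCases with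
      | last => simpa using hY
      | cast s => simpa using (hE s).mono fun y hy => (hWs hy).1
    · induction s using Fin.lastCases with
      | last => simpa using hYD
      | cast s => simpa using fun y hy => hED s y (hWs hy).1
    · have hy1 := (hWs hy).1
      have hEY : ∀ s, inner ℝ (E s y) (Y y) = 0 := fun s => (hYo y hy).2.1 (Sum.inl s)
      have hJEY : ∀ s, inner ℝ (C.Jtot y (E s y)) (Y y) = 0 := fun s =>
        (hYo y hy).2.1 (Sum.inr s)
      have hEE := orthonormal_iff_ite.mp (hEo y hy1)
      set e' : Fin (k + 1) → C.D y :=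
        Fin.snoc (α := fun _ => C.D y) (fun s => ⟨E s y, hED s y hy1⟩) ⟨Y y, hYD y hy⟩ with he'
      have h1 : Orthonormal ℝ e' := by
        rw [orthonormal_iff_ite]
        intro s t
        induction s using Fin.lastCases with
        | last =>
          induction t using Fin.lastCases with
          | last => simp [he', (hYo y hy).1]
          | cast t =>
            simpa [he', real_inner_comm, (Fin.castSucc_lt_last t).ne'] using hEY t
        | cast s =>
          induction t using Fin.lastCases with
          | last => simpa [he', (Fin.castSucc_lt_last s).ne] using hEY s
          | cast t => simpa [he'] using hEE (Sum.inl s) (Sum.inl t)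
      -- The new vector is orthogonal to the old `E` and `JE`. Since `J` is skew, this also makes
      -- its image under `J` orthogonal to the old `E`.
      have h2 : ∀ s t, inner ℝ (e' s : TangentSpace (𝓡 n) y)
          (C.J y (e' t) : TangentSpace (𝓡 n) y) = 0 := fun s t => by
        induction s using Fin.lastCases with
        | last =>
          induction t using Fin.lastCases with
          | last => exact hC.inner_J_self _
          | cast t =>
            have := hJEY t
            rw [Jtot_of_mem (hED t y hy1), real_inner_comm] at this
            simpa [he'] using this
        | cast s =>
          induction t using Fin.lastCases with
          | last =>
            have := hJEY s
            rw [Jtot_of_mem (hED s y hy1)] at this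
            have h3 := hC.inner_J ⟨E s y, hED s y hy1⟩ ⟨Y y, hYD y hy⟩
            rw [this] at h3
            simp [he']; linarith
          | cast t =>
            have := hEE (Sum.inl s) (Sum.inr t)
            simp only [Sum.elim_inl, Sum.elim_inr, Jtot_of_mem (hED t y hy1)] at this
            simpa [he'] using this
      have h3 := hC.orthonormal h1 h2
      have h4 : ∀ s, Fin.snoc (α := fun _ => ∀ y : M, TangentSpace (𝓡 n) y) E Y s y = e' s :=
        fun s => by induction s using Fin.lastCases <;> simp [he']
      simp only [h4, Jtot_coe]
      exact h3

end AlmostCR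

end LocalFrames

set_option linter.unusedSectionVars false

/-! ### Positively oriented adapted frames -/

section AdaptedFrames

variable {n m r : ℕ}

/-- The signs that change an adapted basis into its opposite orientation, if `τ = -1`. -/
def signFrame (h : 2 * m + r = n) (τ : ℤˣ) (a : Fin n) : ℤˣ :=
  Sum.elim 1 (Sum.elim (signVec m r τ) fun k => if k.val = 0 then τ else 1) ((splitEquiv h).symm a)

/-- Exactly one vector carries the sign: the first normal one if `r > 0`, otherwise the partner
under `J` of the first vector, which exists as `m > 0`. -/
theorem prod_signFrame (h : 2 * m + r = n) (hm : 0 < m) (τ : ℤˣ) : ∏ a, signFrame h τ a = τ := by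
  rw [← Equiv.prod_comp (splitEquiv h)]
  simp only [signFrame, Equiv.symm_apply_apply, Fintype.prod_sum_type, Sum.elim_inl, Sum.elim_inr,
    Pi.one_apply, Finset.prod_const_one, one_mul]
  obtain ⟨m, rfl⟩ := Nat.exists_eq_succ_of_ne_zero hm.ne'
  rcases r with _ | r
  · rw [Fin.prod_univ_succ, Finset.prod_eq_one (by simp [signVec])]
    simp [signVec]
  · rw [Finset.prod_eq_one (by simp [signVec]), one_mul, Fin.prod_univ_succ]
    simp

theorem orthonormal_signs_smul {ι T : Type*} [NormedAddCommGroup T] [InnerProductSpace ℝ T]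
    {w : ι → T} (hw : Orthonormal ℝ w) (σ : ι → ℤˣ) :
    Orthonormal ℝ fun a => ((σ a : ℤ) : ℝ) • w a := by
  refine ⟨fun a => ?_, fun a c hac => ?_⟩
  · rcases Int.units_eq_one_or (σ a) with h | h <;> simp [h, hw.1 a]
  · simp only [real_inner_smul_left, real_inner_smul_right, hw.2 hac, mul_zero]

variable {M : Type u} [TopologicalSpace M]
  [ChartedSpace (EuclideanSpace ℝ (Fin n)) M]
  [IsManifold (𝓡 n) ∞ M] [RiemannianBundle (fun x : M => TangentSpace (𝓡 n) x)]
  [IsContMDiffRiemannianBundle (𝓡 n) ∞ (EuclideanSpace ℝ (Fin n))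
    (fun x : M => TangentSpace (𝓡 n) x)]
  {C : AlmostCR n r M}

/-- A unitary frame of `D` completed by normal vectors is adapted but may have the wrong
orientation. One sign `τ`, constant near the point, repairs it. -/
theorem AlmostCR.IsHermitian.exists_adapted_frame (hC : C.IsHermitian) (h : 2 * m + r = n)
    (hm : 0 < m) (o : ManifoldOrientation n M) (x : M) :
    ∃ W, IsOpen W ∧ x ∈ W ∧ ∃ (τ : ℤˣ) (b : ∀ y : M, OrthonormalBasis (Fin n) ℝ
      (TangentSpace (𝓡 n) y)), (∀ a, SmoothFieldOn (fun y => b y a) W) ∧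
      ∀ y ∈ W, IsAdapted (C.D y) (C.J y) h (signVec m r τ) (b y) ∧
        (b y).toBasis.orientation = o.at' y := by
  obtain ⟨W₁, hW₁, hxW₁, E, hE, hED, hEo⟩ := hC.exists_unitary_frame h x m le_rfl
  obtain ⟨U, hU, e, he, heo⟩ := o.exists_frame x
  obtain ⟨W₂, hW₂U, hW₂, hxW₂⟩ := mem_nhds_iff.mp hU
  have hJE : ∀ s, SmoothFieldOn (fun y => C.Jtot y (E s y)) W₁ := fun s =>
    AlmostCR.smooth_Jtot hW₁ (hE s) (hED s)
  obtain ⟨W, hWs, hW, hxW, F, hF, hFo⟩ := exists_smooth_complement (hW₁.inter hW₂)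
    (v := Sum.elim E fun s y => C.Jtot y (E s y)) (fun i => by
      rcases i with i | i
      · exact (hE i).mono Set.inter_subset_left
      · exact (hJE i).mono Set.inter_subset_left)
    (fun y hy => by convert hEo y hy.1 using 1; ext i; rcases i with i | i <;> rfl)
    (e := e) (fun a => (he.contMDiffOn a).mono fun y hy => hW₂U hy.2) ⟨hxW₁, hxW₂⟩
    (top_unique (he.generating (hW₂U hxW₂))) r (by simp; omega)
  set w : Fin n → ∀ y : M, TangentSpace (𝓡 n) y := fun a =>
    Sum.elim E (Sum.elim (fun s y => C.Jtot y (E s y)) F) ((splitEquiv h).symm a) with hw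
  have hws : ∀ a, SmoothFieldOn (w a) W := fun a => by
    simp only [hw]
    rcases (splitEquiv h).symm a with s | s | k
    · exact (hE s).mono fun y hy => (hWs hy).1
    · exact (hJE s).mono fun y hy => (hWs hy).1
    · exact hF k
  have hwo : ∀ y ∈ W, Orthonormal ℝ fun a => w a y := fun y hy => by
    have h1 := (hFo y hy).comp _ ((Equiv.sumAssoc (Fin m) (Fin m) (Fin r)).symm.injective.comp
      (splitEquiv h).symm.injective)
    convert h1 using 1
    ext a
    simp only [hw, Function.comp]
    rcases (splitEquiv h).symm a with s | s | k <;> rfl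
  -- The determinant relative to the positively oriented frame `e`. It is continuous, so the sign
  -- chosen at `x` remains right nearby.
  set N : M → ℝ := fun y => (Matrix.of fun a c => (inner ℝ (w a y) (e c y) : ℝ)).det with hN
  have hNc : ContinuousOn N W := by
    have h1 : ContinuousOn (fun y => (Matrix.of fun a c => (inner ℝ (w a y) (e c y) : ℝ))) W :=
      continuousOn_pi.mpr fun a => continuousOn_pi.mpr fun c =>
        ((hws a).inner ((he.contMDiffOn c).mono fun y hy => hW₂U (hWs hy).2)).continuousOn
    exact (continuous_id.matrix_det).comp_continuousOn h1
  have hdet : ∀ y ∈ W, ∀ (σ : Fin n → ℤˣ) (b : OrthonormalBasis (Fin n) ℝ (TangentSpace (𝓡 n) y)),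
      (∀ a, b a = ((σ a : ℤ) : ℝ) • w a y) → ∀ hy : y ∈ U,
      b.toBasis.det (he.toBasisAt hy) = (((∏ a, σ a : ℤˣ) : ℤ) : ℝ) * N y := by
    intro y hy σ b hb hyU
    have e1 : b.toBasis.toMatrix (he.toBasisAt hyU)
        = Matrix.of fun a c => ((σ a : ℤ) : ℝ) * (inner ℝ (w a y) (e c y) : ℝ) := by
      ext a c
      rw [Module.Basis.toMatrix_apply, OrthonormalBasis.coe_toBasis_repr_apply,
        OrthonormalBasis.repr_apply_apply, hb, real_inner_smul_left, he.toBasisAt_coe]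
      rfl
    rw [Module.Basis.det_apply, e1, hN]
    have e2 := Matrix.det_mul_column (fun a => ((σ a : ℤ) : ℝ))
      (Matrix.of fun a c => (inner ℝ (w a y) (e c y) : ℝ))
    simp only [of_apply] at e2
    rw [e2, Units.coe_prod, Int.cast_prod]
  have hNx : N x ≠ 0 := by
    have h1 := hdet x hxW 1 (onbOf _ (hwo x hxW) (finrank_tangentSpace x)) (fun a => by simp)
      (hW₂U hxW₂)
    simp at h1
    rw [← h1]
    exact (Module.Basis.isUnit_det _ _).ne_zero
  obtain ⟨τ, hτ⟩ : ∃ τ : ℤˣ, 0 < ((τ : ℤ) : ℝ) * N x := by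
    rcases lt_or_gt_of_ne hNx with h1 | h1
    · exact ⟨-1, by simpa using h1⟩
    · exact ⟨1, by simpa using h1⟩
  classical
  have hvo : ∀ y ∈ W, Orthonormal ℝ fun a => ((signFrame h τ a : ℤ) : ℝ) • w a y := fun y hy =>
    orthonormal_signs_smul (hwo y hy) _
  -- Outside `W` any orthonormal basis serves as a default.
  set b : ∀ y : M, OrthonormalBasis (Fin n) ℝ (TangentSpace (𝓡 n) y) := fun y =>
    if hy : y ∈ W then onbOf _ (hvo y hy) (finrank_tangentSpace y)
    else (stdOrthonormalBasis ℝ (TangentSpace (𝓡 n) y)).reindex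
      (finCongr (finrank_tangentSpace y)) with hb
  have hbW : ∀ y ∈ W, ∀ a, b y a = ((signFrame h τ a : ℤ) : ℝ) • w a y := fun y hy a => by
    simp only [hb, dif_pos hy, coe_onbOf]
  refine ⟨W ∩ (fun y => ((τ : ℤ) : ℝ) * N y) ⁻¹' Set.Ioi 0,
    (continuousOn_const.mul hNc).isOpen_inter_preimage hW isOpen_Ioi, ⟨hxW, hτ⟩, τ, b, fun a => ?_,
    fun y hy => ⟨?_, ?_⟩⟩
  · exact (SmoothFieldOn.smul contMDiffOn_const ((hws a).mono Set.inter_subset_left)).congr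
      fun y hy => hbW y hy.1 a
  · have hy1 := (hWs hy.1).1
    have hJ : ∀ s, C.Jtot y (E s y) = C.J y ⟨E s y, hED s y hy1⟩ := fun s => AlmostCR.Jtot_of_mem _
    refine isAdapted_of_eq (C.J_sq y) (fun s => ⟨E s y, hED s y hy1⟩) (fun s => ?_) (fun s => ?_)
      (fun k => ?_)
    · rw [hbW y hy.1]; simp [hw, signFrame]
    · rw [hbW y hy.1]; simp [hw, signFrame, hJ]
    · rw [hbW y hy.1]
      refine Submodule.smul_mem _ _ ?_
      refine mem_orthogonal_of_orthonormal (hEo y hy1) (fun i => ?_) ?_ (fun i => ?_)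
      · rcases i with s | s
        · exact hED s y hy1
        · change C.Jtot y (E s y) ∈ C.D y
          rw [hJ]; exact Subtype.prop _
      · have := C.codim y
        simp; omega
      · have h1 := (hFo y hy.1).2 (i := Sum.inl i) (j := Sum.inr k) (by simp)
        have h2 : w (ixF h k) y = F k y := by simp [hw, ixF]
        rw [h2]
        rcases i with s | s <;> exact h1
  · have hyU := hW₂U (hWs hy.1).2
    rw [← heo y hyU, Module.Basis.orientation_eq_iff_det_pos, hdet y hy.1 _ _ (hbW y hy.1) hyU,
      prod_signFrame h hm]
    exact hy.2

end AdaptedFrames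

set_option linter.unusedSectionVars false

/-! ## The spin structure of a CR structure -/

section GroupBundle

variable {n : ℕ} {M : Type u} [TopologicalSpace M] [ChartedSpace (EuclideanSpace ℝ (Fin n)) M]
  {G : Type} [Group G] {E : Type} [NormedAddCommGroup E] [NormedSpace ℝ E]

/-- A principal bundle whose fibres are copies of the group, with prescribed smooth sections. -/
def groupBundle (ρ : G → E) (dom : M → Set M) (isOpen_dom : ∀ i, IsOpen (dom i))
    (mem_dom : ∀ x, x ∈ dom x) (sec : M → M → G)
    (smooth : ∀ i j, ContMDiffOn (𝓡 n) 𝓘(ℝ, E) ∞ (fun x => ρ ((sec i x)⁻¹ * sec j x))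
      (dom i ∩ dom j)) : SmoothPrincipalBundle n M G ρ where
  Fib _ := ULift G
  act p g := ⟨p.down * g⟩
  act_one p := by simp
  act_mul p g h := by simp [mul_assoc]
  simply_transitive p q := ⟨p.down⁻¹ * q.down, by simp, fun g hg => by rw [← hg]; simp⟩
  Index := M
  dom := dom
  isOpen_dom := isOpen_dom
  exists_mem_dom x := ⟨x, mem_dom x⟩
  sec i x := ⟨sec i x⟩
  smooth_transition i j := ⟨_, fun x _ => by simp, smooth i j⟩

end GroupBundle

/-! ### Lifting the transition functions of adapted frames -/

section Atlas

variable {n m r : ℕ} {M : Type u} [TopologicalSpace M]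
  [ChartedSpace (EuclideanSpace ℝ (Fin n)) M]
  [IsManifold (𝓡 n) ∞ M] [RiemannianBundle (fun x : M => TangentSpace (𝓡 n) x)]
  [IsContMDiffRiemannianBundle (𝓡 n) ∞ (EuclideanSpace ℝ (Fin n))
    (fun x : M => TangentSpace (𝓡 n) x)]

/-- Smooth local adapted orthonormal frames. -/
structure FrameAtlas (C : AlmostCR n r M) (o : ManifoldOrientation n M) (h : 2 * m + r = n) where
  dom : M → Set M
  isOpen_dom : ∀ i, IsOpen (dom i)
  mem_dom : ∀ x, x ∈ dom x
  sgn : M → ℤˣ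
  basis : M → ∀ y : M, OrthonormalBasis (Fin n) ℝ (TangentSpace (𝓡 n) y)
  smooth : ∀ i a, SmoothFieldOn (fun y => basis i y a) (dom i)
  adapted : ∀ i, ∀ y ∈ dom i, IsAdapted (C.D y) (C.J y) h (signVec m r (sgn i)) (basis i y)
  oriented : ∀ i, ∀ y ∈ dom i, (basis i y).toBasis.orientation = o.at' y

variable {C : AlmostCR n r M} {o : ManifoldOrientation n M} {h : 2 * m + r = n}

theorem AlmostCR.IsHermitian.nonempty_frameAtlas (hC : C.IsHermitian) (o : ManifoldOrientation n M)
    (h : 2 * m + r = n) (hm : 0 < m) : Nonempty (FrameAtlas C o h) := by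
  choose W hW hxW τ b hb hba using hC.exists_adapted_frame h hm o
  exact ⟨⟨W, hW, hxW, τ, b, hb, fun i y hy => (hba i y hy).1, fun i y hy => (hba i y hy).2⟩⟩

/-- A model spinor. -/
def modelSpinor (h : 2 * m + r = n) (ε : Fin m → ℤˣ) : TwSpinor r n :=
  (exists_isModelSpinor h ε).choose

theorem isModelSpinor_modelSpinor (h : 2 * m + r = n) (ε : Fin m → ℤˣ) :
    IsModelSpinor h ε (modelSpinor h ε) := (exists_isModelSpinor h ε).choose_spec

theorem modelSpinor_ne_zero (h : 2 * m + r = n) (ε : Fin m → ℤˣ) : modelSpinor h ε ≠ 0 :=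
  ne_zero_of_unit (isModelSpinor_modelSpinor h ε).unit

theorem contDiff_det {k : ℕ} :
    ContDiff ℝ ∞ fun A : Fin k → Fin k → ℂ => (Matrix.of A).det := by
  simp only [det_apply, of_apply]
  refine ContDiff.sum fun σ _ => ContDiff.const_smul _ (contDiff_prod fun i _ => ?_)
  fun_prop

theorem contMDiffOn_volForm (h : 2 * m + r = n) (ε : Fin m → ℤˣ)
    {b : ∀ y : M, OrthonormalBasis (Fin n) ℝ (TangentSpace (𝓡 n) y)} {U : Set M}
    (hb : ∀ a, SmoothFieldOn (fun y => b y a) U) {Y : Fin m → ∀ y : M, TangentSpace (𝓡 n) y}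
    (hY : ∀ s, SmoothFieldOn (Y s) U) :
    ContMDiffOn (𝓡 n) 𝓘(ℝ, ℂ) ∞ (fun y => volForm h ε (b y) fun s => Y s y) U := by
  simp only [volForm_apply]
  refine contDiff_det.contMDiff.comp_contMDiffOn (contMDiffOn_pi_space.mpr fun t =>
    contMDiffOn_pi_space.mpr fun s => ?_)
  simp only [complexCoord_apply]
  have h1 : ContDiff ℝ ∞ fun p : ℝ × ℝ =>
      ((p.1 : ℝ) : ℂ) + ((((ε s : ℤ) : ℝ) * p.2 : ℝ) : ℂ) * Complex.I :=
    (Complex.ofRealCLM.contDiff.comp contDiff_fst).add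
      ((Complex.ofRealCLM.contDiff.comp (contDiff_const.mul contDiff_snd)).mul contDiff_const)
  exact h1.contMDiff.comp_contMDiffOn (((hb _).inner (hY t)).prodMk_space ((hb _).inner (hY t)))

namespace FrameAtlas

variable (𝔄 : FrameAtlas C o h)

/-- The signs of the atlas at a point. -/
def signs (x : M) : Fin m → ℤˣ := signVec m r (𝔄.sgn x)

/-- The value of the spinor at a point, in an adapted frame. -/
def spinor (x : M) : TwSpinor r n := modelSpinor h (𝔄.signs x)

/-- The `i`-th frame at `y` is compared with the reference frame chosen at `y`. The common
orientation gives equal signs and `det B = 1`, and `exists_isLift` then lifts the transition so that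
the model spinor is fixed. Lifting relative to a reference frame makes the cocycle condition
automatic. -/
theorem exists_sec {i y : M} (hy : y ∈ 𝔄.dom i) : 𝔄.signs y = 𝔄.signs i ∧
    ∃ G : Spincr n r,
      (∀ u, frameMap (𝔄.basis i y) u
        = frameMap (𝔄.basis y y) ((spincrToSOn n r G : Matrix (Fin n) (Fin n) ℝ) *ᵥ u)) ∧
      (∀ t, frameMap (𝔄.basis i y) (embF h t)
        = frameMap (𝔄.basis y y)
          (embF h ((spincrToSOr n r G : Matrix (Fin r) (Fin r) ℝ) *ᵥ t))) ∧
      (∀ w, (spincrToU n r G : ℂ) * volForm h (𝔄.signs y) (𝔄.basis y y) w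
        = volForm h (𝔄.signs y) (𝔄.basis i y) w) ∧
      spincrRep n r G *ᵥ 𝔄.spinor y = 𝔄.spinor y := by
  obtain ⟨A, B, hA, hB, hAu, hBu⟩ :=
    (𝔄.adapted y y (𝔄.mem_dom y)).exists_transition (𝔄.adapted i y hy)
  obtain ⟨hs, hBd⟩ := IsAdapted.eq_of_orientation
    ((𝔄.oriented y y (𝔄.mem_dom y)).trans (𝔄.oriented i y hy).symm) hB hAu hBu
  obtain ⟨G, hG⟩ := exists_isLift (isModelSpinor_modelSpinor h (𝔄.signs y)) hA hB hBd
  rw [← hs] at hAu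
  refine ⟨hs, G, fun u => ?_, fun t => ?_, fun w => ?_, hG.fix⟩
  · obtain ⟨z, t, rfl⟩ := exists_embD_add_embF h (𝔄.signs y) u
    rw [mulVec_add, hG.onD, hG.onF, map_add, map_add, ← hBu]
    congr 1
    exact hAu z
  · rw [hG.toSOr, hBu]
  · have := volForm_transition (h := h) (ε := 𝔄.signs y) hAu hBu w
    rw [this, ← mul_assoc, hG.toU, one_mul]

theorem signs_eq {i y : M} (hy : y ∈ 𝔄.dom i) : 𝔄.signs y = 𝔄.signs i := (𝔄.exists_sec hy).1

open Classical in
/-- The lift to the spin group of the local frame, relative to the frame chosen at each point. -/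
def sec (i y : M) : Spincr n r :=
  if hy : y ∈ 𝔄.dom i then (𝔄.exists_sec hy).2.choose else 1

section

variable {𝔄} {i y : M} (hy : y ∈ 𝔄.dom i)

include hy

theorem frameMap_sec (u : Fin n → ℝ) : frameMap (𝔄.basis i y) u = frameMap (𝔄.basis y y)
    ((spincrToSOn n r (𝔄.sec i y) : Matrix (Fin n) (Fin n) ℝ) *ᵥ u) := by
  rw [sec, dif_pos hy]; exact (𝔄.exists_sec hy).2.choose_spec.1 u

theorem frameMap_sec_embF (t : Fin r → ℝ) : frameMap (𝔄.basis i y) (embF h t)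
    = frameMap (𝔄.basis y y)
      (embF h ((spincrToSOr n r (𝔄.sec i y) : Matrix (Fin r) (Fin r) ℝ) *ᵥ t)) := by
  rw [sec, dif_pos hy]; exact (𝔄.exists_sec hy).2.choose_spec.2.1 t

theorem volForm_sec (w : Fin m → TangentSpace (𝓡 n) y) :
    (spincrToU n r (𝔄.sec i y) : ℂ) * volForm h (𝔄.signs y) (𝔄.basis y y) w
        = volForm h (𝔄.signs y) (𝔄.basis i y) w := by
  rw [sec, dif_pos hy]; exact (𝔄.exists_sec hy).2.choose_spec.2.2.1 w

theorem rep_sec : spincrRep n r (𝔄.sec i y) *ᵥ 𝔄.spinor y = 𝔄.spinor y := by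
  rw [sec, dif_pos hy]; exact (𝔄.exists_sec hy).2.choose_spec.2.2.2

theorem rep_sec_inv : spincrRep n r (𝔄.sec i y)⁻¹ *ᵥ 𝔄.spinor y = 𝔄.spinor y := by
  nth_rw 1 [← rep_sec hy]
  rw [mulVec_mulVec, spincrRep_inv_mul, one_mulVec]

end

variable (i j : M)

theorem toSOn_transition {y : M} (hi : y ∈ 𝔄.dom i) (hj : y ∈ 𝔄.dom j) (a c : Fin n) :
    (spincrToSOn n r ((𝔄.sec i y)⁻¹ * 𝔄.sec j y) : Matrix (Fin n) (Fin n) ℝ) a c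
      = inner ℝ (𝔄.basis i y a) (𝔄.basis j y c) := by
  have h1 : frameMap (𝔄.basis i y) ((spincrToSOn n r ((𝔄.sec i y)⁻¹ * 𝔄.sec j y) :
      Matrix (Fin n) (Fin n) ℝ) *ᵥ Pi.single c 1) = 𝔄.basis j y c := by
    rw [frameMap_sec hi, mulVec_mulVec, ← Submonoid.coe_mul, ← map_mul, mul_inv_cancel_left,
      ← frameMap_sec hj, frameMap_single]
  rw [← h1, ← frameMap_single, inner_frameMap]
  simp

theorem toSOr_transition {y : M} (hi : y ∈ 𝔄.dom i) (hj : y ∈ 𝔄.dom j) (k l : Fin r) :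
    (spincrToSOr n r ((𝔄.sec i y)⁻¹ * 𝔄.sec j y) : Matrix (Fin r) (Fin r) ℝ) k l
      = inner ℝ (𝔄.basis i y (ixF h k)) (𝔄.basis j y (ixF h l)) := by
  have h1 : frameMap (𝔄.basis i y) (embF h ((spincrToSOr n r ((𝔄.sec i y)⁻¹ * 𝔄.sec j y) :
      Matrix (Fin r) (Fin r) ℝ) *ᵥ Pi.single l 1)) = 𝔄.basis j y (ixF h l) := by
    rw [frameMap_sec_embF hi, mulVec_mulVec, ← Submonoid.coe_mul, ← map_mul, mul_inv_cancel_left,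
      ← frameMap_sec_embF hj, embF_single, frameMap_single]
  rw [← h1, ← frameMap_single, ← embF_single, inner_frameMap, embF_dot_embF]
  simp

/-- The volume form of the `i`-th frame is `1` on its own unitary basis, so evaluating that of the
`j`-th frame on the same basis gives the transition function. This expression is visibly smooth. -/
theorem toU_transition {y : M} (hi : y ∈ 𝔄.dom i) (hj : y ∈ 𝔄.dom j) :
    (spincrToU n r ((𝔄.sec i y)⁻¹ * 𝔄.sec j y) : ℂ)
      = volForm h (𝔄.signs i) (𝔄.basis j y)
          fun s => 𝔄.basis i y (splitEquiv h (Sum.inl s)) := by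
  have h1 : volForm h (𝔄.signs y) (𝔄.basis i y)
      (fun s => 𝔄.basis i y (splitEquiv h (Sum.inl s))) = 1 := by
    rw [volForm_apply, ← det_one (n := Fin m) (R := ℂ)]
    congr 1
    ext t s
    rw [of_apply, complexCoord_apply, one_apply]
    simp only [orthonormal_iff_ite.mp (𝔄.basis i y).orthonormal, EmbeddingLike.apply_eq_iff_eq,
      Sum.inl.injEq, reduceCtorEq, if_false, mul_zero, Complex.ofReal_zero, zero_mul, add_zero]
    by_cases ht : t = s
    · simp [ht]
    · simp [ht, Ne.symm ht]
  rw [← volForm_sec hi] at h1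
  rw [← 𝔄.signs_eq hi, ← volForm_sec hj, map_mul, map_inv, Circle.coe_mul, Circle.coe_inv,
    inv_mul_eq_div, div_eq_iff (by simp)]
  linear_combination -(spincrToU n r (𝔄.sec j y) : ℂ) * h1

theorem smooth_toSOn (a c : Fin n) : ContMDiffOn (𝓡 n) 𝓘(ℝ, ℝ) ∞
    (fun y => (spincrToSOn n r ((𝔄.sec i y)⁻¹ * 𝔄.sec j y) : Matrix (Fin n) (Fin n) ℝ) a c)
    (𝔄.dom i ∩ 𝔄.dom j) :=
  (((𝔄.smooth i a).mono Set.inter_subset_left).inner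
    ((𝔄.smooth j c).mono Set.inter_subset_right)).congr fun _ hy =>
      𝔄.toSOn_transition i j hy.1 hy.2 a c

theorem smooth_toSOr (k l : Fin r) : ContMDiffOn (𝓡 n) 𝓘(ℝ, ℝ) ∞
    (fun y => (spincrToSOr n r ((𝔄.sec i y)⁻¹ * 𝔄.sec j y) : Matrix (Fin r) (Fin r) ℝ) k l)
    (𝔄.dom i ∩ 𝔄.dom j) :=
  (((𝔄.smooth i _).mono Set.inter_subset_left).inner
    ((𝔄.smooth j _).mono Set.inter_subset_right)).congr fun _ hy =>
      𝔄.toSOr_transition i j hy.1 hy.2 k l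

theorem smooth_toU : ContMDiffOn (𝓡 n) 𝓘(ℝ, ℂ) ∞
    (fun y => (spincrToU n r ((𝔄.sec i y)⁻¹ * 𝔄.sec j y) : ℂ)) (𝔄.dom i ∩ 𝔄.dom j) :=
  (contMDiffOn_volForm h (𝔄.signs i)
    (fun a => (𝔄.smooth j a).mono Set.inter_subset_right)
    (fun _ => (𝔄.smooth i _).mono Set.inter_subset_left)).congr fun _ hy =>
      𝔄.toU_transition i j hy.1 hy.2

/-- Neither lift need vary smoothly with respect to the pointwise reference frames. Their quotient
relates two smooth frames and fixes a constant spinor, so it is smooth. -/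
theorem smooth_sec : ContMDiffOn (𝓡 n)
    𝓘(ℝ, SpinIdx r × SpinIdx n → SpinIdx r × SpinIdx n → ℂ) ∞
    (fun y => embSpincr n r ((𝔄.sec i y)⁻¹ * 𝔄.sec j y)) (𝔄.dom i ∩ 𝔄.dom j) := by
  refine contMDiffOn_embSpincr (modelSpinor_ne_zero h (𝔄.signs i)) (𝔄.smooth_toSOn i j)
    (𝔄.smooth_toSOr i j) fun y hy => ?_
  rw [← 𝔄.signs_eq hy.1, map_mul, ← mulVec_mulVec]
  exact (congrArg _ (rep_sec hy.2)).trans (rep_sec_inv hy.1)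

end FrameAtlas

end Atlas

set_option linter.unusedSectionVars false

/-! ### The spinor field of a CR structure -/

section OfCR

variable {n m r : ℕ} {M : Type u} [TopologicalSpace M]
  [ChartedSpace (EuclideanSpace ℝ (Fin n)) M]
  [IsManifold (𝓡 n) ∞ M] [RiemannianBundle (fun x : M => TangentSpace (𝓡 n) x)]
  [IsContMDiffRiemannianBundle (𝓡 n) ∞ (EuclideanSpace ℝ (Fin n))
    (fun x : M => TangentSpace (𝓡 n) x)]
  {C : AlmostCR n r M} {o : ManifoldOrientation n M}

/-- Every vector in `D` extends to a global section of `D`. -/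
theorem AlmostCR.exists_section_eq [T2Space M] (C : AlmostCR n r M) {x : M}
    {v : TangentSpace (𝓡 n) x} (hv : v ∈ C.D x) : ∃ X : ∀ y, C.D y,
      SmoothFieldOn (fun y => (X y : TangentSpace (𝓡 n) y)) Set.univ ∧
        (X x : TangentSpace (𝓡 n) x) = v := by
  obtain ⟨U, hU, hx, e, he, heU⟩ := C.smooth_D x
  rw [← (heU x hx).2] at hv
  obtain ⟨c, hc⟩ := (Submodule.mem_span_range_iff_exists_fun ℝ).mp hv
  obtain ⟨f, hfx, hf0, hf⟩ := SmoothFieldOn.exists_cutoff hU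
    (SmoothFieldOn.sum (s := Finset.univ) fun a _ => SmoothFieldOn.smul
      (contMDiffOn_const (c := c a)) (he a)) hx
  refine ⟨fun y => ⟨f y • ∑ a, c a • e a y, ?_⟩, hf, ?_⟩
  · by_cases hy : y ∈ U
    · refine Submodule.smul_mem _ _ (Submodule.sum_mem _ fun a _ => Submodule.smul_mem _ _ ?_)
      rw [← (heU y hy).2]; exact Submodule.subset_span ⟨a, rfl⟩
    · rw [hf0 y hy, zero_smul]; exact Submodule.zero_mem _
  · simp only [hfx, one_smul]; exact hc

namespace FrameAtlas

variable {h : 2 * m + r = n} (𝔄 : FrameAtlas C o h)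

/-- The spin structure defined by adapted frames. -/
def spincrStructure : SpincrStructure r o where
  PSpin := groupBundle (embSpincr n r) 𝔄.dom 𝔄.isOpen_dom 𝔄.mem_dom 𝔄.sec 𝔄.smooth_sec
  PSO := groupBundle (embSO r) 𝔄.dom 𝔄.isOpen_dom 𝔄.mem_dom
    (fun i y => spincrToSOr n r (𝔄.sec i y)) fun i j => by
      simp only [← map_inv, ← map_mul]
      exact contMDiffOn_pi_space.mpr fun k => contMDiffOn_pi_space.mpr fun l =>
        𝔄.smooth_toSOr i j k l
  PU := groupBundle embU 𝔄.dom 𝔄.isOpen_dom 𝔄.mem_dom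
    (fun i y => spincrToU n r (𝔄.sec i y)) fun i j => by
      simp only [← map_inv, ← map_mul]
      exact 𝔄.smooth_toU i j
  frame {x} p := rotateBasis (𝔄.basis x x) (spincrToSOn n r p.down)
  frame_oriented {x} p := by
    rw [orientation_rotateBasis, 𝔄.oriented x x (𝔄.mem_dom x)]
  frame_act {x} p g a := by
    rw [← frameMap_single, frameMap_rotateBasis]
    change frameMap _ ((spincrToSOn n r (p.down * g) : Matrix (Fin n) (Fin n) ℝ) *ᵥ _) = _
    rw [map_mul, Submonoid.coe_mul, ← mulVec_mulVec, ← frameMap_rotateBasis, frameMap_apply]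
    simp
  smooth_frame i a := by
    refine (𝔄.smooth i a).congr fun y hy => ?_
    rw [← frameMap_single, ← frameMap_single, frameMap_rotateBasis]
    exact (frameMap_sec hy _).symm
  toSO p := ⟨spincrToSOr n r p.down⟩
  toSO_act p g := congrArg ULift.up (map_mul _ _ _)
  smooth_toSO i j := by
    refine ⟨fun y => spincrToSOr n r ((𝔄.sec j y)⁻¹ * 𝔄.sec i y), fun y _ => ?_, ?_⟩
    · refine congrArg ULift.up ?_
      change spincrToSOr n r (𝔄.sec j y) * _ = spincrToSOr n r (𝔄.sec i y)
      rw [← map_mul, mul_inv_cancel_left]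
    · rw [Set.inter_comm]
      exact contMDiffOn_pi_space.mpr fun k => contMDiffOn_pi_space.mpr fun l =>
        𝔄.smooth_toSOr j i k l
  toU p := ⟨spincrToU n r p.down⟩
  toU_act p g := congrArg ULift.up (map_mul _ _ _)
  smooth_toU i j := by
    refine ⟨fun y => spincrToU n r ((𝔄.sec j y)⁻¹ * 𝔄.sec i y), fun y _ => ?_, ?_⟩
    · refine congrArg ULift.up ?_
      change spincrToU n r (𝔄.sec j y) * _ = spincrToU n r (𝔄.sec i y)
      rw [← map_mul, mul_inv_cancel_left]
    · rw [Set.inter_comm]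
      exact 𝔄.smooth_toU j i

/-- The spinor field which is constant in adapted frames. -/
def spinorField : 𝔄.spincrStructure.SpinorField where
  toFun {x} p := spincrRep n r p.down⁻¹ *ᵥ 𝔄.spinor x
  equivariant {x} p g := by
    change spincrRep n r (p.down * g)⁻¹ *ᵥ _ = _
    rw [_root_.mul_inv_rev, map_mul, mulVec_mulVec]
  smooth i := by
    refine ContMDiffOn.congr (f := fun _ => modelSpinor h (𝔄.signs i)) contMDiffOn_const
      fun y hy => ?_
    exact (rep_sec_inv hy).trans (congrArg (modelSpinor h) (𝔄.signs_eq hy))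

theorem spinorField_apply {x : M} (p : 𝔄.spincrStructure.PSpin.Fib x) :
    𝔄.spinorField.toFun p = spincrRep n r p.down⁻¹ *ᵥ 𝔄.spinor x := rfl

theorem isPure_spinorField (hm : 0 < m) : 𝔄.spinorField.IsPure := fun x _ =>
  (isModelSpinor_modelSpinor h (𝔄.signs x)).isPartiallyPure_spincrRep hm _

variable {𝔄}

/-- The point of the spin bundle given by the chosen frame. -/
def basePoint (𝔄 : FrameAtlas C o h) (x : M) : 𝔄.spincrStructure.PSpin.Fib x := ⟨1⟩

theorem toFun_basePoint (x : M) : 𝔄.spinorField.toFun (𝔄.basePoint x) = 𝔄.spinor x := by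
  rw [spinorField_apply]
  change spincrRep n r (1 : Spincr n r)⁻¹ *ᵥ _ = _
  rw [inv_one, map_one, one_mulVec]

theorem coordsLin_basePoint {x : M} (u : Fin n → ℝ) :
    𝔄.spincrStructure.coordsLin (𝔄.basePoint x) (frameMap (𝔄.basis x x) u) = u := by
  have h1 : 𝔄.spincrStructure.frame (𝔄.basePoint x) = 𝔄.basis x x :=
      orthonormalBasis_ext fun u => by
    change frameMap (rotateBasis (𝔄.basis x x) (spincrToSOn n r 1)) u = _
    rw [frameMap_rotateBasis, map_one]; simp
  funext a
  rw [SpincrStructure.coordsLin_apply, h1]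
  simp only [← frameMap_symm_apply, LinearEquiv.symm_apply_apply]

theorem isPair_J {x : M} (X : C.D x) : 𝔄.spinorField.IsPair (𝔄.basePoint x)
    (X : TangentSpace (𝓡 n) x) (C.J x X : TangentSpace (𝓡 n) x) := by
  obtain ⟨X, hX⟩ := X
  have hA := 𝔄.adapted x x (𝔄.mem_dom x)
  obtain ⟨z, rfl⟩ := hA.exists_of_mem hX
  rw [(hA.J_eq z).2, SpincrStructure.SpinorField.IsPair, SpincrStructure.tcliff_eq,
    SpincrStructure.tcliff_eq, coordsLin_basePoint, coordsLin_basePoint, toFun_basePoint]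
  exact (isModelSpinor_modelSpinor h (𝔄.signs x)).vacuum z

/-- At the reference point of the fibre the field is the model spinor, whose pure space is `ℂᵐ`, and
the reference frame maps `ℂᵐ` onto `D`. -/
theorem V_spinorField (x : M) : 𝔄.spinorField.V x = C.D x := by
  apply le_antisymm
  · intro X hX
    have h1 : 𝔄.spincrStructure.coordsLin (𝔄.basePoint x) X
        ∈ pureSpace (𝔄.spinorField.toFun (𝔄.basePoint x)) := by
      rw [← SpincrStructure.SpinorField.map_V]
      exact Submodule.mem_map_of_mem hX
    rw [toFun_basePoint, spinor, (isModelSpinor_modelSpinor h (𝔄.signs x)).pureSpace_eq] at h1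
    obtain ⟨z, hz⟩ := h1
    have h2 : X = frameMap (𝔄.basis x x) (embD h (𝔄.signs x) z) :=
      𝔄.spincrStructure.coordsLin_injective (𝔄.basePoint x) (by rw [coordsLin_basePoint, hz])
    rw [h2]
    exact (𝔄.adapted x x (𝔄.mem_dom x)).mem_D z
  · exact fun X hX => (𝔄.isPair_J ⟨X, hX⟩).mem_V

theorem J_spinorField {x : M} (X : C.D x) :
    𝔄.spinorField.J x X = (C.J x X : TangentSpace (𝓡 n) x) :=
  (𝔄.isPair_J X).J_eq (by rw [toFun_basePoint]; exact modelSpinor_ne_zero _ _)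

end FrameAtlas

/-! ### Normal frames, volume forms and integrability -/

section Identification

variable {h : 2 * ((n - r) / 2) + r = n} (𝔄 : FrameAtlas C o h)

namespace FrameAtlas

theorem isUnitAnticanonical_volForm {x : M} (q : Circle) :
    IsUnitAnticanonical 𝔄.spinorField.V 𝔄.spinorField.J x
      ((q : ℂ) • volForm h (𝔄.signs x) (𝔄.basis x x)) := by
  have hA := 𝔄.adapted x x (𝔄.mem_dom x)
  have hJ : ∀ w : TangentSpace (𝓡 n) x, ∀ hw : w ∈ C.D x,
      𝔄.spinorField.J x w = (C.J x ⟨w, hw⟩ : TangentSpace (𝓡 n) x) := fun w hw =>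
    J_spinorField (⟨w, hw⟩ : C.D x)
  refine ⟨fun w i hw => ?_, fun w hw i => ?_, fun w hw ho => ?_⟩
  · rw [V_spinorField] at hw
    rw [AlternatingMap.smul_apply]
    exact (congrArg _ (hA.volForm_orthogonal w i hw)).trans (smul_zero _)
  · simp only [V_spinorField] at hw
    rw [hJ _ (hw i), AlternatingMap.smul_apply, AlternatingMap.smul_apply]
    refine (congrArg _ (hA.volForm_update w i (hw i))).trans ?_
    simp only [smul_eq_mul]
    exact mul_left_comm _ _ _
  · simp only [V_spinorField] at hw
    simp only [fun i => hJ _ (hw i)] at ho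
    rw [AlternatingMap.smul_apply, norm_smul, Circle.norm_coe, one_mul]
    exact hA.norm_volForm w hw ho

theorem frameMap_embF_mul {T : Type*} [NormedAddCommGroup T] [InnerProductSpace ℝ T]
    (b : OrthonormalBasis (Fin n) ℝ T) (B A : Matrix.specialOrthogonalGroup (Fin r) ℝ)
    (k : Fin r) : frameMap b (embF h (((B * A : Matrix.specialOrthogonalGroup (Fin r) ℝ) :
      Matrix (Fin r) (Fin r) ℝ) *ᵥ Pi.single k 1))
      = ∑ l, (A : Matrix (Fin r) (Fin r) ℝ) l k •
        frameMap b (embF h ((B : Matrix (Fin r) (Fin r) ℝ) *ᵥ Pi.single l 1)) := by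
  have e : (A : Matrix (Fin r) (Fin r) ℝ) *ᵥ Pi.single k 1
      = ∑ l, (A : Matrix (Fin r) (Fin r) ℝ) l k • (Pi.single l 1 : Fin r → ℝ) := by
    ext l; simp [Finset.sum_apply, Pi.single_apply]
  rw [Submonoid.coe_mul, ← mulVec_mulVec, e, mulVec_sum, map_sum, map_sum]
  simp only [mulVec_smul, map_smul]

theorem orthonormal_frameMap_embF {T : Type*} [NormedAddCommGroup T] [InnerProductSpace ℝ T]
    (b : OrthonormalBasis (Fin n) ℝ T) (B : Matrix.specialOrthogonalGroup (Fin r) ℝ) :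
    Orthonormal ℝ fun k =>
      frameMap b (embF h ((B : Matrix (Fin r) (Fin r) ℝ) *ᵥ Pi.single k 1)) := by
  rw [orthonormal_iff_ite]
  intro k l
  have hR : (B : Matrix (Fin r) (Fin r) ℝ)ᵀ * (B : Matrix (Fin r) (Fin r) ℝ) = 1 :=
    (Matrix.mem_orthogonalGroup_iff' (A := (B : Matrix (Fin r) (Fin r) ℝ))).mp
      (Matrix.mem_specialOrthogonalGroup_iff.mp B.2).1
  rw [inner_frameMap, embF_dot_embF, dotProduct_mulVec, ← mulVec_transpose, mulVec_mulVec, hR,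
    one_mulVec]
  simp [Pi.single_apply, eq_comm]

/-- The identifications of the auxiliary bundles. -/
def identification :
    𝔄.spincrStructure.AdaptedIdentification 𝔄.spinorField.V 𝔄.spinorField.J where
  normalFrame {x} q k := frameMap (𝔄.basis x x)
    (embF h ((q.down : Matrix (Fin r) (Fin r) ℝ) *ᵥ Pi.single k 1))
  normalFrame_mem {x} q k := by
    rw [V_spinorField]; exact (𝔄.adapted x x (𝔄.mem_dom x)).mem_F _
  normalFrame_orthonormal {x} q := orthonormal_frameMap_embF _ _
  normalFrame_act {x} q A k := frameMap_embF_mul _ _ _ k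
  smooth_normalFrame j k := by
    refine (𝔄.smooth j (ixF h k)).congr fun y hy => ?_
    rw [← frameMap_single, ← embF_single]
    exact (frameMap_sec_embF hy _).symm
  anticanonical {x} q := (q.down : ℂ) • volForm h (𝔄.signs x) (𝔄.basis x x)
  anticanonical_unit {x} q := 𝔄.isUnitAnticanonical_volForm q.down
  anticanonical_act {x} q z := by
    change ((q.down * z : Circle) : ℂ) • volForm h (𝔄.signs x) (𝔄.basis x x) = _
    rw [mul_comm, Circle.coe_mul, mul_smul]
  smooth_anticanonical j U Y hU hUj hY := by
    refine (contMDiffOn_volForm h (𝔄.signs j) (fun a => (𝔄.smooth j a).mono hUj)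
      fun s => (hY s).1).congr fun y hy => ?_
    rw [← 𝔄.signs_eq (hUj hy), ← volForm_sec (hUj hy)]
    rfl

/-- The computation of `isCR_toAlmostCR` read backwards. The CR condition is stated for global
sections and the spinor equation for vectors at a point, so the vectors are first extended. -/
theorem isIntegrable_spinorField [T2Space M] (hCR : C.IsCR) :
    SpincrStructure.IsIntegrable 𝔄.spinorField 𝔄.identification := by
  intro i x hx v hv w hw
  rw [V_spinorField] at hv hw
  obtain ⟨X, hX, rfl⟩ := C.exists_section_eq hv
  obtain ⟨Y, hY, rfl⟩ := C.exists_section_eq hw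
  have hJ : ∀ X : ∀ y, C.D y, (fun y => 𝔄.spinorField.J y (X y))
      = fun y => (C.J y (X y) : TangentSpace (𝓡 n) y) := fun X =>
    funext fun y => J_spinorField (X y)
  have hd : ∀ X : ∀ y, C.D y, SmoothFieldOn (fun y => (X y : TangentSpace (𝓡 n) y)) Set.univ →
      DiffFieldAt (fun y => 𝔄.spinorField.J y (X y)) x := fun X hX => by
    rw [hJ]; exact (C.smooth_J _ X isOpen_univ hX).diffFieldAt Filter.univ_mem
  have hp : ∀ (X : ∀ y, C.D y) (y : M), 𝔄.spinorField.IsPair (𝔄.spincrStructure.PSpin.sec i y)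
      (X y : TangentSpace (𝓡 n) y) (𝔄.spinorField.J y (X y)) := fun X y => by
    rw [J_spinorField]; exact (𝔄.isPair_J (X y)).of_fib _
  have key := SpincrStructure.cliffC_nablaC_sub 𝔄.identification 𝔄.spinorField i hx
    (X := fun y => X y) (Y := fun y => Y y)
    (hX.diffFieldAt Filter.univ_mem) (hd X hX) (hY.diffFieldAt Filter.univ_mem) (hd Y hY)
    (Filter.Eventually.of_forall (hp X)) (Filter.Eventually.of_forall (hp Y))
  obtain ⟨h₁, h₂, h₃⟩ := hCR X Y hX hY x
  have h4 := (𝔄.isPair_J ⟨_, h₁⟩).of_fib (𝔄.spincrStructure.PSpin.sec i x)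
  rw [h₃] at h4
  rw [hJ, hJ] at key
  exact sub_eq_zero.mp (key.trans (sub_eq_zero.mpr h4))

end FrameAtlas

end Identification

end OfCR

/-- Over the empty manifold all data are vacuous, whatever the parity of `n - r`. -/
theorem exists_spincr_of_isEmpty {n r : ℕ}
    {M : Type u} [TopologicalSpace M] [IsEmpty M]
    [ChartedSpace (EuclideanSpace ℝ (Fin n)) M] [IsManifold (𝓡 n) ∞ M]
    [RiemannianBundle (fun x : M => TangentSpace (𝓡 n) x)]
    (o : SpinCR.ManifoldOrientation n M) :
    ∃ (S : SpinCR.SpincrStructure r o) (φ : S.SpinorField)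
        (Ψ : S.AdaptedIdentification φ.V φ.J),
        φ.IsPure ∧ SpinCR.SpincrStructure.IsIntegrable φ Ψ := by
  refine ⟨⟨groupBundle _ isEmptyElim isEmptyElim isEmptyElim isEmptyElim isEmptyElim,
    groupBundle _ isEmptyElim isEmptyElim isEmptyElim isEmptyElim isEmptyElim,
    groupBundle _ isEmptyElim isEmptyElim isEmptyElim isEmptyElim isEmptyElim,
    fun {x} => isEmptyElim x, fun {x} => isEmptyElim x, fun {x} => isEmptyElim x,
    fun i => isEmptyElim (α := M) i, fun {x} => isEmptyElim x, fun {x} => isEmptyElim x,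
    fun i => isEmptyElim (α := M) i, fun {x} => isEmptyElim x, fun {x} => isEmptyElim x,
    fun i => isEmptyElim (α := M) i⟩,
    ⟨fun {x} => isEmptyElim x, fun {x} => isEmptyElim x, fun i => isEmptyElim (α := M) i⟩,
    ⟨fun {x} => isEmptyElim x, fun {x} => isEmptyElim x, fun {x} => isEmptyElim x,
      fun {x} => isEmptyElim x, fun i => isEmptyElim (α := M) i, fun {x} => isEmptyElim x,
      fun {x} => isEmptyElim x, fun {x} => isEmptyElim x, fun i => isEmptyElim (α := M) i⟩,
    isEmptyElim, fun i x => isEmptyElim x⟩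

end SpinCR

end

theorem mainTheorem2 {n r : ℕ} (hr : r < n)
    {M : Type u} [TopologicalSpace M] [T2Space M] [SecondCountableTopology M]
    [ChartedSpace (EuclideanSpace ℝ (Fin n)) M] [IsManifold (𝓡 n) ∞ M]
    [RiemannianBundle (fun x : M => TangentSpace (𝓡 n) x)]
    [IsContMDiffRiemannianBundle (𝓡 n) ∞ (EuclideanSpace ℝ (Fin n))
      (fun x : M => TangentSpace (𝓡 n) x)]
    (o : SpinCR.ManifoldOrientation n M) :
    (∃ C : SpinCR.AlmostCR n r M, C.IsHermitian ∧ C.IsCR) ↔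
      ∃ (S : SpinCR.SpincrStructure r o) (φ : S.SpinorField)
        (Ψ : S.AdaptedIdentification φ.V φ.J),
        φ.IsPure ∧ SpinCR.SpincrStructure.IsIntegrable φ Ψ := by
  constructor
  · rintro ⟨C, hC, hCR⟩
    -- A point is needed to know that `n - r` is even: this is a consequence of `J² = -1` on one
    -- fibre.
    rcases isEmpty_or_nonempty M with hM | ⟨⟨x⟩⟩
    · exact SpinCR.exists_spincr_of_isEmpty o
    obtain ⟨m, hm⟩ := SpinCR.exists_rank_eq_two_mul (C.J_sq x)
    have hcodim := C.codim x
    have h : 2 * ((n - r) / 2) + r = n := by omega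
    have hpos : 0 < (n - r) / 2 := by omega
    obtain ⟨𝔄⟩ := hC.nonempty_frameAtlas o h hpos
    exact ⟨𝔄.spincrStructure, 𝔄.spinorField, 𝔄.identification, 𝔄.isPure_spinorField hpos,
      𝔄.isIntegrable_spinorField hCR⟩
  · rintro ⟨S, φ, Ψ, hφ, hi⟩
    exact ⟨SpinCR.SpincrStructure.SpinorField.toAlmostCR hφ,
      SpinCR.SpincrStructure.SpinorField.isHermitian_toAlmostCR hφ,
      SpinCR.SpincrStructure.SpinorField.isCR_toAlmostCR hφ Ψ hi⟩
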